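/- **Setting.** $n$ qubits; $\sigma_x^{(i)},\sigma_y^{(i)},\sigma_z^{(i)}$ Pauli matrices on qubit $i$; $\|\cdot\|$ the operator norm. A circuit is $U(\theta)=\prod_g e^{-i\theta_{S(g)}H_g}V_g$ (the first gate is the leftmost factor; $S$ assigns a parameter to each gate; $V_g$ fixed unitaries, $V_g=\mathbb 1$ unless stated), with loss $\mathcal L(\theta)=\mathrm{Tr}[U(\theta)\rho U(\theta)^\dagger O]$. $\mathrm{Var}_r$ denotes the variance of $\mathcal L(\theta)$ for $\theta$ uniform in the hypercube $[-r,r]^m$. Derivatives below are at $\theta=0$. Put $c_q=|\partial_q^2\mathcal L|$, $\omega(H)=\lambda_{\max}(H)-\lambda_{\min}(H)$, $\omega_{\mathrm{eff},\mu}^2=\|\partial_\mu^2(U^\dagger OU)\|$, $\tilde\omega_{l,\mu}^2=\|\partial_\mu^2\partial_l^2(U^\dagger OU)\|$. * *Uncorrelated parameters* (each gate $l$ has its own parameter), $\Lambda$ a set of parameters: $$r_{\rm patch}^2=\min_{l\in\Lambda}\frac{9c_l^2}{8c_lA_l+24\beta_l},\qquad A_l=4\,\omega(H_l)^2\sum_{\mu<l}\omega_{\mathrm{eff},\mu}^2+\sum_{\mu>l}\tilde\omega_{l,\mu}^2,$$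 with $\beta_l=\tfrac{32}{3}\omega(H_l)^6\|O\|^2$ for $l>1$ and $\beta_1=\tfrac23\omega(H_1)^2\omega_{\mathrm{eff},1}^4$. * *Correlated parameters*, a chosen parameter $p$ (then $\Lambda=\{p\}$), $\omega_q=\sum_{g:S(g)=q}\omega(H_g)$: $$r_{\rm patch}^2=\frac{9c_p^2}{8\left(16c_p\|O\|\omega_p^2\sum_{q\ne p}\omega_q^2+32\|O\|^2\omega_p^6\right)}.$$ **Claim.** In every case below, the variance satisfies $\mathrm{Var}_r\ge\frac1{72}\big(\sum_{l\in\Lambda}c_l^2\big)r^4$ for all $0<r\le r_{\rm patch}$, and the stated scalings hold. The constants implied by $\Theta,\Omega$ are positive and uniform over all instances of the family; they depend only on the fixed data named in each case. 1. **Tensor-product ansatz**, $n\ge1$: $U=\prod_i e^{-i\theta_{i,x_1}\sigma_x^{(i)}}\prod_i e^{-i\theta_{i,z}\sigma_z^{(i)}}\prod_i e^{-i\theta_{i,x_2}\sigma_x^{(i)}}$, $O=\sigma_z^{\otimes n}$, $\rho=|\psi\rangle\langle\psi|$ with $|\psi\rangle=(|+\rangle^{\otimes n}+|-\rangle^{\otimes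 n})/\sqrt2$. - Uncorrelated, $\Lambda$ = all $\sigma_x$ parameters: $r_{\rm patch}=\Theta(1/\sqrt n)$, $\mathrm{Var}_{r_{\rm patch}}=\Omega(1/n)$. - One common parameter for all gates: $r_{\rm patch}=\Theta(1/n)$, $\mathrm{Var}_{r_{\rm patch}}=\Omega(1)$. 2. **Hardware-efficient ansatz**, $n\ge2$, $L\ge1$: $U=\prod_{l=1}^L\Big(\prod_{i=1}^n e^{-i\theta_{l,y_i}\sigma_y^{(i)}}e^{-i\theta_{l,z_i}\sigma_z^{(i)}}\Big)V$ with $V=\prod_i\mathrm{CZ}(i,i+1)$ on a ring, $\rho=|0\rangle\langle0|^{\otimes n}$, uncorrelated parameters. - $O=\sigma_z^{\otimes n}$, $\Lambda$ = all $\sigma_y$ parameters: $r_{\rm patch}=\Theta(1/\sqrt{nL})$, $\mathrm{Var}_{r_{\rm patch}}=\Omega(1/(nL))$. - $O=\sigma_z\otimes\sigma_z\otimes\mathbb 1^{\otimes(n-2)}$, $\Lambda$ = the $\sigma_y$ parameters on the first two qubits: $r_{\rm patch}=\Theta(1/\sqrt L)$, $\mathrm{Var}_{r_{\rm patch}}=\Omega(1/L)$;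 hence in the regime $n\in\Theta(L)$ (that is $n\le BL$, $L\le Bn$, constants depending on $B$) $r_{\rm patch}=\Theta((nL)^{-1/4})$, $\mathrm{Var}_{r_{\rm patch}}=\Omega((nL)^{-1/2})$. 3. **Hamiltonian variational ansatz**, $L\ge 1$. For Hermitian $H_1,\dots,H_K$, the relaxed circuit is $\prod_{l=1}^L\prod_{k=1}^Ke^{-i\theta_{k,l}H_k}$ and the Trotterized one is $\prod_{l=1}^L\prod_{k=1}^Ke^{-i\theta_kH_k}$; $M=KL$. Let $H_k=\sum_{j\le N_k}h^{(k)}_j$ be a sum of distinct commuting Pauli strings, $O=\sum_{i\le N_O}P_i$ ($N_O\ge1$) a sum of distinct Pauli strings, and let the $h^{(k)}_j$ (resp. $P_i$) be geometrically $\kappa$-local (resp. $\kappa_O$-local) for some placement of the qubits at distinct sites of a $D$-dimensional, possibly periodic lattice: each string acts on at most $\kappa$ (resp. $\kappa_O$) qubits, whose positions differ pairwise by at most $\kappa$ (resp. $\kappa_O$) in each coordinate. Let $\rho$ be any state. Constants depend on $K,D,\kappa,\kappa_O$ and on the constants in the curvature assumption. - *Relaxed*, $\Lambda=\{(1,1)\}$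 (the parameter of $H_1$ in the layer closest to $O$), assuming $c_{(1,1)}\in\Theta(N_O)$, and with $\beta_1$ in $r_{\rm patch}$ taken as its locality-based value $\frac{2^5}{3}N_O^2s^6$, where $s$ is the largest number of strings $h^{(1)}_j$ that do not commute with one $P_i$: $r_{\rm patch}=\Theta(1/\sqrt M)$, $\mathrm{Var}_{r_{\rm patch}}=\Omega(N_O^2/M^2)$. - *Trotterized*, $p=1$, assuming $c_1\in\Theta(N_OL^2)$, and with $N=\max_kN_k$: $r_{\rm patch}\ge r_*$ for some $r_*=\Theta(1/(LN^3))$ of the form $r_*=a/(LN^3)$ with a constant $a$, and $\mathrm{Var}_{r_*}=\Omega(N_O^2/N^{12})$. - *Heisenberg ring*: $n>4$ even, $K=3$, with $H_1=\sum_i\sigma_x^{(i)}\sigma_x^{(i+1)}$, $H_2=\sum_i\sigma_y^{(i)}\sigma_y^{(i+1)}$, $H_3=\sum_i\sigma_z^{(i)}\sigma_z^{(i+1)}$ (periodic), $O=H_1+H_2+H_3$, $\rho$ the pure state $(|01\rangle^{\otimes n/2}+|10\rangle^{\otimes n/2})/\sqrt2$. Relaxed ($\Lambda$ and $\beta_1$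 as above): $r_{\rm patch}=\Theta(1/\sqrt L)$, $\mathrm{Var}_{r_{\rm patch}}=\Omega(n^2/L^2)$. Trotterized ($p$ any parameter with the largest $c_p$): $r_{\rm patch}=\Theta(1/(Ln^3))$, $\mathrm{Var}_{r_{\rm patch}}=\Omega(1/n^{10})$. 4. **UCCSD**, $L\ge1$: with $Q_p=(\sigma_x^{(p)}+i\sigma_y^{(p)})/2$, the generators are $H=i(\tau-\tau^\dagger)$ for the excitations $\tau=Q_p^\dagger Q_q$ ($p>q$) and $\tau=Q_p^\dagger Q_q^\dagger Q_rQ_s$ ($p>q>r>s$); $K$ is their number; in each layer the single excitations stand (in any order) to the left of the double ones (in any order). Relaxed circuit $\prod_{l=1}^L\prod_{k=1}^Ke^{-i\theta_{k,l}H_k}$, Trotterized circuit $\prod_{l=1}^L\prod_{k=1}^Ke^{-i\theta_kH_k}$. - *Relaxed, any state and any Hermitian $O$*: if $\Lambda\ne\emptyset$ is a set of excitations with $c_{\mu,l}\in\Theta(1)$ for all $\mu\in\Lambda$ and all layers $l$, then $r_{\rm patch}$ (minimum over $\Lambda\times\{1,\dots,L\}$) is at least $r_*=a/(\sqrt{KL}\,\|O\|)$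 with a constant $a>0$, and $\mathrm{Var}_{r_*}=\Omega\big(L|\Lambda|/((KL)^2\|O\|^4)\big)$. - *Trotterized, any state and any Hermitian $O$*: if $c_p\in\Theta(L^2)$, then $r_{\rm patch}=\Theta\big(1/(L\sqrt{\|O\|(K+\|O\|)})\big)$, $\mathrm{Var}_{r_{\rm patch}}=\Omega\big(1/(\|O\|^2(K+\|O\|)^2)\big)$. - *Example*: $n\ge4$ even, $O=\sum_i\sigma_z^{(i)}\sigma_z^{(i+1)}$ (periodic), $\rho$ the pure state $|1\rangle^{\otimes n/2}\otimes|0\rangle^{\otimes n/2}$. Relaxed, $\Lambda$ = all parameters with $c_l\ne0$: $r_{\rm patch}=\Theta(1/\sqrt{KL+n^2})$, $\mathrm{Var}_{r_{\rm patch}}=\Omega\big(KL/(KL+n^2)^2\big)$, and also $\Omega\big(Ln^2/(KL+n^2)^2\big)$. Trotterized, $p$ any parameter with the largest $c_p$: $r_{\rm patch}=\Theta\big(1/(L\sqrt{n(K+n)})\big)$, $\mathrm{Var}_{r_{\rm patch}}=\Omega\big(1/(n^2(K+n)^2)\big)$. (In the two general cases the constants depend on those in the curvature assumption.) -/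

import Mathlib

open scoped Matrix Matrix.Norms.L2Operator ComplexOrder

noncomputable section

namespace PQC

/-! ## Qubits, Pauli operators, states -/

/-- Operators on `n` qubits, in the computational basis indexed by bit strings. -/
abbrev Op (n : ℕ) := Matrix (Fin n → Fin 2) (Fin n → Fin 2) ℂ

/-- The single-qubit operators `1, σ_x, σ_y, σ_z`, labelled `0, 1, 2, 3`. -/
def pauli : Fin 4 → Matrix (Fin 2) (Fin 2) ℂ :=
  ![1, !![0, 1; 1, 0], !![0, -Complex.I; Complex.I, 0], !![1, 0; 0, -1]]

/-- The tensor product `A 0 ⊗ ... ⊗ A (n-1)` of single-qubit operators. -/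
def tensor {n : ℕ} (A : Fin n → Matrix (Fin 2) (Fin 2) ℂ) : Op n :=
  fun b b' => ∏ j, A j (b j) (b' j)

/-- The single-qubit operator `A` acting on qubit `i` (identity elsewhere). -/
def onQubit {n : ℕ} (i : Fin n) (A : Matrix (Fin 2) (Fin 2) ℂ) : Op n :=
  tensor (Function.update 1 i A)

/-- The Pauli string with label `s j` on qubit `j`. -/
def pauliString {n : ℕ} (s : Fin n → Fin 4) : Op n := tensor (fun j => pauli (s j))

/-- The product vector `v 0 ⊗ ... ⊗ v (n-1)`. -/
def productKet {n : ℕ} (v : Fin n → Fin 2 → ℂ) : (Fin n → Fin 2) → ℂ :=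
  fun b => ∏ j, v j (b j)

/-- The computational basis vectors of one qubit. -/
def ket (x : Fin 2) : Fin 2 → ℂ := Pi.single x 1

/-- `|+⟩ = (|0⟩ + |1⟩)/√2`. -/
def ketPlus : Fin 2 → ℂ := fun _ => ((1 / Real.sqrt 2 : ℝ) : ℂ)

/-- `|-⟩ = (|0⟩ - |1⟩)/√2`. -/
def ketMinus : Fin 2 → ℂ :=
  ![((1 / Real.sqrt 2 : ℝ) : ℂ), -((1 / Real.sqrt 2 : ℝ) : ℂ)]

/-- The operator `|ψ⟩⟨ψ|`. -/
def pureState {n : ℕ} (ψ : (Fin n → Fin 2) → ℂ) : Op n := Matrix.vecMulVec ψ (star ψ)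

/-- Density operators. -/
def IsDensity {n : ℕ} (ρ : Op n) : Prop := ρ.PosSemidef ∧ ρ.trace = 1

/-! ## Parametrized circuits and their loss -/

/-- A parametrized circuit on `n` qubits whose gates are indexed by `G` (in increasing order, the
smallest gate being leftmost, i.e. closest to the observable) and whose parameters are indexed by
`P`. Gate `g` is `exp(-i θ_{par g} gen g)`, followed on its right by the unparametrized operator
`fixed g`. -/
structure Circuit (n : ℕ) (G P : Type) where
  gen : G → Op n
  fixed : G → Op n
  par : G → P

/-- Second derivative of `f` in the coordinate `i`, as a function of the point. -/
def d2 {P E : Type} [NormedAddCommGroup E] [NormedSpace ℝ E] (f : (P → ℝ) → E) (i : P)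
    (θ : P → ℝ) : E :=
  open Classical in iteratedDeriv 2 (fun t => f (Function.update θ i t)) (θ i)

/-- `ω^{(max)}(H) = λ_max(H) - λ_min(H)`. -/
def maxFreq {n : ℕ} (H : Op n) : ℝ := sSup (spectrum ℝ H) - sInf (spectrum ℝ H)

namespace Circuit

variable {n : ℕ} {G P : Type} [LinearOrder G] [Fintype G]

/-- The unitary of gate `g` together with the fixed operator that follows it. -/
def gate (C : Circuit n G P) (θ : P → ℝ) (g : G) : Op n :=
  NormedSpace.exp ((-(Complex.I * (θ (C.par g) : ℂ))) • C.gen g) * C.fixed g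

/-- `U(θ)`: the ordered product of all gates, the smallest gate being the leftmost factor. -/
def U (C : Circuit n G P) (θ : P → ℝ) : Op n :=
  (((Finset.univ : Finset G).sort (· ≤ ·)).map (C.gate θ)).prod

/-- `U(θ)† O U(θ)`. -/
def heis (C : Circuit n G P) (O : Op n) (θ : P → ℝ) : Op n := (C.U θ)ᴴ * O * C.U θ

/-- The loss `Tr[U(θ) ρ U(θ)† O]` (a real number for Hermitian `ρ` and `O`). -/
def loss (C : Circuit n G P) (ρ O : Op n) (θ : P → ℝ) : ℝ :=
  (C.U θ * ρ * (C.U θ)ᴴ * O).trace.re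

/-- `c_q(φ)`, the modulus of the second derivative of the loss. -/
def curv (C : Circuit n G P) (ρ O : Op n) (φ : P → ℝ) (q : P) : ℝ :=
  |d2 (C.loss ρ O) q φ|

/-- `ω_μ^{(eff)}(φ)`. -/
def effFreq (C : Circuit n G P) (O : Op n) (φ : P → ℝ) (μ : P) : ℝ :=
  Real.sqrt ‖d2 (C.heis O) μ φ‖

/-- `ω̃_{l,μ}^{(eff)}(φ)`. -/
def effFreq2 (C : Circuit n G P) (O : Op n) (φ : P → ℝ) (l μ : P) : ℝ :=
  Real.sqrt ‖d2 (d2 (C.heis O) l) μ φ‖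

/-- The uniform distribution on the hypercube `∏ [φ_i - r, φ_i + r]`. -/
def cube [Fintype P] (φ : P → ℝ) (r : ℝ) : MeasureTheory.Measure (P → ℝ) :=
  ProbabilityTheory.cond MeasureTheory.volume
    (Set.Icc (fun i => φ i - r) (fun i => φ i + r))

/-- The variance of the loss over the hypercube of half-width `r` around `0`. -/
def patchVar [Fintype P] (C : Circuit n G P) (ρ O : Op n) (r : ℝ) : ℝ :=
  ProbabilityTheory.variance (C.loss ρ O) (cube 0 r)

/-! ### The patch radius for uncorrelated parameters

Here every gate has its own parameter: `P = G`, and `par` is the identity. -/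

/-- `𝒜_l(φ)`. -/
def ampA (C : Circuit n G G) (O : Op n) (φ : G → ℝ) (l : G) : ℝ :=
  4 * maxFreq (C.gen l) ^ 2 * ∑ μ ∈ Finset.univ.filter (fun μ => μ < l), C.effFreq O φ μ ^ 2
    + ∑ μ ∈ Finset.univ.filter (fun μ => l < μ), C.effFreq2 O φ l μ ^ 2

/-- `β_l(φ)`; the first case is that of the first gate. -/
def beta (C : Circuit n G G) (O : Op n) (φ : G → ℝ) (l : G) : ℝ :=
  open Classical in
  if ∀ μ, l ≤ μ then 2 * maxFreq (C.gen l) ^ 2 * C.effFreq O φ l ^ 4 / 3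
  else 32 * maxFreq (C.gen l) ^ 6 * ‖O‖ ^ 2 / 3

/-- The patch radius at `φ = 0` for uncorrelated parameters and a subset `Λ` of parameters. -/
def rUncorr (C : Circuit n G G) (ρ O : Op n) (Λ : Finset G) : ℝ :=
  Real.sqrt (⨅ l : Λ, 9 * C.curv ρ O 0 l ^ 2 /
    (8 * C.curv ρ O 0 l * C.ampA O 0 l + 24 * C.beta O 0 l))

/-- The patch radius at `φ = 0` for uncorrelated parameters and `Λ = {l}`, with `β_l` replaced by
its value `β` computed from the locality of the observable. -/
def rUncorrWith (C : Circuit n G G) (ρ O : Op n) (l : G) (β : ℝ) : ℝ :=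
  Real.sqrt (9 * C.curv ρ O 0 l ^ 2 / (8 * C.curv ρ O 0 l * C.ampA O 0 l + 24 * β))

/-! ### The patch radius for correlated parameters -/

/-- `ω_q^{(max)} = ∑_{g : par g = q} ω^{(max)}(H_g)`. -/
def parFreq (C : Circuit n G P) (q : P) : ℝ :=
  open Classical in ∑ g ∈ Finset.univ.filter (fun g => C.par g = q), maxFreq (C.gen g)

/-- The patch radius at `φ = 0` for correlated parameters and a chosen parameter `p`. -/
def rCorr [Fintype P] (C : Circuit n G P) (ρ O : Op n) (p : P) : ℝ :=
  open Classical in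
  Real.sqrt (9 * C.curv ρ O 0 p ^ 2 /
    (8 * (16 * C.curv ρ O 0 p * ‖O‖ * C.parFreq p ^ 2 *
        (∑ q ∈ Finset.univ.filter (fun q => q ≠ p), C.parFreq q ^ 2)
      + 32 * ‖O‖ ^ 2 * C.parFreq p ^ 6)))

/-! ### Patch statements -/

/-- The variance guarantee: for every half-width `r ≤ R` the loss variance over the hypercube
around `0` is at least `(1/72) (∑_{l ∈ Λ} c_l²) r⁴`. -/
def Guarantee [Fintype P] (C : Circuit n G P) (ρ O : Op n) (Λ : Finset P) (R : ℝ) : Prop :=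
  ∀ r : ℝ, 0 < r → r ≤ R →
    1 / 72 * (∑ l ∈ Λ, C.curv ρ O 0 l ^ 2) * r ^ 4 ≤ C.patchVar ρ O r

/-- `R` lies between `a w` and `b w`, is a patch radius for `Λ`, and the variance over the patch of
half-width `R` is at least `v g`. -/
def SharpPatch [Fintype P] (C : Circuit n G P) (ρ O : Op n) (Λ : Finset P)
    (R a b w v g : ℝ) : Prop :=
  a * w ≤ R ∧ R ≤ b * w ∧ C.Guarantee ρ O Λ R ∧ v * g ≤ C.patchVar ρ O R

/-- `R` is a patch radius for `Λ`, it is at least `a w`, and the variance over the patch of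
half-width exactly `a w` is at least `v g`. -/
def LowerPatch [Fintype P] (C : Circuit n G P) (ρ O : Op n) (Λ : Finset P)
    (R a w v g : ℝ) : Prop :=
  a * w ≤ R ∧ C.Guarantee ρ O Λ R ∧ v * g ≤ C.patchVar ρ O (a * w)

end Circuit

/-! ## Tensor-product ansatz -/

/-- The `3n` generators, layer by layer: `σ_x`, then `σ_z`, then `σ_x` on every qubit. -/
def tpGen (n : ℕ) (g : Fin 3 ×ₗ Fin n) : Op n :=
  onQubit (ofLex g).2 (pauli (if (ofLex g).1 = 1 then 3 else 1))

/-- One independent parameter per gate. -/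
def tpUncorr (n : ℕ) : Circuit n (Fin 3 ×ₗ Fin n) (Fin 3 ×ₗ Fin n) :=
  ⟨tpGen n, fun _ => 1, id⟩

/-- One single parameter for all gates. -/
def tpCorr (n : ℕ) : Circuit n (Fin 3 ×ₗ Fin n) (Fin 1) := ⟨tpGen n, fun _ => 1, fun _ => 0⟩

/-- The state `(|+⟩^{⊗n} + |-⟩^{⊗n})/√2`, as a density operator. -/
def tpState (n : ℕ) : Op n :=
  pureState (((1 / Real.sqrt 2 : ℝ) : ℂ) •
    (productKet (fun _ => ketPlus) + productKet (fun _ => ketMinus)))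

/-- `σ_z^{⊗n}`. -/
def globalZ (n : ℕ) : Op n := tensor (fun _ => pauli 3)

/-- The parameters of the two `σ_x` layers. -/
def tpSet (n : ℕ) : Finset (Fin 3 ×ₗ Fin n) := Finset.univ.filter (fun g => (ofLex g).1 ≠ 1)

/-! ## Hardware-efficient ansatz -/

/-- The controlled-Z gate between qubits `i` and `j`. -/
def cz {n : ℕ} (i j : Fin n) : Op n :=
  Matrix.diagonal (fun b => if b i = 1 ∧ b j = 1 then -1 else 1)

/-- The ring of controlled-Z gates `∏_i CZ(i, i+1)` (they are diagonal and commute). -/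
def czRing (n : ℕ) : Op n := ((List.finRange n).map (fun i => cz i (finRotate n i))).prod

/-- `U(θ) = ∏_{l} (∏_{i} exp(-iθ_{l,i,y} σ_y^{(i)}) exp(-iθ_{l,i,z} σ_z^{(i)})) V`; the gate
`(l, i, 0)` is the `σ_y` rotation of qubit `i` in layer `l`, and `(l, i, 1)` the `σ_z` rotation. -/
def hea (n L : ℕ) :
    Circuit n (Fin L ×ₗ (Fin n ×ₗ Fin 2)) (Fin L ×ₗ (Fin n ×ₗ Fin 2)) where
  gen g := onQubit (ofLex (ofLex g).2).1 (pauli (if (ofLex (ofLex g).2).2 = 0 then 2 else 3))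
  fixed g :=
    if (ofLex (ofLex g).2).1.val + 1 = n ∧ (ofLex (ofLex g).2).2 = 1 then czRing n else 1
  par := id

/-- `|0⟩⟨0|^{⊗n}`. -/
def zeroState (n : ℕ) : Op n := pureState (productKet (fun _ => ket 0))

/-- `σ_z ⊗ σ_z ⊗ 1^{⊗(n-2)}`. -/
def localZ (n : ℕ) : Op n := tensor (fun j => if j.val < 2 then pauli 3 else 1)

/-- All parameters of `σ_y` rotations. -/
def heaSetGlobal (n L : ℕ) : Finset (Fin L ×ₗ (Fin n ×ₗ Fin 2)) :=
  Finset.univ.filter (fun g => (ofLex (ofLex g).2).2 = 0)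

/-- All parameters of `σ_y` rotations on the first two qubits. -/
def heaSetLocal (n L : ℕ) : Finset (Fin L ×ₗ (Fin n ×ₗ Fin 2)) :=
  Finset.univ.filter
    (fun g => (ofLex (ofLex g).2).2 = 0 ∧ (ofLex (ofLex g).2).1.val < 2)

/-! ## Layered circuits: relaxed and Trotterized versions -/

/-- `∏_{l<L} ∏_{k<K} exp(-iθ_{k,l} H_k)`. -/
def relaxed {n K : ℕ} (L : ℕ) (H : Fin K → Op n) :
    Circuit n (Fin L ×ₗ Fin K) (Fin L ×ₗ Fin K) :=
  ⟨fun g => H (ofLex g).2, fun _ => 1, id⟩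

/-- `∏_{l<L} ∏_{k<K} exp(-iθ_k H_k)`. -/
def trotter {n K : ℕ} (L : ℕ) (H : Fin K → Op n) : Circuit n (Fin L ×ₗ Fin K) (Fin K) :=
  ⟨fun g => H (ofLex g).2, fun _ => 1, fun g => (ofLex g).2⟩

/-! ## Hamiltonian variational ansatz -/

/-- A sum of Pauli strings. -/
def pauliSum {n : ℕ} {ι : Type} [Fintype ι] (s : ι → Fin n → Fin 4) : Op n :=
  ∑ j, pauliString (s j)

/-- The qubits on which a Pauli string acts nontrivially. -/
def support {n : ℕ} (s : Fin n → Fin 4) : Finset (Fin n) :=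
  Finset.univ.filter (fun j => s j ≠ 0)

/-- A Pauli string is geometrically `κ`-local for the placement `pos` of the qubits on a
`D`-dimensional lattice (periodic of period `size d` in direction `d` if `size d ≠ 0`, infinite in
that direction if `size d = 0`): it acts on at most `κ` qubits, and any two of them differ by at
most `κ` in each coordinate. -/
def IsGeomLocal {n D : ℕ} {size : Fin D → ℕ} (pos : Fin n → (d : Fin D) → ZMod (size d))
    (κ : ℕ) (s : Fin n → Fin 4) : Prop :=
  (support s).card ≤ κ ∧ ∀ i ∈ support s, ∀ j ∈ support s, ∀ d,
    ∃ z : ℤ, |z| ≤ (κ : ℤ) ∧ pos i d - pos j d = (z : ZMod (size d))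

/-- A geometrically local Hamiltonian `∑_k H_k`, `H_k = ∑_j h k j`, and a geometrically local
observable `∑_i P i`: for some placement of the qubits on distinct sites of a `D`-dimensional
lattice, all `h k j` are `κ`-local and all `P i` are `κ_O`-local; the strings in each sum are
distinct, and those within one `H_k` commute. -/
def IsLocalModel {n K : ℕ} {ι : Type} (D κ κO : ℕ) {N : Fin K → ℕ}
    (h : (k : Fin K) → Fin (N k) → Fin n → Fin 4) (P : ι → Fin n → Fin 4) : Prop :=
  (∃ (size : Fin D → ℕ) (pos : Fin n → (d : Fin D) → ZMod (size d)),
      Function.Injective pos ∧ (∀ k j, IsGeomLocal pos κ (h k j)) ∧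
      ∀ i, IsGeomLocal pos κO (P i)) ∧
    (∀ k, Function.Injective (h k)) ∧ Function.Injective P ∧
    ∀ k i j, Commute (pauliString (h k i)) (pauliString (h k j))

/-- The largest number of strings among the `h j` that do not commute with one string `P i`. -/
def maxOverlap {n : ℕ} {κ ι : Type} [Fintype κ] [Fintype ι] (h : κ → Fin n → Fin 4)
    (P : ι → Fin n → Fin 4) : ℕ :=
  open Classical in
  Finset.univ.sup (fun i =>
    (Finset.univ.filter (fun j => ¬ Commute (pauliString (h j)) (pauliString (P i)))).card)

/-- The value of `β` for the first gate of the relaxed circuit, from the locality of the model: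
`2⁵ N_O² s⁶ / 3`, where `N_O` is the number of strings of the observable. -/
def localBeta {n : ℕ} {κ ι : Type} [Fintype κ] [Fintype ι] (h : κ → Fin n → Fin 4)
    (P : ι → Fin n → Fin 4) : ℝ :=
  2 ^ 5 * (Fintype.card ι : ℝ) ^ 2 * (maxOverlap h P : ℝ) ^ 6 / 3

/-- The string acting as `σ_x`, `σ_y`, `σ_z` (for `k = 0, 1, 2`) on qubits `i` and `i+1` of a
ring. -/
def bond {n : ℕ} (k : Fin 3) (i : Fin n) : Fin n → Fin 4 :=
  fun j => if j = i ∨ j = finRotate n i then k.succ else 0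

/-- All strings of the Heisenberg Hamiltonian on a ring. -/
def heisenbergStrings (n : ℕ) (x : Fin 3 × Fin n) : Fin n → Fin 4 := bond x.1 x.2

/-- The Heisenberg Hamiltonian `∑_i (XX + YY + ZZ)_{i,i+1}` on a ring. -/
def heisenberg (n : ℕ) : Op n := pauliSum (heisenbergStrings n)

/-- Its three terms, `XX`, `YY`, `ZZ` in this order. -/
def heisenbergTerm (n : ℕ) (k : Fin 3) : Op n := pauliSum (bond (n := n) k)

/-- The state `(|01⟩^{⊗n/2} + |10⟩^{⊗n/2})/√2`, as a density operator. -/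
def neelState (n : ℕ) : Op n :=
  pureState (((1 / Real.sqrt 2 : ℝ) : ℂ) •
    (productKet (fun j => if j.val % 2 = 0 then ket 0 else ket 1) +
      productKet (fun j => if j.val % 2 = 0 then ket 1 else ket 0)))

/-! ## Unitary coupled cluster ansatz -/

/-- `Q_p = (σ_x^{(p)} + i σ_y^{(p)})/2`. -/
def lowering {n : ℕ} (p : Fin n) : Op n :=
  (1 / 2 : ℂ) • (onQubit p (pauli 1) + Complex.I • onQubit p (pauli 2))

/-- Single excitations `(p, q)`, `p > q`. -/
abbrev Single (n : ℕ) := {x : Fin n × Fin n // x.2 < x.1}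

/-- Double excitations `(p, q, r, s)`, `p > q > r > s`. -/
abbrev Double (n : ℕ) :=
  {x : Fin n × Fin n × Fin n × Fin n // x.2.2.2 < x.2.2.1 ∧ x.2.2.1 < x.2.1 ∧ x.2.1 < x.1}

/-- The excitation operators `Q_p† Q_q` and `Q_p† Q_q† Q_r Q_s`. -/
def excitation {n : ℕ} : Single n ⊕ Double n → Op n
  | .inl x => (lowering x.1.1)ᴴ * lowering x.1.2
  | .inr x =>
    (lowering x.1.1)ᴴ * (lowering x.1.2.1)ᴴ * lowering x.1.2.2.1 * lowering x.1.2.2.2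

/-- The Hermitian generator `H = i (τ - τ†)`, so that `exp(θ (τ - τ†)) = exp(-iθH)`. -/
def uccGen {n : ℕ} (x : Single n ⊕ Double n) : Op n :=
  Complex.I • (excitation x - (excitation x)ᴴ)

/-- An enumeration of all single and double excitations, the singles coming first. -/
def SinglesFirst {n K : ℕ} (e : Fin K ≃ Single n ⊕ Double n) : Prop :=
  ∀ i j, (e i).isLeft → (e j).isRight → i < j

/-- `∑_i σ_z^{(i)} σ_z^{(i+1)}` on a ring. -/
def zzRing (n : ℕ) : Op n := pauliSum (bond (n := n) 2)

/-- The state `|1⟩^{⊗n/2} ⊗ |0⟩^{⊗n/2}`, as a density operator. -/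
def halfFilled (n : ℕ) : Op n :=
  pureState (productKet (fun j => if j.val < n / 2 then ket 1 else ket 0))

/-- The parameters at which the second derivative of the loss at `0` does not vanish. -/
def curvedSet {n : ℕ} {G P : Type} [LinearOrder G] [Fintype G] [Fintype P] (C : Circuit n G P)
    (ρ O : Op n) : Finset P :=
  open Classical in Finset.univ.filter (fun l => C.curv ρ O 0 l ≠ 0)

end PQC

end

open PQC

set_option linter.unusedSectionVars false

namespace PQC

open MeasureTheory ProbabilityTheory

/-! ## The uniform distribution on a hypercube -/

/-! The variance guarantee is Bessel's inequality plus Taylor expansion. On the hypercube the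
centred squares `quad r (θ l)` of the coordinates are orthogonal, with variance 4r⁴/45, so the
variance of the loss is at least the sum of its squared correlations with them, divided by 4r⁴/45
(`bessel_cube`). By reflection symmetry the correlation with coordinate `l` is 2r⁴/45 times the mean
of ∂_l² of the loss on the slice θ_l = 0, up to an error of order r⁶ governed by the fourth
derivative (`integral_quad_mul_approx`). That mean differs from the value at the centre by the mixed
derivatives ∂_μ²∂_l², and zeroing the coordinates in the order of the gates requires these only
where all earlier angles vanish (`integral_cube_sub_le`). `variance_cube_ge` combines the estimates:
if r²(8 ∑_μ B_μ + 4M) ≤ 9c for every `l`, the factor 1/72 results.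

The derivatives of U†OU are Heisenberg evolutions with commutators i[H_g, ·] inserted at the gates
(`isPD_heisD`). Conjugation by unitaries keeps the norm and a commutator costs at most ω(H_g). When
the angles before a gate vanish and no commutator follows it, the norm equals that at the origin.
This explains 𝒜_l and β_l and gives `guarantee_rUncorr`, `guarantee_rUncorrWith` and
`guarantee_rCorr`. By `SharpPatch.of_guarantee` each scaling statement is then a matter of bounding
the curvature from below and the explicit radius from both sides.

For the tensor-product ansatz with independent parameters and the hardware-efficient ansatz, every
generator is either an involution anticommuting with O or commutes with O, so all even derivatives
at the origin are multiples of O (`HasSigns.sharpPatch`); with one common parameter, the second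
derivatives are evaluated by stabilizers of the state. For sums of local Pauli strings, nested
commutators are bounded by counting strings. The matching upper bound on the relaxed radius uses the
Landau–Kolmogorov type inequality `norm_ad_four_ge`: a large second derivative of a bounded
evolution forces a large fourth one. In Trotterized circuits the depth factors out of the radius
exactly (`trotter_rCorr`).

For the Heisenberg ring the curvature is exactly 8n (`expect_neel_ad_sq`). The excitation generators
of UCCSD have ω between 2 and 4. In the half-filled example O is diagonal and counts domain walls;
curvatures are integers, so nonzero ones are at least 1 (`one_le_abs_expect`), and a fixed fraction
of all excitations is curved (`card_excitations_le`). -/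

/-- The uniform distribution on `[-r, r]`. -/
noncomputable def unif (r : ℝ) : Measure ℝ := cond volume (Set.Icc (-r) r)

lemma isProbabilityMeasure_unif {r : ℝ} (hr : 0 < r) : IsProbabilityMeasure (unif r) := by
  apply cond_isProbabilityMeasure_of_finite
  · simp [hr]
  · simp

lemma integral_unif {r : ℝ} (hr : 0 < r) (f : ℝ → ℝ) :
    ∫ t, f t ∂(unif r) = (1 / (2 * r)) * ∫ t in (-r)..r, f t := by
  rw [unif, ProbabilityTheory.cond, integral_smul_measure, intervalIntegral.integral_of_le (by linarith),
    ← integral_Icc_eq_integral_Ioc, Real.volume_Icc, smul_eq_mul, ENNReal.toReal_inv,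
    ENNReal.toReal_ofReal (by linarith)]
  congr 1
  field_simp
  norm_num

lemma integral_pow_unif {r : ℝ} (hr : 0 < r) (k : ℕ) :
    ∫ t, t ^ (2 * k) ∂(unif r) = r ^ (2 * k) / (2 * k + 1) := by
  rw [integral_unif hr, integral_pow]
  have h : (-r) ^ (2 * k + 1) = -r ^ (2 * k + 1) := Odd.neg_pow ⟨k, rfl⟩ r
  rw [h]
  push_cast
  field_simp
  ring

variable {P : Type} [Fintype P]

open Circuit

/-- The normalizing volume of a box is the product of its side lengths, so conditioning factorizes.
From here on the coordinates are independent. -/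
lemma cube_eq_pi {r : ℝ} (hr : 0 < r) :
    cube (0 : P → ℝ) r = Measure.pi (fun _ => unif r) := by
  have := isProbabilityMeasure_unif hr
  symm
  apply Measure.pi_eq
  intro s hs
  have hI : Set.Icc (fun i : P => (0 : P → ℝ) i - r) (fun i => (0 : P → ℝ) i + r)
      = Set.pi Set.univ (fun _ : P => Set.Icc (-r) r) := by
    rw [Set.pi_univ_Icc]; simp
  rw [cube, hI, cond_apply (MeasurableSet.univ_pi fun _ => measurableSet_Icc), ← Set.pi_inter_distrib,
    volume_pi_pi, volume_pi_pi]
  simp only [unif, cond_apply measurableSet_Icc]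
  rw [Finset.prod_mul_distrib, ENNReal.prod_inv_distrib]
  intro i _ j _ _
  right; simp

lemma isProbabilityMeasure_cube {r : ℝ} (hr : 0 < r) :
    IsProbabilityMeasure (cube (0 : P → ℝ) r) := by
  have := isProbabilityMeasure_unif hr
  rw [cube_eq_pi hr]; infer_instance

lemma integrable_cube {r : ℝ} (hr : 0 < r) {f : (P → ℝ) → ℝ} (hf : Continuous f) :
    Integrable f (cube (0 : P → ℝ) r) := by
  unfold cube ProbabilityTheory.cond
  apply Integrable.smul_measure
  · exact hf.continuousOn.integrableOn_compact isCompact_Icc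
  · simp only [Real.volume_Icc_pi]
    simp [hr]

lemma memLp_cube {r : ℝ} (hr : 0 < r) {f : (P → ℝ) → ℝ} (hf : Continuous f) :
    MemLp f 2 (cube (0 : P → ℝ) r) :=
  (memLp_two_iff_integrable_sq hf.aestronglyMeasurable).2 (integrable_cube hr (hf.pow 2))

variable [DecidableEq P]

/-- The reflection preserves the product measure and is a measurable embedding, so no integrability
is needed. This symmetry removes all odd Taylor terms below. -/
lemma integral_cube_flip {r : ℝ} (hr : 0 < r) (l : P) (f : (P → ℝ) → ℝ) :
    ∫ θ, f (Function.update θ l (-θ l)) ∂(cube (0 : P → ℝ) r) = ∫ θ, f θ ∂(cube (0 : P → ℝ) r) := by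
  have := isProbabilityMeasure_unif hr
  rw [cube_eq_pi hr]
  have h1 : MeasurePreserving (fun t : ℝ => -t) (unif r) (unif r) := by
    refine ⟨measurable_neg, ?_⟩
    ext s hs
    rw [Measure.map_apply measurable_neg hs, unif, cond_apply measurableSet_Icc,
      cond_apply measurableSet_Icc]
    congr 1
    have : Set.Icc (-r) r ∩ (fun t : ℝ => -t) ⁻¹' s = (fun t : ℝ => -t) ⁻¹' (Set.Icc (-r) r ∩ s) := by
      ext t; simp only [Set.mem_inter_iff, Set.mem_Icc, Set.mem_preimage]
      constructor <;> rintro ⟨⟨a, b⟩, c⟩ <;> exact ⟨⟨by linarith, by linarith⟩, c⟩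
    rw [this]
    exact (Measure.measurePreserving_neg volume).measure_preimage
      (measurableSet_Icc.inter hs).nullMeasurableSet
  have h2 : MeasurePreserving (fun θ : P → ℝ => fun i => (if i = l then (fun t : ℝ => -t) else id) (θ i))
      (Measure.pi fun _ => unif r) (Measure.pi fun _ => unif r) := by
    apply measurePreserving_pi
    intro i
    split_ifs
    · exact h1
    · exact MeasurePreserving.id _
  have h3 : (fun θ : P → ℝ => Function.update θ l (-θ l))
      = fun θ : P → ℝ => fun i => (if i = l then (fun t : ℝ => -t) else id) (θ i) := by
    funext θ i
    by_cases h : i = l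
    · subst h; simp
    · simp [h]
  have he : MeasurableEmbedding (fun θ : P → ℝ => Function.update θ l (-θ l)) := by
    have hm : Measurable (fun θ : P → ℝ => Function.update θ l (-θ l)) := by
      rw [h3]; exact h2.measurable
    refine (MeasurableEquiv.mk ⟨fun θ : P → ℝ => Function.update θ l (-θ l),
      fun θ : P → ℝ => Function.update θ l (-θ l), ?_, ?_⟩ hm hm).measurableEmbedding
    all_goals intro θ; simp
  rw [← h3] at h2
  exact h2.integral_comp he f

/-- Independence of one coordinate from the others. That `f` ignores coordinate `l` is expressed as
invariance under resetting that coordinate to 0. -/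
lemma integral_cube_mul {r : ℝ} (hr : 0 < r) (l : P) (u : ℝ → ℝ) (hu : Continuous u)
    (f : (P → ℝ) → ℝ) (hf : Continuous f) (h : ∀ θ, f (Function.update θ l 0) = f θ) :
    ∫ θ, u (θ l) * f θ ∂(cube (0 : P → ℝ) r)
      = (∫ t, u t ∂(unif r)) * ∫ θ, f θ ∂(cube (0 : P → ℝ) r) := by
  have := isProbabilityMeasure_unif hr
  rw [cube_eq_pi hr]
  have hind : iIndepFun (fun (i : P) (θ : P → ℝ) => θ i) (Measure.pi fun _ => unif r) :=
    iIndepFun_pi (X := fun _ t => t) (fun _ => measurable_id.aemeasurable)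
  have h2 := hind.indepFun_finset {l} (Finset.univ.erase l) (by simp) (fun i => measurable_pi_apply i)
  -- `F` is `f` read as a function of the other coordinates only, with 0 in slot `l`; independence
  -- of disjoint blocks of coordinates then applies.
  let F : (↥(Finset.univ.erase l) → ℝ) → ℝ := fun η =>
    f (fun i => if hi : i ∈ Finset.univ.erase l then η ⟨i, hi⟩ else 0)
  have hF : Continuous F := by
    refine hf.comp (continuous_pi fun i => ?_)
    by_cases hi : i ∈ Finset.univ.erase l
    · simp only [hi, dite_true]; fun_prop
    · simp only [hi, dite_false]; fun_prop
  have h3 := h2.comp (φ := fun η : ↥({l} : Finset P) → ℝ => u (η ⟨l, by simp⟩)) (ψ := F)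
    (by fun_prop) hF.measurable
  have h4 := h3.integral_fun_mul_eq_mul_integral ?_ ?_
  · have e1 : ∀ θ : P → ℝ, F (fun i => θ i) = f θ := by
      intro θ
      rw [← h θ]
      simp only [F]
      congr 1
      funext i
      by_cases hi : i = l
      · subst hi; simp
      · simp [hi]
    simp only [Function.comp_apply, e1] at h4
    rw [h4]
    congr 1
    exact integral_comp_eval (μ := fun _ : P => unif r) (i := l) hu.aestronglyMeasurable
  · apply Measurable.aestronglyMeasurable
    have := hu.measurable
    fun_prop
  · apply Measurable.aestronglyMeasurable
    have := hF.measurable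
    fun_prop

lemma integral_cube_eval {r : ℝ} (hr : 0 < r) (l : P) (u : ℝ → ℝ) (hu : Continuous u) :
    ∫ θ, u (θ l) ∂(cube (0 : P → ℝ) r) = ∫ t, u t ∂(unif r) := by
  have := isProbabilityMeasure_cube (P := P) hr
  have := integral_cube_mul hr l u hu (fun _ => 1) continuous_const (fun _ => rfl)
  simpa using this

end PQC

namespace PQC

open MeasureTheory ProbabilityTheory Circuit

/-! ## One-dimensional Taylor estimates -/

lemma nonneg_of_deriv_nonneg {f f' : ℝ → ℝ} (h : ∀ t, HasDerivAt f (f' t) t) (h0 : 0 ≤ f 0)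
    (hp : ∀ t, 0 ≤ t → 0 ≤ f' t) {t : ℝ} (ht : 0 ≤ t) : 0 ≤ f t := by
  have hm : MonotoneOn f (Set.Ici 0) := by
    apply monotoneOn_of_deriv_nonneg (convex_Ici 0)
    · exact fun x _ => (h x).continuousAt.continuousWithinAt
    · exact fun x _ => (h x).differentiableAt.differentiableWithinAt
    · intro x hx
      rw [interior_Ici] at hx
      rw [(h x).deriv]; exact hp x (le_of_lt hx)
  exact h0.trans (hm Set.self_mem_Ici ht ht)

lemma hasDerivAt_comp_neg' {f f' : ℝ → ℝ} (h : ∀ t, HasDerivAt f (f' t) t) (t : ℝ) :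
    HasDerivAt (fun t => f (-t)) (-f' (-t)) t := by
  have := (h (-t)).comp t (hasDerivAt_neg t)
  exact this.congr_deriv (by ring)

/-- The symmetrized function vanishes at 0 together with its first derivative, and its second
derivative is at most 2B in modulus; integrating twice compares it with B t². -/
lemma second_difference_le {h h₁ h₂ : ℝ → ℝ} (H1 : ∀ t, HasDerivAt h (h₁ t) t)
    (H2 : ∀ t, HasDerivAt h₁ (h₂ t) t) {B : ℝ} (hB : ∀ t, |h₂ t| ≤ B) (t : ℝ) :
    |h t + h (-t) - 2 * h 0| ≤ B * t ^ 2 := by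
  -- The sign σ = ±1 treats the upper and the lower bound at once.
  have key : ∀ σ : ℝ, |σ| = 1 → ∀ t, 0 ≤ t → 0 ≤ B * t ^ 2 - σ * (h t + h (-t) - 2 * h 0) := by
    intro σ hσ t ht
    refine nonneg_of_deriv_nonneg
      (f := fun t => B * t ^ 2 - σ * (h t + h (-t) - 2 * h 0))
      (f' := fun t => B * (2 * t) - σ * (h₁ t - h₁ (-t))) ?_ ?_ ?_ ht
    · intro t
      have a := (hasDerivAt_pow 2 t).const_mul B
      have b := (((H1 t).add (hasDerivAt_comp_neg' H1 t)).sub_const (2 * h 0)).const_mul σ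
      refine (a.sub b).congr_deriv ?_
      norm_num; left; ring
    · simp [show h 0 + h 0 - 2 * h 0 = 0 by ring]
    · intro t ht
      refine nonneg_of_deriv_nonneg (f := fun t => B * (2 * t) - σ * (h₁ t - h₁ (-t)))
        (f' := fun t => B * 2 - σ * (h₂ t + h₂ (-t))) ?_ ?_ ?_ ht
      · intro t
        have a := ((hasDerivAt_id t).const_mul 2).const_mul B
        have b := (((H2 t).sub (hasDerivAt_comp_neg' H2 t))).const_mul σ
        refine (a.sub b).congr_deriv ?_
        simp
      · simp
      · intro t _
        have := abs_le.1 (hB t)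
        have := abs_le.1 (hB (-t))
        rcases (abs_eq zero_le_one).1 hσ with rfl | rfl <;> linarith
  have key2 : ∀ t, 0 ≤ t → |h t + h (-t) - 2 * h 0| ≤ B * t ^ 2 := by
    intro t ht
    have a := key 1 (by simp) t ht
    have b := key (-1) (by simp) t ht
    rw [abs_le]; constructor <;> linarith
  rcases le_total 0 t with ht | ht
  · exact key2 t ht
  · have := key2 (-t) (by linarith)
    simpa [add_comm] using this

/-- Two differentiations reduce this to `second_difference_le` for `h₂`; the constant 1/12 is the
one for which (M t⁴/12)'' = M t². -/
lemma fourth_difference_le {h h₁ h₂ h₃ h₄ : ℝ → ℝ} (H1 : ∀ t, HasDerivAt h (h₁ t) t)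
    (H2 : ∀ t, HasDerivAt h₁ (h₂ t) t) (H3 : ∀ t, HasDerivAt h₂ (h₃ t) t)
    (H4 : ∀ t, HasDerivAt h₃ (h₄ t) t) {M : ℝ} (hM : ∀ t, |h₄ t| ≤ M) (t : ℝ) :
    |h t + h (-t) - 2 * h 0 - h₂ 0 * t ^ 2| ≤ M * t ^ 4 / 12 := by
  have key : ∀ σ : ℝ, |σ| = 1 → ∀ t, 0 ≤ t →
      0 ≤ M / 12 * t ^ 4 - σ * (h t + h (-t) - 2 * h 0 - h₂ 0 * t ^ 2) := by
    intro σ hσ t ht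
    refine nonneg_of_deriv_nonneg
      (f := fun t => M / 12 * t ^ 4 - σ * (h t + h (-t) - 2 * h 0 - h₂ 0 * t ^ 2))
      (f' := fun t => M / 12 * (4 * t ^ 3)
      - σ * (h₁ t - h₁ (-t) - h₂ 0 * (2 * t))) ?_ ?_ ?_ ht
    · intro t
      have a := (hasDerivAt_pow 4 t).const_mul (M / 12)
      have b := ((((H1 t).add (hasDerivAt_comp_neg' H1 t)).sub_const (2 * h 0)).sub
        ((hasDerivAt_pow 2 t).const_mul (h₂ 0))).const_mul σ
      refine (a.sub b).congr_deriv ?_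
      norm_num; left; ring
    · simp [show h 0 + h 0 - 2 * h 0 = 0 by ring]
    · intro t ht
      refine nonneg_of_deriv_nonneg
        (f := fun t => M / 12 * (4 * t ^ 3) - σ * (h₁ t - h₁ (-t) - h₂ 0 * (2 * t)))
        (f' := fun t => M / 12 * (4 * (3 * t ^ 2))
        - σ * (h₂ t + h₂ (-t) - h₂ 0 * 2)) ?_ ?_ ?_ ht
      · intro t
        have a := ((hasDerivAt_pow 3 t).const_mul 4).const_mul (M / 12)
        have b := (((H2 t).sub (hasDerivAt_comp_neg' H2 t)).sub
          (((hasDerivAt_id t).const_mul 2).const_mul (h₂ 0))).const_mul σ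
        refine (a.sub b).congr_deriv ?_
        simp
      · simp
      · intro t _
        have := abs_le.1 (second_difference_le H3 H4 hM t)
        rcases (abs_eq zero_le_one).1 hσ with rfl | rfl <;> linarith
  have key2 : ∀ t, 0 ≤ t → |h t + h (-t) - 2 * h 0 - h₂ 0 * t ^ 2| ≤ M * t ^ 4 / 12 := by
    intro t ht
    have a := key 1 (by simp) t ht
    have b := key (-1) (by simp) t ht
    rw [abs_le]; constructor <;> linarith
  rcases le_total 0 t with ht | ht
  · exact key2 t ht
  · have := key2 (-t) (by linarith)
    rw [neg_neg, add_comm (h (-t))] at this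
    simpa [Even.neg_pow (show Even 4 by decide)] using this

/-! ## Bessel's inequality for the quadratic functions of the coordinates -/

lemma integral_poly_unif {r : ℝ} (hr : 0 < r) (a₀ a₁ a₂ a₃ a₄ : ℝ) :
    ∫ t, (a₀ + a₁ * t ^ 2 + a₂ * t ^ 4 + a₃ * t ^ 6 + a₄ * t ^ 8) ∂(unif r)
      = a₀ + a₁ * (r ^ 2 / 3) + a₂ * (r ^ 4 / 5) + a₃ * (r ^ 6 / 7) + a₄ * (r ^ 8 / 9) := by
  rw [integral_unif hr]
  have : ∀ t ∈ Set.uIcc (-r) r, HasDerivAt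
      (fun t => a₀ * t + a₁ * (t ^ 3 / 3) + a₂ * (t ^ 5 / 5) + a₃ * (t ^ 7 / 7) + a₄ * (t ^ 9 / 9))
      (a₀ + a₁ * t ^ 2 + a₂ * t ^ 4 + a₃ * t ^ 6 + a₄ * t ^ 8) t := by
    intro t _
    have := ((((hasDerivAt_id t).const_mul a₀).add
      (((hasDerivAt_pow 3 t).div_const 3).const_mul a₁)).add
      (((hasDerivAt_pow 5 t).div_const 5).const_mul a₂)).add
      (((hasDerivAt_pow 7 t).div_const 7).const_mul a₃) |>.add
      (((hasDerivAt_pow 9 t).div_const 9).const_mul a₄)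
    refine this.congr_deriv ?_
    norm_num
  rw [intervalIntegral.integral_eq_sub_of_hasDerivAt this
    (Continuous.intervalIntegrable (by fun_prop) _ _)]
  field_simp
  ring

/-- The centred square of a coordinate. -/
noncomputable def quad (r t : ℝ) : ℝ := t ^ 2 - r ^ 2 / 3

lemma continuous_quad (r : ℝ) : Continuous (quad r) := by unfold quad; fun_prop

lemma integral_quad {r : ℝ} (hr : 0 < r) : ∫ t, quad r t ∂(unif r) = 0 := by
  have := integral_poly_unif hr (-(r ^ 2 / 3)) 1 0 0 0
  have e : ∀ t, quad r t = -(r ^ 2 / 3) + 1 * t ^ 2 + 0 * t ^ 4 + 0 * t ^ 6 + 0 * t ^ 8 := by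
    intro t; unfold quad; ring
  simp_rw [e]; rw [this]; ring

lemma integral_quad_sq {r : ℝ} (hr : 0 < r) : ∫ t, quad r t ^ 2 ∂(unif r) = 4 * r ^ 4 / 45 := by
  have := integral_poly_unif hr (r ^ 4 / 9) (-(2 * r ^ 2 / 3)) 1 0 0
  have e : ∀ t, quad r t ^ 2
      = (r ^ 4 / 9) + (-(2 * r ^ 2 / 3)) * t ^ 2 + 1 * t ^ 4 + 0 * t ^ 6 + 0 * t ^ 8 := by
    intro t; unfold quad; ring
  simp_rw [e]; rw [this]; ring

lemma integral_quad_mul_sq {r : ℝ} (hr : 0 < r) :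
    ∫ t, quad r t * t ^ 2 ∂(unif r) = 4 * r ^ 4 / 45 := by
  have := integral_poly_unif hr 0 (-(r ^ 2 / 3)) 1 0 0
  have e : ∀ t, quad r t * t ^ 2
      = 0 + (-(r ^ 2 / 3)) * t ^ 2 + 1 * t ^ 4 + 0 * t ^ 6 + 0 * t ^ 8 := by
    intro t; unfold quad; ring
  simp_rw [e]; rw [this]; ring

/-- The weight is the polynomial majorant of |quad| from `abs_quad_le`, chosen so that its moments
are explicit. -/
lemma integral_quad_remainder {r : ℝ} (hr : 0 < r) :
    ∫ t, (quad r t ^ 2 / r ^ 2 + r ^ 2 / 4) * t ^ 4 ∂(unif r) = 37 / 420 * r ^ 6 := by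
  have := integral_poly_unif hr 0 0 (r ^ 2 / 9 + r ^ 2 / 4) (-(2 / 3)) (1 / r ^ 2)
  have e : ∀ t, (quad r t ^ 2 / r ^ 2 + r ^ 2 / 4) * t ^ 4
      = 0 + 0 * t ^ 2 + (r ^ 2 / 9 + r ^ 2 / 4) * t ^ 4 + (-(2 / 3)) * t ^ 6
        + (1 / r ^ 2) * t ^ 8 := by
    intro t; unfold quad; field_simp; ring
  simp_rw [e]; rw [this]; field_simp; ring

/-- The arithmetic–geometric mean inequality for |quad|/r and r/2. -/
lemma abs_quad_le {r : ℝ} (hr : 0 < r) (t : ℝ) : |quad r t| ≤ quad r t ^ 2 / r ^ 2 + r ^ 2 / 4 := by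
  have h : 0 ≤ (|quad r t| / r - r / 2) ^ 2 := sq_nonneg _
  have e : (|quad r t| / r - r / 2) ^ 2 = quad r t ^ 2 / r ^ 2 + r ^ 2 / 4 - |quad r t| := by
    rw [← sq_abs (quad r t)]; field_simp; ring
  linarith

variable {P : Type} [Fintype P] [DecidableEq P]

/-- The functions `quad r (θ l)` have mean 0 and are pairwise uncorrelated by independence.
Subtracting from `f` its projection `g` onto their span leaves a nonnegative variance, and Cov(f, g)
= Var(g). -/
theorem bessel_cube {r : ℝ} (hr : 0 < r) {f : (P → ℝ) → ℝ} (hf : Continuous f) (Λ : Finset P) :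
    ∑ l ∈ Λ, (∫ θ, quad r (θ l) * f θ ∂(cube (0 : P → ℝ) r)) ^ 2 / (4 * r ^ 4 / 45)
      ≤ variance f (cube (0 : P → ℝ) r) := by
  have := isProbabilityMeasure_cube (P := P) hr
  set s := 4 * r ^ 4 / 45 with hs
  have hs0 : 0 < s := by positivity
  set a : P → ℝ := fun l => (∫ θ, quad r (θ l) * f θ ∂(cube (0 : P → ℝ) r)) / s with ha
  have cq : ∀ l : P, Continuous fun θ : P → ℝ => quad r (θ l) := fun l =>
    (continuous_quad r).comp (continuous_apply l)
  set g : (P → ℝ) → ℝ := fun θ => ∑ l ∈ Λ, a l * quad r (θ l) with hg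
  have cg : Continuous g := continuous_finsetSum _ fun l _ => continuous_const.mul (cq l)
  have Eq0 : ∀ l : P, ∫ θ, quad r (θ l) ∂(cube (0 : P → ℝ) r) = 0 := fun l => by
    rw [integral_cube_eval hr l _ (continuous_quad r), integral_quad hr]
  have Eqq : ∀ l k : P, ∫ θ, quad r (θ l) * quad r (θ k) ∂(cube (0 : P → ℝ) r) = if l = k then s else 0 := by
    intro l k
    split_ifs with h
    · subst h
      have := integral_cube_eval hr l (fun t => quad r t ^ 2) (by have := continuous_quad r; fun_prop)
      simp_rw [← sq]
      rw [this, integral_quad_sq hr]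
    · rw [integral_cube_mul hr l _ (continuous_quad r) (fun θ => quad r (θ k)) (cq k),
        integral_quad hr, zero_mul]
      intro θ
      simp [Function.update_of_ne (Ne.symm h)]
  have Eg : ∫ θ, g θ ∂(cube (0 : P → ℝ) r) = 0 := by
    rw [hg, integral_finsetSum _ fun l _ => (integrable_cube hr (cq l)).const_mul (a l)]
    simp [integral_const_mul, Eq0]
  have Efg : ∫ θ, g θ * f θ ∂(cube (0 : P → ℝ) r) = ∑ l ∈ Λ, a l ^ 2 * s := by
    simp_rw [hg, Finset.sum_mul, mul_assoc]
    rw [integral_finsetSum _ fun l _ => (integrable_cube (f := fun θ => quad r (θ l) * f θ) hr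
      ((cq l).mul hf)).const_mul (a l)]
    refine Finset.sum_congr rfl fun l _ => ?_
    rw [integral_const_mul, ha]
    field_simp
  have Eqg : ∀ l ∈ Λ, ∫ θ, quad r (θ l) * g θ ∂(cube (0 : P → ℝ) r) = a l * s := by
    intro l hl
    simp_rw [hg, Finset.mul_sum]
    rw [integral_finsetSum _ fun k _ => ?_]
    · have : ∀ k ∈ Λ, ∫ θ, quad r (θ l) * (a k * quad r (θ k)) ∂(cube (0 : P → ℝ) r) = if l = k then a k * s else 0 := by
        intro k _
        have e : ∀ θ : P → ℝ, quad r (θ l) * (a k * quad r (θ k))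
          = a k * (quad r (θ l) * quad r (θ k)) := fun θ => by ring
        simp_rw [e]; rw [integral_const_mul, Eqq]; split_ifs <;> simp
      rw [Finset.sum_congr rfl this]; simp [hl]
    · exact integrable_cube hr ((cq l).mul (continuous_const.mul (cq k)))
  have Egg : ∫ θ, g θ * g θ ∂(cube (0 : P → ℝ) r) = ∑ l ∈ Λ, a l ^ 2 * s := by
    have e : ∀ θ, g θ * g θ = ∑ l ∈ Λ, a l * (quad r (θ l) * g θ) := fun θ => by
      conv_lhs => enter [1]; rw [hg]
      rw [Finset.sum_mul]
      exact Finset.sum_congr rfl fun l _ => by ring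
    simp_rw [e]
    rw [integral_finsetSum _ fun l _ => (integrable_cube (f := fun θ => quad r (θ l) * g θ) hr
      ((cq l).mul cg)).const_mul (a l)]
    refine Finset.sum_congr rfl fun l hl => ?_
    rw [integral_const_mul, Eqg l hl]; ring
  have hsub := variance_sub (memLp_cube hr hf) (memLp_cube hr cg)
  have h0 : 0 ≤ variance (f - g) (cube (0 : P → ℝ) r) := variance_nonneg _ _
  have hcov : covariance f g (cube (0 : P → ℝ) r) = ∑ l ∈ Λ, a l ^ 2 * s := by
    rw [covariance_eq_sub (memLp_cube hr hf) (memLp_cube hr cg), Eg, mul_zero, sub_zero, ← Efg]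
    exact integral_congr_ae (Filter.Eventually.of_forall fun θ => by simp [mul_comm])
  have hvar : variance g (cube (0 : P → ℝ) r) = ∑ l ∈ Λ, a l ^ 2 * s := by
    rw [variance_eq_sub (memLp_cube hr cg), Eg, ← Egg]
    simp [sq]
  rw [hsub, hcov, hvar] at h0
  have hsum : ∑ l ∈ Λ, (∫ θ, quad r (θ l) * f θ ∂(cube (0 : P → ℝ) r)) ^ 2 / s = ∑ l ∈ Λ, a l ^ 2 * s :=
    Finset.sum_congr rfl fun l _ => by rw [ha]; field_simp
  rw [hsum]; linarith

end PQC

namespace PQC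

open MeasureTheory ProbabilityTheory Circuit

/-! ## Partial derivatives and the variance on a small hypercube -/

/-- `F'` is the partial derivative of `F` in the coordinate `p`. -/
def IsPD {P E : Type} [DecidableEq P] [NormedAddCommGroup E] [NormedSpace ℝ E] (p : P)
    (F F' : (P → ℝ) → E) : Prop :=
  ∀ θ, HasDerivAt (fun t => F (Function.update θ p t)) (F' θ) (θ p)

namespace IsPD

variable {P E : Type} [DecidableEq P] [NormedAddCommGroup E] [NormedSpace ℝ E] {p : P}
  {F F' F'' : (P → ℝ) → E}

lemma update (h : IsPD p F F') (θ : P → ℝ) (t : ℝ) :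
    HasDerivAt (fun s => F (Function.update θ p s)) (F' (Function.update θ p t)) t := by
  have := h (Function.update θ p t)
  simpa using this

lemma d2_eq (h : IsPD p F F') (h' : IsPD p F' F'') : d2 F p = F'' := by
  funext θ
  unfold d2
  -- `d2` updates with classical decidable equality, `IsPD` with the ambient instance; the updates
  -- agree.
  have e : ∀ t, @Function.update P (fun _ => ℝ) (fun a b => Classical.propDecidable (a = b)) θ p t
      = Function.update θ p t := fun t => by
    congr; exact Subsingleton.elim _ _
  simp_rw [e]
  rw [iteratedDeriv_succ, iteratedDeriv_one]
  have e1 : deriv (fun t => F (Function.update θ p t)) = fun t => F' (Function.update θ p t) := by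
    funext t; exact (h.update θ t).deriv
  rw [e1, (h'.update θ (θ p)).deriv]
  simp

lemma clm {E' : Type} [NormedAddCommGroup E'] [NormedSpace ℝ E'] (h : IsPD p F F')
    (ℓ : E →L[ℝ] E') : IsPD p (fun θ => ℓ (F θ)) (fun θ => ℓ (F' θ)) :=
  fun θ => ℓ.hasFDerivAt.comp_hasDerivAt (θ p) (h θ)

end IsPD

variable {P : Type} [Fintype P]

section
variable [DecidableEq P]

/-- The correlation of `f` with the centred square of one coordinate, up to fourth order. -/
lemma integral_quad_mul_approx {r : ℝ} (hr : 0 < r) (l : P) {f f₁ f₂ f₃ f₄ : (P → ℝ) → ℝ}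
    (hf : Continuous f) (hf₂ : Continuous f₂) (h₁ : IsPD l f f₁) (h₂ : IsPD l f₁ f₂)
    (h₃ : IsPD l f₂ f₃) (h₄ : IsPD l f₃ f₄) {M : ℝ} (hM : ∀ θ, |f₄ θ| ≤ M) :
    |(∫ θ, quad r (θ l) * f θ ∂(cube (0 : P → ℝ) r))
        - 2 * r ^ 4 / 45 * ∫ θ, f₂ (Function.update θ l 0) ∂(cube (0 : P → ℝ) r)|
      ≤ 37 / 10080 * M * r ^ 6 := by
  have := isProbabilityMeasure_cube (P := P) hr
  have cq : Continuous fun θ : P → ℝ => quad r (θ l) := (continuous_quad r).comp (continuous_apply l)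
  have cu : ∀ u : (P → ℝ) → ℝ, Continuous u → Continuous fun θ : P → ℝ => Function.update θ l (u θ) :=
    fun u hu => continuous_id.update l hu
  have c0 : Continuous fun θ : P → ℝ => f (Function.update θ l 0) := hf.comp (cu _ continuous_const)
  have c2 : Continuous fun θ : P → ℝ => f₂ (Function.update θ l 0) := hf₂.comp (cu _ continuous_const)
  have cf : Continuous fun θ : P → ℝ => f (Function.update θ l (-θ l)) :=
    hf.comp (cu _ (continuous_apply l).neg)
  have I1 : ∫ θ, quad r (θ l) * f θ ∂(cube (0 : P → ℝ) r)
      = ∫ θ, quad r (θ l) * f (Function.update θ l (-θ l)) ∂(cube (0 : P → ℝ) r) := by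
    rw [← integral_cube_flip hr l]
    simp [quad]
  have I2 : ∫ θ, quad r (θ l) * (θ l ^ 2) * f₂ (Function.update θ l 0) ∂(cube (0 : P → ℝ) r)
      = 4 * r ^ 4 / 45 * ∫ θ, f₂ (Function.update θ l 0) ∂(cube (0 : P → ℝ) r) := by
    rw [integral_cube_mul hr l (fun t => quad r t * t ^ 2) (by have := continuous_quad r; fun_prop)
      _ c2 (by simp), integral_quad_mul_sq hr]
  have I3 : ∫ θ, quad r (θ l) * f (Function.update θ l 0) ∂(cube (0 : P → ℝ) r) = 0 := by
    rw [integral_cube_mul hr l _ (continuous_quad r) _ c0 (by simp), integral_quad hr, zero_mul]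
  -- Averaging `f` with its reflection kills the odd orders. The zeroth order drops out because
  -- `quad` is centred, and the second order carries the moment 4r⁴/45.
  have I4 : ∫ θ, quad r (θ l) * (f θ + f (Function.update θ l (-θ l))
        - 2 * f (Function.update θ l 0) - f₂ (Function.update θ l 0) * θ l ^ 2)
        ∂(cube (0 : P → ℝ) r)
      = 2 * (∫ θ, quad r (θ l) * f θ ∂(cube (0 : P → ℝ) r))
        - 4 * r ^ 4 / 45 * ∫ θ, f₂ (Function.update θ l 0) ∂(cube (0 : P → ℝ) r) := by
    have e : ∀ θ : P → ℝ, quad r (θ l) * (f θ + f (Function.update θ l (-θ l))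
        - 2 * f (Function.update θ l 0) - f₂ (Function.update θ l 0) * θ l ^ 2)
        = quad r (θ l) * f θ + quad r (θ l) * f (Function.update θ l (-θ l))
          - 2 * (quad r (θ l) * f (Function.update θ l 0))
          - quad r (θ l) * (θ l ^ 2) * f₂ (Function.update θ l 0) := fun θ => by ring
    simp_rw [e]
    rw [integral_sub, integral_sub, integral_add, integral_const_mul, I2, I3, ← I1]
    · ring
    all_goals apply integrable_cube hr
    all_goals fun_prop
  have hpt : ∀ θ : P → ℝ, ‖quad r (θ l) * (f θ + f (Function.update θ l (-θ l))
        - 2 * f (Function.update θ l 0) - f₂ (Function.update θ l 0) * θ l ^ 2)‖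
      ≤ M / 12 * ((quad r (θ l) ^ 2 / r ^ 2 + r ^ 2 / 4) * θ l ^ 4) := by
    intro θ
    rw [norm_mul, Real.norm_eq_abs, Real.norm_eq_abs]
    have a := abs_quad_le hr (θ l)
    have b := fourth_difference_le (fun t => h₁.update θ t) (fun t => h₂.update θ t)
      (fun t => h₃.update θ t) (fun t => h₄.update θ t) (fun t => hM _) (θ l)
    rw [Function.update_eq_self] at b
    calc _ ≤ _ := mul_le_mul a b (abs_nonneg _) (by positivity)
      _ = _ := by ring
  -- The final 37/10080 is 1/2 (symmetrization) times 1/12 (Taylor) times 37/420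
  -- (`integral_quad_remainder`).
  have hb := norm_integral_le_of_norm_le (μ := cube (0 : P → ℝ) r) (integrable_cube hr (by
    have := continuous_quad r; fun_prop)) (Filter.Eventually.of_forall hpt)
  rw [I4, integral_const_mul, integral_cube_eval hr l
    (fun t => (quad r t ^ 2 / r ^ 2 + r ^ 2 / 4) * t ^ 4) (by have := continuous_quad r; fun_prop),
    integral_quad_remainder hr, Real.norm_eq_abs] at hb
  rw [abs_le] at hb ⊢
  constructor <;> linarith [hb.1, hb.2]

end

variable [LinearOrder P]

/-- The mean over the hypercube differs from the value at its centre by the second derivatives,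
where the `μ`-th second derivative is needed only where all smaller coordinates vanish. -/
lemma integral_cube_sub_le {r : ℝ} (hr : 0 < r) {D : (P → ℝ) → ℝ} (hD : Continuous D)
    {D₁ D₂ : P → (P → ℝ) → ℝ} (h₁ : ∀ μ, IsPD μ D (D₁ μ)) (h₂ : ∀ μ, IsPD μ (D₁ μ) (D₂ μ))
    {B : P → ℝ} (hB : ∀ μ θ, (∀ ν, ν < μ → θ ν = 0) → |D₂ μ θ| ≤ B μ) :
    |(∫ θ, D θ ∂(cube (0 : P → ℝ) r)) - D 0| ≤ r ^ 2 / 6 * ∑ μ, B μ := by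
  have := isProbabilityMeasure_cube (P := P) hr
  -- `Z s` resets the coordinates in `s` to 0. Only lower sets `s` occur, added to in increasing
  -- order, so when a coordinate is removed all smaller ones already vanish. Telescoping over `s`
  -- gives the sum of the `B μ`.
  let Z : Finset P → (P → ℝ) → P → ℝ := fun s θ i => if i ∈ s then 0 else θ i
  have cZ : ∀ s, Continuous (Z s) := fun s => continuous_pi fun i => by
    by_cases h : i ∈ s
    · simp only [Z, h, if_true]; fun_prop
    · simp only [Z, h, if_false]; fun_prop
  have key : ∀ s : Finset P, (∀ i ∈ s, ∀ j, j < i → j ∈ s) →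
      |(∫ θ, D θ ∂(cube (0 : P → ℝ) r)) - ∫ θ, D (Z s θ) ∂(cube (0 : P → ℝ) r)|
        ≤ r ^ 2 / 6 * ∑ μ ∈ s, B μ := by
    intro s
    induction s using Finset.induction_on_max with
    | empty => intro _; simp [Z]
    | insert a s ha ih =>
      intro hs
      have hs' : ∀ i ∈ s, ∀ j, j < i → j ∈ s := by
        intro i hi j hj
        rcases Finset.mem_insert.1 (hs i (Finset.mem_insert_of_mem hi) j hj) with h | h
        · subst h; exact absurd (ha i hi) (not_lt.2 hj.le)
        · exact h
      have has : a ∉ s := fun h => lt_irrefl _ (ha a h)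
      have e1 : ∀ θ, Z s (Function.update θ a (-θ a)) = Function.update (Z s θ) a (-θ a) := by
        intro θ; funext i
        by_cases h : i = a
        · subst h; simp [Z, has]
        · simp [Z, h]
      have e2 : ∀ θ, Z (insert a s) θ = Function.update (Z s θ) a 0 := by
        intro θ; funext i
        by_cases h : i = a
        · subst h; simp [Z]
        · simp [Z, h]
      have e3 : ∀ θ, Z s θ = Function.update (Z s θ) a (θ a) := by
        intro θ; funext i
        by_cases h : i = a
        · subst h; simp [Z, has]
        · simp [h]
      have I1 : ∫ θ, D (Z s θ) ∂(cube (0 : P → ℝ) r)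
          = ∫ θ, D (Z s (Function.update θ a (-θ a))) ∂(cube (0 : P → ℝ) r) :=
        (integral_cube_flip hr a (fun θ => D (Z s θ))).symm
      have c1 : Continuous fun θ => D (Z s θ) := hD.comp (cZ s)
      have c2 : Continuous fun θ => D (Z (insert a s) θ) := hD.comp (cZ _)
      have c3 : Continuous fun θ : P → ℝ => D (Z s (Function.update θ a (-θ a))) :=
        c1.comp (continuous_id.update a (continuous_apply a).neg)
      have I2 : ∫ θ, (D (Z s θ) + D (Z s (Function.update θ a (-θ a)))
            - 2 * D (Z (insert a s) θ)) ∂(cube (0 : P → ℝ) r)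
          = 2 * (∫ θ, D (Z s θ) ∂(cube (0 : P → ℝ) r))
            - 2 * ∫ θ, D (Z (insert a s) θ) ∂(cube (0 : P → ℝ) r) := by
        rw [integral_sub, integral_add, ← I1, integral_const_mul]
        · ring
        all_goals apply integrable_cube hr
        all_goals fun_prop
      have hpt : ∀ θ : P → ℝ, ‖D (Z s θ) + D (Z s (Function.update θ a (-θ a)))
            - 2 * D (Z (insert a s) θ)‖ ≤ B a * θ a ^ 2 := by
        intro θ
        rw [e1, e2, Real.norm_eq_abs]
        conv_lhs => enter [1, 1, 1]; rw [e3]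
        refine second_difference_le (h := fun t => D (Function.update (Z s θ) a t))
          (fun t => (h₁ a).update (Z s θ) t) (fun t => (h₂ a).update (Z s θ) t) (fun t => ?_) (θ a)
        refine hB a _ fun ν hν => ?_
        rw [Function.update_of_ne hν.ne]
        have : ν ∈ s := by
          rcases Finset.mem_insert.1 (hs a (Finset.mem_insert_self a s) ν hν) with h | h
          · exact absurd h hν.ne
          · exact h
        simp [Z, this]
      -- The mean of θ_a² is r²/3, and the factor 2 in `I2` halves it to r²/6.
      have hb := norm_integral_le_of_norm_le (μ := cube (0 : P → ℝ) r) (integrable_cube hr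
        (by fun_prop)) (Filter.Eventually.of_forall hpt)
      have hm := integral_pow_unif hr 1
      rw [I2, integral_const_mul, integral_cube_eval hr a (fun t => t ^ 2) (by fun_prop)] at hb
      simp only [mul_one] at hm
      rw [hm, Real.norm_eq_abs] at hb
      have ih' := ih hs'
      rw [Finset.sum_insert has]
      rw [abs_le] at hb ih' ⊢
      norm_num at hb ih' ⊢
      constructor <;> linarith [hb.1, hb.2, ih'.1, ih'.2]
  have h := key Finset.univ (by simp)
  simpa [Z, ← Pi.zero_def] using h

/-- The variance guarantee for a function of independent uniform coordinates. -/
theorem variance_cube_ge {r : ℝ} (hr : 0 < r) (Λ : Finset P) {f : (P → ℝ) → ℝ} (hf : Continuous f)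
    {f₁ f₂ f₃ f₄ : P → (P → ℝ) → ℝ} {g₁ g₂ : P → P → (P → ℝ) → ℝ} {B : P → P → ℝ} {M : P → ℝ}
    (hf₂ : ∀ l ∈ Λ, Continuous (f₂ l)) (h₁ : ∀ l ∈ Λ, IsPD l f (f₁ l))
    (h₂ : ∀ l ∈ Λ, IsPD l (f₁ l) (f₂ l))
    (h₃ : ∀ l ∈ Λ, IsPD l (f₂ l) (f₃ l)) (h₄ : ∀ l ∈ Λ, IsPD l (f₃ l) (f₄ l))
    (hM : ∀ l ∈ Λ, ∀ θ, |f₄ l θ| ≤ M l) (k₁ : ∀ l ∈ Λ, ∀ μ, μ ≠ l → IsPD μ (f₂ l) (g₁ l μ))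
    (k₂ : ∀ l ∈ Λ, ∀ μ, μ ≠ l → IsPD μ (g₁ l μ) (g₂ l μ))
    (hB : ∀ l ∈ Λ, ∀ μ, μ ≠ l → ∀ θ, (∀ ν, ν < μ → θ ν = 0) → |g₂ l μ θ| ≤ B l μ)
    (hr2 : ∀ l ∈ Λ, r ^ 2 * (8 * ∑ μ ∈ Finset.univ.filter (fun μ => μ ≠ l), B l μ + 4 * M l)
      ≤ 9 * |f₂ l 0|) :
    1 / 72 * (∑ l ∈ Λ, |f₂ l 0| ^ 2) * r ^ 4 ≤ variance f (cube (0 : P → ℝ) r) := by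
  refine le_trans ?_ (bessel_cube hr hf Λ)
  rw [Finset.mul_sum, Finset.sum_mul]
  refine Finset.sum_le_sum fun l hl => ?_
  have a1 := integral_quad_mul_approx hr l hf (hf₂ l hl) (h₁ l hl) (h₂ l hl) (h₃ l hl) (h₄ l hl)
    (hM l hl)
  set S := ∑ μ ∈ Finset.univ.filter (fun μ => μ ≠ l), B l μ with hS
  have a2 : |(∫ θ, f₂ l (Function.update θ l 0) ∂(cube (0 : P → ℝ) r)) - f₂ l 0|
      ≤ r ^ 2 / 6 * S := by
    -- Once θ_l is frozen at 0 the function no longer depends on that coordinate, so its derivatives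
    -- and its bound are entered as 0.
    have := integral_cube_sub_le (P := P) hr (D := fun θ => f₂ l (Function.update θ l 0))
      (D₁ := fun μ θ => if μ = l then 0 else g₁ l μ (Function.update θ l 0))
      (D₂ := fun μ θ => if μ = l then 0 else g₂ l μ (Function.update θ l 0))
      (B := fun μ => if μ = l then 0 else B l μ)
      ((hf₂ l hl).comp (continuous_id.update l continuous_const)) ?_ ?_ ?_
    · have e : Function.update (0 : P → ℝ) l 0 = 0 := Function.update_eq_self l 0
      rw [e] at this
      refine this.trans (le_of_eq ?_)
      rw [hS, Finset.sum_filter]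
      congr 1
      exact Finset.sum_congr rfl fun μ _ => by by_cases h : μ = l <;> simp [h]
    · intro μ θ
      by_cases h : μ = l
      · subst h
        simpa using hasDerivAt_const _ _
      · have := (k₁ l hl μ h).update (Function.update θ l 0) (θ μ)
        simp only [h, if_false]
        have e : ∀ t, Function.update (Function.update θ μ t) l 0
          = Function.update (Function.update θ l 0) μ t := fun t => Function.update_comm h t 0 θ
        simp_rw [e]
        convert this using 2
        rw [Function.update_comm (Ne.symm h), Function.update_eq_self]
    · intro μ θ
      by_cases h : μ = l
      · subst h
        simpa using hasDerivAt_const _ _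
      · have := (k₂ l hl μ h).update (Function.update θ l 0) (θ μ)
        simp only [h, if_false]
        have e : ∀ t, Function.update (Function.update θ μ t) l 0
          = Function.update (Function.update θ l 0) μ t := fun t => Function.update_comm h t 0 θ
        simp_rw [e]
        convert this using 2
        rw [Function.update_comm (Ne.symm h), Function.update_eq_self]
    · intro μ θ hθ
      by_cases h : μ = l
      · simp [h]
      · simp only [h, if_false]
        refine hB l hl μ h _ fun ν hν => ?_
        by_cases h' : ν = l
        · subst h'; simp
        · simp [h', hθ ν hν]
  have h3 := hr2 l hl
  have r2 : 0 < r ^ 2 := by positivity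
  have r4 : 0 < r ^ 4 := by positivity
  set J := ∫ θ, quad r (θ l) * f θ ∂(cube (0 : P → ℝ) r)
  set E := ∫ θ, f₂ l (Function.update θ l 0) ∂(cube (0 : P → ℝ) r)
  set c := |f₂ l 0|
  have hM0 : 0 ≤ M l := (abs_nonneg _).trans (hM l hl 0)
  have hE : c - r ^ 2 / 6 * S ≤ |E| := by
    have := abs_sub_abs_le_abs_sub (f₂ l 0) E
    rw [abs_sub_comm] at this
    linarith
  have hJ : 2 * r ^ 4 / 45 * |E| - 37 / 10080 * M l * r ^ 6 ≤ |J| := by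
    have := abs_sub_abs_le_abs_sub (2 * r ^ 4 / 45 * E) J
    rw [abs_sub_comm] at this
    rw [abs_mul, abs_of_pos (show 0 < 2 * r ^ 4 / 45 by positivity)] at this
    linarith
  have hS0 : 0 ≤ S := (mul_nonneg_iff_of_pos_left (show 0 < r ^ 2 / 6 by positivity)).1
    ((abs_nonneg _).trans a2)
  -- The error terms cost at most (8S + 4M) r²/1080 ≤ c/120 in units of r⁴, and 2/45 − 1/120 =
  -- 13/360 exceeds 0.036. Finally 0.036² · 45/4 exceeds 1/72.
  have hfin : 36 / 1000 * c * r ^ 4 ≤ |J| := by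
    refine le_trans ?_ hJ
    have : 36 / 1000 * c * r ^ 4
        ≤ r ^ 4 * (2 / 45 * (c - r ^ 2 / 6 * S) - 37 / 10080 * M l * r ^ 2) := by
      rw [mul_comm]
      refine mul_le_mul_of_nonneg_left ?_ r4.le
      nlinarith [mul_nonneg r2.le hS0, mul_nonneg r2.le hM0]
    have h5 : 2 * r ^ 4 / 45 * (c - r ^ 2 / 6 * S) ≤ 2 * r ^ 4 / 45 * |E| :=
      mul_le_mul_of_nonneg_left hE (by positivity)
    nlinarith
  rw [le_div_iff₀ (by positivity), ← sq_abs J]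
  have hc0 : 0 ≤ c := abs_nonneg _
  calc 1 / 72 * c ^ 2 * r ^ 4 * (4 * r ^ 4 / 45) ≤ (36 / 1000 * c * r ^ 4) ^ 2 := by
        nlinarith [mul_nonneg (sq_nonneg c) (sq_nonneg (r ^ 4))]
    _ ≤ |J| ^ 2 := pow_le_pow_left₀ (by positivity) hfin 2

end PQC

namespace PQC

/-! ## Commutators -/

section Commutators

variable {n : ℕ}

/-- The derivation `X ↦ i [H, X]`. -/
noncomputable def ad (H : Op n) : Module.End ℂ (Op n) :=
  Complex.I • (LinearMap.mulLeft ℂ H - LinearMap.mulRight ℂ H)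

lemma ad_apply (H X : Op n) : ad H X = Complex.I • (H * X - X * H) := rfl

lemma ad_eq_zero {H X : Op n} (h : Commute H X) : ad H X = 0 := by
  rw [ad_apply, h.eq, sub_self, smul_zero]

lemma ad_sq_apply (H X : Op n) : (ad H ^ 2) X = -(H * (H * X - X * H) - (H * X - X * H) * H) := by
  rw [pow_two, Module.End.mul_apply, ad_apply, ad_apply, mul_smul_comm, smul_mul_assoc, ← smul_sub,
    smul_smul, Complex.I_mul_I, neg_one_smul]

lemma ad_pow_eq_zero {H X : Op n} (h : Commute H X) {k : ℕ} (hk : k ≠ 0) : (ad H ^ k) X = 0 := by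
  obtain ⟨j, rfl⟩ := Nat.exists_eq_succ_of_ne_zero hk
  rw [pow_succ, Module.End.mul_apply, ad_eq_zero h, map_zero]

lemma norm_ad_le_two (H X : Op n) : ‖ad H X‖ ≤ 2 * ‖H‖ * ‖X‖ := by
  rw [ad_apply, norm_smul, Complex.norm_I, one_mul]
  calc ‖H * X - X * H‖ ≤ ‖H * X‖ + ‖X * H‖ := norm_sub_le _ _
    _ ≤ ‖H‖ * ‖X‖ + ‖X‖ * ‖H‖ := add_le_add (norm_mul_le _ _) (norm_mul_le _ _)
    _ = _ := by ring

lemma norm_ad_pow_le_two (H X : Op n) (k : ℕ) : ‖(ad H ^ k) X‖ ≤ (2 * ‖H‖) ^ k * ‖X‖ := by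
  induction k with
  | zero => simp
  | succ k ih =>
    rw [pow_succ', Module.End.mul_apply]
    calc _ ≤ _ := norm_ad_le_two _ _
      _ ≤ 2 * ‖H‖ * ((2 * ‖H‖) ^ k * ‖X‖) := by gcongr
      _ = _ := by ring

lemma isBounded_spectrum (H : Op n) : Bornology.IsBounded (spectrum ℝ H) :=
  spectrum.isBounded H

lemma sInf_le_sSup_spectrum (H : Op n) : sInf (spectrum ℝ H) ≤ sSup (spectrum ℝ H) :=
  Real.sInf_le_sSup _ (isBounded_spectrum H).bddBelow (isBounded_spectrum H).bddAbove

lemma maxFreq_nonneg (H : Op n) : 0 ≤ maxFreq H := sub_nonneg.2 (sInf_le_sSup_spectrum H)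

lemma maxFreq_le (H : Op n) : maxFreq H ≤ 2 * ‖H‖ := by
  have h : ∀ x ∈ spectrum ℝ H, |x| ≤ ‖H‖ := fun x hx => by
    simpa using spectrum.norm_le_norm_of_mem hx
  have a : sSup (spectrum ℝ H) ≤ ‖H‖ := Real.sSup_le (fun x hx => (abs_le.1 (h x hx)).2) (norm_nonneg _)
  have b : -‖H‖ ≤ sInf (spectrum ℝ H) := by
    rcases (spectrum ℝ H).eq_empty_or_nonempty with he | he
    · rw [he]; simp
    · exact le_csInf he fun x hx => (abs_le.1 (h x hx)).1
  unfold maxFreq; linarith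

/-- A Hermitian matrix is within `maxFreq H / 2` of a scalar. -/
lemma exists_norm_sub_le {H : Op n} (hH : H.IsHermitian) :
    ∃ c : ℝ, ‖H - algebraMap ℝ (Op n) c‖ ≤ maxFreq H / 2 := by
  refine ⟨(sSup (spectrum ℝ H) + sInf (spectrum ℝ H)) / 2, ?_⟩
  set c := (sSup (spectrum ℝ H) + sInf (spectrum ℝ H)) / 2 with hc
  have hs : IsSelfAdjoint H := hH
  have e : cfc (fun x => x - c) H = H - algebraMap ℝ _ c := by
    rw [cfc_sub (fun x => x) (fun _ => c), cfc_id' ℝ H, cfc_const c H]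
  rw [← e]
  refine norm_cfc_le (by have := maxFreq_nonneg H; linarith) fun x hx => ?_
  have h1 := le_csSup (isBounded_spectrum H).bddAbove hx
  have h2 := csInf_le (isBounded_spectrum H).bddBelow hx
  unfold maxFreq
  rw [Real.norm_eq_abs, abs_le]
  constructor <;> rw [hc] <;> linarith

/-- Scalars drop out of a commutator, so `H` may be shifted to norm at most ω(H)/2. -/
lemma norm_ad_le {H : Op n} (hH : H.IsHermitian) (X : Op n) : ‖ad H X‖ ≤ maxFreq H * ‖X‖ := by
  obtain ⟨c, hc⟩ := exists_norm_sub_le hH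
  have e : ad H X = ad (H - algebraMap ℝ (Op n) c) X := by
    rw [ad_apply, ad_apply, sub_mul, mul_sub, ← Algebra.commutes c X]
    congr 1; abel
  rw [e]
  refine (norm_ad_le_two _ _).trans ?_
  gcongr
  linarith

lemma norm_ad_pow_le {H : Op n} (hH : H.IsHermitian) (X : Op n) (k : ℕ) :
    ‖(ad H ^ k) X‖ ≤ maxFreq H ^ k * ‖X‖ := by
  induction k with
  | zero => simp
  | succ k ih =>
    rw [pow_succ', Module.End.mul_apply]
    calc _ ≤ _ := norm_ad_le hH _
      _ ≤ maxFreq H * (maxFreq H ^ k * ‖X‖) := by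
        gcongr; exact maxFreq_nonneg H
      _ = _ := by ring

lemma norm_conj_unitary {W : Op n} (hW : W ∈ unitary (Op n)) (X : Op n) : ‖Wᴴ * X * W‖ = ‖X‖ := by
  rw [CStarRing.norm_mul_mem_unitary _ hW, ← Matrix.star_eq_conjTranspose,
    CStarRing.norm_mem_unitary_mul _ (Unitary.star_mem hW)]

end Commutators

/-! ## Derivatives of the Heisenberg evolution -/

section Evolution

variable {n : ℕ}

lemma exp_mem_unitary {H : Op n} (hH : H.IsHermitian) (t : ℝ) :
    NormedSpace.exp ((-(Complex.I * (t : ℂ))) • H) ∈ unitary (Op n) := by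
  let _ : NormedAlgebra ℚ (Op n) := NormedAlgebra.restrictScalars ℚ ℂ (Op n)
  refine NormedSpace.exp_mem_unitary_of_mem_skewAdjoint ?_
  rw [skewAdjoint.mem_iff, Matrix.star_eq_conjTranspose, Matrix.conjTranspose_smul, hH.eq]
  simp

/-- Heisenberg evolution through one gate. -/
noncomputable def conjGate (H V : Op n) (t : ℝ) (X : Op n) : Op n :=
  (NormedSpace.exp ((-(Complex.I * (t : ℂ))) • H) * V)ᴴ * X *
    (NormedSpace.exp ((-(Complex.I * (t : ℂ))) • H) * V)

/-- Since `B` commutes with its exponential, the derivatives of the two outer factors move inwards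
and form a commutator with `X t`. -/
lemma hasDerivAt_exp_conj {A : Type*} [NormedRing A] [NormedAlgebra ℝ A] [CompleteSpace A]
    (B W V : A) {X : ℝ → A} {X' : A} {t : ℝ} (hX : HasDerivAt X X' t) :
    HasDerivAt (fun s : ℝ => W * NormedSpace.exp (s • (-B)) * X s * (NormedSpace.exp (s • B) * V))
      (W * NormedSpace.exp (t • (-B)) * (X' + (X t * B - B * X t)) *
        (NormedSpace.exp (t • B) * V)) t := by
  have d1 := (hasDerivAt_exp_smul_const (𝕂 := ℝ) (-B) t).const_mul W
  have d2 := (hasDerivAt_exp_smul_const (𝕂 := ℝ) B t).mul_const V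
  refine ((d1.mul hX).mul d2).congr_deriv ?_
  have hc : ∀ Y, NormedSpace.exp (t • B) * (B * Y) = B * (NormedSpace.exp (t • B) * Y) := by
    intro Y
    rw [← mul_assoc, ((Commute.refl B).smul_left t).exp_left.eq, mul_assoc]
  simp only [Pi.mul_apply, mul_add, add_mul, mul_sub, sub_mul, mul_assoc, hc, mul_neg, neg_mul]
  abel

/-- `X` is allowed to vary with the angle because earlier gates may carry the same parameter. -/
lemma hasDerivAt_conjGate {H : Op n} (hH : H.IsHermitian) (V : Op n) {X : ℝ → Op n} {X' : Op n}
    {t : ℝ} (hX : HasDerivAt X X' t) :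
    HasDerivAt (fun s => conjGate H V s (X s)) (conjGate H V t (X' + ad H (X t))) t := by
  obtain ⟨B, hB⟩ : ∃ B : Op n, B = -(Complex.I • H) := ⟨_, rfl⟩
  have eB : ∀ s : ℝ, (-(Complex.I * (s : ℂ))) • H = s • B := fun s => by
    rw [hB, ← Complex.coe_smul, smul_neg, smul_smul, neg_smul, mul_comm]
  have hBs : Bᴴ = -B := by
    rw [hB, Matrix.conjTranspose_neg, Matrix.conjTranspose_smul, hH.eq]; simp
  have ec : ∀ s : ℝ, (NormedSpace.exp (s • B) * V)ᴴ = Vᴴ * NormedSpace.exp (s • (-B)) := fun s => by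
    rw [Matrix.conjTranspose_mul, ← Matrix.exp_conjTranspose, Matrix.conjTranspose_smul, hBs]
    simp
  have ha : ad H (X t) = X t * B - B * X t := by
    rw [ad_apply, hB]
    simp [smul_sub]
    abel
  have e : ∀ s Y, conjGate H V s Y
      = Vᴴ * NormedSpace.exp (s • (-B)) * Y * (NormedSpace.exp (s • B) * V) := fun s Y => by
    rw [conjGate, eB, ec]
  simp only [e, ha]
  exact hasDerivAt_exp_conj B Vᴴ V hX

lemma continuous_conjGate (H V : Op n) {S : Type} [TopologicalSpace S] {u : S → ℝ} {X : S → Op n}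
    (hu : Continuous u) (hX : Continuous X) : Continuous fun s => conjGate H V (u s) (X s) := by
  have : Continuous fun s => NormedSpace.exp ((-(Complex.I * (u s : ℂ))) • H) := by
    let _ : NormedAlgebra ℚ (Op n) := NormedAlgebra.restrictScalars ℚ ℂ (Op n)
    refine NormedSpace.exp_continuous.comp ?_
    fun_prop
  unfold conjGate
  have h3 := this.mul (continuous_const (y := V))
  exact (h3.matrix_conjTranspose.mul hX).mul h3

end Evolution

/-! ### Differentiating a circuit by inserting commutators -/

namespace Circuit

variable {n : ℕ} {G P : Type}

/-- All generators are Hermitian and all fixed gates are unitary. -/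
def IsUnitary (C : Circuit n G P) : Prop :=
  (∀ g, (C.gen g).IsHermitian) ∧ ∀ g, C.fixed g ∈ unitary (Op n)

/-- Heisenberg evolution through a list of gates, with `k g` commutators with the generator
inserted at the gate `g`. -/
noncomputable def evo (C : Circuit n G P) (k : G → ℕ) (θ : P → ℝ) : List G → Op n → Op n
  | [], X => X
  | g :: gs, X =>
    evo C k θ gs (conjGate (C.gen g) (C.fixed g) (θ (C.par g)) ((ad (C.gen g) ^ k g) X))

variable {C : Circuit n G P} {k : G → ℕ} {θ : P → ℝ}

lemma evo_append (gs gs' : List G) (X : Op n) :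
    C.evo k θ (gs ++ gs') X = C.evo k θ gs' (C.evo k θ gs X) := by
  induction gs generalizing X with
  | nil => rfl
  | cons g gs ih => exact ih _

lemma evo_congr {k' : G → ℕ} {θ' : P → ℝ} {gs : List G} (hk : ∀ g ∈ gs, k g = k' g)
    (hθ : ∀ g ∈ gs, θ (C.par g) = θ' (C.par g)) (X : Op n) :
    C.evo k θ gs X = C.evo k' θ' gs X := by
  induction gs generalizing X with
  | nil => rfl
  | cons g gs ih =>
    simp only [evo]
    rw [hk g (by simp), hθ g (by simp), ih (fun x hx => hk x (by simp [hx]))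
      (fun x hx => hθ x (by simp [hx]))]

lemma evo_add (gs : List G) (X Y : Op n) :
    C.evo k θ gs (X + Y) = C.evo k θ gs X + C.evo k θ gs Y := by
  induction gs generalizing X Y with
  | nil => rfl
  | cons g gs ih =>
    simp only [evo]
    rw [map_add, ← ih]
    congr 1
    simp [conjGate, mul_add, add_mul]

lemma evo_zero_right (gs : List G) : C.evo k θ gs 0 = 0 := by
  have := evo_add (C := C) (k := k) (θ := θ) gs 0 0
  simpa using this

lemma norm_conjGate (hC : C.IsUnitary) (g : G) (t : ℝ) (X : Op n) :
    ‖conjGate (C.gen g) (C.fixed g) t X‖ = ‖X‖ :=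
  norm_conj_unitary (mul_mem (exp_mem_unitary (hC.1 g) t) (hC.2 g)) X

/-- Conjugation by a unitary preserves the norm, and each inserted commutator costs at most ω(H_g).
-/
lemma norm_evo_le (hC : C.IsUnitary) (gs : List G) (X : Op n) :
    ‖C.evo k θ gs X‖ ≤ (gs.map fun g => maxFreq (C.gen g) ^ k g).prod * ‖X‖ := by
  induction gs generalizing X with
  | nil => simp [evo]
  | cons g gs ih =>
    simp only [evo, List.map_cons, List.prod_cons]
    refine (ih _).trans ?_
    rw [norm_conjGate hC, mul_comm (maxFreq _ ^ _), mul_assoc]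
    refine mul_le_mul_of_nonneg_left (norm_ad_pow_le (hC.1 g) X _) ?_
    refine List.prod_nonneg fun x hx => ?_
    obtain ⟨y, -, rfl⟩ := List.mem_map.1 hx
    exact pow_nonneg (maxFreq_nonneg _) _

lemma norm_evo_eq (hC : C.IsUnitary) {gs : List G} (hk : ∀ g ∈ gs, k g = 0) (X : Op n) :
    ‖C.evo k θ gs X‖ = ‖X‖ := by
  induction gs generalizing X with
  | nil => rfl
  | cons g gs ih =>
    simp only [evo]
    rw [ih fun x hx => hk x (by simp [hx]), norm_conjGate hC, hk g (by simp)]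
    simp

lemma evo_eq_conj (gs : List G) (X : Op n) :
    C.evo 0 θ gs X = ((gs.map (C.gate θ)).prod)ᴴ * X * (gs.map (C.gate θ)).prod := by
  induction gs generalizing X with
  | nil => simp [evo]
  | cons g gs ih =>
    simp only [evo, List.map_cons, List.prod_cons]
    rw [ih]
    simp only [Pi.zero_apply, pow_zero, Module.End.one_apply, conjGate, gate,
      Matrix.conjTranspose_mul, mul_assoc]

lemma continuous_evo (gs : List G) {X : (P → ℝ) → Op n} (hX : Continuous X) :
    Continuous fun θ => C.evo k θ gs (X θ) := by
  induction gs generalizing X with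
  | nil => exact hX
  | cons g gs ih =>
    simp only [evo]
    refine ih (continuous_conjGate _ _ (continuous_apply _) ?_)
    exact (LinearMap.continuous_of_finiteDimensional (ad (C.gen g) ^ k g)).comp hX

/-- Product rule along the list: every gate carrying the parameter `p` contributes one further
commutator at its place. The input operator must be allowed to move with the parameter for the
induction to pass through such a gate. -/
lemma hasDerivAt_evo [DecidableEq G] [DecidableEq P] (hC : C.IsUnitary) (p : P) {gs : List G} (hgs : gs.Nodup)
    {X : ℝ → Op n} {X' : Op n} {t : ℝ} (hX : HasDerivAt X X' t) :
    HasDerivAt (fun s => C.evo k (Function.update θ p s) gs (X s))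
      (C.evo k (Function.update θ p t) gs X' +
        ((gs.filter fun g => C.par g = p).map fun g =>
          C.evo (k + Pi.single g 1) (Function.update θ p t) gs (X t)).sum) t := by
  induction gs generalizing X X' with
  | nil => simpa [evo] using hX
  | cons g gs ih =>
    rw [List.nodup_cons] at hgs
    have hX1 : HasDerivAt (fun s => (ad (C.gen g) ^ k g) (X s)) ((ad (C.gen g) ^ k g) X') t := by
      have := ((LinearMap.toContinuousLinearMap (ad (C.gen g) ^ k g)).restrictScalars
        ℝ).hasFDerivAt.comp_hasDerivAt t hX
      exact this
    have hrest : ∀ Y, ((gs.filter fun g => C.par g = p).map fun g' =>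
        C.evo (k + Pi.single g' 1) (Function.update θ p t) (g :: gs) Y).sum
        = ((gs.filter fun g => C.par g = p).map fun g' =>
          C.evo (k + Pi.single g' 1) (Function.update θ p t) gs
            (conjGate (C.gen g) (C.fixed g) (Function.update θ p t (C.par g))
              ((ad (C.gen g) ^ k g) Y))).sum := by
      intro Y
      congr 1
      refine List.map_congr_left fun g' hg' => ?_
      simp only [evo]
      have : g' ≠ g := by
        rintro rfl
        exact hgs.1 (List.mem_of_mem_filter hg')
      simp [Pi.single_eq_of_ne this.symm]
    by_cases hp : C.par g = p
    · have h2 := hasDerivAt_conjGate (hC.1 g) (C.fixed g) hX1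
      have h3 := ih hgs.2 h2
      simp only [evo]
      have e : ∀ s, Function.update θ p s (C.par g) = s := fun s => by rw [hp]; simp
      simp_rw [e]
      refine h3.congr_deriv ?_
      rw [List.filter_cons_of_pos (by simpa using hp), List.map_cons, List.sum_cons, ← add_assoc]
      have hre := hrest (X t)
      simp only [evo, e] at hre
      rw [hre]
      congr 1
      have e4 : conjGate (C.gen g) (C.fixed g) t
          ((ad (C.gen g) ^ k g) X' + ad (C.gen g) ((ad (C.gen g) ^ k g) (X t)))
          = conjGate (C.gen g) (C.fixed g) t ((ad (C.gen g) ^ k g) X') +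
          conjGate (C.gen g) (C.fixed g) t ((ad (C.gen g) ^ ((k + Pi.single g 1 : G → ℕ) g)) (X t)) := by
        simp [conjGate, mul_add, add_mul, pow_succ']
      rw [e4, evo_add]
      congr 1
      refine evo_congr (fun x hx => ?_) (fun _ _ => rfl) _
      have : x ≠ g := by rintro rfl; exact hgs.1 hx
      simp [Pi.single_eq_of_ne this]
    · have e : ∀ s, Function.update θ p s (C.par g) = θ (C.par g) := fun s => by
        rw [Function.update_of_ne hp]
      have h2 : HasDerivAt (fun s => conjGate (C.gen g) (C.fixed g) (θ (C.par g))
          ((ad (C.gen g) ^ k g) (X s))) (conjGate (C.gen g) (C.fixed g) (θ (C.par g))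
          ((ad (C.gen g) ^ k g) X')) t := (hX1.const_mul _).mul_const _
      have h3 := ih hgs.2 h2
      simp only [evo]
      simp_rw [e]
      refine h3.congr_deriv ?_
      rw [List.filter_cons_of_neg (by simpa using hp)]
      have hre := hrest (X t)
      simp only [evo, e] at hre
      rw [hre]

variable [LinearOrder G] [Fintype G]

/-- The derivatives of `heis`: `k g` derivatives in the angle of the gate `g`. -/
noncomputable def heisD (C : Circuit n G P) (O : Op n) (k : G → ℕ) (θ : P → ℝ) : Op n :=
  C.evo k θ ((Finset.univ : Finset G).sort (· ≤ ·)) O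

lemma heis_eq (O : Op n) : C.heis O = C.heisD O 0 := by
  funext θ
  rw [heisD, evo_eq_conj]; rfl

lemma continuous_heisD (O : Op n) : Continuous (C.heisD O k) :=
  continuous_evo _ continuous_const

/-- The family `heisD` is closed under differentiation, so derivatives of every order are described
by how often each gate is hit. -/
lemma isPD_heisD [DecidableEq P] (hC : C.IsUnitary) (O : Op n) (k : G → ℕ) (p : P) :
    IsPD p (C.heisD O k)
      (fun θ => ∑ g ∈ Finset.univ.filter (fun g => C.par g = p), C.heisD O (k + Pi.single g 1) θ) := by
  intro θ
  have := hasDerivAt_evo (k := k) (θ := θ) hC p (Finset.sort_nodup (Finset.univ : Finset G) (· ≤ ·))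
    (hasDerivAt_const (θ p) O)
  refine this.congr_deriv ?_
  rw [evo_zero_right, zero_add, Function.update_eq_self,
    ← List.sum_toFinset _ ((Finset.sort_nodup _ _).filter _)]
  refine Finset.sum_congr ?_ fun _ _ => rfl
  ext g; simp

end Circuit

end PQC

namespace PQC

/-! ## Expectation values -/

section Expectation

variable {n : ℕ}

/-- The expectation value `Re Tr(ρ X)` as a continuous linear functional. -/
noncomputable def expect (ρ : Op n) : Op n →L[ℝ] ℝ :=
  LinearMap.toContinuousLinearMap
    { toFun := fun X => (ρ * X).trace.re
      map_add' := fun X Y => by simp [mul_add]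
      map_smul' := fun c X => by simp }

lemma expect_apply (ρ X : Op n) : expect ρ X = (ρ * X).trace.re := rfl

lemma sum_normSq_eq_norm_sq {ι : Type*} [Fintype ι] (v : ι → ℂ) :
    (star v ⬝ᵥ v) = ((‖WithLp.toLp 2 v‖ ^ 2 : ℝ) : ℂ) := by
  rw [EuclideanSpace.norm_sq_eq]
  simp only [dotProduct, Pi.star_apply, RCLike.star_def]
  push_cast
  refine Finset.sum_congr rfl fun i _ => ?_
  rw [mul_comm, Complex.mul_conj, Complex.normSq_eq_norm_sq]
  push_cast; rfl

lemma norm_star_dotProduct_mulVec_le {ι : Type*} [Fintype ι] [DecidableEq ι] (v : ι → ℂ)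
    (X : Matrix ι ι ℂ) : ‖star v ⬝ᵥ (X *ᵥ v)‖ ≤ ‖X‖ * ‖WithLp.toLp 2 v‖ ^ 2 := by
  have h : star v ⬝ᵥ (X *ᵥ v)
      = inner ℂ (WithLp.toLp 2 v) (WithLp.toLp 2 (X *ᵥ v)) := by
    rw [EuclideanSpace.inner_eq_star_dotProduct, dotProduct_comm]
  rw [h]
  refine (norm_inner_le_norm _ _).trans ?_
  have := Matrix.l2_opNorm_mulVec X (WithLp.toLp 2 v)
  calc _ ≤ ‖WithLp.toLp 2 v‖ * (‖X‖ * ‖WithLp.toLp 2 v‖) :=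
        mul_le_mul_of_nonneg_left this (norm_nonneg _)
    _ = _ := by ring

-- Writing ρ = B†B turns the trace into a sum of quadratic forms of `X` at the conjugated rows of
-- `B`, whose squared norms add up to Tr ρ = 1.
open scoped MatrixOrder in
lemma norm_trace_mul_le {ρ : Op n} (hρ : IsDensity ρ) (X : Op n) : ‖(ρ * X).trace‖ ≤ ‖X‖ := by
  obtain ⟨B, hB⟩ : ∃ B : Op n, ρ = Bᴴ * B :=
    CStarAlgebra.nonneg_iff_eq_star_mul_self.1 hρ.1.nonneg
  have key : ∀ Y : Op n, (ρ * Y).trace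
      = ∑ i, star (fun j => star (B i j)) ⬝ᵥ (Y *ᵥ fun j => star (B i j)) := by
    intro Y
    rw [hB, mul_assoc, Matrix.trace_mul_comm]
    simp only [Matrix.trace, Matrix.diag]
    refine Finset.sum_congr rfl fun i _ => ?_
    rw [mul_assoc, Matrix.mul_apply]
    simp [dotProduct, Matrix.mul_apply, Matrix.mulVec]
  have h1 : ∑ i, ‖WithLp.toLp 2 (fun j => star (B i j))‖ ^ 2 = 1 := by
    have := key 1
    rw [mul_one, hρ.2] at this
    simp only [Matrix.one_mulVec, sum_normSq_eq_norm_sq] at this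
    exact_mod_cast this.symm
  rw [key X]
  calc _ ≤ ∑ i, ‖X‖ * ‖WithLp.toLp 2 (fun j => star (B i j))‖ ^ 2 :=
        (norm_sum_le _ _).trans (Finset.sum_le_sum fun i _ => norm_star_dotProduct_mulVec_le _ X)
    _ = ‖X‖ := by rw [← Finset.mul_sum, h1, mul_one]

lemma abs_expect_le {ρ : Op n} (hρ : IsDensity ρ) (X : Op n) : |expect ρ X| ≤ ‖X‖ :=
  (Complex.abs_re_le_norm _).trans (norm_trace_mul_le hρ X)

lemma expect_algebraMap {ρ : Op n} (hρ : IsDensity ρ) (c : ℝ) :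
    expect ρ (algebraMap ℝ (Op n) c) = c := by
  rw [expect_apply, Algebra.algebraMap_eq_smul_one]
  simp [hρ.2]

/-- Expectation values of `H` differ by at most `maxFreq H`. -/
lemma expect_sub_le_maxFreq {ρ σ H : Op n} (hρ : IsDensity ρ) (hσ : IsDensity σ)
    (hH : H.IsHermitian) : expect ρ H - expect σ H ≤ maxFreq H := by
  obtain ⟨c, hc⟩ := exists_norm_sub_le hH
  have a := abs_le.1 ((abs_expect_le hρ (H - algebraMap ℝ (Op n) c)).trans hc)
  have b := abs_le.1 ((abs_expect_le hσ (H - algebraMap ℝ (Op n) c)).trans hc)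
  rw [map_sub, expect_algebraMap hρ] at a
  rw [map_sub, expect_algebraMap hσ] at b
  linarith [a.2, b.1]

end Expectation

/-! ### The loss as an expectation value, and its derivatives -/

namespace Circuit

variable {n : ℕ} {G P : Type} [LinearOrder G] [Fintype G]

lemma loss_eq (C : Circuit n G P) (ρ O : Op n) :
    C.loss ρ O = fun θ => expect ρ (C.heisD O 0 θ) := by
  funext θ
  rw [← heis_eq, expect_apply, loss, heis, mul_assoc, mul_assoc, Matrix.trace_mul_comm]
  simp only [mul_assoc]

lemma prod_map_sort (f : G → ℝ) :
    (((Finset.univ : Finset G).sort (· ≤ ·)).map f).prod = ∏ g, f g := by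
  rw [← List.prod_toFinset _ (Finset.sort_nodup _ _), Finset.sort_toFinset]

lemma norm_heisD_le {C : Circuit n G P} (hC : C.IsUnitary) (O : Op n) (k : G → ℕ) (θ : P → ℝ) :
    ‖C.heisD O k θ‖ ≤ (∏ g, maxFreq (C.gen g) ^ k g) * ‖O‖ := by
  rw [← prod_map_sort]
  exact norm_evo_le hC _ _

lemma prod_pow_add_single (f : G → ℝ) (k : G → ℕ) (g : G) (m : ℕ) :
    ∏ x, f x ^ ((k + Pi.single g m : G → ℕ) x) = f g ^ m * ∏ x, f x ^ k x := by
  simp_rw [Pi.add_apply, pow_add, Finset.prod_mul_distrib]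
  rw [mul_comm]
  congr 1
  rw [Finset.prod_eq_single g]
  · simp
  · intro b _ hb; simp [Pi.single_eq_of_ne hb]
  · simp

/-- Splits the evolution into the gates before, at and after `l`; vanishing angles are used on the
first block and the absence of commutators on the last. -/
lemma exists_sort_eq (l : G) : ∃ a b : List G,
    (Finset.univ : Finset G).sort (· ≤ ·) = a ++ l :: b ∧ (∀ x ∈ a, x < l) ∧ ∀ x ∈ b, l < x := by
  have hl : l ∈ (Finset.univ : Finset G).sort (· ≤ ·) := by simp
  obtain ⟨a, b, hab⟩ := List.append_of_mem hl
  have hs := (Finset.sortedLT_sort (Finset.univ : Finset G)).pairwise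
  rw [hab, List.pairwise_append] at hs
  exact ⟨a, b, hab, fun x hx => hs.2.2 x hx l (by simp), (List.pairwise_cons.1 hs.2.1).1⟩

/-! ### Correlated parameters -/

section Correlated

variable [LinearOrder P]

/-- Differentiation in the parameter `p`, acting on a family indexed by the numbers of derivatives
in the angles of the gates. -/
noncomputable def der {E : Type*} [AddCommMonoid E] (C : Circuit n G P) (p : P)
    (Φ : (G → ℕ) → (P → ℝ) → E) (k : G → ℕ) (θ : P → ℝ) : E :=
  ∑ g ∈ Finset.univ.filter (fun g => C.par g = p), Φ (k + Pi.single g 1) θ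

/-- Adding commutators at different gates commutes, so `der` preserves the property of being closed
under differentiation. Higher derivatives with shared parameters thus become iterates of `der`. -/
lemma isPD_der {E : Type} [NormedAddCommGroup E] [NormedSpace ℝ E] {C : Circuit n G P}
    {Φ : (G → ℕ) → (P → ℝ) → E} (h : ∀ k q, IsPD q (Φ k) (C.der q Φ k)) (p : P) (k : G → ℕ)
    (q : P) : IsPD q (C.der p Φ k) (C.der q (C.der p Φ) k) := by
  intro θ
  have := HasDerivAt.fun_sum (u := Finset.univ.filter (fun g => C.par g = p))
    fun g _ => h (k + Pi.single g 1) q θ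
  refine this.congr_deriv ?_
  unfold der
  rw [Finset.sum_comm]
  simp_rw [add_right_comm]

lemma parFreq_eq (C : Circuit n G P) (p : P) :
    C.parFreq p = ∑ g ∈ Finset.univ.filter (fun g => C.par g = p), maxFreq (C.gen g) := by
  unfold parFreq
  congr

lemma rCorr_eq [Fintype P] (C : Circuit n G P) (ρ O : Op n) (p : P) :
    C.rCorr ρ O p = Real.sqrt (9 * C.curv ρ O 0 p ^ 2 /
      (8 * (16 * C.curv ρ O 0 p * ‖O‖ * C.parFreq p ^ 2 *
          (∑ q ∈ Finset.univ.filter (fun q => q ≠ p), C.parFreq q ^ 2)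
        + 32 * ‖O‖ ^ 2 * C.parFreq p ^ 6))) := by
  unfold rCorr
  congr!

lemma parFreq_nonneg (C : Circuit n G P) (p : P) : 0 ≤ C.parFreq p := by
  rw [parFreq_eq]
  exact Finset.sum_nonneg fun g _ => maxFreq_nonneg _

/-- The hypothesis and the conclusion have the same shape, with the constant multiplied by `parFreq
p`; iteration bounds derivatives of all orders. -/
lemma abs_der_le {C : Circuit n G P} {Φ : (G → ℕ) → (P → ℝ) → ℝ} {K : ℝ}
    (h : ∀ k θ, |Φ k θ| ≤ K * ∏ g, maxFreq (C.gen g) ^ k g) (p : P) (k : G → ℕ) (θ : P → ℝ) :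
    |C.der p Φ k θ| ≤ (K * C.parFreq p) * ∏ g, maxFreq (C.gen g) ^ k g := by
  unfold der
  refine (Finset.abs_sum_le_sum_abs _ _).trans ?_
  rw [parFreq_eq, Finset.mul_sum, Finset.sum_mul]
  refine Finset.sum_le_sum fun g _ => (h _ θ).trans (le_of_eq ?_)
  rw [prod_pow_add_single]; ring

lemma loss_family {C : Circuit n G P} (hC : C.IsUnitary) (ρ O : Op n) (k : G → ℕ) (q : P) :
    IsPD q (fun θ => expect ρ (C.heisD O k θ)) (C.der q (fun k θ => expect ρ (C.heisD O k θ)) k) := by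
  intro θ
  refine ((isPD_heisD hC O k q).clm (expect ρ) θ).congr_deriv ?_
  simp [der, map_sum]

lemma d2_loss_eq {C : Circuit n G P} (hC : C.IsUnitary) (ρ O : Op n) (p : P) :
    d2 (C.loss ρ O) p = C.der p (C.der p (fun k θ => expect ρ (C.heisD O k θ))) 0 := by
  rw [loss_eq]
  exact (loss_family hC ρ O 0 p).d2_eq (isPD_der (loss_family hC ρ O) p 0 p)

lemma curv_eq_abs_sum {C : Circuit n G P} (hC : C.IsUnitary) (ρ O : Op n) (p : P) :
    C.curv ρ O 0 p = |∑ g ∈ Finset.univ.filter (fun g => C.par g = p),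
      ∑ g' ∈ Finset.univ.filter (fun g => C.par g = p),
        expect ρ (C.heisD O (Pi.single g 1 + Pi.single g' 1) 0)| := by
  rw [curv, d2_loss_eq hC]
  simp [der]

lemma abs_loss_family_le {C : Circuit n G P} (hC : C.IsUnitary) {ρ : Op n} (hρ : IsDensity ρ)
    (O : Op n) (k : G → ℕ) (θ : P → ℝ) :
    |expect ρ (C.heisD O k θ)| ≤ ‖O‖ * ∏ g, maxFreq (C.gen g) ^ k g := by
  rw [mul_comm]
  exact (abs_expect_le hρ _).trans (norm_heisD_le hC O k θ)

lemma curv_le_parFreq {C : Circuit n G P} (hC : C.IsUnitary) {ρ : Op n} (hρ : IsDensity ρ)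
    (O : Op n) (p : P) : C.curv ρ O 0 p ≤ C.parFreq p ^ 2 * ‖O‖ := by
  rw [curv, d2_loss_eq hC]
  refine (abs_der_le (abs_der_le (abs_loss_family_le hC hρ O) p) p 0 0).trans (le_of_eq ?_)
  simp; ring

/-- The patch guarantee for correlated parameters. -/
theorem guarantee_rCorr [Fintype P] {C : Circuit n G P} (hC : C.IsUnitary) {ρ : Op n}
    (hρ : IsDensity ρ) (O : Op n) (p : P) : C.Guarantee ρ O {p} (C.rCorr ρ O p) := by
  intro r hr hrR
  set Φ : (G → ℕ) → (P → ℝ) → ℝ := fun k θ => expect ρ (C.heisD O k θ) with hΦ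
  have F0 := loss_family hC ρ O
  have F1 := isPD_der F0 p
  have F2 := isPD_der F1 p
  have F3 := isPD_der F2 p
  have B0 := abs_loss_family_le hC hρ O
  have B2 := abs_der_le (abs_der_le B0 p) p
  have hcont : ∀ k, Continuous (Φ k) := fun k => (expect ρ).continuous.comp (continuous_heisD O)
  have hcd : ∀ {Ψ : (G → ℕ) → (P → ℝ) → ℝ}, (∀ k, Continuous (Ψ k)) →
      ∀ k, Continuous (C.der p Ψ k) := fun h k => continuous_finsetSum _ fun g _ => h _
  have hcurv : C.curv ρ O 0 p = |C.der p (C.der p Φ) 0 0| := by rw [curv, d2_loss_eq hC]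
  have key := variance_cube_ge hr {p} (f := C.loss ρ O) (f₁ := fun p => C.der p Φ 0)
    (f₂ := fun p => C.der p (C.der p Φ) 0)
    (f₃ := fun p => C.der p (C.der p (C.der p Φ)) 0)
    (f₄ := fun p => C.der p (C.der p (C.der p (C.der p Φ))) 0)
    (g₁ := fun p q => C.der q (C.der p (C.der p Φ)) 0)
    (g₂ := fun p q => C.der q (C.der q (C.der p (C.der p Φ))) 0)
    (B := fun p q => C.parFreq p ^ 2 * C.parFreq q ^ 2 * ‖O‖)
    (M := fun p => C.parFreq p ^ 4 * ‖O‖) ?_ ?_ ?_ ?_ ?_ ?_ ?_ ?_ ?_ ?_ ?_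
  · simp only [Finset.sum_singleton] at key ⊢
    rw [hcurv]
    exact key
  · rw [loss_eq]; exact hcont 0
  all_goals simp only [Finset.mem_singleton, forall_eq]
  · exact hcd (hcd hcont) 0
  · rw [loss_eq]; exact F0 0 p
  · exact F1 0 p
  · exact F2 0 p
  · exact F3 0 p
  · intro θ
    refine (abs_der_le (abs_der_le B2 p) p 0 θ).trans (le_of_eq ?_)
    simp; ring
  · exact fun q _ => F2 0 q
  · exact fun q _ => isPD_der F2 q 0 q
  · intro q _ θ _
    refine (abs_der_le (abs_der_le B2 q) q 0 θ).trans (le_of_eq ?_)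
    simp; ring
  · rw [← hcurv]
    have hc0 : 0 ≤ C.curv ρ O 0 p := abs_nonneg _
    have hcle := curv_le_parFreq hC hρ O p
    have hω := parFreq_nonneg C p
    rw [← Finset.sum_mul, ← Finset.mul_sum]
    rw [rCorr_eq] at hrR
    set S := ∑ q ∈ Finset.univ.filter (fun q => q ≠ p), C.parFreq q ^ 2
    have hS : 0 ≤ S := Finset.sum_nonneg fun q _ => sq_nonneg _
    set c := C.curv ρ O 0 p
    set w := C.parFreq p
    have hx := Real.le_sqrt' hr |>.1 hrR
    -- A nonpositive denominator (zero included, as x/0 = 0) would make the quotient nonpositive,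
    -- contradicting 0 < r.
    have hden : 0 < 8 * (16 * c * ‖O‖ * w ^ 2 * S + 32 * ‖O‖ ^ 2 * w ^ 6) := by
      by_contra hneg
      have := div_nonpos_of_nonneg_of_nonpos (by positivity : 0 ≤ 9 * c ^ 2) (not_lt.1 hneg)
      have : 0 < r ^ 2 := by positivity
      linarith
    rw [le_div_iff₀ hden] at hx
    have hcpos : 0 < c := by
      rcases hc0.eq_or_lt with h | h
      · rw [← h] at hx
        have := mul_pos (pow_pos hr 2) hden
        rw [← h] at this
        simp at hx this
        linarith
      · exact h
    refine le_of_mul_le_mul_left ?_ hcpos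
    -- The bound c ≤ ω²‖O‖ converts the fourth-derivative term into the ‖O‖²ω⁶ of the radius.
    have h1 : c * (w ^ 4 * ‖O‖) ≤ ‖O‖ ^ 2 * w ^ 6 := by
      calc _ ≤ w ^ 2 * ‖O‖ * (w ^ 4 * ‖O‖) := by gcongr
        _ = _ := by ring
    have h2 : 0 ≤ c * ‖O‖ * w ^ 2 * S := by positivity
    calc c * (r ^ 2 * (8 * (w ^ 2 * S * ‖O‖) + 4 * (w ^ 4 * ‖O‖)))
        = r ^ 2 * (8 * (c * ‖O‖ * w ^ 2 * S) + 4 * (c * (w ^ 4 * ‖O‖))) := by ring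
      _ ≤ r ^ 2 * (8 * (16 * c * ‖O‖ * w ^ 2 * S + 32 * ‖O‖ ^ 2 * w ^ 6)) := by
        refine mul_le_mul_of_nonneg_left ?_ (by positivity)
        nlinarith [mul_nonneg (sq_nonneg ‖O‖) (pow_nonneg hω 6)]
      _ ≤ 9 * c ^ 2 := hx
      _ = c * (9 * c) := by ring

end Correlated

end Circuit

end PQC

namespace PQC

namespace Circuit

/-! ### Uncorrelated parameters -/

section Uncorrelated

variable {n : ℕ} {G : Type} [LinearOrder G] [Fintype G] {C : Circuit n G G}

lemma isPD_heisD_uncorr (hC : C.IsUnitary) (hpar : C.par = id) (O : Op n) (k : G → ℕ) (l : G) :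
    IsPD l (C.heisD O k) (C.heisD O (k + Pi.single l 1)) := by
  intro θ
  refine (isPD_heisD hC O k l θ).congr_deriv ?_
  simp [hpar, Finset.filter_eq']

lemma isPD_heisD_single (hC : C.IsUnitary) (hpar : C.par = id) (O : Op n) (k : G → ℕ) (l : G)
    (m : ℕ) : IsPD l (C.heisD O (k + Pi.single l m)) (C.heisD O (k + Pi.single l (m + 1))) := by
  have := isPD_heisD_uncorr hC hpar O (k + Pi.single l m) l
  rwa [add_assoc, ← Pi.single_add] at this

lemma isPD_heisD_zero (hC : C.IsUnitary) (hpar : C.par = id) (O : Op n) (k : G → ℕ) (l : G) :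
    IsPD l (C.heisD O k) (C.heisD O (k + Pi.single l 1)) := by
  simpa using isPD_heisD_single hC hpar O k l 0

lemma isPD_heisD_zero' (hC : C.IsUnitary) (hpar : C.par = id) (O : Op n) (l : G)
    (m : ℕ) : IsPD l (C.heisD O (Pi.single l m)) (C.heisD O (Pi.single l (m + 1))) := by
  simpa using isPD_heisD_single hC hpar O 0 l m

lemma d2_heisD (hC : C.IsUnitary) (hpar : C.par = id) (O : Op n) (k : G → ℕ) (l : G) :
    d2 (C.heisD O k) l = C.heisD O (k + Pi.single l 2) :=
  (isPD_heisD_zero hC hpar O k l).d2_eq (isPD_heisD_single hC hpar O k l 1)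

lemma d2_heis (hC : C.IsUnitary) (hpar : C.par = id) (O : Op n) (l : G) :
    d2 (C.heis O) l = C.heisD O (Pi.single l 2) := by
  rw [heis_eq, d2_heisD hC hpar, zero_add]

lemma curv_eq (hC : C.IsUnitary) (hpar : C.par = id) (ρ O : Op n) (l : G) :
    C.curv ρ O 0 l = |expect ρ (C.heisD O (Pi.single l 2) 0)| := by
  have h1 := (isPD_heisD_zero hC hpar O 0 l).clm (expect ρ)
  have h2 := (isPD_heisD_single hC hpar O 0 l 1).clm (expect ρ)
  rw [curv, loss_eq, h1.d2_eq h2, zero_add]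

lemma effFreq_sq (hC : C.IsUnitary) (hpar : C.par = id) (O : Op n) (l : G) :
    C.effFreq O 0 l ^ 2 = ‖C.heisD O (Pi.single l 2) 0‖ := by
  rw [effFreq, Real.sq_sqrt (norm_nonneg _), d2_heis hC hpar]

lemma effFreq2_sq (hC : C.IsUnitary) (hpar : C.par = id) (O : Op n) (l μ : G) :
    C.effFreq2 O 0 l μ ^ 2 = ‖C.heisD O (Pi.single l 2 + Pi.single μ 2) 0‖ := by
  rw [effFreq2, Real.sq_sqrt (norm_nonneg _), d2_heis hC hpar, d2_heisD hC hpar]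

lemma curv_le_effFreq_sq (hC : C.IsUnitary) (hpar : C.par = id) {ρ : Op n} (hρ : IsDensity ρ)
    (O : Op n) (l : G) : C.curv ρ O 0 l ≤ C.effFreq O 0 l ^ 2 := by
  rw [curv_eq hC hpar, effFreq_sq hC hpar]
  exact abs_expect_le hρ _

lemma norm_heisD_single_le (hC : C.IsUnitary) (O : Op n) (l : G) (m : ℕ) (θ : G → ℝ) :
    ‖C.heisD O (Pi.single l m) θ‖ ≤ maxFreq (C.gen l) ^ m * ‖O‖ := by
  refine (norm_heisD_le hC O _ θ).trans (le_of_eq ?_)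
  congr 1
  have := prod_pow_add_single (fun g => maxFreq (C.gen g)) 0 l m
  simpa using this

lemma effFreq_sq_le (hC : C.IsUnitary) (hpar : C.par = id) (O : Op n) (l : G) :
    C.effFreq O 0 l ^ 2 ≤ maxFreq (C.gen l) ^ 2 * ‖O‖ := by
  rw [effFreq_sq hC hpar]
  exact norm_heisD_single_le hC O l 2 0

/-- If no derivative is taken after the gate `μ` and all angles before it vanish, then the norm of
the derivative does not depend on the remaining angles. -/
lemma norm_heisD_eq (hC : C.IsUnitary) (hpar : C.par = id) (O : Op n) {k : G → ℕ} {μ : G}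
    (hk : ∀ ν, μ < ν → k ν = 0) {θ : G → ℝ} (hθ : ∀ ν, ν < μ → θ ν = 0) :
    ‖C.heisD O k θ‖ = ‖C.heisD O k 0‖ := by
  obtain ⟨a, b, hab, ha, hb⟩ := exists_sort_eq μ
  unfold heisD
  rw [hab, evo_append, evo_append]
  simp only [evo]
  rw [norm_evo_eq hC (fun g hg => hk g (hb g hg)), norm_evo_eq hC (fun g hg => hk g (hb g hg)),
    norm_conjGate hC, norm_conjGate hC]
  rw [evo_congr (k := k) (k' := k) (θ := θ) (θ' := 0) (fun _ _ => rfl)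
    (fun g hg => by rw [hpar]; exact hθ g (ha g hg))]

/-- Up to and including the gate `μ` the inserted commutators are those at the origin, because the
earlier angles vanish and the gate `l` has not been reached. The two commutators at `l` then cost
ω(H_l)². This is the source of the first sum in `ampA`. -/
lemma norm_heisD_le_of_lt (hC : C.IsUnitary) (hpar : C.par = id) (O : Op n) {l μ : G} (hμ : μ < l)
    {θ : G → ℝ} (hθ : ∀ ν, ν < μ → θ ν = 0) :
    ‖C.heisD O (Pi.single l 2 + Pi.single μ 2) θ‖
      ≤ maxFreq (C.gen l) ^ 2 * ‖C.heisD O (Pi.single μ 2) 0‖ := by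
  obtain ⟨a, b, hab, ha, hb⟩ := exists_sort_eq μ
  have hnd : b.Nodup := by
    have := Finset.sort_nodup (Finset.univ : Finset G) (· ≤ ·)
    rw [hab] at this
    exact (List.nodup_cons.1 (List.nodup_append.1 this).2.1).2
  unfold heisD
  rw [hab, evo_append, evo_append]
  simp only [evo]
  rw [norm_evo_eq (k := Pi.single μ 2) hC
    (fun g hg => by rw [Pi.single_eq_of_ne (hb g hg).ne']), norm_conjGate hC]
  refine (norm_evo_le hC _ _).trans ?_
  rw [norm_conjGate hC]
  have e1 : C.evo (Pi.single l 2 + Pi.single μ 2) θ a O = C.evo (Pi.single μ 2) 0 a O := by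
    refine evo_congr (fun g hg => ?_) (fun g hg => by rw [hpar]; exact hθ g (ha g hg)) O
    have h1 : g ≠ l := ((ha g hg).trans hμ).ne
    simp [h1]
  have e2 : (Pi.single l 2 + Pi.single μ 2 : G → ℕ) μ = (Pi.single μ 2 : G → ℕ) μ := by
    simp [hμ.ne]
  rw [e1, e2]
  refine mul_le_mul_of_nonneg_right (le_of_eq ?_) (norm_nonneg _)
  have hl : l ∈ b := by
    have : l ∈ a ++ μ :: b := by rw [← hab]; simp
    rcases List.mem_append.1 this with h | h
    · exact absurd (ha l h) (not_lt.2 hμ.le)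
    · rcases List.mem_cons.1 h with h | h
      · exact absurd h hμ.ne'
      · exact h
  rw [← List.prod_toFinset _ hnd, Finset.prod_eq_single l]
  · simp [hμ.ne']
  · intro g hg hgl
    have : g ≠ μ := (hb g (List.mem_toFinset.1 hg)).ne'
    simp [hgl, this]
  · intro h; exact absurd (List.mem_toFinset.2 hl) h

/-- No gate precedes `l`, so its four commutators act directly on `O` and split as two on top of
two. This is why β of the first gate involves the effective frequency. -/
lemma norm_heisD_first_le (hC : C.IsUnitary) (O : Op n) {l : G}
    (hl : ∀ μ, l ≤ μ) (θ : G → ℝ) :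
    ‖C.heisD O (Pi.single l 4) θ‖ ≤ maxFreq (C.gen l) ^ 2 * ‖C.heisD O (Pi.single l 2) 0‖ := by
  obtain ⟨a, b, hab, ha, hb⟩ := exists_sort_eq l
  have ha0 : a = [] := List.eq_nil_iff_forall_not_mem.2 fun x hx => absurd (ha x hx) (not_lt.2 (hl x))
  subst ha0
  unfold heisD
  rw [hab, List.nil_append]
  simp only [evo, Pi.single_eq_same]
  rw [norm_evo_eq hC fun g hg => by rw [Pi.single_eq_of_ne (hb g hg).ne'],
    norm_evo_eq hC fun g hg => by rw [Pi.single_eq_of_ne (hb g hg).ne'],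
    norm_conjGate hC, norm_conjGate hC]
  rw [show (4 : ℕ) = 2 + 2 from rfl, pow_add, Module.End.mul_apply]
  exact norm_ad_pow_le (hC.1 l) _ 2

lemma norm_heisD_first (hC : C.IsUnitary) (O : Op n) {l : G}
    (hl : ∀ μ, l ≤ μ) (m : ℕ) (θ : G → ℝ) :
    ‖C.heisD O (Pi.single l m) θ‖ = ‖(ad (C.gen l) ^ m) O‖ := by
  obtain ⟨a, b, hab, ha, hb⟩ := exists_sort_eq l
  have ha0 : a = [] := List.eq_nil_iff_forall_not_mem.2 fun x hx => absurd (ha x hx) (not_lt.2 (hl x))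
  subst ha0
  unfold heisD
  rw [hab, List.nil_append]
  simp only [evo, Pi.single_eq_same]
  rw [norm_evo_eq hC fun g hg => by rw [Pi.single_eq_of_ne (hb g hg).ne'], norm_conjGate hC]

lemma ampA_nonneg (O : Op n) (l : G) : 0 ≤ C.ampA O 0 l :=
  add_nonneg (mul_nonneg (mul_nonneg (by norm_num) (sq_nonneg _))
    (Finset.sum_nonneg fun _ _ => sq_nonneg _)) (Finset.sum_nonneg fun _ _ => sq_nonneg _)

/-- The variance guarantee for uncorrelated parameters, in terms of bounds `M` on the fourth
derivatives. -/
theorem patchVar_ge (hC : C.IsUnitary) (hpar : C.par = id) {ρ : Op n} (hρ : IsDensity ρ) (O : Op n)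
    (Λ : Finset G) {M : G → ℝ} (hM : ∀ l ∈ Λ, ∀ θ, ‖C.heisD O (Pi.single l 4) θ‖ ≤ M l) {r : ℝ}
    (hr : 0 < r)
    (h : ∀ l ∈ Λ, r ^ 2 * (8 * C.ampA O 0 l + 4 * M l) ≤ 9 * C.curv ρ O 0 l) :
    1 / 72 * (∑ l ∈ Λ, C.curv ρ O 0 l ^ 2) * r ^ 4 ≤ C.patchVar ρ O r := by
  have hcont : ∀ k, Continuous fun θ => expect ρ (C.heisD O k θ) := fun k =>
    (expect ρ).continuous.comp (continuous_heisD O)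
  have key := variance_cube_ge hr Λ (f := C.loss ρ O)
    (f₁ := fun l θ => expect ρ (C.heisD O (Pi.single l 1) θ))
    (f₂ := fun l θ => expect ρ (C.heisD O (Pi.single l 2) θ))
    (f₃ := fun l θ => expect ρ (C.heisD O (Pi.single l 3) θ))
    (f₄ := fun l θ => expect ρ (C.heisD O (Pi.single l 4) θ))
    (g₁ := fun l μ θ => expect ρ (C.heisD O (Pi.single l 2 + Pi.single μ 1) θ))
    (g₂ := fun l μ θ => expect ρ (C.heisD O (Pi.single l 2 + Pi.single μ 2) θ))
    -- For gates before `l` the bound goes through the commutators at `μ`; for gates after `l` the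
    -- norm is exactly the one at the origin.
    (B := fun l μ => if μ < l then maxFreq (C.gen l) ^ 2 * ‖C.heisD O (Pi.single μ 2) 0‖
      else ‖C.heisD O (Pi.single l 2 + Pi.single μ 2) 0‖)
    (M := M) ?_ ?_ ?_ ?_ ?_ ?_ ?_ ?_ ?_ ?_ ?_
  · unfold patchVar
    refine le_of_eq_of_le ?_ key
    simp only [curv_eq hC hpar]
  · rw [loss_eq]; exact hcont 0
  · exact fun l _ => hcont _
  · intro l _
    rw [loss_eq]
    simpa using (isPD_heisD_zero hC hpar O 0 l).clm (expect ρ)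
  · exact fun l _ => (isPD_heisD_zero' hC hpar O l 1).clm (expect ρ)
  · exact fun l _ => (isPD_heisD_zero' hC hpar O l 2).clm (expect ρ)
  · exact fun l _ => (isPD_heisD_zero' hC hpar O l 3).clm (expect ρ)
  · exact fun l hl θ => (abs_expect_le hρ _).trans (hM l hl θ)
  · exact fun l _ μ _ => (isPD_heisD_zero hC hpar O _ μ).clm (expect ρ)
  · exact fun l _ μ _ => (isPD_heisD_single hC hpar O _ μ 1).clm (expect ρ)
  · intro l _ μ hμ θ hθ
    refine (abs_expect_le hρ _).trans ?_
    split_ifs with hlt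
    · exact norm_heisD_le_of_lt hC hpar O hlt hθ
    · have hlt' : l < μ := lt_of_le_of_ne (not_lt.1 hlt) hμ.symm
      refine (norm_heisD_eq hC hpar O (fun ν hν => ?_) hθ).le
      simp [hν.ne', (hlt'.trans hν).ne']
  · intro l hl
    rw [← curv_eq hC hpar]
    refine le_trans ?_ (h l hl)
    have e : ∑ μ ∈ Finset.univ.filter (fun μ => μ ≠ l),
        (if μ < l then maxFreq (C.gen l) ^ 2 * ‖C.heisD O (Pi.single μ 2) 0‖
          else ‖C.heisD O (Pi.single l 2 + Pi.single μ 2) 0‖)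
        = maxFreq (C.gen l) ^ 2 * ∑ μ ∈ Finset.univ.filter (fun μ => μ < l), C.effFreq O 0 μ ^ 2
          + ∑ μ ∈ Finset.univ.filter (fun μ => l < μ), C.effFreq2 O 0 l μ ^ 2 := by
      rw [Finset.sum_ite, Finset.mul_sum, Finset.filter_filter, Finset.filter_filter]
      congr 1
      · refine Finset.sum_congr ?_ fun μ _ => by rw [effFreq_sq hC hpar]
        ext μ; simp only [Finset.mem_filter, Finset.mem_univ, true_and]
        exact ⟨fun h => h.2, fun h => ⟨h.ne, h⟩⟩
      · refine Finset.sum_congr ?_ fun μ _ => by rw [effFreq2_sq hC hpar]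
        ext μ; simp only [Finset.mem_filter, Finset.mem_univ, true_and]
        exact ⟨fun h => lt_of_le_of_ne (not_lt.1 h.2) h.1.symm, fun h => ⟨h.ne', not_lt.2 h.le⟩⟩
    rw [e]
    refine mul_le_mul_of_nonneg_left ?_ (by positivity)
    have h1 : 0 ≤ maxFreq (C.gen l) ^ 2
        * ∑ μ ∈ Finset.univ.filter (fun μ => μ < l), C.effFreq O 0 μ ^ 2 :=
      mul_nonneg (sq_nonneg _) (Finset.sum_nonneg fun _ _ => sq_nonneg _)
    -- Only one of the four copies of the first sum of `ampA` is needed.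
    unfold ampA
    linarith

/-- Multiplied by `c`, the required inequality contains 4cM, which 24β majorizes; this is how β
stands in for the fourth derivative. Division by `c` is allowed because c = 0 would make the radius
0. -/
lemma radius_sq_mul_le {r c A β M : ℝ} (hr : 0 < r) (hc : 0 ≤ c) (hA : 0 ≤ A) (hβ : 0 ≤ β)
    (hM : c * M ≤ 6 * β) (h : r ^ 2 ≤ 9 * c ^ 2 / (8 * c * A + 24 * β)) :
    r ^ 2 * (8 * A + 4 * M) ≤ 9 * c := by
  have hr2 : 0 < r ^ 2 := by positivity
  have hden : 0 < 8 * c * A + 24 * β := by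
    rcases (show 0 ≤ 8 * c * A + 24 * β by positivity).eq_or_lt with h0 | h0
    · rw [← h0, div_zero] at h; linarith
    · exact h0
  rw [le_div_iff₀ hden] at h
  have hcpos : 0 < c := by
    rcases hc.eq_or_lt with h0 | h0
    · rw [← h0] at h hden
      have := mul_pos hr2 hden
      simp at h this
      linarith
    · exact h0
  refine le_of_mul_le_mul_left ?_ hcpos
  nlinarith [mul_le_mul_of_nonneg_left hM hr2.le]

lemma beta_nonneg (O : Op n) (l : G) : 0 ≤ C.beta O 0 l := by
  unfold beta
  have := maxFreq_nonneg (C.gen l)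
  split_ifs <;> positivity

lemma curv_nonneg (ρ O : Op n) (l : G) : 0 ≤ C.curv ρ O 0 l := abs_nonneg _

lemma curv_le (hC : C.IsUnitary) (hpar : C.par = id) {ρ : Op n} (hρ : IsDensity ρ)
    (O : Op n) (l : G) : C.curv ρ O 0 l ≤ maxFreq (C.gen l) ^ 2 * ‖O‖ :=
  (curv_le_effFreq_sq hC hpar hρ O l).trans (effFreq_sq_le hC hpar O l)

lemma beta_of_first (O : Op n) {l : G} (hl : ∀ μ, l ≤ μ) :
    C.beta O 0 l = 2 * maxFreq (C.gen l) ^ 2 * C.effFreq O 0 l ^ 4 / 3 := by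
  rw [beta, if_pos hl]

lemma beta_of_not_first (O : Op n) {l : G} (hl : ¬ ∀ μ, l ≤ μ) :
    C.beta O 0 l = 32 * maxFreq (C.gen l) ^ 6 * ‖O‖ ^ 2 / 3 := by
  rw [beta, if_neg hl]

/-- The patch guarantee for uncorrelated parameters. -/
theorem guarantee_rUncorr (hC : C.IsUnitary) (hpar : C.par = id) {ρ : Op n} (hρ : IsDensity ρ)
    (O : Op n) (Λ : Finset G) : C.Guarantee ρ O Λ (C.rUncorr ρ O Λ) := by
  classical
  intro r hr hrR
  refine patchVar_ge hC hpar hρ O Λ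
    (M := fun l => if ∀ μ, l ≤ μ then maxFreq (C.gen l) ^ 2 * ‖C.heisD O (Pi.single l 2) 0‖
      else maxFreq (C.gen l) ^ 4 * ‖O‖) ?_ hr ?_
  · intro l _ θ
    split_ifs with h
    · exact norm_heisD_first_le hC O h θ
    · exact norm_heisD_single_le hC O l 4 θ
  · intro l hl
    refine radius_sq_mul_le (β := C.beta O 0 l) hr (curv_nonneg ρ O l) (ampA_nonneg O l)
      (beta_nonneg O l) ?_ ?_
    -- For the first gate c ≤ ω_eff² and M = ω²ω_eff²; for the others c ≤ ω²‖O‖ and M = ω⁴‖O‖. In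
    -- both cases cM ≤ 6β with room to spare.
    · have hω := maxFreq_nonneg (C.gen l)
      split_ifs with h
      · rw [beta_of_first O h, ← effFreq_sq hC hpar]
        have := curv_le_effFreq_sq hC hpar hρ O l
        calc _ ≤ C.effFreq O 0 l ^ 2 * (maxFreq (C.gen l) ^ 2 * C.effFreq O 0 l ^ 2) := by gcongr
          _ = maxFreq (C.gen l) ^ 2 * C.effFreq O 0 l ^ 4 := by ring
          _ ≤ _ := by
            have : 0 ≤ maxFreq (C.gen l) ^ 2 * C.effFreq O 0 l ^ 4 := by positivity
            linarith
      · rw [beta_of_not_first O h]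
        have := curv_le hC hpar hρ O l
        calc _ ≤ maxFreq (C.gen l) ^ 2 * ‖O‖ * (maxFreq (C.gen l) ^ 4 * ‖O‖) := by gcongr
          _ = maxFreq (C.gen l) ^ 6 * ‖O‖ ^ 2 := by ring
          _ ≤ _ := by
            have : 0 ≤ maxFreq (C.gen l) ^ 6 * ‖O‖ ^ 2 := by positivity
            linarith
    · exact ((Real.le_sqrt' hr).1 hrR).trans (ciInf_le (Set.finite_range _).bddBelow (⟨l, hl⟩ : Λ))

/-- The patch guarantee for one uncorrelated parameter and a given value of `β`. -/
theorem guarantee_rUncorrWith (hC : C.IsUnitary) (hpar : C.par = id) {ρ : Op n} (hρ : IsDensity ρ)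
    (O : Op n) (l : G) {β M : ℝ} (hβ : 0 ≤ β)
    (hM : ∀ θ, ‖C.heisD O (Pi.single l 4) θ‖ ≤ M) (hβM : C.curv ρ O 0 l * M ≤ 6 * β) :
    C.Guarantee ρ O {l} (C.rUncorrWith ρ O l β) := by
  intro r hr hrR
  refine patchVar_ge hC hpar hρ O {l} (M := fun _ => M) (by simpa using hM) hr ?_
  simp only [Finset.mem_singleton, forall_eq]
  exact radius_sq_mul_le hr (curv_nonneg ρ O l) (ampA_nonneg O l) hβ hβM
    ((Real.le_sqrt' hr).1 hrR)

end Uncorrelated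

end Circuit

end PQC

namespace PQC

namespace Circuit

/-! ### From the guarantee to the scaling statements -/

section Scaling

variable {n : ℕ} {G P : Type} [LinearOrder G] [Fintype G] [Fintype P] {C : Circuit n G P}
  {ρ O : Op n} {Λ : Finset P} {R a b w v g : ℝ}

/-- The guaranteed variance grows with the half-width, so evaluating it at `R` and then replacing
`R` by its lower bound `a * w` is enough. -/
lemma SharpPatch.of_guarantee (hpos : 0 < a * w) (hlow : a * w ≤ R) (hup : R ≤ b * w)
    (hG : C.Guarantee ρ O Λ R)
    (hv : v * g ≤ 1 / 72 * (∑ l ∈ Λ, C.curv ρ O 0 l ^ 2) * (a * w) ^ 4) :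
    C.SharpPatch ρ O Λ R a b w v g := by
  refine ⟨hlow, hup, hG, hv.trans (le_trans ?_ (hG R (hpos.trans_le hlow) le_rfl))⟩
  have : 0 ≤ ∑ l ∈ Λ, C.curv ρ O 0 l ^ 2 := Finset.sum_nonneg fun _ _ => sq_nonneg _
  gcongr

lemma LowerPatch.of_guarantee (hpos : 0 < a * w) (hlow : a * w ≤ R)
    (hG : C.Guarantee ρ O Λ R)
    (hv : v * g ≤ 1 / 72 * (∑ l ∈ Λ, C.curv ρ O 0 l ^ 2) * (a * w) ^ 4) :
    C.LowerPatch ρ O Λ R a w v g :=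
  ⟨hlow, hG, hv.trans (hG _ hpos hlow)⟩

lemma SharpPatch.mono {a' b' w' v' g' : ℝ} (h : C.SharpPatch ρ O Λ R a b w v g)
    (ha : a' * w' ≤ a * w) (hb : b * w ≤ b' * w') (hv : v' * g' ≤ v * g) :
    C.SharpPatch ρ O Λ R a' b' w' v' g' :=
  ⟨ha.trans h.1, h.2.1.trans hb, h.2.2.1, hv.trans h.2.2.2⟩

end Scaling

/-! ### Derivatives at the origin -/

section Origin

variable {n : ℕ} {G P : Type} {C : Circuit n G P}

lemma conjGate_zero (H V X : Op n) : conjGate H V 0 X = Vᴴ * X * V := by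
  simp [conjGate]

lemma evo_origin_eq_self (hV : ∀ g, C.fixed g = 1) {k : G → ℕ} {gs : List G}
    (hk : ∀ g ∈ gs, k g = 0) (X : Op n) : C.evo k 0 gs X = X := by
  induction gs generalizing X with
  | nil => rfl
  | cons g gs ih =>
    simp only [evo, Pi.zero_apply]
    rw [ih fun x hx => hk x (by simp [hx]), conjGate_zero, hV, hk g (by simp)]
    simp

variable [LinearOrder G] [Fintype G]

lemma heisD_single_origin (hV : ∀ g, C.fixed g = 1) (O : Op n) (l : G) (m : ℕ) :
    C.heisD O (Pi.single l m) 0 = (ad (C.gen l) ^ m) O := by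
  obtain ⟨a, b, hab, ha, hb⟩ := exists_sort_eq l
  unfold heisD
  rw [hab, evo_append]
  simp only [evo, Pi.zero_apply]
  rw [evo_origin_eq_self (gs := a) hV fun g hg => by rw [Pi.single_eq_of_ne (ha g hg).ne],
    evo_origin_eq_self (gs := b) hV fun g hg => by rw [Pi.single_eq_of_ne (hb g hg).ne'],
    conjGate_zero, hV]
  simp

/-- All gates are trivial at the origin, so only their order remains: the commutators of the gate
nearer to `O` are the inner ones. -/
lemma heisD_pair_origin (hV : ∀ g, C.fixed g = 1) (O : Op n) {l μ : G} (hl : l < μ) (i j : ℕ) :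
    C.heisD O (Pi.single l i + Pi.single μ j) 0
      = (ad (C.gen μ) ^ j) ((ad (C.gen l) ^ i) O) := by
  obtain ⟨a, b, hab, ha, hb⟩ := exists_sort_eq μ
  have h1 : C.evo (Pi.single l i + Pi.single μ j) 0 a O = (ad (C.gen l) ^ i) O := by
    rw [← heisD_single_origin hV, heisD, hab, evo_append]
    simp only [evo, Pi.zero_apply]
    rw [evo_origin_eq_self (gs := b) hV fun g hg => by rw [Pi.single_eq_of_ne (hl.trans (hb g hg)).ne'],
      conjGate_zero, hV, Pi.single_eq_of_ne hl.ne']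
    simp only [pow_zero, Module.End.one_apply, Matrix.conjTranspose_one, one_mul, mul_one]
    refine evo_congr (fun g hg => ?_) (fun _ _ => rfl) O
    simp [(ha g hg).ne]
  unfold heisD
  rw [hab, evo_append, h1]
  simp only [evo, Pi.zero_apply]
  rw [evo_origin_eq_self hV fun g hg => by
    simp [(hb g hg).ne', (hl.trans (hb g hg)).ne'], conjGate_zero, hV]
  simp [hl.ne']

end Origin

/-! ### Circuits whose generators commute or anticommute with the observable -/

section Signs

variable {n : ℕ} {G : Type} [LinearOrder G] [Fintype G] {C : Circuit n G G}

/-- From H² = 1 and HO = −OH one has HOH = −O, so the double commutator is 4O; the factor i² gives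
the sign. -/
lemma ad_sq_of_anticommute {H O : Op n} (h1 : H * H = 1) (h2 : H * O = -(O * H)) :
    (ad H ^ 2) O = (-4 : ℝ) • O := by
  have h3 : H * (H * O) = O := by rw [← mul_assoc, h1, one_mul]
  have h4 : O * H * H = O := by rw [mul_assoc, h1, mul_one]
  have h5 : H * (O * H) = -O := by
    have : O * H = -(H * O) := by rw [h2, neg_neg]
    rw [this, mul_neg, h3]
  have h6 : H * O * H = -O := by rw [mul_assoc, h5]
  rw [ad_sq_apply, mul_sub, sub_mul, h3, h4, h5, h6]
  module

/-- `O` is a common eigenvector of all the squared derivations and is fixed by the entangling gates,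
so every even derivative at the origin is a scalar times `O`. -/
lemma evo_origin_signs {O : Op n} (hVu : ∀ g, C.fixed g ∈ unitary (Op n))
    (hV : ∀ g, Commute (C.fixed g) O) {χ : G → ℝ}
    (hχ : ∀ g, (ad (C.gen g) ^ 2) O = χ g • O) (j : G → ℕ) (gs : List G) (c : ℝ) :
    C.evo (fun g => 2 * j g) 0 gs (c • O) = (c * (gs.map fun g => χ g ^ j g).prod) • O := by
  induction gs generalizing c with
  | nil => simp [evo]
  | cons g gs ih =>
    have e1 : ∀ (m : ℕ) (c : ℝ), (ad (C.gen g) ^ (2 * m)) (c • O) = (c * χ g ^ m) • O := by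
      intro m
      induction m with
      | zero => intro c; simp
      | succ m ihm =>
        intro c
        rw [mul_add, mul_one, pow_add, Module.End.mul_apply]
        have : (ad (C.gen g) ^ 2) (c • O) = (c * χ g) • O := by
          rw [← Complex.coe_smul, map_smul, hχ, Complex.coe_smul, smul_smul]
        rw [this, ihm, pow_succ']
        congr 1; ring
    have e2 : (C.fixed g)ᴴ * O * C.fixed g = O := by
      rw [mul_assoc, ← (hV g).eq, ← mul_assoc, ← Matrix.star_eq_conjTranspose,
        Unitary.star_mul_self_of_mem (hVu g), one_mul]
    simp only [evo, Pi.zero_apply]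
    rw [e1, conjGate_zero, mul_smul_comm, smul_mul_assoc, e2, ih, List.map_cons, List.prod_cons]
    congr 1; ring

/-- The structure shared by the tensor-product and the hardware-efficient ansatz. -/
structure HasSigns (C : Circuit n G G) (O : Op n) (Λ : Finset G) : Prop where
  unitary : C.IsUnitary
  par : C.par = id
  sq : ∀ g ∈ Λ, C.gen g * C.gen g = 1
  anti : ∀ g ∈ Λ, C.gen g * O = -(O * C.gen g)
  comm : ∀ g, g ∉ Λ → Commute (C.gen g) O
  fixed : ∀ g, Commute (C.fixed g) O

variable {O : Op n} {Λ : Finset G}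

lemma HasSigns.heisD_eq (h : HasSigns C O Λ) (j : G → ℕ) :
    C.heisD O (fun g => 2 * j g) 0 = (∏ g, (if g ∈ Λ then (-4 : ℝ) else 0) ^ j g) • O := by
  have := evo_origin_signs (C := C) (χ := fun g => if g ∈ Λ then (-4 : ℝ) else 0) h.unitary.2 h.fixed
    (fun g => ?_) j ((Finset.univ : Finset G).sort (· ≤ ·)) 1
  · rw [one_smul, one_mul, prod_map_sort] at this
    exact this
  · by_cases hg : g ∈ Λ
    · simp only [hg, if_true]; exact ad_sq_of_anticommute (h.sq g hg) (h.anti g hg)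
    · simp only [hg, if_false, zero_smul]; exact ad_pow_eq_zero (h.comm g hg) two_ne_zero

lemma two_mul_single (l : G) : (fun g => 2 * (Pi.single l 1 : G → ℕ) g) = Pi.single l 2 := by
  funext g
  by_cases hg : g = l
  · subst hg; simp
  · simp [hg]

lemma HasSigns.heisD_single (h : HasSigns C O Λ) (l : G) :
    C.heisD O (Pi.single l 2) 0 = (if l ∈ Λ then (-4 : ℝ) else 0) • O := by
  have := h.heisD_eq (Pi.single l 1)
  rw [two_mul_single] at this
  rw [this]
  congr 1
  have := prod_pow_add_single (fun g => if g ∈ Λ then (-4 : ℝ) else 0) 0 l 1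
  simpa using this

lemma HasSigns.heisD_pair (h : HasSigns C O Λ) (l μ : G) :
    C.heisD O (Pi.single l 2 + Pi.single μ 2) 0
      = ((if μ ∈ Λ then (-4 : ℝ) else 0) * (if l ∈ Λ then (-4 : ℝ) else 0)) • O := by
  have := h.heisD_eq (Pi.single l 1 + Pi.single μ 1)
  rw [show (fun g => 2 * (Pi.single l 1 + Pi.single μ 1 : G → ℕ) g) = Pi.single l 2 + Pi.single μ 2 by
    rw [← two_mul_single, ← two_mul_single]; funext g; simp [mul_add]] at this
  rw [this]
  congr 1
  rw [prod_pow_add_single, pow_one]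
  congr 1
  have := prod_pow_add_single (fun g => if g ∈ Λ then (-4 : ℝ) else 0) 0 l 1
  simpa using this

lemma norm_le_one_of_sq {H : Op n} (hH : H.IsHermitian) (h : H * H = 1) : ‖H‖ = 1 := by
  have := CStarRing.norm_star_mul_self (x := H)
  rw [Matrix.star_eq_conjTranspose, hH.eq, h, CStarRing.norm_one] at this
  nlinarith [norm_nonneg H]

lemma card_lt_add_card_gt {l : G} (hl : l ∈ Λ) :
    (Λ.filter (fun μ => μ < l)).card + (Λ.filter (fun μ => l < μ)).card + 1 = Λ.card := by
  have h1 := Finset.card_filter_add_card_filter_not (s := Λ) (fun μ => μ < l)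
  have h2 : Λ.filter (fun μ => ¬ μ < l) = insert l (Λ.filter (fun μ => l < μ)) := by
    ext μ
    simp only [Finset.mem_filter, Finset.mem_insert, not_lt]
    constructor
    · rintro ⟨h, h'⟩
      rcases h'.eq_or_lt with h'' | h''
      · exact Or.inl h''.symm
      · exact Or.inr ⟨h, h''⟩
    · rintro (rfl | h)
      · exact ⟨hl, le_rfl⟩
      · exact ⟨h.1, h.2.le⟩
  rw [h2, Finset.card_insert_of_notMem (by simp)] at h1
  omega

/-- All ingredients of the radius are explicit numbers: c = 4, ω = 2, ω_eff² = 4 and ω̃² = 16 on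
`Λ`, and 0 outside. Hence 𝒜_l lies between 16 and 64 times the number of other elements of `Λ`. -/
theorem HasSigns.sharpPatch (h : HasSigns C O Λ) {ρ : Op n} (hρ : IsDensity ρ) (hO : ‖O‖ = 1)
    (hE : expect ρ O = 1) (hne : Λ.Nonempty) :
    C.SharpPatch ρ O Λ (C.rUncorr ρ O Λ) (1 / 12) 1 (1 / Real.sqrt Λ.card) (1 / 93312)
      (1 / Λ.card) := by
  have hcurv : ∀ l ∈ Λ, C.curv ρ O 0 l = 4 := fun l hl => by
    rw [curv_eq h.unitary h.par, h.heisD_single, if_pos hl, map_smul, hE]; norm_num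
  have heff : ∀ μ, C.effFreq O 0 μ ^ 2 = if μ ∈ Λ then 4 else 0 := fun μ => by
    rw [effFreq_sq h.unitary h.par, h.heisD_single, norm_smul, hO]; split_ifs <;> norm_num
  have heff2 : ∀ l ∈ Λ, ∀ μ, C.effFreq2 O 0 l μ ^ 2 = if μ ∈ Λ then 16 else 0 := fun l hl μ => by
    rw [effFreq2_sq h.unitary h.par, h.heisD_pair, norm_smul, hO, if_pos hl]
    split_ifs <;> norm_num
  -- The lower bound comes from the curvature itself: 4 = c ≤ ω²‖O‖ with ‖O‖ = 1.
  have hω : ∀ l ∈ Λ, maxFreq (C.gen l) = 2 := fun l hl => by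
    have h1 := curv_le h.unitary h.par hρ O l
    rw [hcurv l hl, hO] at h1
    have h2 := maxFreq_le (C.gen l)
    rw [norm_le_one_of_sq (h.unitary.1 l) (h.sq l hl)] at h2
    have h3 := maxFreq_nonneg (C.gen l)
    nlinarith
  have hN : (1 : ℝ) ≤ Λ.card := by exact_mod_cast hne.card_pos
  have hA : ∀ l ∈ Λ, C.ampA O 0 l = 64 * ((Λ.filter (fun μ => μ < l)).card : ℝ)
      + 16 * ((Λ.filter (fun μ => l < μ)).card : ℝ) := fun l hl => by
    unfold ampA
    rw [hω l hl, Finset.sum_congr rfl fun μ _ => heff μ, Finset.sum_congr rfl fun μ _ => heff2 l hl μ,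
      ← Finset.sum_filter, ← Finset.sum_filter, Finset.filter_filter, Finset.filter_filter,
      Finset.sum_const, Finset.sum_const]
    have e1 : Finset.univ.filter (fun μ => μ < l ∧ μ ∈ Λ) = Λ.filter (fun μ => μ < l) := by
      ext; simp [and_comm]
    have e2 : Finset.univ.filter (fun μ => l < μ ∧ μ ∈ Λ) = Λ.filter (fun μ => l < μ) := by
      ext; simp [and_comm]
    rw [e1, e2]
    simp only [nsmul_eq_mul]
    ring
  have hβ : ∀ l ∈ Λ, C.beta O 0 l = 128 / 3 ∨ C.beta O 0 l = 2048 / 3 := fun l hl => by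
    by_cases hf : ∀ μ, l ≤ μ
    · left
      have := heff l
      rw [if_pos hl] at this
      rw [beta_of_first O hf, hω l hl, show (4 : ℕ) = 2 * 2 from rfl, pow_mul, this]; norm_num
    · right
      rw [beta_of_not_first O hf, hω l hl, hO]; norm_num
  -- With N = `Λ.card`, the denominator lies between 512(N − 1) + 1024 and 2048(N − 1) + 16384, and
  -- the numerator is 144.
  have hterm : ∀ l ∈ Λ, 1 / (144 * (Λ.card : ℝ)) ≤ 9 * C.curv ρ O 0 l ^ 2 /
      (8 * C.curv ρ O 0 l * C.ampA O 0 l + 24 * C.beta O 0 l) ∧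
      9 * C.curv ρ O 0 l ^ 2 /
      (8 * C.curv ρ O 0 l * C.ampA O 0 l + 24 * C.beta O 0 l) ≤ 1 / (Λ.card : ℝ) := by
    intro l hl
    have hc : (((Λ.filter (fun μ => μ < l)).card : ℝ) + ((Λ.filter (fun μ => l < μ)).card : ℝ)) + 1
        = Λ.card := by exact_mod_cast card_lt_add_card_gt hl
    have hx : (0 : ℝ) ≤ ((Λ.filter (fun μ => μ < l)).card : ℝ) := Nat.cast_nonneg _
    have hy : (0 : ℝ) ≤ ((Λ.filter (fun μ => l < μ)).card : ℝ) := Nat.cast_nonneg _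
    rw [hcurv l hl, hA l hl]
    generalize ((Λ.filter (fun μ => μ < l)).card : ℝ) = x at *
    generalize ((Λ.filter (fun μ => l < μ)).card : ℝ) = y at *
    generalize (Λ.card : ℝ) = N at *
    rcases hβ l hl with hb | hb <;> rw [hb] <;> constructor <;>
      rw [div_le_div_iff₀ (by nlinarith) (by nlinarith)] <;> nlinarith
  have hsq : Real.sqrt Λ.card ^ 2 = Λ.card := Real.sq_sqrt (Nat.cast_nonneg _)
  have hsp : 0 < Real.sqrt Λ.card := Real.sqrt_pos.2 (by linarith)
  have : Nonempty Λ := hne.to_subtype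
  refine SharpPatch.of_guarantee (by positivity) ?_ ?_ (guarantee_rUncorr h.unitary h.par hρ O Λ) ?_
  · refine Real.le_sqrt_of_sq_le (le_ciInf fun l => le_trans (le_of_eq ?_) (hterm l l.2).1)
    rw [mul_pow, div_pow, div_pow, hsq]
    field_simp
    norm_num
  · obtain ⟨l, hl⟩ := hne
    refine Real.sqrt_le_iff.2 ⟨by positivity, ?_⟩
    refine (ciInf_le (Set.finite_range _).bddBelow (⟨l, hl⟩ : Λ)).trans ((hterm l hl).2.trans ?_)
    rw [one_mul, div_pow, hsq, one_pow]
  · rw [Finset.sum_congr rfl fun l hl => by rw [hcurv l hl], Finset.sum_const, nsmul_eq_mul, mul_pow,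
      show (4 : ℕ) = 2 * 2 from rfl, pow_mul (1 / Real.sqrt Λ.card), div_pow 1 (Real.sqrt Λ.card), hsq]
    refine le_of_eq ?_
    field_simp
    norm_num

end Signs

end Circuit

end PQC

namespace PQC

/-! ## Tensor products and Pauli strings -/

section Tensor

variable {n : ℕ}

lemma tensor_mul (A B : Fin n → Matrix (Fin 2) (Fin 2) ℂ) :
    tensor A * tensor B = tensor (fun j => A j * B j) := by
  ext b b'
  simp only [tensor, Matrix.mul_apply, Finset.prod_univ_sum, ← Finset.prod_mul_distrib]
  rw [Fintype.piFinset_univ]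

lemma tensor_one : tensor (fun _ : Fin n => (1 : Matrix (Fin 2) (Fin 2) ℂ)) = 1 := by
  ext b b'
  simp only [tensor, Matrix.one_apply]
  by_cases h : b = b'
  · subst h; simp
  · rw [if_neg h]
    obtain ⟨j, hj⟩ := Function.ne_iff.1 h
    exact Finset.prod_eq_zero (Finset.mem_univ j) (by simp [hj])

lemma conjTranspose_tensor (A : Fin n → Matrix (Fin 2) (Fin 2) ℂ) :
    (tensor A)ᴴ = tensor (fun j => (A j)ᴴ) := by
  ext b b'
  simp [tensor, Matrix.conjTranspose_apply]

lemma tensor_smul (z : Fin n → ℂ) (A : Fin n → Matrix (Fin 2) (Fin 2) ℂ) :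
    tensor (fun j => z j • A j) = (∏ j, z j) • tensor A := by
  ext b b'
  simp [tensor, Finset.prod_mul_distrib]

lemma tensor_update_apply (A : Fin n → Matrix (Fin 2) (Fin 2) ℂ) (i : Fin n)
    (M : Matrix (Fin 2) (Fin 2) ℂ) (b b' : Fin n → Fin 2) :
    tensor (Function.update A i M) b b'
      = M (b i) (b' i) * ∏ j ∈ Finset.univ.erase i, A j (b j) (b' j) := by
  rw [tensor, ← Finset.mul_prod_erase _ _ (Finset.mem_univ i)]
  congr 1
  · simp
  · exact Finset.prod_congr rfl fun j hj => by simp [Finset.ne_of_mem_erase hj]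

lemma tensor_update_neg (A : Fin n → Matrix (Fin 2) (Fin 2) ℂ) (i : Fin n)
    (M : Matrix (Fin 2) (Fin 2) ℂ) :
    tensor (Function.update A i (-M)) = -tensor (Function.update A i M) := by
  ext b b'
  simp [tensor_update_apply]

lemma tensor_mulVec (A : Fin n → Matrix (Fin 2) (Fin 2) ℂ) (v : Fin n → Fin 2 → ℂ) :
    tensor A *ᵥ productKet v = productKet (fun j => A j *ᵥ v j) := by
  ext b
  simp only [Matrix.mulVec, dotProduct, tensor, productKet, Finset.prod_univ_sum,
    ← Finset.prod_mul_distrib]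
  rw [Fintype.piFinset_univ]

lemma star_productKet_dotProduct (v w : Fin n → Fin 2 → ℂ) :
    star (productKet v) ⬝ᵥ productKet w = ∏ j, star (v j) ⬝ᵥ w j := by
  simp only [dotProduct, productKet, Finset.prod_univ_sum, Pi.star_apply, star_prod,
    ← Finset.prod_mul_distrib]
  rw [Fintype.piFinset_univ]

lemma onQubit_mul_tensor (i : Fin n) (M : Matrix (Fin 2) (Fin 2) ℂ)
    (A : Fin n → Matrix (Fin 2) (Fin 2) ℂ) :
    onQubit i M * tensor A = tensor (Function.update A i (M * A i)) := by
  rw [onQubit, tensor_mul]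
  congr 1
  funext j
  by_cases h : j = i
  · subst h; simp
  · simp [h]

lemma tensor_mul_onQubit (i : Fin n) (M : Matrix (Fin 2) (Fin 2) ℂ)
    (A : Fin n → Matrix (Fin 2) (Fin 2) ℂ) :
    tensor A * onQubit i M = tensor (Function.update A i (A i * M)) := by
  rw [onQubit, tensor_mul]
  congr 1
  funext j
  by_cases h : j = i
  · subst h; simp
  · simp [h]

lemma conjTranspose_onQubit (i : Fin n) (M : Matrix (Fin 2) (Fin 2) ℂ) :
    (onQubit i M)ᴴ = onQubit i Mᴴ := by
  rw [onQubit, conjTranspose_tensor, onQubit]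
  congr 1
  funext j
  by_cases h : j = i
  · subst h; simp
  · simp [h]

lemma pauli_isHermitian (a : Fin 4) : (pauli a)ᴴ = pauli a := by
  fin_cases a
  · simp [pauli]
  all_goals ext i j; fin_cases i <;> fin_cases j <;> simp [pauli]

lemma pauli_mul_self (a : Fin 4) : pauli a * pauli a = 1 := by
  fin_cases a
  · simp [pauli]
  all_goals ext i j; fin_cases i <;> fin_cases j <;> simp [pauli, Matrix.mul_apply, Fin.sum_univ_two]

/-- The sign in the commutation relation of two Pauli matrices. -/
def pauliSign (a b : Fin 4) : ℂ := if a = 0 ∨ b = 0 ∨ a = b then 1 else -1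

lemma pauli_mul_comm (a b : Fin 4) : pauli a * pauli b = pauliSign a b • (pauli b * pauli a) := by
  unfold pauliSign
  by_cases h0 : a = 0
  · subst h0; simp [pauli]
  by_cases h1 : b = 0
  · subst h1; simp [pauli]
  by_cases h2 : a = b
  · subst h2; simp
  · rw [if_neg (by tauto)]
    revert h0 h1 h2
    fin_cases a <;> fin_cases b <;> intro h0 h1 h2 <;>
      first
      | exact absurd rfl h0
      | exact absurd rfl h1
      | exact absurd rfl h2
      | (ext i j; fin_cases i <;> fin_cases j <;>
          simp [pauli, Matrix.mul_apply, Fin.sum_univ_two])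

/-- The label of the product of two Pauli matrices, up to a phase. -/
def pauliLabel (a b : Fin 4) : Fin 4 :=
  if a = 0 then b else if b = 0 then a else if a = b then 0 else
    (if a ≠ 1 ∧ b ≠ 1 then 1 else if a ≠ 2 ∧ b ≠ 2 then 2 else 3)

lemma pauli_mul_eq (a b : Fin 4) :
    ∃ z : ℂ, ‖z‖ = 1 ∧ pauli a * pauli b = z • pauli (pauliLabel a b) := by
  have hmem : ∀ z : ℂ, z = 1 ∨ z = Complex.I ∨ z = -Complex.I → ‖z‖ = 1 := by
    rintro z (rfl | rfl | rfl) <;> simp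
  have : (pauli a * pauli b = (1 : ℂ) • pauli (pauliLabel a b)) ∨
      (pauli a * pauli b = Complex.I • pauli (pauliLabel a b)) ∨
      (pauli a * pauli b = (-Complex.I) • pauli (pauliLabel a b)) := by
    by_cases h0 : a = 0
    · subst h0; left; simp [pauli, pauliLabel]
    by_cases h1 : b = 0
    · subst h1; left; simp [pauli, pauliLabel, h0]
    by_cases h2 : a = b
    · subst h2; left; rw [pauli_mul_self]; simp [pauliLabel, h0, pauli]
    revert h0 h1 h2
    fin_cases a <;> fin_cases b <;> intro h0 h1 h2 <;>
      first
      | exact absurd rfl h0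
      | exact absurd rfl h1
      | exact absurd rfl h2
      | (right; left; ext i j; fin_cases i <;> fin_cases j <;>
          simp [pauli, pauliLabel, Matrix.mul_apply, Fin.sum_univ_two]; done)
      | (right; right; ext i j; fin_cases i <;> fin_cases j <;>
          simp [pauli, pauliLabel, Matrix.mul_apply, Fin.sum_univ_two])
  rcases this with h | h | h
  · exact ⟨_, hmem _ (Or.inl rfl), h⟩
  · exact ⟨_, hmem _ (Or.inr (Or.inl rfl)), h⟩
  · exact ⟨_, hmem _ (Or.inr (Or.inr rfl)), h⟩

lemma pauliString_isHermitian (s : Fin n → Fin 4) : (pauliString s).IsHermitian := by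
  rw [Matrix.IsHermitian, pauliString, conjTranspose_tensor]
  simp_rw [pauli_isHermitian]

lemma pauliString_mul_self (s : Fin n → Fin 4) : pauliString s * pauliString s = 1 := by
  rw [pauliString, tensor_mul]
  simp_rw [pauli_mul_self]
  exact tensor_one

lemma norm_pauliString (s : Fin n → Fin 4) : ‖pauliString s‖ = 1 :=
  Circuit.norm_le_one_of_sq (pauliString_isHermitian s) (pauliString_mul_self s)

lemma pauliString_mul_comm (s t : Fin n → Fin 4) : pauliString s * pauliString t
    = (∏ j, pauliSign (s j) (t j)) • (pauliString t * pauliString s) := by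
  rw [pauliString, pauliString, tensor_mul, tensor_mul, ← tensor_smul]
  congr 1
  funext j
  exact pauli_mul_comm _ _

lemma onQubit_pauli (i : Fin n) (a : Fin 4) :
    onQubit i (pauli a) = pauliString (Pi.single i a) := by
  rw [onQubit, pauliString]
  congr 1
  funext j
  by_cases h : j = i
  · subst h; simp
  · simp [h, pauli]

lemma onQubit_pauli_isHermitian (i : Fin n) (a : Fin 4) : (onQubit i (pauli a)).IsHermitian := by
  rw [onQubit_pauli]; exact pauliString_isHermitian _

lemma onQubit_pauli_sq (i : Fin n) (a : Fin 4) : onQubit i (pauli a) * onQubit i (pauli a) = 1 := by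
  rw [onQubit_pauli]; exact pauliString_mul_self _

end Tensor

/-! ## Pure states -/

section PureState

variable {n : ℕ}

lemma isDensity_pureState {ψ : (Fin n → Fin 2) → ℂ} (h : star ψ ⬝ᵥ ψ = 1) :
    IsDensity (pureState ψ) := by
  refine ⟨Matrix.posSemidef_vecMulVec_self_star ψ, ?_⟩
  rw [pureState, Matrix.trace_vecMulVec, dotProduct_comm, h]

lemma expect_pureState (ψ : (Fin n → Fin 2) → ℂ) (X : Op n) :
    expect (pureState ψ) X = (star ψ ⬝ᵥ (X *ᵥ ψ)).re := by
  rw [expect_apply, pureState, Matrix.vecMulVec_mul, Matrix.trace_vecMulVec, dotProduct_comm,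
    Matrix.dotProduct_mulVec]

/-- An operator that anticommutes with a Hermitian stabilizer has expectation value zero. -/
lemma expect_eq_zero_of_anticommute {ψ : (Fin n → Fin 2) → ℂ} {S X : Op n} {ε : ℝ}
    (hS : S.IsHermitian) (hε : ε ^ 2 = 1) (hψ : S *ᵥ ψ = (ε : ℂ) • ψ) (h : S * X = -(X * S)) :
    expect (pureState ψ) X = 0 := by
  have h1 : star ψ ᵥ* S = (ε : ℂ) • star ψ := by
    have := congrArg star hψ
    rw [Matrix.star_mulVec, hS.eq] at this
    rw [this]; ext; simp
  have h2 : star ψ ⬝ᵥ ((S * X) *ᵥ ψ) = ε * (star ψ ⬝ᵥ (X *ᵥ ψ)) := by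
    rw [← Matrix.mulVec_mulVec, Matrix.dotProduct_mulVec, h1, smul_dotProduct, smul_eq_mul]
  have h3 : star ψ ⬝ᵥ ((S * X) *ᵥ ψ) = -(ε * (star ψ ⬝ᵥ (X *ᵥ ψ))) := by
    rw [h, Matrix.neg_mulVec, dotProduct_neg, ← Matrix.mulVec_mulVec, hψ, Matrix.mulVec_smul,
      dotProduct_smul, smul_eq_mul]
  have h4 : (ε : ℂ) * (star ψ ⬝ᵥ (X *ᵥ ψ)) = 0 := self_eq_neg.1 (h2.symm.trans h3)
  have hε0 : (ε : ℂ) ≠ 0 := by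
    intro h0
    have : ε = 0 := by exact_mod_cast h0
    rw [this] at hε; norm_num at hε
  rw [expect_pureState, (mul_eq_zero.1 h4).resolve_left hε0]; simp

end PureState

end PQC

namespace PQC

open Circuit

/-! ## Tensor products of `σ_z` and `1` -/

section ZString

variable {n : ℕ}

/-- The string with `σ_z` on the qubits satisfying `q`. -/
noncomputable def zString (q : Fin n → Prop) [DecidablePred q] : Op n :=
  tensor (fun j => if q j then pauli 3 else 1)

variable (q : Fin n → Prop) [DecidablePred q]

lemma zString_eq_pauliString : zString q = pauliString (fun j => if q j then 3 else 0) := by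
  rw [zString, pauliString]
  congr 1
  funext j
  split_ifs <;> simp [pauli]

lemma zString_isHermitian : (zString q).IsHermitian := by
  rw [zString_eq_pauliString]; exact pauliString_isHermitian _

lemma norm_zString : ‖zString q‖ = 1 := by
  rw [zString_eq_pauliString]; exact norm_pauliString _

lemma onQubit_anticommute_zString {a : Fin 4} (ha : a = 1 ∨ a = 2) {i : Fin n} (hi : q i) :
    onQubit i (pauli a) * zString q = -(zString q * onQubit i (pauli a)) := by
  rw [zString, onQubit_mul_tensor, tensor_mul_onQubit, ← tensor_update_neg]
  congr 2
  rw [if_pos hi, pauli_mul_comm]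
  rcases ha with rfl | rfl <;> simp [pauliSign]

lemma onQubit_commute_zString {a : Fin 4} {i : Fin n} (h : a = 3 ∨ ¬ q i) :
    Commute (onQubit i (pauli a)) (zString q) := by
  rw [Commute, SemiconjBy, zString, onQubit_mul_tensor, tensor_mul_onQubit]
  congr 2
  rcases h with rfl | h
  · split_ifs <;> simp
  · simp [h]

lemma zString_eq_diagonal : ∃ d : (Fin n → Fin 2) → ℂ, zString q = Matrix.diagonal d := by
  refine ⟨fun b => zString q b b, ?_⟩
  ext b b'
  by_cases h : b = b'
  · subst h; simp
  · rw [Matrix.diagonal_apply_ne _ h]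
    obtain ⟨j, hj⟩ := Function.ne_iff.1 h
    refine Finset.prod_eq_zero (Finset.mem_univ j) ?_
    by_cases hq : q j
    · simp only [hq, if_true]
      revert hj
      generalize b j = x; generalize b' j = y
      fin_cases x <;> fin_cases y <;> simp [pauli]
    · simp [hq, Matrix.one_apply_ne hj]

end ZString

lemma globalZ_eq (n : ℕ) : globalZ n = zString (fun _ => True) := by
  simp [globalZ, zString]

lemma isUnitary_of_fixed_one {n : ℕ} {G P : Type} {C : Circuit n G P}
    (h : ∀ g, (C.gen g).IsHermitian) (h1 : ∀ g, C.fixed g = 1) : C.IsUnitary :=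
  ⟨h, fun g => by rw [h1]; exact one_mem _⟩

/-! ## Tensor-product ansatz -/

section TensorProduct

variable {n : ℕ}

lemma ket_inner : star ketPlus ⬝ᵥ ketPlus = 1 ∧ star ketMinus ⬝ᵥ ketMinus = 1 ∧
    star ketPlus ⬝ᵥ ketMinus = 0 ∧ star ketMinus ⬝ᵥ ketPlus = 0 := by
  have h : ((Real.sqrt 2 : ℝ) : ℂ)⁻¹ * ((Real.sqrt 2 : ℝ) : ℂ)⁻¹ = 1 / 2 := by
    rw [← mul_inv, ← Complex.ofReal_mul, Real.mul_self_sqrt (by norm_num)]; norm_num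
  refine ⟨?_, ?_, ?_, ?_⟩ <;> simp [dotProduct, Fin.sum_univ_two, ketPlus, ketMinus, h] <;> norm_num

lemma pauli_ket : pauli 3 *ᵥ ketPlus = ketMinus ∧ pauli 3 *ᵥ ketMinus = ketPlus ∧
    pauli 1 *ᵥ ketPlus = ketPlus ∧ pauli 1 *ᵥ ketMinus = -ketMinus := by
  refine ⟨?_, ?_, ?_, ?_⟩ <;> ext x <;> fin_cases x <;>
    simp [pauli, ketPlus, ketMinus, Matrix.mulVec, dotProduct, Fin.sum_univ_two]

/-- The vectors `(|+⟩^{⊗n} ± |-⟩^{⊗n})/√2`. -/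
noncomputable def tpKet (n : ℕ) (ε : ℂ) : (Fin n → Fin 2) → ℂ :=
  ((1 / Real.sqrt 2 : ℝ) : ℂ) •
    (productKet (fun _ : Fin n => ketPlus) + ε • productKet (fun _ => ketMinus))

lemma tpState_eq (n : ℕ) : tpState n = pureState (tpKet n 1) := by
  simp [tpState, tpKet]

lemma tpKet_inner (hn : 1 ≤ n) : star (tpKet n 1) ⬝ᵥ tpKet n 1 = 1 := by
  obtain ⟨h1, h2, h3, h4⟩ := ket_inner
  have h : ((Real.sqrt 2 : ℝ) : ℂ)⁻¹ * ((Real.sqrt 2 : ℝ) : ℂ)⁻¹ = 1 / 2 := by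
    rw [← mul_inv, ← Complex.ofReal_mul, Real.mul_self_sqrt (by norm_num)]; norm_num
  rw [tpKet, star_smul, smul_dotProduct, dotProduct_smul, smul_smul, one_smul, star_add,
    add_dotProduct, dotProduct_add, dotProduct_add]
  simp only [star_productKet_dotProduct, h1, h2, h3, h4]
  simp only [Finset.prod_const, Finset.card_univ, Fintype.card_fin, one_pow, zero_pow (by omega : n ≠ 0)]
  simp [h]
  norm_num

lemma isDensity_tpState (hn : 1 ≤ n) : IsDensity (tpState n) := by
  rw [tpState_eq]; exact isDensity_pureState (tpKet_inner hn)

/-- On each qubit σ_z exchanges |+⟩ and |−⟩, so the two branches of the state are swapped. -/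
lemma globalZ_mulVec_tpKet (n : ℕ) : globalZ n *ᵥ tpKet n 1 = tpKet n 1 := by
  obtain ⟨h1, h2, -, -⟩ := pauli_ket
  rw [tpKet, Matrix.mulVec_smul, Matrix.mulVec_add, Matrix.mulVec_smul, globalZ, tensor_mulVec,
    tensor_mulVec, h1, h2, one_smul, one_smul, add_comm]

/-- A single σ_x only changes the relative sign of the two branches; consequently any two of them,
on whichever qubits, stabilize the state. -/
lemma onQubit_x_mulVec_tpKet (i : Fin n) (ε : ℂ) :
    onQubit i (pauli 1) *ᵥ tpKet n ε = tpKet n (-ε) := by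
  obtain ⟨-, -, h1, h2⟩ := pauli_ket
  rw [tpKet, Matrix.mulVec_smul, Matrix.mulVec_add, Matrix.mulVec_smul, onQubit, tensor_mulVec,
    tensor_mulVec]
  have e1 : (fun j => Function.update (1 : Fin n → Matrix (Fin 2) (Fin 2) ℂ) i (pauli 1) j *ᵥ ketPlus)
      = fun _ => ketPlus := by
    funext j
    by_cases h : j = i
    · subst h; simp [h1]
    · simp [h]
  have e2 : productKet
      (fun j => Function.update (1 : Fin n → Matrix (Fin 2) (Fin 2) ℂ) i (pauli 1) j *ᵥ ketMinus)
      = -productKet (fun _ => ketMinus) := by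
    funext b
    simp only [productKet, Pi.neg_apply]
    rw [← Finset.mul_prod_erase _ _ (Finset.mem_univ i),
      ← Finset.mul_prod_erase _ (fun j => ketMinus (b j)) (Finset.mem_univ i)]
    rw [Finset.prod_congr rfl fun j hj => by
      rw [Function.update_of_ne (Finset.ne_of_mem_erase hj), Pi.one_apply, Matrix.one_mulVec]]
    rw [Function.update_self, h2]
    simp
  rw [e1, e2, smul_neg, tpKet, neg_smul]

lemma expect_tpState_globalZ (hn : 1 ≤ n) : expect (tpState n) (globalZ n) = 1 := by
  rw [tpState_eq, expect_pureState, globalZ_mulVec_tpKet, tpKet_inner hn, Complex.one_re]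

lemma mem_tpSet (g : Fin 3 ×ₗ Fin n) : g ∈ tpSet n ↔ (ofLex g).1 ≠ 1 := by
  simp [tpSet]

lemma card_tpSet (n : ℕ) : (tpSet n).card = 2 * n := by
  have : (tpSet n).card = (Finset.univ : Finset (Bool × Fin n)).card := by
    symm
    refine Finset.card_bij (fun x _ => toLex (if x.1 then (0 : Fin 3) else 2, x.2)) ?_ ?_ ?_
    · rintro ⟨x, i⟩ _
      rw [mem_tpSet]; cases x <;> simp
    · rintro ⟨x, i⟩ _ ⟨y, j⟩ _ h
      cases x <;> cases y <;> simp_all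
    · rintro g hg
      rw [mem_tpSet] at hg
      obtain ⟨c, i⟩ := g
      by_cases h0 : c = 0
      · exact ⟨(true, i), Finset.mem_univ _, by subst h0; rfl⟩
      · refine ⟨(false, i), Finset.mem_univ _, ?_⟩
        have : c = 2 := by
          change c ≠ 1 at hg
          omega
        subst this; rfl
  rw [this]; simp

lemma tpGen_isHermitian (g : Fin 3 ×ₗ Fin n) : (tpGen n g).IsHermitian :=
  onQubit_pauli_isHermitian _ _

lemma tpGen_of_mem {g : Fin 3 ×ₗ Fin n} (hg : g ∈ tpSet n) :
    tpGen n g = onQubit (ofLex g).2 (pauli 1) := by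
  rw [mem_tpSet] at hg
  rw [tpGen, if_neg hg]

lemma tpGen_of_not_mem {g : Fin 3 ×ₗ Fin n} (hg : g ∉ tpSet n) :
    tpGen n g = onQubit (ofLex g).2 (pauli 3) := by
  rw [mem_tpSet, not_not] at hg
  rw [tpGen, if_pos hg]

lemma tpGen_anticommute {g : Fin 3 ×ₗ Fin n} (hg : g ∈ tpSet n) :
    tpGen n g * globalZ n = -(globalZ n * tpGen n g) := by
  rw [tpGen_of_mem hg, globalZ_eq]
  exact onQubit_anticommute_zString _ (Or.inl rfl) trivial

lemma tpGen_commute {g : Fin 3 ×ₗ Fin n} (hg : g ∉ tpSet n) : Commute (tpGen n g) (globalZ n) := by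
  rw [tpGen_of_not_mem hg, globalZ_eq]
  exact onQubit_commute_zString _ (Or.inl rfl)

lemma norm_globalZ (n : ℕ) : ‖globalZ n‖ = 1 := by rw [globalZ_eq, norm_zString]

lemma tpUncorr_hasSigns (n : ℕ) : (tpUncorr n).HasSigns (globalZ n) (tpSet n) where
  unitary := isUnitary_of_fixed_one tpGen_isHermitian fun _ => rfl
  par := rfl
  sq _ _ := onQubit_pauli_sq _ _
  anti _ hg := tpGen_anticommute hg
  comm _ hg := tpGen_commute hg
  fixed _ := Commute.one_left _

theorem tpUncorr_sharpPatch (hn : 1 ≤ n) :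
    (tpUncorr n).SharpPatch (tpState n) (globalZ n) (tpSet n)
        ((tpUncorr n).rUncorr (tpState n) (globalZ n) (tpSet n))
        (1 / 24) 1 (1 / Real.sqrt n) (1 / 186624) (1 / n) := by
  have hc := card_tpSet n
  have hn' : (1 : ℝ) ≤ n := by exact_mod_cast hn
  have h := (tpUncorr_hasSigns n).sharpPatch (isDensity_tpState hn) (norm_globalZ n)
    (expect_tpState_globalZ hn) (Finset.card_pos.1 (by omega))
  rw [hc] at h
  push_cast at h
  have h0 : 0 < Real.sqrt n := Real.sqrt_pos.2 (by linarith)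
  have h1 : Real.sqrt n ≤ Real.sqrt (2 * n) := Real.sqrt_le_sqrt (by linarith)
  have h2 : Real.sqrt (2 * n) ≤ 2 * Real.sqrt n := by
    refine Real.sqrt_le_iff.2 ⟨by positivity, ?_⟩
    rw [mul_pow, Real.sq_sqrt (by linarith)]; linarith
  refine h.mono ?_ ?_ ?_
  · rw [div_mul_div_comm, div_mul_div_comm, div_le_div_iff₀ (by positivity) (by positivity)]
    linarith
  · have := one_div_le_one_div_of_le h0 h1
    linarith
  · refine le_of_eq ?_
    field_simp
    norm_num

/-- Two σ_x generators leave −4 times σ_x σ_x O, whose factors all act trivially in total. With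
exactly one σ_x generator, acting first, the double commutator anticommutes with the stabilizer
σ_z^{⊗n}. A σ_z generator acting first commutes with `O`. -/
lemma expect_second_tpCorr (hn : 1 ≤ n) (g g' : Fin 3 ×ₗ Fin n) :
    expect (tpState n) (ad (tpGen n g') (ad (tpGen n g) (globalZ n)))
      = if g ∈ tpSet n ∧ g' ∈ tpSet n then -4 else 0 := by
  by_cases hg : g ∈ tpSet n
  · have ha := tpGen_anticommute hg
    have e : ad (tpGen n g') (ad (tpGen n g) (globalZ n))
        = -((tpGen n g' * (tpGen n g * globalZ n) + tpGen n g' * (tpGen n g * globalZ n))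
          - (tpGen n g * globalZ n * tpGen n g' + tpGen n g * globalZ n * tpGen n g')) := by
      have : globalZ n * tpGen n g = -(tpGen n g * globalZ n) := by rw [ha, neg_neg]
      rw [ad_apply, ad_apply, this, mul_smul_comm, smul_mul_assoc, ← smul_sub, smul_smul,
        Complex.I_mul_I, neg_one_smul, sub_neg_eq_add, mul_add, add_mul]
    by_cases hg' : g' ∈ tpSet n
    · rw [if_pos ⟨hg, hg'⟩, e]
      have ha' := tpGen_anticommute hg'
      have : tpGen n g * globalZ n * tpGen n g' = -(tpGen n g * (tpGen n g' * globalZ n)) := by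
        rw [ha', mul_neg, neg_neg, mul_assoc]
      rw [this]
      have key : ∀ i j : Fin n, expect (tpState n)
          (onQubit i (pauli 1) * (onQubit j (pauli 1) * globalZ n)) = 1 := by
        intro i j
        rw [tpState_eq, expect_pureState, ← Matrix.mulVec_mulVec, ← Matrix.mulVec_mulVec,
          globalZ_mulVec_tpKet, onQubit_x_mulVec_tpKet, onQubit_x_mulVec_tpKet, neg_neg,
          tpKet_inner hn, Complex.one_re]
      simp only [map_neg, map_sub, map_add, tpGen_of_mem hg, tpGen_of_mem hg', key]
      norm_num
    · rw [if_neg fun h => hg' h.2, tpState_eq]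
      have hc := (tpGen_commute hg').eq
      refine expect_eq_zero_of_anticommute (S := globalZ n) (ε := 1) ?_ (by norm_num) ?_ ?_
      · rw [globalZ_eq]; exact zString_isHermitian _
      · rw [globalZ_mulVec_tpKet]; simp
      · rw [e]
        have h1 : ∀ Y, globalZ n * (tpGen n g * Y) = -(tpGen n g * (globalZ n * Y)) := fun Y => by
          rw [← mul_assoc, ← mul_assoc, ha, neg_mul, neg_neg]
        have h2 : ∀ Y, globalZ n * (tpGen n g' * Y) = tpGen n g' * (globalZ n * Y) := fun Y => by
          rw [← mul_assoc, ← mul_assoc, hc]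
        simp only [mul_neg, mul_sub, mul_add, neg_mul, sub_mul, add_mul, mul_assoc, h1, h2, ← hc]
        abel
  · rw [if_neg fun h => hg h.1, ad_eq_zero (tpGen_commute hg), map_zero, map_zero]

/-- The common parameter hits every ordered pair of gates; the 2n gates of σ_x type give (2n)² equal
terms −4. -/
lemma tpCorr_curv (hn : 1 ≤ n) : (tpCorr n).curv (tpState n) (globalZ n) 0 0 = 16 * (n : ℝ) ^ 2 := by
  have hU : (tpCorr n).IsUnitary := isUnitary_of_fixed_one tpGen_isHermitian fun _ => rfl
  have hV : ∀ g, (tpCorr n).fixed g = 1 := fun _ => rfl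
  rw [curv_eq_abs_sum hU]
  have hall : ∀ g, (tpCorr n).par g = 0 := fun _ => rfl
  have e : ∀ g g' : Fin 3 ×ₗ Fin n, expect (tpState n)
      ((tpCorr n).heisD (globalZ n) (Pi.single g 1 + Pi.single g' 1) 0)
      = if g ∈ tpSet n ∧ g' ∈ tpSet n then -4 else 0 := by
    intro g g'
    rcases lt_trichotomy g g' with h | h | h
    · rw [heisD_pair_origin hV _ h, pow_one, pow_one]
      exact expect_second_tpCorr hn g g'
    · subst h
      rw [← Pi.single_add, heisD_single_origin hV, pow_two]
      exact expect_second_tpCorr hn g g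
    · rw [add_comm, heisD_pair_origin hV _ h, pow_one, pow_one]
      simp only [and_comm (a := g ∈ tpSet n)]
      exact expect_second_tpCorr hn g' g
  simp only [hall, e, Finset.filter_true]
  have : ∀ g : Fin 3 ×ₗ Fin n, ∑ g', (if g ∈ tpSet n ∧ g' ∈ tpSet n then (-4 : ℝ) else 0)
      = if g ∈ tpSet n then -8 * (n : ℝ) else 0 := by
    intro g
    by_cases hg : g ∈ tpSet n
    · simp only [hg, true_and, if_true]
      rw [← Finset.sum_filter, Finset.filter_mem_eq_inter, Finset.univ_inter, Finset.sum_const,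
        card_tpSet]
      simp; ring
    · simp [hg]
  rw [Finset.sum_congr rfl fun g _ => this g, ← Finset.sum_filter, Finset.filter_mem_eq_inter,
    Finset.univ_inter, Finset.sum_const, card_tpSet]
  rw [nsmul_eq_mul, abs_of_nonpos] <;> push_cast
  · ring
  · nlinarith [sq_nonneg (n : ℝ)]

theorem tpCorr_sharpPatch (hn : 1 ≤ n) :
    (tpCorr n).SharpPatch (tpState n) (globalZ n) {0}
        ((tpCorr n).rCorr (tpState n) (globalZ n) 0) (1 / 72) 1 (1 / n) (256 / 72 ^ 5) 1 := by
  have hU : (tpCorr n).IsUnitary := isUnitary_of_fixed_one tpGen_isHermitian fun _ => rfl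
  have hρ := isDensity_tpState hn
  have hn' : (1 : ℝ) ≤ n := by exact_mod_cast hn
  have hc := tpCorr_curv hn
  have h1 := curv_le_parFreq hU hρ (globalZ n) 0
  have h2 : (tpCorr n).parFreq 0 ≤ 6 * n := by
    rw [parFreq_eq]
    have : ∀ g ∈ Finset.univ.filter (fun g => (tpCorr n).par g = 0),
        maxFreq ((tpCorr n).gen g) ≤ 2 := fun g _ => by
      have := maxFreq_le (tpGen n g)
      rw [norm_le_one_of_sq (tpGen_isHermitian g) (onQubit_pauli_sq _ _), mul_one] at this
      exact this
    refine (Finset.sum_le_card_nsmul _ _ _ this).trans ?_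
    have hall : ∀ g, (tpCorr n).par g = 0 := fun _ => rfl
    simp only [hall, Finset.filter_true, nsmul_eq_mul]
    have : (Finset.univ : Finset (Fin 3 ×ₗ Fin n)).card = 3 * n := by
      rw [Finset.card_univ]
      exact (Fintype.card_congr ofLex).trans (by simp)
    rw [this]; push_cast; linarith
  have h0 := parFreq_nonneg (tpCorr n) 0
  rw [hc, norm_globalZ, mul_one] at h1
  -- There is no second parameter, so only the ω⁶ term of the denominator survives; ω² lies between
  -- 16n² (from the curvature) and 36n² (from 3n gates of frequency at most 2).
  have e0 : Finset.univ.filter (fun q : Fin 1 => q ≠ 0) = ∅ := by decide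
  have hR := rCorr_eq (tpCorr n) (tpState n) (globalZ n) 0
  rw [e0, Finset.sum_empty, hc, norm_globalZ] at hR
  set ω := (tpCorr n).parFreq 0
  have hω2 : ω ^ 2 ≤ 36 * (n : ℝ) ^ 2 := by nlinarith
  have hx : 0 < (n : ℝ) ^ 2 := by positivity
  have e6 : ω ^ 6 = (ω ^ 2) ^ 3 := by ring
  have hlow : (16 * (n : ℝ) ^ 2) ^ 3 ≤ ω ^ 6 := by
    rw [e6]; exact pow_le_pow_left₀ (by positivity) h1 3
  have hup : ω ^ 6 ≤ (36 * (n : ℝ) ^ 2) ^ 3 := by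
    rw [e6]; exact pow_le_pow_left₀ (by positivity) hω2 3
  have hω6 : 0 < ω ^ 6 := lt_of_lt_of_le (by positivity) hlow
  refine SharpPatch.of_guarantee (by positivity) ?_ ?_ (guarantee_rCorr hU hρ _ 0) ?_
  · rw [hR]
    refine Real.le_sqrt_of_sq_le ?_
    rw [div_mul_div_comm, div_pow, div_le_div_iff₀ (by positivity) (by positivity)]
    ring_nf at hup ⊢
    nlinarith [mul_le_mul_of_nonneg_left hup (by positivity : (0 : ℝ) ≤ 1)]
  · rw [hR]
    refine Real.sqrt_le_iff.2 ⟨by positivity, ?_⟩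
    rw [one_mul, div_pow, div_le_div_iff₀ (by positivity) (by positivity)]
    ring_nf at hlow ⊢
    nlinarith
  · simp only [Finset.sum_singleton]
    rw [hc]
    refine le_of_eq ?_
    field_simp
    norm_num

end TensorProduct

/-! ## Hardware-efficient ansatz -/

section HardwareEfficient

variable {n : ℕ}

lemma cz_mem_unitary (i j : Fin n) : cz i j ∈ unitary (Op n) := by
  have h1 : (cz i j)ᴴ = cz i j := by
    rw [cz, Matrix.diagonal_conjTranspose]
    congr 1
    funext b
    simp only [Pi.star_apply]
    split_ifs <;> simp
  have h2 : cz i j * cz i j = 1 := by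
    rw [cz, Matrix.diagonal_mul_diagonal, ← Matrix.diagonal_one]
    congr 1
    funext b
    split_ifs <;> simp
  rw [Unitary.mem_iff, Matrix.star_eq_conjTranspose, h1]
  exact ⟨h2, h2⟩

lemma czRing_mem_unitary (n : ℕ) : czRing n ∈ unitary (Op n) := by
  refine Submonoid.list_prod_mem _ fun x hx => ?_
  obtain ⟨i, -, rfl⟩ := List.mem_map.1 hx
  exact cz_mem_unitary _ _

/-- Both operators are diagonal. Hence the entangling layers leave the observable unchanged at every
depth, and the sign structure persists. -/
lemma czRing_commute_zString (q : Fin n → Prop) [DecidablePred q] :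
    Commute (czRing n) (zString q) := by
  obtain ⟨d, hd⟩ := zString_eq_diagonal q
  refine Commute.list_prod_left _ _ fun x hx => ?_
  obtain ⟨i, -, rfl⟩ := List.mem_map.1 hx
  rw [hd, cz, Commute, SemiconjBy, Matrix.diagonal_mul_diagonal, Matrix.diagonal_mul_diagonal]
  simp_rw [mul_comm]

lemma hea_isUnitary (n L : ℕ) : (hea n L).IsUnitary := by
  refine ⟨fun g => onQubit_pauli_isHermitian _ _, fun g => ?_⟩
  simp only [hea]
  split_ifs
  · exact czRing_mem_unitary n
  · exact one_mem _

/-- The `σ_y` rotations of the qubits satisfying `q`. -/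
def heaSet (n L : ℕ) (q : Fin n → Prop) [DecidablePred q] : Finset (Fin L ×ₗ (Fin n ×ₗ Fin 2)) :=
  Finset.univ.filter (fun g => (ofLex (ofLex g).2).2 = 0 ∧ q (ofLex (ofLex g).2).1)

lemma hea_hasSigns (n L : ℕ) (q : Fin n → Prop) [DecidablePred q] :
    (hea n L).HasSigns (zString q) (heaSet n L q) where
  unitary := hea_isUnitary n L
  par := rfl
  sq _ _ := onQubit_pauli_sq _ _
  anti g hg := by
    simp only [heaSet, Finset.mem_filter, Finset.mem_univ, true_and] at hg
    simp only [hea, hg.1, if_true]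
    exact onQubit_anticommute_zString q (Or.inr rfl) hg.2
  comm g hg := by
    simp only [heaSet, Finset.mem_filter, Finset.mem_univ, true_and, not_and_or] at hg
    simp only [hea]
    refine onQubit_commute_zString q ?_
    rcases hg with h | h
    · left; rw [if_neg h]
    · right; exact h
  fixed g := by
    simp only [hea]
    split_ifs
    · exact czRing_commute_zString q
    · exact Commute.one_left _

lemma ket_zero_inner : star (ket 0) ⬝ᵥ ket 0 = 1 := by
  simp [ket, dotProduct, Fin.sum_univ_two]

lemma isDensity_zeroState (n : ℕ) : IsDensity (zeroState n) := by
  refine isDensity_pureState ?_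
  rw [star_productKet_dotProduct]
  exact Finset.prod_eq_one fun _ _ => ket_zero_inner

lemma expect_zeroState_zString (q : Fin n → Prop) [DecidablePred q] :
    expect (zeroState n) (zString q) = 1 := by
  have h3 : pauli 3 *ᵥ ket 0 = ket 0 := by
    ext x; fin_cases x <;> simp [pauli, ket, Matrix.mulVec, dotProduct, Fin.sum_univ_two]
  rw [zeroState, expect_pureState, zString, tensor_mulVec, star_productKet_dotProduct]
  rw [Finset.prod_eq_one, Complex.one_re]
  intro j _
  split_ifs
  · rw [h3, ket_zero_inner]
  · rw [Matrix.one_mulVec, ket_zero_inner]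

lemma hea_sharpPatch (n L : ℕ) (q : Fin n → Prop) [DecidablePred q] (hne : (heaSet n L q).Nonempty) :
    (hea n L).SharpPatch (zeroState n) (zString q) (heaSet n L q)
      ((hea n L).rUncorr (zeroState n) (zString q) (heaSet n L q)) (1 / 12) 1
      (1 / Real.sqrt (heaSet n L q).card) (1 / 93312) (1 / (heaSet n L q).card) :=
  (hea_hasSigns n L q).sharpPatch (isDensity_zeroState n) (norm_zString q)
    (expect_zeroState_zString q) hne

lemma heaSetGlobal_eq (n L : ℕ) : heaSetGlobal n L = heaSet n L (fun _ => True) := by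
  simp [heaSetGlobal, heaSet]

lemma card_heaSetGlobal (n L : ℕ) : (heaSetGlobal n L).card = n * L := by
  have : (heaSetGlobal n L).card = (Finset.univ : Finset (Fin n × Fin L)).card := by
    symm
    refine Finset.card_bij (fun x _ => toLex (x.2, toLex (x.1, (0 : Fin 2)))) ?_ ?_ ?_
    · rintro ⟨i, l⟩ _
      simp [heaSetGlobal]
    · rintro ⟨i, l⟩ _ ⟨i', l'⟩ _ h
      simp_all
    · intro g hg
      replace hg := (Finset.mem_filter.1 hg).2
      obtain ⟨l, i, c⟩ := g
      change c = 0 at hg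
      subst hg
      exact ⟨(i, l), Finset.mem_univ _, rfl⟩
  rw [this]; simp

lemma card_heaSetLocal (hn : 2 ≤ n) (L : ℕ) : (heaSetLocal n L).card = 2 * L := by
  have : (heaSetLocal n L).card = (Finset.univ : Finset (Fin 2 × Fin L)).card := by
    symm
    refine Finset.card_bij (fun x _ => toLex (x.2, toLex (Fin.castLE hn x.1, (0 : Fin 2)))) ?_ ?_ ?_
    · rintro ⟨i, l⟩ _
      simp [heaSetLocal]
      omega
    · rintro ⟨i, l⟩ _ ⟨i', l'⟩ _ h
      simp_all
    · intro g hg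
      obtain ⟨h1, h2⟩ := (Finset.mem_filter.1 hg).2
      obtain ⟨l, i, c⟩ := g
      change c = 0 at h1
      change i.val < 2 at h2
      subst h1
      exact ⟨(⟨i.val, h2⟩, l), Finset.mem_univ _, rfl⟩
  rw [this]; simp

theorem hea_global_sharpPatch {L : ℕ} (hn : 2 ≤ n) (hL : 1 ≤ L) :
    (hea n L).SharpPatch (zeroState n) (globalZ n) (heaSetGlobal n L)
        ((hea n L).rUncorr (zeroState n) (globalZ n) (heaSetGlobal n L))
        (1 / 12) 1 (1 / Real.sqrt (n * L)) (1 / 93312) (1 / (n * L)) := by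
  have hc := card_heaSetGlobal n L
  have hpos : 0 < (heaSetGlobal n L).card := by rw [hc]; positivity
  have h := hea_sharpPatch n L (fun _ => True) (by rw [← heaSetGlobal_eq]; exact Finset.card_pos.1 hpos)
  rw [← heaSetGlobal_eq, ← globalZ_eq, hc] at h
  push_cast at h
  exact h

theorem hea_local_sharpPatch {L : ℕ} (hn : 2 ≤ n) (hL : 1 ≤ L) :
    (hea n L).SharpPatch (zeroState n) (localZ n) (heaSetLocal n L)
        ((hea n L).rUncorr (zeroState n) (localZ n) (heaSetLocal n L))
        (1 / 24) 1 (1 / Real.sqrt L) (1 / 186624) (1 / L) := by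
  have hc := card_heaSetLocal hn L
  have hL' : (1 : ℝ) ≤ L := by exact_mod_cast hL
  have h : (hea n L).SharpPatch (zeroState n) (localZ n) (heaSetLocal n L)
      ((hea n L).rUncorr (zeroState n) (localZ n) (heaSetLocal n L)) (1 / 12) 1
      (1 / Real.sqrt (heaSetLocal n L).card) (1 / 93312) (1 / (heaSetLocal n L).card) :=
    hea_sharpPatch n L (fun j => j.val < 2)
      (Finset.card_pos.1 (show 0 < (heaSetLocal n L).card by omega))
  rw [hc] at h
  push_cast at h
  have h0 : 0 < Real.sqrt L := Real.sqrt_pos.2 (by linarith)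
  have h1 : Real.sqrt L ≤ Real.sqrt (2 * L) := Real.sqrt_le_sqrt (by linarith)
  have h2 : Real.sqrt (2 * L) ≤ 2 * Real.sqrt L := by
    refine Real.sqrt_le_iff.2 ⟨by positivity, ?_⟩
    rw [mul_pow, Real.sq_sqrt (by linarith)]; linarith
  refine h.mono ?_ ?_ ?_
  · rw [div_mul_div_comm, div_mul_div_comm, div_le_div_iff₀ (by positivity) (by positivity)]
    linarith
  · have := one_div_le_one_div_of_le h0 h1
    linarith
  · refine le_of_eq ?_
    field_simp
    norm_num

theorem hea_local_sharpPatch_proportional (B : ℝ) : ∃ a b v : ℝ, 0 < a ∧ 0 < b ∧ 0 < v ∧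
    ∀ n L : ℕ, 2 ≤ n → 1 ≤ L → (n : ℝ) ≤ B * L → (L : ℝ) ≤ B * n →
      (hea n L).SharpPatch (zeroState n) (localZ n) (heaSetLocal n L)
        ((hea n L).rUncorr (zeroState n) (localZ n) (heaSetLocal n L))
        a b (1 / ((n : ℝ) * L) ^ (1 / 4 : ℝ)) v (1 / Real.sqrt (n * L)) := by
  -- Taking the maximum with 1 makes √D ≤ D, so one constant serves both for L against √(nL) and for
  -- its square root.
  set D := max B 1 with hD
  have hD1 : 1 ≤ D := le_max_right _ _
  refine ⟨1 / 24 / D, D, 1 / 186624 / D, by positivity, by positivity, by positivity, ?_⟩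
  intro n L hn hL h1 h2
  have hn' : (2 : ℝ) ≤ n := by exact_mod_cast hn
  have hL' : (1 : ℝ) ≤ L := by exact_mod_cast hL
  have h1' : (n : ℝ) ≤ D * L := h1.trans (by gcongr; exact le_max_left _ _)
  have h2' : (L : ℝ) ≤ D * n := h2.trans (by gcongr; exact le_max_left _ _)
  set s := Real.sqrt (n * L) with hs
  have hs2 : s ^ 2 = n * L := Real.sq_sqrt (by positivity)
  have hs0 : 0 < s := Real.sqrt_pos.2 (by positivity)
  have hq : ((n : ℝ) * L) ^ (1 / 4 : ℝ) = Real.sqrt s := by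
    rw [hs, Real.sqrt_eq_rpow, Real.sqrt_eq_rpow, ← Real.rpow_mul (by positivity)]; norm_num
  have hlow : (L : ℝ) ≤ D * s := by
    refine le_of_sq_le_sq ?_ (by positivity)
    rw [mul_pow, hs2]
    nlinarith [mul_le_mul_of_nonneg_left h2' (by positivity : (0:ℝ) ≤ L),
      mul_le_mul_of_nonneg_right hD1 (by positivity : (0:ℝ) ≤ D * (n * L))]
  have hup : s ≤ D * L := by
    refine le_of_sq_le_sq ?_ (by positivity)
    rw [mul_pow, hs2]
    nlinarith [mul_le_mul_of_nonneg_right h1' (by positivity : (0:ℝ) ≤ L),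
      mul_le_mul_of_nonneg_right hD1 (by positivity : (0:ℝ) ≤ D * (L * L))]
  have r0 : 0 < Real.sqrt s := Real.sqrt_pos.2 hs0
  have r1 : 0 < Real.sqrt L := Real.sqrt_pos.2 (by linarith)
  have rD : Real.sqrt D ≤ D := by
    refine Real.sqrt_le_iff.2 ⟨by positivity, ?_⟩
    nlinarith
  have hlow' : Real.sqrt L ≤ D * Real.sqrt s := by
    refine (Real.sqrt_le_sqrt hlow).trans ?_
    rw [Real.sqrt_mul (by positivity)]
    gcongr
  have hup' : Real.sqrt s ≤ D * Real.sqrt L := by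
    refine (Real.sqrt_le_sqrt hup).trans ?_
    rw [Real.sqrt_mul (by positivity)]
    gcongr
  rw [hq]
  refine (hea_local_sharpPatch hn hL).mono ?_ ?_ ?_
  · rw [div_div, div_mul_div_comm, div_mul_div_comm, div_le_div_iff₀ (by positivity) (by positivity)]
    linarith
  · rw [one_mul, mul_one_div, div_le_div_iff₀ r1 r0]
    linarith
  · rw [div_div, div_mul_div_comm, div_mul_div_comm, div_le_div_iff₀ (by positivity) (by positivity)]
    linarith

end HardwareEfficient

/-! ## Layered circuits -/

section Layered

variable {n K L : ℕ} {H : Fin K → Op n}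

lemma relaxed_isUnitary (hH : ∀ k, (H k).IsHermitian) : (relaxed L H).IsUnitary :=
  isUnitary_of_fixed_one (fun g => hH (ofLex g).2) fun _ => rfl

lemma trotter_isUnitary (hH : ∀ k, (H k).IsHermitian) : (trotter L H).IsUnitary :=
  isUnitary_of_fixed_one (fun g => hH (ofLex g).2) fun _ => rfl

lemma relaxed_curv (hH : ∀ k, (H k).IsHermitian) (ρ O : Op n) (g : Fin L ×ₗ Fin K) :
    (relaxed L H).curv ρ O 0 g = |expect ρ ((ad (H (ofLex g).2) ^ 2) O)| := by
  rw [curv_eq (relaxed_isUnitary hH) rfl, heisD_single_origin fun _ => rfl]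
  rfl

lemma relaxed_effFreq2_sq (hH : ∀ k, (H k).IsHermitian) (O : Op n) {l μ : Fin L ×ₗ Fin K}
    (hl : l < μ) : (relaxed L H).effFreq2 O 0 l μ ^ 2
      = ‖(ad (H (ofLex μ).2) ^ 2) ((ad (H (ofLex l).2) ^ 2) O)‖ := by
  rw [effFreq2_sq (relaxed_isUnitary hH) rfl, heisD_pair_origin (fun _ => rfl) O hl]
  rfl

lemma norm_heisD_relaxed_first [NeZero K] [NeZero L] (hH : ∀ k, (H k).IsHermitian) (O : Op n)
    (m : ℕ) (θ : Fin L ×ₗ Fin K → ℝ) :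
    ‖(relaxed L H).heisD O (Pi.single (toLex (0, 0)) m) θ‖ = ‖(ad (H 0) ^ m) O‖ := by
  rw [norm_heisD_first (relaxed_isUnitary hH) O]
  · rfl
  · intro μ
    rw [Prod.Lex.le_iff]
    rcases (Fin.zero_le (ofLex μ).1).lt_or_eq with h | h
    · exact Or.inl h
    · exact Or.inr ⟨h, Fin.zero_le _⟩

lemma relaxed_ampA_first [NeZero K] [NeZero L] (O : Op n) :
    (relaxed L H).ampA O 0 (toLex (0, 0)) = ∑ μ ∈ Finset.univ.filter
      (fun μ : Fin L ×ₗ Fin K => toLex (0, 0) < μ), (relaxed L H).effFreq2 O 0 (toLex (0, 0)) μ ^ 2 := by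
  have : Finset.univ.filter (fun μ : Fin L ×ₗ Fin K => μ < toLex (0, 0)) = ∅ := by
    refine Finset.filter_eq_empty_iff.2 fun μ _ => not_lt.2 ?_
    rw [Prod.Lex.le_iff]
    rcases (Fin.zero_le (ofLex μ).1).lt_or_eq with h | h
    · exact Or.inl h
    · exact Or.inr ⟨h, Fin.zero_le _⟩
  rw [ampA, this]
  simp

lemma card_trotter_par (p : Fin K) :
    (Finset.univ.filter (fun g : Fin L ×ₗ Fin K => (ofLex g).2 = p)).card = L := by
  have : Finset.univ.filter (fun g : Fin L ×ₗ Fin K => (ofLex g).2 = p)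
      = (Finset.univ : Finset (Fin L)).map
        ⟨fun l => toLex (l, p), fun a b h => congrArg (fun g => (ofLex g).1) h⟩ := by
    ext g
    simp only [Finset.mem_filter, Finset.mem_univ, true_and, Finset.mem_map]
    constructor
    · intro h
      exact ⟨(ofLex g).1, by rw [← h]; rfl⟩
    · rintro ⟨l, rfl⟩
      rfl
  rw [this]
  simp

lemma trotter_parFreq (q : Fin K) : (trotter L H).parFreq q = L * maxFreq (H q) := by
  rw [parFreq_eq, Finset.sum_congr rfl (g := fun _ => maxFreq (H q)), Finset.sum_const,
    nsmul_eq_mul]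
  · congr 2
    exact card_trotter_par q
  · intro g hg
    rw [← (Finset.mem_filter.1 hg).2]
    rfl

/-- At the origin the gates between two copies of H_p are trivial, so each of the L² pairs of copies
contributes the same double commutator. -/
lemma trotter_curv (hH : ∀ k, (H k).IsHermitian) (ρ O : Op n) (p : Fin K) :
    (trotter L H).curv ρ O 0 p = L ^ 2 * |expect ρ ((ad (H p) ^ 2) O)| := by
  have hV : ∀ g, (trotter L H).fixed g = 1 := fun _ => rfl
  have hgen : ∀ g, (ofLex g).2 = p → (trotter L H).gen g = H p := fun g h => by rw [← h]; rfl
  rw [curv_eq_abs_sum (trotter_isUnitary hH)]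
  have e : ∀ g ∈ Finset.univ.filter (fun g => (trotter L H).par g = p),
      ∀ g' ∈ Finset.univ.filter (fun g => (trotter L H).par g = p), expect ρ
      ((trotter L H).heisD O (Pi.single g 1 + Pi.single g' 1) 0)
      = expect ρ ((ad (H p) ^ 2) O) := by
    intro g hg g' hg'
    have hg := hgen g (Finset.mem_filter.1 hg).2
    have hg' := hgen g' (Finset.mem_filter.1 hg').2
    rcases lt_trichotomy g g' with h | h | h
    · rw [heisD_pair_origin hV _ h, pow_one, pow_one, hg, hg', pow_two]; rfl
    · subst h
      rw [← Pi.single_add, heisD_single_origin hV, hg]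
    · rw [add_comm, heisD_pair_origin hV _ h, pow_one, pow_one, hg, hg', pow_two]; rfl
  rw [Finset.sum_congr rfl fun g hg => Finset.sum_congr rfl (e g hg)]
  have hc : (Finset.univ.filter (fun g => (trotter L H).par g = p)).card = L :=
    card_trotter_par p
  rw [Finset.sum_const, Finset.sum_const, hc, nsmul_eq_mul, nsmul_eq_mul, ← mul_assoc, abs_mul,
    ← pow_two, abs_of_nonneg (sq_nonneg (L : ℝ))]

/-- The curvature scales as L² and each ω as L. Thus the numerator carries L⁴ and both terms of the
denominator carry L⁶, leaving exactly a factor 1/L in the radius. -/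
lemma trotter_rCorr (hH : ∀ k, (H k).IsHermitian) (hL : 1 ≤ L) (ρ O : Op n) (p : Fin K) :
    (trotter L H).rCorr ρ O p = Real.sqrt (9 * |expect ρ ((ad (H p) ^ 2) O)| ^ 2 /
      (8 * (16 * |expect ρ ((ad (H p) ^ 2) O)| * ‖O‖ * maxFreq (H p) ^ 2 *
          (∑ q ∈ Finset.univ.filter (fun q => q ≠ p), maxFreq (H q) ^ 2)
        + 32 * ‖O‖ ^ 2 * maxFreq (H p) ^ 6))) / L := by
  have hL0 : (0 : ℝ) < L := by exact_mod_cast hL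
  have hLs : (L : ℝ) = Real.sqrt ((L : ℝ) ^ 2) := (Real.sqrt_sq hL0.le).symm
  rw [rCorr_eq, trotter_curv hH]
  simp only [trotter_parFreq, mul_pow]
  rw [← Finset.mul_sum]
  set γ := |expect ρ ((ad (H p) ^ 2) O)|
  set S := ∑ q ∈ Finset.univ.filter (fun q => q ≠ p), maxFreq (H q) ^ 2
  conv_rhs => rw [hLs, ← Real.sqrt_div' _ (sq_nonneg _), div_div]
  congr 1
  rw [show 9 * (((L : ℝ) ^ 2) ^ 2 * γ ^ 2) = (L : ℝ) ^ 4 * (9 * γ ^ 2) by ring,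
    show 8 * (16 * ((L : ℝ) ^ 2 * γ) * ‖O‖ * ((L : ℝ) ^ 2 * maxFreq (H p) ^ 2) * ((L : ℝ) ^ 2 * S)
      + 32 * ‖O‖ ^ 2 * ((L : ℝ) ^ 6 * maxFreq (H p) ^ 6))
      = (L : ℝ) ^ 4 * (8 * (16 * γ * ‖O‖ * maxFreq (H p) ^ 2 * S
      + 32 * ‖O‖ ^ 2 * maxFreq (H p) ^ 6) * (L : ℝ) ^ 2) by ring]
  exact mul_div_mul_left _ _ (by positivity)

lemma abs_expect_ad_sq_le {ρ H : Op n} (hρ : IsDensity ρ) (hH : H.IsHermitian) (O : Op n) :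
    |expect ρ ((ad H ^ 2) O)| ≤ maxFreq H ^ 2 * ‖O‖ :=
  (abs_expect_le hρ _).trans (norm_ad_pow_le hH O 2)

/-- Monotonicity of the radius in its ingredients. Positivity of `B` and `W` is part of the
conclusion: a nonzero curvature forces nonzero norm and frequency. -/
lemma trotter_rCorr_ge (hH : ∀ k, (H k).IsHermitian) (hL : 1 ≤ L) {ρ O : Op n} (hρ : IsDensity ρ)
    (p : Fin K) {x y B W : ℝ} (hx : 0 < x) (h1 : x ≤ |expect ρ ((ad (H p) ^ 2) O)|)
    (h2 : |expect ρ ((ad (H p) ^ 2) O)| ≤ y) (hB : ‖O‖ ≤ B) (hW : ∀ k, maxFreq (H k) ≤ W) :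
    0 < B ∧ 0 < W ∧ Real.sqrt (9 * x ^ 2 / (8 * (16 * y * B * W ^ 4 * K + 32 * B ^ 2 * W ^ 6))) / L
      ≤ (trotter L H).rCorr ρ O p := by
  have hle := abs_expect_ad_sq_le hρ (hH p) O
  rw [trotter_rCorr hH hL]
  generalize |expect ρ ((ad (H p) ^ 2) O)| = γ at *
  have hγ0 : 0 < γ := hx.trans_le h1
  have hw0 : 0 < maxFreq (H p) := by
    refine (maxFreq_nonneg _).lt_of_ne fun h0 => ?_
    rw [← h0] at hle
    simp at hle
    linarith
  have hO0 : 0 < ‖O‖ := by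
    refine (norm_nonneg _).lt_of_ne fun h0 => ?_
    rw [← h0] at hle
    simp at hle
    linarith
  have hy : 0 < y := hγ0.trans_le h2
  have hB0 : 0 < B := hO0.trans_le hB
  have hW0 : 0 < W := hw0.trans_le (hW p)
  have hSle : ∑ q ∈ Finset.univ.filter (fun q => q ≠ p), maxFreq (H q) ^ 2 ≤ K * W ^ 2 := by
    calc _ ≤ ∑ q : Fin K, maxFreq (H q) ^ 2 :=
          Finset.sum_le_sum_of_subset_of_nonneg (Finset.filter_subset _ _) fun _ _ _ => sq_nonneg _
      _ ≤ ∑ q : Fin K, W ^ 2 := Finset.sum_le_sum fun q _ =>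
          pow_le_pow_left₀ (maxFreq_nonneg _) (hW q) 2
      _ = K * W ^ 2 := by simp
  have hS0 : 0 ≤ ∑ q ∈ Finset.univ.filter (fun q => q ≠ p), maxFreq (H q) ^ 2 :=
    Finset.sum_nonneg fun _ _ => sq_nonneg _
  generalize ∑ q ∈ Finset.univ.filter (fun q => q ≠ p), maxFreq (H q) ^ 2 = S at *
  have hWp := hW p
  generalize maxFreq (H p) = w at *
  generalize ‖O‖ = o at *
  refine ⟨hB0, hW0, div_le_div_of_nonneg_right (Real.sqrt_le_sqrt ?_) (Nat.cast_nonneg L)⟩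
  calc 9 * x ^ 2 / (8 * (16 * y * B * W ^ 4 * K + 32 * B ^ 2 * W ^ 6))
      = 9 * x ^ 2 / (8 * (16 * y * B * W ^ 2 * (K * W ^ 2) + 32 * B ^ 2 * W ^ 6)) := by
        congr 2; ring
    _ ≤ _ := by gcongr

/-- The factor K − 1 appears because the chosen parameter is left out of the sum of frequencies. -/
lemma trotter_rCorr_le (hH : ∀ k, (H k).IsHermitian) (hL : 1 ≤ L) {ρ O : Op n}
    (p : Fin K) {x y B W : ℝ} (hx : 0 < x) (h1 : x ≤ |expect ρ ((ad (H p) ^ 2) O)|)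
    (h2 : |expect ρ ((ad (H p) ^ 2) O)| ≤ y) (hB0 : 0 < B) (hB : B ≤ ‖O‖)
    (hW0 : 0 < W) (hW : ∀ k, W ≤ maxFreq (H k)) :
    (trotter L H).rCorr ρ O p
      ≤ Real.sqrt (9 * y ^ 2 / (8 * (16 * x * B * W ^ 4 * (K - 1) + 32 * B ^ 2 * W ^ 6))) / L := by
  rw [trotter_rCorr hH hL]
  generalize |expect ρ ((ad (H p) ^ 2) O)| = γ at *
  have hγ0 : 0 < γ := hx.trans_le h1
  have hK : (1 : ℝ) ≤ K := by exact_mod_cast p.pos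
  have hSle : (K - 1) * W ^ 2 ≤ ∑ q ∈ Finset.univ.filter (fun q => q ≠ p), maxFreq (H q) ^ 2 := by
    calc ((K : ℝ) - 1) * W ^ 2 = ∑ q ∈ Finset.univ.filter (fun q : Fin K => q ≠ p), W ^ 2 := by
          rw [Finset.sum_const, Finset.filter_ne', Finset.card_erase_of_mem (Finset.mem_univ _),
            Finset.card_univ, Fintype.card_fin, nsmul_eq_mul, Nat.cast_pred p.pos]
      _ ≤ _ := Finset.sum_le_sum fun q _ => pow_le_pow_left₀ hW0.le (hW q) 2
  generalize ∑ q ∈ Finset.univ.filter (fun q => q ≠ p), maxFreq (H q) ^ 2 = S at *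
  have hWp := hW p
  generalize maxFreq (H p) = w at *
  generalize ‖O‖ = o at *
  have hK' : (0 : ℝ) ≤ K - 1 := by linarith
  have ho : 0 < o := hB0.trans_le hB
  refine div_le_div_of_nonneg_right (Real.sqrt_le_sqrt ?_) (Nat.cast_nonneg L)
  calc _ ≤ 9 * y ^ 2 / (8 * (16 * x * B * W ^ 2 * ((K - 1) * W ^ 2) + 32 * B ^ 2 * W ^ 6)) := by
        gcongr
    _ = _ := by congr 2; ring

end Layered

/-! ## Sums of Pauli strings -/

section PauliSum

variable {n : ℕ} {ι : Type} [Fintype ι]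

lemma pauliSum_isHermitian (s : ι → Fin n → Fin 4) : (pauliSum s).IsHermitian := by
  unfold pauliSum
  rw [Matrix.IsHermitian, Matrix.conjTranspose_sum]
  exact Finset.sum_congr rfl fun j _ => pauliString_isHermitian _

lemma norm_pauliSum_le (s : ι → Fin n → Fin 4) : ‖pauliSum s‖ ≤ Fintype.card ι := by
  refine (norm_sum_le _ _).trans ?_
  simp [norm_pauliString]

lemma maxFreq_pauliSum_le (s : ι → Fin n → Fin 4) : maxFreq (pauliSum s) ≤ 2 * Fintype.card ι :=
  (maxFreq_le _).trans (by have := norm_pauliSum_le s; linarith)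

end PauliSum

/-! ## Trotterized Hamiltonian variational ansatz -/

theorem trotter_hva_lowerPatch (K : ℕ) [NeZero K] {c₁ c₂ : ℝ} (hc : 0 < c₁) (hc₂ : c₁ ≤ c₂) :
    ∃ a v : ℝ, 0 < a ∧ 0 < v ∧
      ∀ (n L NO : ℕ) [NeZero L] (N : Fin K → ℕ)
        (h : (k : Fin K) → Fin (N k) → Fin n → Fin 4) (P : Fin NO → Fin n → Fin 4) (ρ : Op n),
        IsDensity ρ → 1 ≤ NO →
        c₁ * (NO * (L : ℝ) ^ 2) ≤ (trotter L (fun k => pauliSum (h k))).curv ρ (pauliSum P) 0 0 →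
        (trotter L (fun k => pauliSum (h k))).curv ρ (pauliSum P) 0 0 ≤ c₂ * (NO * (L : ℝ) ^ 2) →
        (trotter L (fun k => pauliSum (h k))).LowerPatch ρ (pauliSum P) {0}
          ((trotter L (fun k => pauliSum (h k))).rCorr ρ (pauliSum P) 0)
          a (1 / (L * ((Finset.univ.sup N : ℕ) : ℝ) ^ 3))
          v ((NO : ℝ) ^ 2 / ((Finset.univ.sup N : ℕ) : ℝ) ^ 12) := by
  have hc₂' : 0 < c₂ := hc.trans_le hc₂
  -- 256 = 16 · 2⁴ and 2048 = 32 · 2⁶, from ω(H_k) ≤ 2N and ‖O‖ ≤ N_O. Only the numbers of strings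
  -- enter here.
  set D : ℝ := 8 * (256 * c₂ * K + 2048) with hD
  have hD0 : 0 < D := by positivity
  set a : ℝ := Real.sqrt (9 * c₁ ^ 2 / D) with ha
  have ha0 : 0 < a := Real.sqrt_pos.2 (by positivity)
  have ha2 : a ^ 2 = 9 * c₁ ^ 2 / D := Real.sq_sqrt (by positivity)
  refine ⟨a, c₁ ^ 2 * a ^ 4 / 72, ha0, by positivity, ?_⟩
  intro n L NO _ N h P ρ hρ hNO h1 h2
  have hH : ∀ k, (pauliSum (h k)).IsHermitian := fun k => pauliSum_isHermitian _
  have hLn : 1 ≤ L := NeZero.one_le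
  have hL : (0 : ℝ) < L := by exact_mod_cast hLn
  have hNO0 : (0 : ℝ) < NO := by exact_mod_cast hNO
  have hw : ∀ k, maxFreq (pauliSum (h k)) ≤ 2 * ((Finset.univ.sup N : ℕ) : ℝ) := by
    intro k
    refine (maxFreq_pauliSum_le (h k)).trans ?_
    rw [Fintype.card_fin]
    have : ((N k : ℕ) : ℝ) ≤ ((Finset.univ.sup N : ℕ) : ℝ) :=
      Nat.cast_le.2 (Finset.le_sup (Finset.mem_univ k))
    linarith
  have hN1 : 0 < ((Finset.univ.sup N : ℕ) : ℝ) → 1 ≤ ((Finset.univ.sup N : ℕ) : ℝ) := fun h =>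
    Nat.one_le_cast.2 (Nat.cast_pos.1 h)
  generalize ((Finset.univ.sup N : ℕ) : ℝ) = N' at *
  have hO : ‖pauliSum P‖ ≤ NO := by simpa using norm_pauliSum_le P
  have hG := guarantee_rCorr (trotter_isUnitary (L := L) hH) hρ (pauliSum P) 0
  have hcurv := trotter_curv (L := L) hH ρ (pauliSum P) 0
  rw [hcurv] at h1 h2
  have h1' : c₁ * NO ≤ |expect ρ ((ad (pauliSum (h 0)) ^ 2) (pauliSum P))| :=
    le_of_mul_le_mul_left (by linarith : (L : ℝ) ^ 2 * (c₁ * NO) ≤ _)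
      (by positivity : (0 : ℝ) < (L : ℝ) ^ 2)
  have h2' : |expect ρ ((ad (pauliSum (h 0)) ^ 2) (pauliSum P))| ≤ c₂ * NO :=
    le_of_mul_le_mul_left (by linarith : _ ≤ (L : ℝ) ^ 2 * (c₂ * NO))
      (by positivity : (0 : ℝ) < (L : ℝ) ^ 2)
  obtain ⟨-, hN0, hR⟩ := trotter_rCorr_ge hH hLn hρ 0 (by positivity : 0 < c₁ * NO) h1' h2' hO hw
  have hN0 : 0 < N' := by linarith
  have hlow : a * (1 / (L * N' ^ 3)) ≤ (trotter L (fun k => pauliSum (h k))).rCorr ρ (pauliSum P) 0 := by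
    refine le_trans (le_of_eq_of_le ?_ (div_le_div_of_nonneg_right (Real.sqrt_le_sqrt
      (?_ : 9 * c₁ ^ 2 / D / (N' ^ 3) ^ 2 ≤ _)) hL.le)) hR
    · rw [Real.sqrt_div' _ (sq_nonneg _), Real.sqrt_sq (by positivity), ← ha]
      field_simp
    -- `N'` is a natural number and is positive because the curvature is nonzero, so the N⁴ term can
    -- be absorbed into N⁶.
    · have : N' ^ 4 ≤ N' ^ 6 := pow_le_pow_right₀ (hN1 hN0) (by norm_num)
      rw [div_div, div_le_div_iff₀ (by positivity) (by positivity)]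
      calc 9 * c₁ ^ 2 * (8 * (16 * (c₂ * NO) * NO * (2 * N') ^ 4 * K + 32 * (NO : ℝ) ^ 2 * (2 * N') ^ 6))
          = 9 * (c₁ * NO) ^ 2 * (8 * (256 * c₂ * K * N' ^ 4 + 2048 * N' ^ 6)) := by ring
        _ ≤ 9 * (c₁ * NO) ^ 2 * (8 * (256 * c₂ * K * N' ^ 6 + 2048 * N' ^ 6)) := by gcongr
        _ = 9 * (c₁ * NO) ^ 2 * (D * (N' ^ 3) ^ 2) := by rw [hD]; ring
  refine LowerPatch.of_guarantee (by positivity) hlow hG ?_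
  rw [Finset.sum_singleton, hcurv]
  generalize |expect ρ ((ad (pauliSum (h 0)) ^ 2) (pauliSum P))| = γ at *
  calc c₁ ^ 2 * a ^ 4 / 72 * ((NO : ℝ) ^ 2 / N' ^ 12)
      = 1 / 72 * ((L : ℝ) ^ 2 * (c₁ * NO)) ^ 2 * (a * (1 / (L * N' ^ 3))) ^ 4 := by
        field_simp
    _ ≤ _ := by gcongr

/-! ## Commutators of Pauli strings -/

section PauliCommutator

variable {n : ℕ}

lemma mem_support {s : Fin n → Fin 4} {q : Fin n} : q ∈ support s ↔ s q ≠ 0 := by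
  simp [support]

lemma pauliSign_mem (a b : Fin 4) : pauliSign a b = 1 ∨ pauliSign a b = -1 := by
  unfold pauliSign; split_ifs <;> simp

lemma prod_pauliSign_mem {ι : Type*} (t : Finset ι) (f g : ι → Fin 4) :
    ∏ j ∈ t, pauliSign (f j) (g j) = 1 ∨ ∏ j ∈ t, pauliSign (f j) (g j) = -1 := by
  classical
  induction t using Finset.induction_on with
  | empty => simp
  | insert a t ha ih =>
    rw [Finset.prod_insert ha]
    rcases ih with h | h <;> rcases pauliSign_mem (f a) (g a) with h' | h' <;> simp [h, h']

lemma pauliString_commute_or (s t : Fin n → Fin 4) :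
    Commute (pauliString s) (pauliString t) ∨
      pauliString s * pauliString t = -(pauliString t * pauliString s) := by
  rcases prod_pauliSign_mem Finset.univ s t with h | h
  · left
    have := pauliString_mul_comm s t
    rwa [h, one_smul] at this
  · right
    have := pauliString_mul_comm s t
    rwa [h, neg_one_smul] at this

lemma pauliString_commute_of_disjoint {s t : Fin n → Fin 4} (h : ∀ q ∈ support t, s q = 0) :
    Commute (pauliString s) (pauliString t) := by
  have := pauliString_mul_comm s t
  rw [Finset.prod_eq_one, one_smul] at this
  · exact this
  · intro q _
    unfold pauliSign
    by_cases hq : t q = 0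
    · simp [hq]
    · simp [h q (mem_support.2 hq)]

lemma pauliString_mul (s t : Fin n → Fin 4) : ∃ z : ℂ, ‖z‖ = 1 ∧
    pauliString s * pauliString t = z • pauliString (fun j => pauliLabel (s j) (t j)) := by
  choose z hz h using fun j => pauli_mul_eq (s j) (t j)
  refine ⟨∏ j, z j, by simp [hz], ?_⟩
  rw [pauliString, pauliString, tensor_mul, pauliString, ← tensor_smul]
  congr 1
  funext j
  exact h j

lemma card_support_label_le (s t : Fin n → Fin 4) :
    (support (fun j => pauliLabel (s j) (t j))).card ≤ (support s).card + (support t).card := by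
  refine (Finset.card_le_card fun q hq => ?_).trans (Finset.card_union_le _ _)
  rw [Finset.mem_union]
  by_contra h
  rw [not_or, mem_support, mem_support, not_not, not_not] at h
  rw [mem_support] at hq
  exact hq (by simp [pauliLabel, h.1, h.2])

/-- Strings that do not commute anticommute, so the commutator is twice a single string up to a
phase. Norms of nested commutators thus reduce to counting strings. -/
lemma ad_pauliString (s t : Fin n → Fin 4) (h : ¬ Commute (pauliString s) (pauliString t)) :
    ∃ z : ℂ, ‖z‖ = 2 ∧ ad (pauliString s) (pauliString t)
      = z • pauliString (fun j => pauliLabel (s j) (t j)) := by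
  obtain ⟨z, hz, e⟩ := pauliString_mul s t
  have h' := (pauliString_commute_or s t).resolve_left h
  refine ⟨2 * Complex.I * z, by simp [hz], ?_⟩
  have : pauliString t * pauliString s = -(pauliString s * pauliString t) := by rw [h', neg_neg]
  rw [ad_apply, this, sub_neg_eq_add, e, ← add_smul, smul_smul]
  congr 1; ring

variable {J : Type} [Fintype J]

lemma ad_sum (h : J → Op n) (X : Op n) : ad (∑ j, h j) X = ∑ j, ad (h j) X := by
  simp only [ad_apply, ← Finset.smul_sum, Finset.sum_sub_distrib, Finset.sum_mul, Finset.mul_sum]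

/-- A string that fails to commute with `s` must touch the support of `s`, and each qubit is touched
by at most `T` strings. -/
lemma card_not_commute_le {h : J → Fin n → Fin 4} {T : ℕ}
    (hT : ∀ q, (Finset.univ.filter (fun j => h j q ≠ 0)).card ≤ T) (s : Fin n → Fin 4)
    [DecidablePred fun j => ¬ Commute (pauliString (h j)) (pauliString s)] :
    (Finset.univ.filter (fun j => ¬ Commute (pauliString (h j)) (pauliString s))).card
      ≤ (support s).card * T := by
  classical
  refine (Finset.card_le_card (t := (support s).biUnion
    fun q => Finset.univ.filter (fun j => h j q ≠ 0)) fun j hj => ?_).trans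
    (Finset.card_biUnion_le_card_mul _ _ T fun q _ => hT q)
  simp only [Finset.mem_filter, Finset.mem_univ, true_and, Finset.mem_biUnion] at hj ⊢
  by_contra hne
  push Not at hne
  exact hj (pauliString_commute_of_disjoint hne)

/-- A bound for `Φ` on strings of larger support gives a bound for `Φ ∘ [H, ·]`. -/
lemma norm_mul_ad_le {h : J → Fin n → Fin 4} {T κ S : ℕ} {b : ℝ} (hb : 0 ≤ b)
    (hT : ∀ q, (Finset.univ.filter (fun j => h j q ≠ 0)).card ≤ T)
    (hκ : ∀ j, (support (h j)).card ≤ κ) {Φ : Module.End ℂ (Op n)}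
    (hΦ : ∀ s, (support s).card ≤ S + κ → ‖Φ (pauliString s)‖ ≤ b) (s : Fin n → Fin 4)
    (hs : (support s).card ≤ S) :
    ‖(Φ * ad (pauliSum h)) (pauliString s)‖ ≤ 2 * (S * T) * b := by
  classical
  rw [Module.End.mul_apply, pauliSum, ad_sum, map_sum,
    ← Finset.sum_filter_add_sum_filter_not Finset.univ
      (fun j => ¬ Commute (pauliString (h j)) (pauliString s))]
  have e : ∑ j ∈ Finset.univ.filter (fun j => ¬ ¬ Commute (pauliString (h j)) (pauliString s)),
      Φ (ad (pauliString (h j)) (pauliString s)) = 0 := by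
    refine Finset.sum_eq_zero fun j hj => ?_
    rw [ad_eq_zero (not_not.1 (Finset.mem_filter.1 hj).2), map_zero]
  rw [e, add_zero]
  refine (norm_sum_le_of_le _ (n := fun _ => 2 * b) fun j hj => ?_).trans ?_
  · obtain ⟨z, hz, e⟩ := ad_pauliString _ _ (Finset.mem_filter.1 hj).2
    rw [e, map_smul, norm_smul, hz]
    refine mul_le_mul_of_nonneg_left (hΦ _ ?_) zero_le_two
    have := card_support_label_le (h j) s
    have := hκ j
    omega
  · rw [Finset.sum_const, nsmul_eq_mul]
    have h1 : ((Finset.univ.filter (fun j => ¬ Commute (pauliString (h j))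
        (pauliString s))).card : ℝ) ≤ S * T := by
      have := (card_not_commute_le hT s).trans (Nat.mul_le_mul_right T hs)
      exact_mod_cast this
    calc _ ≤ (S * T : ℝ) * (2 * b) := by gcongr
      _ = _ := by ring

/-- Each commutator costs 2 times support size times `T` and enlarges the support by at most `κ`;
the larger support is used for both factors. -/
lemma norm_ad_sq_pauliString_le {h : J → Fin n → Fin 4} {T κ S : ℕ}
    (hT : ∀ q, (Finset.univ.filter (fun j => h j q ≠ 0)).card ≤ T)
    (hκ : ∀ j, (support (h j)).card ≤ κ) (s : Fin n → Fin 4) (hs : (support s).card ≤ S) :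
    ‖(ad (pauliSum h) ^ 2) (pauliString s)‖ ≤ (2 * ((S + κ : ℕ) * T)) ^ 2 := by
  have h0 : ∀ s : Fin n → Fin 4, (support s).card ≤ S + κ + κ →
      ‖(1 : Module.End ℂ (Op n)) (pauliString s)‖ ≤ 1 := fun s _ => by
    rw [Module.End.one_apply, norm_pauliString]
  have h1 := norm_mul_ad_le zero_le_one hT hκ h0
  have h2 := norm_mul_ad_le (by positivity) hT hκ h1 s hs
  rw [one_mul, ← pow_two] at h2
  refine h2.trans ?_
  have : (S : ℝ) ≤ (S + κ : ℕ) := by push_cast; linarith [Nat.cast_nonneg (α := ℝ) κ]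
  calc _ ≤ 2 * (((S + κ : ℕ) : ℝ) * T) * (2 * ((S + κ : ℕ) * T) * 1) := by gcongr
    _ = _ := by ring

lemma norm_ad_sq_ad_sq_pauliString_le {J' : Type} [Fintype J'] {h : J → Fin n → Fin 4}
    {h' : J' → Fin n → Fin 4} {T κ S : ℕ}
    (hT : ∀ q, (Finset.univ.filter (fun j => h j q ≠ 0)).card ≤ T)
    (hT' : ∀ q, (Finset.univ.filter (fun j => h' j q ≠ 0)).card ≤ T)
    (hκ : ∀ j, (support (h j)).card ≤ κ) (hκ' : ∀ j, (support (h' j)).card ≤ κ)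
    (s : Fin n → Fin 4) (hs : (support s).card ≤ S) :
    ‖(ad (pauliSum h') ^ 2) ((ad (pauliSum h) ^ 2) (pauliString s))‖
      ≤ (2 * ((S + 3 * κ : ℕ) * T)) ^ 4 := by
  have h0 : ∀ s : Fin n → Fin 4, (support s).card ≤ S + κ + κ →
      ‖(ad (pauliSum h') ^ 2) (pauliString s)‖ ≤ (2 * ((S + κ + κ + κ : ℕ) * T)) ^ 2 :=
    fun s hs => norm_ad_sq_pauliString_le hT' hκ' s hs
  have h1 := norm_mul_ad_le (by positivity) hT hκ h0
  have h2 := norm_mul_ad_le (by positivity) hT hκ h1 s hs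
  rw [mul_assoc, ← pow_two, Module.End.mul_apply] at h2
  refine h2.trans ?_
  have e : S + κ + κ + κ = S + 3 * κ := by ring
  rw [e]
  have h3 : (S : ℝ) ≤ (S + 3 * κ : ℕ) := by push_cast; linarith [Nat.cast_nonneg (α := ℝ) κ]
  have h4 : ((S + κ : ℕ) : ℝ) ≤ (S + 3 * κ : ℕ) := by push_cast; linarith [Nat.cast_nonneg (α := ℝ) κ]
  calc _ ≤ 2 * (((S + 3 * κ : ℕ) : ℝ) * T) * (2 * ((S + 3 * κ : ℕ) * T) *
        (2 * ((S + 3 * κ : ℕ) * T)) ^ 2) := by gcongr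
    _ = _ := by ring

lemma norm_map_pauliSum_le {I : Type} [Fintype I] (P : I → Fin n → Fin 4)
    (Φ : Module.End ℂ (Op n)) {b : ℝ} (h : ∀ i, ‖Φ (pauliString (P i))‖ ≤ b) :
    ‖Φ (pauliSum P)‖ ≤ Fintype.card I * b := by
  rw [pauliSum, map_sum]
  refine (norm_sum_le_of_le _ fun i _ => h i).trans ?_
  simp

lemma commute_ad {B A X : Op n} (h1 : Commute B A) (h2 : Commute B X) : Commute B (ad A X) := by
  rw [ad_apply]
  exact ((h1.mul_right h2).sub_right (h2.mul_right h1)).smul_right _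

/-- `B` commutes with all the iterated commutators of `A` with `X`, hence never contributes; the
second conjunct carries the induction. -/
lemma ad_pow_add {A B X : Op n} (h1 : Commute B A) (h2 : Commute B X) (k : ℕ) :
    (ad (A + B) ^ k) X = (ad A ^ k) X ∧ Commute B ((ad A ^ k) X) := by
  induction k with
  | zero => exact ⟨rfl, h2⟩
  | succ k ih =>
    simp only [pow_succ', Module.End.mul_apply]
    refine ⟨?_, commute_ad h1 ih.2⟩
    rw [ih.1]
    have : ad (A + B) ((ad A ^ k) X) = ad A ((ad A ^ k) X) + ad B ((ad A ^ k) X) := by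
      simp only [ad_apply, ← smul_add]; congr 1; noncomm_ring
    rw [this, ad_eq_zero ih.2, add_zero]

/-- Only the strings that do not commute with the observable contribute to nested commutators. -/
lemma norm_ad_pow_pauliString_le (h : J → Fin n → Fin 4)
    (hc : ∀ i j, Commute (pauliString (h i)) (pauliString (h j))) (s : Fin n → Fin 4) (k : ℕ)
    [DecidablePred fun j => ¬ Commute (pauliString (h j)) (pauliString s)] :
    ‖(ad (pauliSum h) ^ k) (pauliString s)‖ ≤ (2 * ((Finset.univ.filter
      (fun j => ¬ Commute (pauliString (h j)) (pauliString s))).card : ℝ)) ^ k := by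
  rw [pauliSum, ← Finset.sum_filter_add_sum_filter_not Finset.univ
      (fun j => ¬ Commute (pauliString (h j)) (pauliString s))]
  rw [(ad_pow_add ?_ ?_ k).1]
  · refine (norm_ad_pow_le_two _ _ k).trans ?_
    rw [norm_pauliString, mul_one]
    gcongr
    refine (norm_sum_le _ _).trans ?_
    simp [norm_pauliString]
  · exact Commute.sum_left _ _ _ fun i _ => Commute.sum_right _ _ _ fun j _ => hc i j
  · exact Commute.sum_left _ _ _ fun i hi => not_not.1 (Finset.mem_filter.1 hi).2

variable {I : Type} [Fintype I]

/-- The cases k = 2 and k = 4 bound the curvature and the fourth derivative behind `localBeta`. -/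
lemma norm_ad_pow_pauliSum_le (h : J → Fin n → Fin 4)
    (hc : ∀ i j, Commute (pauliString (h i)) (pauliString (h j))) (P : I → Fin n → Fin 4) (k : ℕ) :
    ‖(ad (pauliSum h) ^ k) (pauliSum P)‖
      ≤ Fintype.card I * (2 * (maxOverlap h P : ℝ)) ^ k := by
  classical
  refine norm_map_pauliSum_le P _ fun i => (norm_ad_pow_pauliString_le h hc (P i) k).trans ?_
  gcongr
  unfold maxOverlap
  convert Finset.le_sup (f := fun i => (Finset.univ.filter
    (fun j => ¬ Commute (pauliString (h j)) (pauliString (P i)))).card) (Finset.mem_univ i)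

lemma maxOverlap_le {h : J → Fin n → Fin 4} {P : I → Fin n → Fin 4} {T S : ℕ}
    (hT : ∀ q, (Finset.univ.filter (fun j => h j q ≠ 0)).card ≤ T)
    (hS : ∀ i, (support (P i)).card ≤ S) : maxOverlap h P ≤ S * T := by
  classical
  unfold maxOverlap
  exact Finset.sup_le fun i _ =>
    (card_not_commute_le hT (P i)).trans (Nat.mul_le_mul_right T (hS i))

end PauliCommutator

/-! ## A lower bound for fourth nested commutators -/

section Fourth

variable {n : ℕ}

/-- An inequality of Landau–Kolmogorov type. The evolved expectation value f(t) is bounded by ‖O‖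
and its fourth derivative by ‖ad⁴ O‖; if f''(0) were large compared with both, f would leave its
bounds. It supplies the lower bound on 𝒜 behind the upper bounds on relaxed radii. -/
lemma norm_ad_four_ge {ρ H : Op n} (hρ : IsDensity ρ) (hH : H.IsHermitian) (O : Op n) :
    3 * |expect ρ ((ad H ^ 2) O)| ^ 2 ≤ 4 * ‖O‖ * ‖(ad H ^ 4) O‖ := by
  set c := |expect ρ ((ad H ^ 2) O)| with hc
  set M := ‖(ad H ^ 4) O‖ with hM
  set f : ℕ → ℝ → ℝ := fun k t => expect ρ (conjGate H 1 t ((ad H ^ k) O)) with hf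
  have hd : ∀ k t, HasDerivAt (f k) (f (k + 1) t) t := by
    intro k t
    have h1 := hasDerivAt_conjGate hH 1 (hasDerivAt_const t ((ad H ^ k) O))
    have h2 := (expect ρ).hasFDerivAt.comp_hasDerivAt t h1
    refine h2.congr_deriv ?_
    rw [zero_add, hf]
    simp only [pow_succ', Module.End.mul_apply]
  have hb : ∀ k t, |f k t| ≤ ‖(ad H ^ k) O‖ := by
    intro k t
    refine (abs_expect_le hρ _).trans (le_of_eq ?_)
    rw [conjGate, mul_one]
    exact norm_conj_unitary (exp_mem_unitary hH t) _
  have h20 : |f 2 0| = c := by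
    rw [hf]
    simp only [conjGate_zero]
    simp [hc]
  have key := fun t => fourth_difference_le (hd 0) (hd 1) (hd 2) (hd 3) (hb 4) t
  have hO : ∀ t, |f 0 t| ≤ ‖O‖ := fun t => by simpa using hb 0 t
  have hc0 : 0 ≤ c := abs_nonneg _
  have hO0 := norm_nonneg O
  have hmain : ∀ t : ℝ, c * t ^ 2 ≤ 4 * ‖O‖ + M * t ^ 4 / 12 := by
    intro t
    have k := key t
    have a1 := hO t
    have a2 := hO (-t)
    have a3 := hO 0
    rw [abs_le] at k a1 a2 a3
    have : |f 2 0 * t ^ 2| ≤ 4 * ‖O‖ + M * t ^ 4 / 12 := by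
      rw [abs_le]; constructor <;> linarith [k.1, k.2, a1.1, a1.2, a2.1, a2.2, a3.1, a3.2]
    rwa [abs_mul, h20, abs_of_nonneg (sq_nonneg t)] at this
  rcases hc0.eq_or_lt with h | h
  · rw [← h, hM]
    have := mul_nonneg hO0 (norm_nonneg ((ad H ^ 4) O))
    simp only [ne_eq, OfNat.ofNat_ne_zero, not_false_eq_true, zero_pow, mul_zero]
    linarith
  rcases hO0.eq_or_lt with h' | h'
  · have : ‖(ad H ^ 2) O‖ ≤ 0 := by rw [norm_eq_zero.1 h'.symm]; simp
    have := abs_expect_le hρ ((ad H ^ 2) O)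
    linarith
  clear_value M c
  generalize ‖O‖ = o at *
  -- At t² = 8‖O‖/c the left side is 8‖O‖, so half of it must come from the quartic term.
  have := hmain (Real.sqrt (8 * o / c))
  have e2 : Real.sqrt (8 * o / c) ^ 2 = 8 * o / c := Real.sq_sqrt (by positivity)
  rw [show Real.sqrt (8 * o / c) ^ 4 = (Real.sqrt (8 * o / c) ^ 2) ^ 2 by ring, e2] at this
  have e3 : c * (8 * o / c) = 8 * o := by field_simp
  have e4 : M * (8 * o / c) ^ 2 / 12 * (3 * c ^ 2) = 16 * o ^ 2 * M := by field_simp; ring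
  have h5 : 4 * o ≤ M * (8 * o / c) ^ 2 / 12 := by linarith
  have h6 := mul_le_mul_of_nonneg_right h5 (by positivity : 0 ≤ 3 * c ^ 2)
  rw [e4] at h6
  refine le_of_mul_le_mul_left ?_ (by positivity : 0 < 4 * o)
  linarith

end Fourth

/-! ## Relaxed circuits generated by sums of Pauli strings of bounded degree -/

section RelaxedLocal

/-- No gate precedes the first one, so 𝒜 consists only of the double commutators with the later
gates, fewer than KL in number. -/
lemma relaxed_ampA_first_le {n K L : ℕ} [NeZero K] [NeZero L] {H : Fin K → Op n}
    (hH : ∀ k, (H k).IsHermitian) (O : Op n) {b : ℝ}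
    (hb : ∀ k, ‖(ad (H k) ^ 2) ((ad (H 0) ^ 2) O)‖ ≤ b) :
    (relaxed L H).ampA O 0 (toLex (0, 0)) ≤ K * L * b := by
  rw [relaxed_ampA_first]
  have hb0 : 0 ≤ b := (norm_nonneg _).trans (hb 0)
  calc _ ≤ ∑ μ ∈ Finset.univ.filter (fun μ : Fin L ×ₗ Fin K => toLex (0, 0) < μ), b := by
        refine Finset.sum_le_sum fun μ hμ => ?_
        rw [relaxed_effFreq2_sq hH _ (Finset.mem_filter.1 hμ).2]
        exact hb _
    _ ≤ ∑ μ : Fin L ×ₗ Fin K, b :=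
        Finset.sum_le_sum_of_subset_of_nonneg (Finset.filter_subset _ _) fun _ _ _ => hb0
    _ = K * L * b := by
        rw [Finset.sum_const, nsmul_eq_mul, Finset.card_univ, Fintype.card_lex, Fintype.card_prod,
          Fintype.card_fin, Fintype.card_fin]
        push_cast; ring

/-- Only the copies of the first generator in the L − 1 later layers are kept; each contributes its
fourth nested commutator with `O`. -/
lemma relaxed_ampA_first_ge {n K L : ℕ} [NeZero K] [NeZero L] {H : Fin K → Op n}
    (hH : ∀ k, (H k).IsHermitian) (O : Op n) :
    (L - 1) * ‖(ad (H 0) ^ 4) O‖ ≤ (relaxed L H).ampA O 0 (toLex (0, 0)) := by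
  rw [relaxed_ampA_first]
  have hsub : ((Finset.univ : Finset (Fin L)).erase 0).map
      ⟨fun l => (toLex (l, 0) : Fin L ×ₗ Fin K), fun a b h => congrArg (fun g => (ofLex g).1) h⟩
      ⊆ Finset.univ.filter (fun μ : Fin L ×ₗ Fin K => toLex (0, 0) < μ) := by
    intro μ hμ
    obtain ⟨l, hl, rfl⟩ := Finset.mem_map.1 hμ
    refine Finset.mem_filter.2 ⟨Finset.mem_univ _, Prod.Lex.lt_iff.2 (Or.inl ?_)⟩
    exact Fin.pos_iff_ne_zero.2 (Finset.ne_of_mem_erase hl)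
  refine le_trans (le_of_eq ?_) (Finset.sum_le_sum_of_subset_of_nonneg hsub
    fun _ _ _ => sq_nonneg _)
  rw [Finset.sum_map, Finset.sum_congr rfl
    (g := fun _ => ‖(ad (H 0) ^ 4) O‖), Finset.sum_const,
    Finset.card_erase_of_mem (Finset.mem_univ _), Finset.card_univ, Fintype.card_fin, nsmul_eq_mul,
    Nat.cast_pred (NeZero.pos L)]
  intro l hl
  have hlt : (toLex (0, 0) : Fin L ×ₗ Fin K) < toLex (l, 0) :=
    Prod.Lex.lt_iff.2 (Or.inl (Fin.pos_iff_ne_zero.2 (Finset.ne_of_mem_erase hl)))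
  change (relaxed L H).effFreq2 O 0 (toLex (0, 0)) (toLex (l, 0)) ^ 2 = _
  rw [relaxed_effFreq2_sq hH _ hlt]
  rw [← Module.End.mul_apply]
  change ‖(ad (H 0) ^ 2 * ad (H 0) ^ 2) _‖ = _
  rw [← pow_add]

/-- Both terms of the denominator are at most a constant times N²m, while c² is at least of order
N². The summand 1 keeps the constant well defined even when the locality constants vanish. -/
lemma localRadius_ge {c c₁ c₂ A N s E W m : ℝ} (hm : 1 ≤ m) (hc₁ : 0 < c₁) (hN : 0 < N) (hE : 0 ≤ E)
    (hA0 : 0 ≤ A) (hs0 : 0 ≤ s) (h1 : c₁ * N ≤ c) (h2 : c ≤ c₂ * N) (hA : A ≤ m * (N * E))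
    (hs : s ≤ W) (hcs : c ≤ N * (2 * s) ^ 2) :
    Real.sqrt (9 * c₁ ^ 2 / (8 * c₂ * E + 256 * W ^ 6 + 1)) * (1 / Real.sqrt m)
      ≤ Real.sqrt (9 * c ^ 2 / (8 * c * A + 24 * (2 ^ 5 * N ^ 2 * s ^ 6 / 3))) := by
  have hc0 : 0 < c := lt_of_lt_of_le (by positivity) h1
  have hc₂ : 0 ≤ c₂ := by
    by_contra hneg
    nlinarith
  have hs0 : 0 < s := by
    refine lt_of_le_of_ne hs0 fun h0 => ?_
    rw [← h0] at hcs
    simp at hcs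
    linarith
  have hW : 0 < W := hs0.trans_le hs
  refine Real.le_sqrt_of_sq_le ?_
  have hm0 : 0 < m := by linarith
  rw [mul_pow, Real.sq_sqrt (by positivity), div_pow, one_pow, Real.sq_sqrt (by positivity),
    div_mul_div_comm, mul_one, div_le_div_iff₀ (by positivity) (by positivity)]
  calc 9 * c₁ ^ 2 * (8 * c * A + 24 * (2 ^ 5 * N ^ 2 * s ^ 6 / 3))
      ≤ 9 * c₁ ^ 2 * (8 * (c₂ * N) * (m * (N * E)) + 24 * (2 ^ 5 * N ^ 2 * W ^ 6 / 3)) := by gcongr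
    _ = 9 * (c₁ * N) ^ 2 * (8 * c₂ * E * m + 256 * W ^ 6 * 1) := by ring
    _ ≤ 9 * (c₁ * N) ^ 2 * (8 * c₂ * E * m + 256 * W ^ 6 * m + 1 * m) := by
      refine mul_le_mul_of_nonneg_left ?_ (by positivity)
      have : 256 * W ^ 6 * 1 ≤ 256 * W ^ 6 * m := by gcongr
      linarith
    _ = 9 * (c₁ * N) ^ 2 * ((8 * c₂ * E + 256 * W ^ 6 + 1) * m) := by ring
    _ ≤ 9 * c ^ 2 * ((8 * c₂ * E + 256 * W ^ 6 + 1) * m) := by gcongr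

/-- The inequality 3c² ≤ 4NM gives 8cM ≥ 6c₁c², so 𝒜 accounts for L − 1 units of c² in the
denominator; the β term, with s ≥ 1 and c ≤ c₂N, supplies the remaining unit and alone covers L = 1.
-/
lemma localRadius_le {c c₁ c₂ A N s K L M : ℝ} (hK : 1 ≤ K) (hL : 1 ≤ L) (hc₁ : 0 < c₁)
    (hc₂ : 0 < c₂) (hN : 0 < N) (hs : 1 ≤ s) (h1 : c₁ * N ≤ c) (h2 : c ≤ c₂ * N)
    (hM : 3 * c ^ 2 ≤ 4 * N * M) (hA : (L - 1) * M ≤ A) :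
    Real.sqrt (9 * c ^ 2 / (8 * c * A + 24 * (2 ^ 5 * N ^ 2 * s ^ 6 / 3)))
      ≤ Real.sqrt (9 * K / min (6 * c₁) (256 / c₂ ^ 2)) * (1 / Real.sqrt (K * L)) := by
  have hc0 : 0 < c := lt_of_lt_of_le (by positivity) h1
  have hL0 : 0 < L := by linarith
  have hK0 : 0 < K := by linarith
  obtain ⟨m, hm⟩ : ∃ m, m = min (6 * c₁) (256 / c₂ ^ 2) := ⟨_, rfl⟩
  have hm0 : 0 < m := hm ▸ lt_min (by positivity) (by positivity)
  have k2 : 3 * c * c₁ ≤ 4 * M := by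
    refine le_of_mul_le_mul_left ?_ hN
    calc N * (3 * c * c₁) = 3 * c * (c₁ * N) := by ring
      _ ≤ 3 * c * c := by gcongr
      _ ≤ _ := by linarith
  have hM0 : 0 ≤ M := by
    have : 0 < 3 * c * c₁ := by positivity
    linarith
  have hL' : 0 ≤ L - 1 := by linarith
  have hA0 : 0 ≤ A := (mul_nonneg hL' hM0).trans hA
  have k3 : m ≤ 6 * c₁ := hm ▸ min_le_left _ _
  have k4 : m * c ^ 2 ≤ 256 * N ^ 2 := by
    calc m * c ^ 2 ≤ 256 / c₂ ^ 2 * (c₂ * N) ^ 2 := by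
          gcongr
          exact hm ▸ min_le_right _ _
      _ = _ := by field_simp
  have k5 : 1 ≤ s ^ 6 := one_le_pow₀ hs
  rw [← hm, mul_one_div, ← Real.sqrt_div' _ (by positivity)]
  refine Real.sqrt_le_sqrt ?_
  rw [show 9 * K / m / (K * L) = 9 / (m * L) by field_simp,
    div_le_div_iff₀ (by positivity) (by positivity)]
  calc 9 * c ^ 2 * (m * L) = 9 * (m * c ^ 2 * (L - 1) + m * c ^ 2) := by ring
    _ ≤ 9 * (6 * c₁ * c ^ 2 * (L - 1) + 256 * N ^ 2 * 1) := by
      have : m * c ^ 2 * (L - 1) ≤ 6 * c₁ * c ^ 2 * (L - 1) := by gcongr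
      linarith
    _ = 9 * (2 * c * ((3 * c * c₁) * (L - 1)) + 256 * N ^ 2 * 1) := by ring
    _ ≤ 9 * (2 * c * ((4 * M) * (L - 1)) + 256 * N ^ 2 * s ^ 6) := by gcongr
    _ = 9 * (8 * c * ((L - 1) * M) + 24 * (2 ^ 5 * N ^ 2 * s ^ 6 / 3)) := by ring
    _ ≤ _ := by gcongr

/-- The scaling of the patch for a relaxed circuit generated by Pauli sums, each qubit being touched
by at most `T` strings of each sum. -/
theorem relaxed_pauliSum_sharpPatch {K T κ κO n L : ℕ} [NeZero K] [NeZero L] {c₁ c₂ : ℝ}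
    (hc : 0 < c₁) (hc₂ : c₁ ≤ c₂) {J : Fin K → Type} [∀ k, Fintype (J k)] {I : Type} [Fintype I]
    {h : (k : Fin K) → J k → Fin n → Fin 4} {P : I → Fin n → Fin 4} {ρ : Op n}
    (hT : ∀ k q, (Finset.univ.filter (fun j => h k j q ≠ 0)).card ≤ T)
    (hκ : ∀ k j, (support (h k j)).card ≤ κ) (hκO : ∀ i, (support (P i)).card ≤ κO)
    (hcom : ∀ i j, Commute (pauliString (h 0 i)) (pauliString (h 0 j)))
    (hρ : IsDensity ρ) (hI : 0 < Fintype.card I) {a : ℝ} (ha : a = Real.sqrt (9 * c₁ ^ 2 /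
      (8 * c₂ * (2 * ((κO + 3 * κ : ℕ) * T)) ^ 4 + 256 * ((κO * T : ℕ) : ℝ) ^ 6 + 1)))
    {C : Circuit n (Fin L ×ₗ Fin K) (Fin L ×ₗ Fin K)} (hC : C = relaxed L (fun k => pauliSum (h k)))
    (h1 : c₁ * Fintype.card I ≤ C.curv ρ (pauliSum P) 0 (toLex (0, 0)))
    (h2 : C.curv ρ (pauliSum P) 0 (toLex (0, 0)) ≤ c₂ * Fintype.card I) :
    C.SharpPatch ρ (pauliSum P) {toLex (0, 0)}
      (C.rUncorrWith ρ (pauliSum P) (toLex (0, 0)) (localBeta (h 0) P))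
      a (Real.sqrt (9 * K / min (6 * c₁) (256 / c₂ ^ 2))) (1 / Real.sqrt (K * L))
      (c₁ ^ 2 * a ^ 4 / 72) ((Fintype.card I : ℝ) ^ 2 / ((K : ℝ) * L) ^ 2) := by
  have hc₂' : 0 < c₂ := hc.trans_le hc₂
  have hH : ∀ k, (pauliSum (h k)).IsHermitian := fun k => pauliSum_isHermitian _
  have hK1 : (1 : ℝ) ≤ K := Nat.one_le_cast.2 NeZero.one_le
  have hL1 : (1 : ℝ) ≤ L := Nat.one_le_cast.2 NeZero.one_le
  have hNO : (0 : ℝ) < Fintype.card I := Nat.cast_pos.2 hI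
  have hcurv := relaxed_curv (L := L) hH ρ (pauliSum P) (toLex (0, 0))
  simp only [ofLex_toLex, ← hC] at hcurv
  have hU : C.IsUnitary := hC ▸ relaxed_isUnitary (L := L) hH
  have hpow := norm_ad_pow_pauliSum_le (h 0) hcom P
  have hcle := (abs_expect_le hρ ((ad (pauliSum (h 0)) ^ 2) (pauliSum P))).trans (hpow 2)
  have hnest : ∀ k, ‖(ad (pauliSum (h k)) ^ 2) ((ad (pauliSum (h 0)) ^ 2) (pauliSum P))‖
      ≤ Fintype.card I * (2 * ((κO + 3 * κ : ℕ) * T)) ^ 4 := by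
    intro k
    rw [← Module.End.mul_apply]
    refine norm_map_pauliSum_le P _ fun i => ?_
    rw [Module.End.mul_apply]
    exact norm_ad_sq_ad_sq_pauliString_le (hT 0) (hT _) (hκ 0) (hκ _) (P i) (hκO i)
  have hAle := relaxed_ampA_first_le (L := L) hH (pauliSum P) hnest
  have hAge := relaxed_ampA_first_ge (L := L) hH (pauliSum P)
  rw [← hC] at hAle hAge
  have hG : C.Guarantee ρ (pauliSum P) {toLex (0, 0)}
      (C.rUncorrWith ρ (pauliSum P) (toLex (0, 0)) (localBeta (h 0) P)) := by
    refine guarantee_rUncorrWith hU (by rw [hC]; rfl) hρ _ _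
      (M := Fintype.card I * (2 * (maxOverlap (h 0) P : ℝ)) ^ 4) (by unfold localBeta; positivity)
      (fun θ => ?_) ?_
    · rw [hC, norm_heisD_relaxed_first hH]
      exact hpow 4
    · rw [hcurv]
      -- The powers combine to 2² · 2⁴ N_O² s⁶ = 64 N_O² s⁶, which is exactly 6 times `localBeta`.
      calc _ ≤ Fintype.card I * (2 * (maxOverlap (h 0) P : ℝ)) ^ 2
            * (Fintype.card I * (2 * (maxOverlap (h 0) P : ℝ)) ^ 4) :=
          mul_le_mul_of_nonneg_right hcle (by positivity)
        _ = 6 * localBeta (h 0) P := by unfold localBeta; ring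
  have ha0 : 0 < a := by rw [ha]; positivity
  have hw : 0 < 1 / Real.sqrt (K * L) := by positivity
  refine SharpPatch.of_guarantee (mul_pos ha0 hw) ?_ ?_ hG ?_
  · unfold rUncorrWith localBeta
    rw [hcurv] at h1 h2 ⊢
    rw [ha]
    exact localRadius_ge (one_le_mul_of_one_le_of_one_le hK1 hL1) hc hNO (by positivity)
      (ampA_nonneg _ _) (Nat.cast_nonneg _) h1 h2 hAle (Nat.cast_le.2 (maxOverlap_le (hT 0) hκO)) hcle
  · unfold rUncorrWith localBeta
    rw [hcurv] at h1 h2 ⊢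
    -- If every string of H_1 commuted with the observable the curvature would vanish; hence s ≥ 1.
    have hsn : maxOverlap (h 0) P ≠ 0 := fun h0 => by
      rw [h0] at hcle
      have h3 : 0 < c₁ * Fintype.card I := by positivity
      have h4 := h1.trans hcle
      simp at h4
      linarith
    refine localRadius_le hK1 hL1 hc hc₂' hNO
      (Nat.one_le_cast.2 (Nat.one_le_iff_ne_zero.2 hsn)) h1 h2
      ((norm_ad_four_ge hρ (hH 0) (pauliSum P)).trans ?_) hAge
    have := norm_pauliSum_le P
    gcongr
  · rw [Finset.sum_singleton]
    clear ha
    calc c₁ ^ 2 * a ^ 4 / 72 * ((Fintype.card I : ℝ) ^ 2 / ((K : ℝ) * L) ^ 2)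
        = 1 / 72 * (c₁ * Fintype.card I) ^ 2 * (a * (1 / Real.sqrt (K * L))) ^ 4 := by
          have : Real.sqrt (K * L) ^ 4 = ((K : ℝ) * L) ^ 2 := by
            rw [show Real.sqrt (K * L) ^ 4 = (Real.sqrt (K * L) ^ 2) ^ 2 by ring,
              Real.sq_sqrt (by positivity)]
          rw [mul_pow a, div_pow, this]
          ring
      _ ≤ _ := by gcongr

end RelaxedLocal

/-! ## Geometric locality -/

section Geometry

variable {n D : ℕ} {size : Fin D → ℕ} {pos : Fin n → (d : Fin D) → ZMod (size d)}

/-- A qubit is determined by its displacement from `q`, which can be chosen in the integer box [−κ,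
κ]^D whether or not the lattice is periodic. -/
lemma card_near_le (hpos : Function.Injective pos) (κ : ℕ) (q : Fin n) (B : Finset (Fin n))
    (hB : ∀ i ∈ B, ∀ d, ∃ z : ℤ, |z| ≤ (κ : ℤ) ∧ pos i d - pos q d = (z : ZMod (size d))) :
    B.card ≤ (2 * κ + 1) ^ D := by
  choose! z hz e using hB
  have : B.card ≤ (Fintype.piFinset fun _ : Fin D => Finset.Icc (-(κ : ℤ)) κ).card := by
    refine Finset.card_le_card_of_injOn z (fun i hi => ?_) fun i hi j hj hij => ?_
    · simp only [Finset.mem_coe, Fintype.mem_piFinset, Finset.mem_Icc]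
      exact fun d => abs_le.1 (hz i hi d)
    · refine hpos (funext fun d => ?_)
      have h1 := e i hi d
      have h2 := e j hj d
      rw [hij] at h1
      exact sub_left_injective (h1.trans h2.symm)
  refine this.trans (le_of_eq ?_)
  rw [Fintype.card_piFinset, Finset.prod_const, Finset.card_univ, Fintype.card_fin, Int.card_Icc]
  congr 1
  omega

/-- A local string touching `q` lives on the neighbourhood of `q`, so distinct such strings restrict
to distinct labellings of at most (2κ + 1)^D qubits. -/
lemma card_touching_le (hpos : Function.Injective pos) {κ : ℕ} {J : Type} [Fintype J]
    {h : J → Fin n → Fin 4} (hh : Function.Injective h) (hloc : ∀ j, IsGeomLocal pos κ (h j))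
    (q : Fin n) : (Finset.univ.filter (fun j => h j q ≠ 0)).card ≤ 4 ^ ((2 * κ + 1) ^ D) := by
  classical
  set B : Finset (Fin n) := Finset.univ.filter
    (fun i => ∀ d, ∃ z : ℤ, |z| ≤ (κ : ℤ) ∧ pos i d - pos q d = (z : ZMod (size d))) with hB
  have hBc := card_near_le hpos κ q B fun i hi => (Finset.mem_filter.1 hi).2
  have : (Finset.univ.filter (fun j => h j q ≠ 0)).card ≤ (Finset.univ : Finset (B → Fin 4)).card := by
    refine Finset.card_le_card_of_injOn (fun j i => h j i) (fun _ _ => Finset.mem_coe.2 (Finset.mem_univ _)) ?_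
    intro j hj j' hj' hjj
    refine hh (funext fun i => ?_)
    by_cases hi : i ∈ B
    · exact congrFun hjj ⟨i, hi⟩
    · have key : ∀ j, h j q ≠ 0 → h j i = 0 := by
        intro j hj
        by_contra hne
        exact hi (Finset.mem_filter.2 ⟨Finset.mem_univ _,
          (hloc j).2 i (mem_support.2 hne) q (mem_support.2 hj)⟩)
      rw [key j (by simpa using hj), key j' (by simpa using hj')]
  refine this.trans ?_
  rw [Finset.card_univ, Fintype.card_fun, Fintype.card_fin, Fintype.card_coe]
  exact Nat.pow_le_pow_right (by norm_num) hBc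

end Geometry

theorem relaxed_hva_sharpPatch (K D κ κO : ℕ) [NeZero K] (c₁ c₂ : ℝ) (hc : 0 < c₁)
    (hc₂ : c₁ ≤ c₂) : ∃ a b v : ℝ, 0 < a ∧ 0 < b ∧ 0 < v ∧
      ∀ (n L NO : ℕ) [NeZero L] (N : Fin K → ℕ)
        (h : (k : Fin K) → Fin (N k) → Fin n → Fin 4) (P : Fin NO → Fin n → Fin 4) (ρ : Op n)
        (C : Circuit n (Fin L ×ₗ Fin K) (Fin L ×ₗ Fin K)) (O : Op n) (l₁ : Fin L ×ₗ Fin K),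
        IsLocalModel D κ κO h P → IsDensity ρ → 1 ≤ NO →
        C = relaxed L (fun k => pauliSum (h k)) → O = pauliSum P → l₁ = toLex (0, 0) →
        c₁ * NO ≤ C.curv ρ O 0 l₁ → C.curv ρ O 0 l₁ ≤ c₂ * NO →
        C.SharpPatch ρ O {l₁} (C.rUncorrWith ρ O l₁ (localBeta (h 0) P))
          a b (1 / Real.sqrt (K * L)) v ((NO : ℝ) ^ 2 / ((K : ℝ) * L) ^ 2) := by
  have hc₂' : 0 < c₂ := hc.trans_le hc₂
  have hK : 0 < (K : ℝ) := Nat.cast_pos.2 (NeZero.pos K)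
  obtain ⟨a, ha⟩ : ∃ a, a = Real.sqrt (9 * c₁ ^ 2 / (8 * c₂ * (2 * ((κO + 3 * κ : ℕ) *
    (4 ^ ((2 * κ + 1) ^ D) : ℕ))) ^ 4 + 256 * ((κO * 4 ^ ((2 * κ + 1) ^ D) : ℕ) : ℝ) ^ 6 + 1)) := ⟨_, rfl⟩
  have ha0 : 0 < a := by rw [ha]; positivity
  refine ⟨a, Real.sqrt (9 * K / min (6 * c₁) (256 / c₂ ^ 2)), c₁ ^ 2 * a ^ 4 / 72, ha0,
    Real.sqrt_pos.2 (div_pos (by positivity) (lt_min (by positivity) (by positivity))),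
    by positivity, ?_⟩
  rintro n L NO _ N h P ρ C _ _ ⟨⟨size, pos, hpos, hh, hP⟩, hinj, -, hcom⟩ hρ hNO hC rfl rfl h1 h2
  have := relaxed_pauliSum_sharpPatch hc hc₂ (J := fun k => Fin (N k)) (I := Fin NO)
    (fun k => card_touching_le hpos (hinj k) (hh k)) (fun k j => (hh k j).1) (fun i => (hP i).1)
    (hcom 0) hρ (by rw [Fintype.card_fin]; omega) ha hC
  simp only [Fintype.card_fin] at this
  exact this h1 h2

/-! ## Bonds of a ring -/

section Ring

variable {n : ℕ}

lemma val_finRotate (i : Fin n) :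
    (finRotate n i).val = if i.val + 1 = n then 0 else i.val + 1 := by
  cases n with
  | zero => exact i.elim0
  | succ n =>
    rw [coe_finRotate]
    simp [Fin.ext_iff]

lemma finRotate_ne (hn : 2 ≤ n) (i : Fin n) : finRotate n i ≠ i := by
  have := val_finRotate i
  rw [Ne, Fin.ext_iff]
  split_ifs at this <;> omega

lemma pauliSign_zero_right (a : Fin 4) : pauliSign a 0 = 1 := by simp [pauliSign]

/-- Only the two ends of the bond contribute signs, and they are distinct because n ≥ 2. -/
lemma bond_mul_comm (hn : 2 ≤ n) (k : Fin 3) (i : Fin n) (s : Fin n → Fin 4) :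
    pauliString (bond k i) * pauliString s
      = (pauliSign k.succ (s i) * pauliSign k.succ (s (finRotate n i)))
        • (pauliString s * pauliString (bond k i)) := by
  rw [pauliString_mul_comm]
  congr 1
  have : ∏ j ∈ {i, finRotate n i}, pauliSign (bond k i j) (s j)
      = ∏ j, pauliSign (bond k i j) (s j) := by
    refine Finset.prod_subset (Finset.subset_univ _) fun j _ hj => ?_
    rw [Finset.mem_insert, Finset.mem_singleton] at hj
    rw [bond, if_neg hj]
    simp [pauliSign]
  rw [← this, Finset.prod_pair (finRotate_ne hn i).symm]
  simp [bond]

lemma bond_commute_same (hn : 2 ≤ n) (k : Fin 3) (i j : Fin n) :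
    Commute (pauliString (bond k i)) (pauliString (bond k j)) := by
  have h : ∀ x, pauliSign k.succ (bond k j x) = 1 := by
    intro x
    unfold bond pauliSign
    split_ifs <;> simp_all
  have := bond_mul_comm hn k i (bond k j)
  rwa [h, h, one_mul, one_smul] at this

lemma pauliSign_bond {k k' : Fin 3} (hk : k ≠ k') (j x : Fin n) :
    pauliSign k.succ (bond k' j x) = if x = j ∨ x = finRotate n j then -1 else 1 := by
  unfold bond
  split_ifs with h
  · unfold pauliSign
    rw [if_neg]
    simp [Fin.succ_ne_zero, hk]
  · exact pauliSign_zero_right _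

lemma support_bond (k : Fin 3) (i : Fin n) : (support (bond k i)).card ≤ 2 := by
  refine (Finset.card_le_card (t := {i, finRotate n i}) fun j hj => ?_).trans Finset.card_le_two
  rw [mem_support, bond] at hj
  rw [Finset.mem_insert, Finset.mem_singleton]
  by_contra h
  exact hj (if_neg h)

lemma card_bond_touching (k : Fin 3) (q : Fin n) :
    (Finset.univ.filter (fun j => bond k j q ≠ 0)).card ≤ 2 := by
  refine (Finset.card_le_card (t := {q, (finRotate n).symm q}) fun j hj => ?_).trans
    Finset.card_le_two
  rw [Finset.mem_filter, bond] at hj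
  rw [Finset.mem_insert, Finset.mem_singleton]
  by_contra h
  push Not at h
  refine hj.2 (if_neg ?_)
  rintro (h' | h')
  · exact h.1 h'.symm
  · exact h.2 (by rw [h', Equiv.symm_apply_apply])

end Ring

/-! ## Product states -/

section ProductState

variable {n : ℕ}

lemma isDensity_productKet {v : Fin n → Fin 2 → ℂ} (hv : ∀ j, star (v j) ⬝ᵥ v j = 1) :
    IsDensity (pureState (productKet v)) := by
  refine isDensity_pureState ?_
  rw [star_productKet_dotProduct]
  exact Finset.prod_eq_one fun j _ => hv j

lemma expect_productKet_pauliString (v : Fin n → Fin 2 → ℂ) (s : Fin n → Fin 4) :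
    expect (pureState (productKet v)) (pauliString s)
      = (∏ j, star (v j) ⬝ᵥ (pauli (s j) *ᵥ v j)).re := by
  rw [expect_pureState, pauliString, tensor_mulVec, star_productKet_dotProduct]

lemma expect_productKet_bond (hn : 2 ≤ n) {u : Fin 2 → ℂ} (hu : star u ⬝ᵥ u = 1) (k : Fin 3)
    (i : Fin n) : expect (pureState (productKet fun _ : Fin n => u)) (pauliString (bond k i))
      = ((star u ⬝ᵥ (pauli k.succ *ᵥ u)) ^ 2).re := by
  rw [expect_productKet_pauliString]
  have : ∏ j ∈ {i, finRotate n i}, star u ⬝ᵥ (pauli (bond k i j) *ᵥ u)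
      = ∏ j, star u ⬝ᵥ (pauli (bond k i j) *ᵥ u) := by
    refine Finset.prod_subset (Finset.subset_univ _) fun j _ hj => ?_
    rw [Finset.mem_insert, Finset.mem_singleton] at hj
    rw [bond, if_neg hj]
    simp [pauli, hu]
  rw [← this, Finset.prod_pair (finRotate_ne hn i).symm]
  simp [bond, pow_two]

/-- Single-qubit states with prescribed expectation values of a Pauli matrix. -/
lemma exists_ket (k : Fin 3) : (∃ u : Fin 2 → ℂ, star u ⬝ᵥ u = 1 ∧ star u ⬝ᵥ (pauli k.succ *ᵥ u) = 1) ∧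
    ∃ u : Fin 2 → ℂ, star u ⬝ᵥ u = 1 ∧ star u ⬝ᵥ (pauli k.succ *ᵥ u) = 0 := by
  have h : ((Real.sqrt 2 : ℝ) : ℂ)⁻¹ * ((Real.sqrt 2 : ℝ) : ℂ)⁻¹ = 1 / 2 := by
    rw [← mul_inv, ← Complex.ofReal_mul, Real.mul_self_sqrt (by norm_num)]; norm_num
  have hp := ket_inner.1
  fin_cases k
  · refine ⟨⟨ketPlus, hp, ?_⟩, ket 0, ket_zero_inner, ?_⟩
    · simp [pauli, ketPlus, Matrix.mulVec, dotProduct, Fin.sum_univ_two, h]; norm_num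
    · simp [pauli, ket, Matrix.mulVec, dotProduct, Fin.sum_univ_two]
  · refine ⟨⟨![((1 / Real.sqrt 2 : ℝ) : ℂ), Complex.I * ((1 / Real.sqrt 2 : ℝ) : ℂ)], ?_, ?_⟩,
      ket 0, ket_zero_inner, ?_⟩
    · simp [dotProduct, Fin.sum_univ_two, h]
      ring_nf
      rw [Complex.I_sq, pow_two, h]; norm_num
    · simp [pauli, Matrix.mulVec, dotProduct, Fin.sum_univ_two]
      ring_nf
      rw [Complex.I_sq, pow_two, h]; norm_num
    · simp [pauli, ket, Matrix.mulVec, dotProduct, Fin.sum_univ_two]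
  · refine ⟨⟨ket 0, ket_zero_inner, ?_⟩, ketPlus, hp, ?_⟩
    · simp [pauli, ket, Matrix.mulVec, dotProduct, Fin.sum_univ_two]
    · simp [pauli, ketPlus, Matrix.mulVec, dotProduct, Fin.sum_univ_two]

lemma productKet_smul (z : Fin n → ℂ) (v : Fin n → Fin 2 → ℂ) :
    productKet (fun j => z j • v j) = (∏ j, z j) • productKet v := by
  funext b
  simp [productKet, Finset.prod_mul_distrib]

end ProductState

/-! ## The Heisenberg ring -/

section Heisenberg

variable {n : ℕ}

/-- The spectral width is at least the gap between two expectation values: n in a product of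
eigenstates of the Pauli matrix, 0 in a product of states in which its mean vanishes. -/
lemma le_maxFreq_heisenbergTerm (hn : 2 ≤ n) (k : Fin 3) : (n : ℝ) ≤ maxFreq (heisenbergTerm n k) := by
  obtain ⟨⟨u, hu, hu1⟩, w, hw, hw0⟩ := exists_ket k
  have h := expect_sub_le_maxFreq (H := heisenbergTerm n k)
    (isDensity_productKet (v := fun _ : Fin n => u) fun _ => hu)
    (isDensity_productKet (v := fun _ : Fin n => w) fun _ => hw) (pauliSum_isHermitian _)
  unfold heisenbergTerm at h ⊢
  rw [pauliSum, map_sum, map_sum] at h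
  rw [pauliSum]
  simp only [expect_productKet_bond hn hu, expect_productKet_bond hn hw, hu1, hw0] at h
  simpa using h

/-- In |0…0⟩ every ZZ bond has value 1 and the XX and YY bonds have value 0. -/
lemma le_norm_heisenberg (hn : 2 ≤ n) : (n : ℝ) ≤ ‖heisenberg n‖ := by
  have h := abs_expect_le (isDensity_productKet (v := fun _ : Fin n => ket 0) fun _ => ket_zero_inner)
    (heisenberg n)
  refine le_trans ?_ ((le_abs_self _).trans h)
  rw [heisenberg, pauliSum, map_sum, Fintype.sum_prod_type, Fin.sum_univ_three]
  have e : ∀ (k : Fin 3) (i : Fin n), expect (pureState (productKet fun _ : Fin n => ket 0))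
      (pauliString (heisenbergStrings n (k, i)))
      = ((star (ket 0) ⬝ᵥ (pauli k.succ *ᵥ ket 0)) ^ 2).re :=
    fun k i => expect_productKet_bond hn ket_zero_inner k i
  simp only [e]
  simp [pauli, ket, Matrix.mulVec, dotProduct, Fin.sum_univ_two]

lemma ket_inner_basis (x y : Fin 2) : star (ket x) ⬝ᵥ ket y = if x = y then 1 else 0 := by
  fin_cases x <;> fin_cases y <;> simp [ket, dotProduct, Fin.sum_univ_two]

lemma pauli_three_mulVec_ket (x : Fin 2) :
    pauli 3 *ᵥ ket x = (if x = 0 then (1 : ℂ) else -1) • ket x := by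
  fin_cases x <;> ext y <;> fin_cases y <;>
    simp [pauli, ket, Matrix.mulVec, dotProduct, Fin.sum_univ_two]

/-- The state vector of `neelState`. -/
noncomputable def neelKet (n : ℕ) : (Fin n → Fin 2) → ℂ :=
  ((1 / Real.sqrt 2 : ℝ) : ℂ) •
    (productKet (fun j => if j.val % 2 = 0 then ket 0 else ket 1) +
      productKet (fun j => if j.val % 2 = 0 then ket 1 else ket 0))

lemma neelKet_inner (hn : 1 ≤ n) : star (neelKet n) ⬝ᵥ neelKet n = 1 := by
  have h : ((Real.sqrt 2 : ℝ) : ℂ)⁻¹ * ((Real.sqrt 2 : ℝ) : ℂ)⁻¹ = 1 / 2 := by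
    rw [← mul_inv, ← Complex.ofReal_mul, Real.mul_self_sqrt (by norm_num)]; norm_num
  have hdiag : ∀ (p : Fin n → Prop) [DecidablePred p] (x y : Fin 2),
      ∏ j : Fin n, star (if p j then ket x else ket y) ⬝ᵥ (if p j then ket x else ket y) = 1 := by
    intro p _ x y
    refine Finset.prod_eq_one fun j _ => ?_
    split_ifs <;> rw [ket_inner_basis, if_pos rfl]
  have hoff : ∀ (p : Fin n → Prop) [DecidablePred p] (x y : Fin 2), x ≠ y →
      ∏ j : Fin n, star (if p j then ket x else ket y) ⬝ᵥ (if p j then ket y else ket x) = 0 := by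
    intro p _ x y hxy
    refine Finset.prod_eq_zero (Finset.mem_univ (⟨0, hn⟩ : Fin n)) ?_
    split_ifs
    · rw [ket_inner_basis, if_neg hxy]
    · rw [ket_inner_basis, if_neg hxy.symm]
  rw [neelKet, star_smul, smul_dotProduct, dotProduct_smul, smul_smul, star_add,
    add_dotProduct, dotProduct_add, dotProduct_add]
  simp only [star_productKet_dotProduct]
  rw [hdiag, hdiag, hoff _ 0 1 (by decide), hoff _ 1 0 (by decide)]
  simp [h]
  norm_num

lemma isDensity_neelState (hn : 1 ≤ n) : IsDensity (neelState n) :=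
  isDensity_pureState (neelKet_inner hn)

lemma bond_z_mulVec_productKet (hn : 2 ≤ n) (i : Fin n) (x : Fin n → Fin 2) :
    pauliString (bond 2 i) *ᵥ productKet (fun j => ket (x j))
      = ((if x i = 0 then (1 : ℂ) else -1) * (if x (finRotate n i) = 0 then (1 : ℂ) else -1))
        • productKet (fun j => ket (x j)) := by
  have e : (fun j => pauli (bond 2 i j) *ᵥ ket (x j)) = fun j =>
      (if j = i ∨ j = finRotate n i then (if x j = 0 then (1 : ℂ) else -1) else 1) • ket (x j) := by
    funext j
    rw [bond]
    split_ifs with h1 h2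
    · exact (pauli_three_mulVec_ket (x j)).trans (by rw [if_pos h2])
    · exact (pauli_three_mulVec_ket (x j)).trans (by rw [if_neg h2])
    · simp [pauli]
  rw [pauliString, tensor_mulVec, e, productKet_smul]
  congr 1
  rw [← Finset.prod_subset (Finset.subset_univ {i, finRotate n i}),
    Finset.prod_pair (finRotate_ne hn i).symm]
  · simp
  · intro j _ hj
    rw [Finset.mem_insert, Finset.mem_singleton] at hj
    rw [if_neg hj]

/-- Neighbours carry opposite bits in both branches; evenness of n makes this hold across the
closing bond too. -/
lemma bond_z_mulVec_neelKet (hn : 2 ≤ n) (he : Even n) (i : Fin n) :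
    pauliString (bond 2 i) *ᵥ neelKet n = ((-1 : ℝ) : ℂ) • neelKet n := by
  have hpar : (finRotate n i).val % 2 = 0 ↔ ¬ i.val % 2 = 0 := by
    have := val_finRotate i
    obtain ⟨m, hm⟩ := he
    split_ifs at this <;> omega
  have e : ∀ x y : Fin 2, (fun j : Fin n => if j.val % 2 = 0 then ket x else ket y)
      = fun j => ket (if j.val % 2 = 0 then x else y) := by
    intro x y; funext j; split_ifs <;> rfl
  rw [neelKet, Matrix.mulVec_smul, Matrix.mulVec_add, e, e, bond_z_mulVec_productKet hn,
    bond_z_mulVec_productKet hn, smul_comm, smul_add (((-1 : ℝ) : ℂ))]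
  congr 3
  all_goals
    simp only [hpar]
    by_cases h : i.val % 2 = 0 <;> simp [h]

lemma expect_neel_eq_zero (hn : 2 ≤ n) (he : Even n) (i : Fin n) {X : Op n}
    (h : pauliString (bond 2 i) * X = -(X * pauliString (bond 2 i))) :
    expect (neelState n) X = 0 :=
  expect_eq_zero_of_anticommute (pauliString_isHermitian _) (by norm_num)
    (bond_z_mulVec_neelKet hn he i) h

lemma expect_neel_bond_z (hn : 2 ≤ n) (he : Even n) (i : Fin n) :
    expect (neelState n) (pauliString (bond 2 i)) = -1 := by
  change expect (pureState (neelKet n)) _ = -1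
  rw [expect_pureState, bond_z_mulVec_neelKet hn he, dotProduct_smul, neelKet_inner (by omega)]
  simp

/-- Anticommutation turns the double commutator into −4(A + B)²Q, and (A + B)² = 2 + 2AB. -/
lemma ad_sq_sum_anticommute {A B Q : Op n} (hA : A * A = 1) (hB : B * B = 1) (hAB : Commute A B)
    (h1 : A * Q = -(Q * A)) (h2 : B * Q = -(Q * B)) :
    (ad (A + B) ^ 2) Q = (-8 : ℝ) • Q + (-8 : ℝ) • (A * B * Q) := by
  have e1 : ad (A + B) Q = (2 * Complex.I) • ((A + B) * Q) := by
    have : Q * (A + B) = -((A + B) * Q) := by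
      rw [mul_add, add_mul, h1, h2]; abel
    rw [ad_apply, this, sub_neg_eq_add, ← two_smul ℂ, smul_smul, mul_comm]
  have e2 : (A + B) * Q * (A + B) = -((A + B) * ((A + B) * Q)) := by
    have : Q * (A + B) = -((A + B) * Q) := by
      rw [mul_add, add_mul, h1, h2]; abel
    rw [mul_assoc, this, mul_neg]
  have e3 : (A + B) * ((A + B) * Q) = (2 : ℝ) • Q + (2 : ℝ) • (A * B * Q) := by
    rw [← mul_assoc]
    have : (A + B) * (A + B) = (2 : ℝ) • 1 + (2 : ℝ) • (A * B) := by
      rw [mul_add, add_mul, add_mul, hA, hB, ← hAB.eq, two_smul, two_smul]; abel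
    rw [this, add_mul, smul_mul_assoc, one_mul, smul_mul_assoc]
  rw [pow_two, Module.End.mul_apply, e1, map_smul, ad_apply, e2, sub_neg_eq_add, e3, ← two_smul ℂ,
    smul_smul, smul_smul]
  have : (2 * Complex.I * Complex.I * 2 : ℂ) = ((-4 : ℝ) : ℂ) := by
    ring_nf; rw [Complex.I_sq]; norm_num
  rw [this, Complex.coe_smul, smul_add, smul_smul, smul_smul]
  norm_num

/-- Only the two XX bonds adjacent to the given bond Q, one on each side, fail to commute with it,
so the double commutator is −8Q − 8ABQ. The ZZ bond just outside kills ABQ. A ZZ bond Q has value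
−1, giving 8, while a YY bond anticommutes with a neighbouring ZZ stabilizer and gives 0. -/
lemma expect_neel_ad_sq_bond (hn : 4 < n) (he : Even n) {k : Fin 3} (hk : k ≠ 0) (b : Fin n) :
    expect (neelState n) ((ad (heisenbergTerm n 0) ^ 2)
      (pauliString (bond k (finRotate n b)))) = if k = 2 then 8 else 0 := by
  have hn2 : 2 ≤ n := by omega
  obtain ⟨a, rfl⟩ := (finRotate n).surjective b
  set b := finRotate n a with hb
  set c := finRotate n b with hc
  set d := finRotate n c with hd
  set e := finRotate n d with he'
  have vb := val_finRotate a
  have vc := val_finRotate b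
  have vd := val_finRotate c
  have ve := val_finRotate d
  rw [← hb] at vb
  rw [← hc] at vc
  rw [← hd] at vd
  rw [← he'] at ve
  -- Five consecutive sites are distinct; this needs n > 4. On a ring of four sites `a` and `e`
  -- would coincide.
  have hne : a ≠ b ∧ a ≠ c ∧ a ≠ d ∧ a ≠ e ∧ b ≠ c ∧ b ≠ d ∧ b ≠ e ∧ c ≠ d ∧ c ≠ e ∧ d ≠ e := by
    simp only [Ne, Fin.ext_iff]
    split_ifs at vb vc vd ve <;> omega
  obtain ⟨hab, hac, had, hae, hbc, hbd, hbe, hcd, hce, hde⟩ := hne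
  have hinj : ∀ x y : Fin n, finRotate n x = finRotate n y ↔ x = y := fun x y =>
    (finRotate n).injective.eq_iff
  have comm := fun (k : Fin 3) (i : Fin n) (s : Fin n → Fin 4) => bond_mul_comm hn2 k i s
  have hA : ∀ {k : Fin 3}, k ≠ 0 → pauliString (bond 0 b) * pauliString (bond k c)
      = -(pauliString (bond k c) * pauliString (bond 0 b)) := by
    intro k hk
    rw [comm, pauliSign_bond hk.symm, pauliSign_bond hk.symm, ← hc, ← hd]
    simp [hbc, hbd]
  have hB : pauliString (bond 0 d) * pauliString (bond k c)
      = -(pauliString (bond k c) * pauliString (bond 0 d)) := by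
    rw [comm, pauliSign_bond hk.symm, pauliSign_bond hk.symm, ← hd, ← he']
    simp [hde.symm, hce.symm]
  have hsplit : heisenbergTerm n 0 = (pauliString (bond 0 b) + pauliString (bond 0 d))
      + ∑ j ∈ Finset.univ \ {b, d}, pauliString (bond 0 j) := by
    rw [heisenbergTerm, pauliSum, ← Finset.sum_sdiff (Finset.subset_univ {b, d}),
      Finset.sum_pair hbd, add_comm]
  have hrest : ∀ j ∈ Finset.univ \ {b, d}, Commute (pauliString (bond 0 j)) (pauliString (bond k c)) := by
    intro j hj
    rw [Finset.mem_sdiff, Finset.mem_insert, Finset.mem_singleton] at hj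
    push Not at hj
    have := comm 0 j (bond k c)
    rw [pauliSign_bond hk.symm, pauliSign_bond hk.symm] at this
    have h1 : finRotate n j = c ↔ j = b := by rw [hc, hinj]
    have h2 : finRotate n j = d ↔ j = c := by rw [hd, hinj]
    simp only [h1, h2, ← hd] at this
    -- The XX bond on the same two sites picks up two signs, which cancel; the remaining bonds share
    -- no site with it.
    by_cases hjc : j = c
    · rw [hjc] at this ⊢
      simp only [true_or, or_true, if_true] at this
      rw [commute_iff_eq]
      simpa using this
    · rw [commute_iff_eq]
      simpa only [hjc, hj.2.1, hj.2.2, or_self, if_false, mul_one, one_smul] using this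
  rw [hsplit, (ad_pow_add ?_ ?_ 2).1, ad_sq_sum_anticommute (pauliString_mul_self _)
    (pauliString_mul_self _) (bond_commute_same hn2 0 b d) (hA hk) hB]
  -- ZZ on the bond `a` meets ABQ only at the site `b`, where AB acts as σ_x and Q is absent, so it
  -- anticommutes with ABQ.
  · have hprod : expect (neelState n) (pauliString (bond 0 b) * pauliString (bond 0 d)
        * pauliString (bond k c)) = 0 := by
      refine expect_neel_eq_zero hn2 he a ?_
      have s1 : pauliString (bond 2 a) * pauliString (bond 0 b)
          = -(pauliString (bond 0 b) * pauliString (bond 2 a)) := by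
        rw [comm, pauliSign_bond (by decide), pauliSign_bond (by decide), ← hb, ← hc]
        simp [hab, hac]
      have s2 : pauliString (bond 2 a) * pauliString (bond 0 d)
          = pauliString (bond 0 d) * pauliString (bond 2 a) := by
        rw [comm, pauliSign_bond (by decide), pauliSign_bond (by decide), ← hb, ← he']
        simp [had, hae, hbd, hbe]
      have s3 : pauliString (bond 2 a) * pauliString (bond k c)
          = pauliString (bond k c) * pauliString (bond 2 a) := by
        by_cases hk2 : k = 2
        · rw [hk2]; exact bond_commute_same hn2 2 a c
        · rw [comm, pauliSign_bond (Ne.symm hk2), pauliSign_bond (Ne.symm hk2), ← hb, ← hd]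
          simp [hac, had, hbc, hbd]
      rw [mul_assoc, ← mul_assoc, s1, neg_mul, mul_assoc, ← mul_assoc (pauliString (bond 2 a)), s2,
        mul_assoc (pauliString (bond 0 d)), s3]
      simp only [mul_assoc]
    rw [map_add, map_smul, map_smul, hprod, smul_zero, add_zero]
    by_cases hk2 : k = 2
    · rw [if_pos hk2, hk2, expect_neel_bond_z hn2 he]; norm_num
    · rw [if_neg hk2, expect_neel_eq_zero hn2 he b, smul_zero]
      rw [comm, pauliSign_bond (Ne.symm hk2), pauliSign_bond (Ne.symm hk2), ← hc, ← hd]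
      simp [hbc, hbd]
  · refine Commute.sum_left _ _ _ fun j _ => Commute.add_right ?_ ?_
    · exact bond_commute_same hn2 0 j b
    · exact bond_commute_same hn2 0 j d
  · exact Commute.sum_left _ _ _ hrest

lemma expect_neel_ad_sq (hn : 4 < n) (he : Even n) :
    expect (neelState n) ((ad (heisenbergTerm n 0) ^ 2) (heisenberg n)) = 8 * n := by
  rw [heisenberg, pauliSum, map_sum, map_sum, Fintype.sum_prod_type, Fin.sum_univ_three]
  have h0 : ∀ i, (ad (heisenbergTerm n 0) ^ 2) (pauliString (heisenbergStrings n (0, i))) = 0 :=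
    fun i => ad_pow_eq_zero (Commute.sum_left _ _ _ fun j _ =>
      bond_commute_same (by omega) 0 j i) two_ne_zero
  have hk : ∀ k : Fin 3, k ≠ 0 → ∀ i, expect (neelState n) ((ad (heisenbergTerm n 0) ^ 2)
      (pauliString (heisenbergStrings n (k, i)))) = if k = 2 then 8 else 0 := by
    intro k hk i
    have := expect_neel_ad_sq_bond hn he hk ((finRotate n).symm i)
    rwa [Equiv.apply_symm_apply] at this
  simp only [h0, hk 1 (by decide), hk 2 (by decide), map_zero]
  simp
  ring

lemma heisenbergTerm_isHermitian (k : Fin 3) : (heisenbergTerm n k).IsHermitian :=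
  pauliSum_isHermitian _

lemma support_heisenbergStrings (x : Fin 3 × Fin n) : (support (heisenbergStrings n x)).card ≤ 2 :=
  support_bond x.1 x.2

lemma card_heisenberg : Fintype.card (Fin 3 × Fin n) = 3 * n := by simp

theorem relaxed_heisenberg_sharpPatch : ∃ a b v : ℝ, 0 < a ∧ 0 < b ∧ 0 < v ∧
    ∀ (n L : ℕ) [NeZero L], Even n → 4 < n → ∀ l₁ : Fin L ×ₗ Fin 3, l₁ = toLex (0, 0) →
      (relaxed L (heisenbergTerm n)).SharpPatch (neelState n) (heisenberg n) {l₁}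
        ((relaxed L (heisenbergTerm n)).rUncorrWith (neelState n) (heisenberg n) l₁
          (localBeta (bond (n := n) 0) (heisenbergStrings n)))
        a b (1 / Real.sqrt L) v ((n : ℝ) ^ 2 / (L : ℝ) ^ 2) := by
  obtain ⟨a, ha⟩ : ∃ a, a = Real.sqrt (9 * (8 / 3 : ℝ) ^ 2 / (8 * (8 / 3) *
    (2 * ((2 + 3 * 2 : ℕ) * (2 : ℕ))) ^ 4 + 256 * ((2 * 2 : ℕ) : ℝ) ^ 6 + 1)) := ⟨_, rfl⟩
  have ha0 : 0 < a := by rw [ha]; positivity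
  refine ⟨a / Real.sqrt 3, Real.sqrt (9 * (3 : ℕ) / min (6 * (8 / 3)) (256 / (8 / 3) ^ 2)) / Real.sqrt 3,
    (8 / 3) ^ 2 * a ^ 4 / 72, by positivity, ?_, by positivity, ?_⟩
  · exact div_pos (Real.sqrt_pos.2 (div_pos (by norm_num) (lt_min (by norm_num) (by norm_num))))
      (by positivity)
  rintro n L _ he hn _ rfl
  have hn2 : 2 ≤ n := by omega
  -- The observable has N_O = 3n strings, so the exact curvature 8n is (8/3)N_O and both curvature
  -- constants are 8/3. The factor K = 3 is absorbed into the scale.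
  have hcurv : (relaxed L (heisenbergTerm n)).curv (neelState n) (pauliSum (heisenbergStrings n)) 0
      (toLex (0, 0)) = 8 / 3 * (Fintype.card (Fin 3 × Fin n) : ℝ) := by
    rw [relaxed_curv heisenbergTerm_isHermitian]
    have := expect_neel_ad_sq hn he
    rw [heisenberg] at this
    simp only [ofLex_toLex, this, card_heisenberg]
    rw [abs_of_nonneg (by positivity)]
    push_cast
    ring
  have key := relaxed_pauliSum_sharpPatch (K := 3) (T := 2) (κ := 2) (κO := 2) (L := L)
    (J := fun _ => Fin n) (I := Fin 3 × Fin n) (h := fun k => bond k) (P := heisenbergStrings n)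
    (ρ := neelState n) (c₁ := 8 / 3) (c₂ := 8 / 3) (by norm_num) le_rfl
    card_bond_touching support_bond support_heisenbergStrings
    (bond_commute_same hn2 0) (isDensity_neelState (by omega)) (by rw [card_heisenberg]; omega) ha
    (C := relaxed L (heisenbergTerm n)) rfl hcurv.ge hcurv.le
  have hL : (0 : ℝ) < L := Nat.cast_pos.2 (NeZero.pos L)
  have e : Real.sqrt ((3 : ℕ) * L) = Real.sqrt 3 * Real.sqrt L := by
    rw [Nat.cast_ofNat, Real.sqrt_mul (by norm_num)]
  refine key.mono (le_of_eq ?_) (le_of_eq ?_) (le_of_eq ?_)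
  · rw [e]; field_simp
  · rw [e]; field_simp
  · rw [card_heisenberg]; push_cast; field_simp

theorem trotter_heisenberg_sharpPatch : ∃ a b v : ℝ, 0 < a ∧ 0 < b ∧ 0 < v ∧
    ∀ (n L : ℕ), Even n → 4 < n → 1 ≤ L →
      ∀ (C : Circuit n (Fin L ×ₗ Fin 3) (Fin 3)) (p : Fin 3),
        C = trotter L (heisenbergTerm n) →
        (∀ q, C.curv (neelState n) (heisenberg n) 0 q
          ≤ C.curv (neelState n) (heisenberg n) 0 p) →
        C.SharpPatch (neelState n) (heisenberg n) {p}
          (C.rCorr (neelState n) (heisenberg n) p)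
          a b (1 / (L * (n : ℝ) ^ 3)) v (1 / (n : ℝ) ^ 10) := by
  obtain ⟨D, hD⟩ : ∃ D : ℝ, D = 8 * (16 * 768 * 3 * 2 ^ 4 * 3 + 32 * 9 * 2 ^ 6) := ⟨_, rfl⟩
  have hD0 : 0 < D := by rw [hD]; norm_num
  obtain ⟨a, ha⟩ : ∃ a, a = Real.sqrt (9 * 64 / D) := ⟨_, rfl⟩
  have ha0 : 0 < a := by rw [ha]; positivity
  refine ⟨a, 144, 64 * a ^ 4 / 72, ha0, by norm_num, by positivity, ?_⟩
  rintro n L he hn hL1 C p hC hp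
  have hn2 : 2 ≤ n := by omega
  have hn0 : (0 : ℝ) < n := Nat.cast_pos.2 (by omega)
  have hn1 : (1 : ℝ) ≤ n := Nat.one_le_cast.2 (by omega)
  have hL : (0 : ℝ) < L := Nat.cast_pos.2 hL1
  have hρ := isDensity_neelState (n := n) (by omega)
  have hU : C.IsUnitary := hC ▸ trotter_isUnitary heisenbergTerm_isHermitian
  have hcurv : ∀ q, C.curv (neelState n) (heisenberg n) 0 q
      = L ^ 2 * |expect (neelState n) ((ad (heisenbergTerm n q) ^ 2) (heisenberg n))| :=
    fun q => hC ▸ trotter_curv heisenbergTerm_isHermitian _ _ q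
  have h1 : 8 * (n : ℝ) ≤ |expect (neelState n) ((ad (heisenbergTerm n p) ^ 2) (heisenberg n))| := by
    have := hp 0
    rw [hcurv, hcurv, expect_neel_ad_sq hn he, abs_of_nonneg (by positivity)] at this
    exact le_of_mul_le_mul_left this (by positivity)
  -- 768 = 3 · (2 · 4 · 2)²: 3n strings, supports at most 4 after one commutator, two bonds through
  -- each site.
  have h2 : |expect (neelState n) ((ad (heisenbergTerm n p) ^ 2) (heisenberg n))| ≤ 768 * n := by
    refine (abs_expect_le hρ _).trans ((norm_map_pauliSum_le (heisenbergStrings n)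
      (ad (heisenbergTerm n p) ^ 2) (b := (2 * ((2 + 2 : ℕ) * (2 : ℕ))) ^ 2) fun x => ?_).trans
      (le_of_eq ?_))
    · exact norm_ad_sq_pauliString_le (card_bond_touching p) (support_bond p) _
        (support_heisenbergStrings x)
    · rw [card_heisenberg]; push_cast; ring
  have hO : ‖heisenberg n‖ ≤ 3 * n := by
    refine (norm_pauliSum_le _).trans (le_of_eq ?_)
    rw [card_heisenberg]; push_cast; ring
  have hω : ∀ k, maxFreq (heisenbergTerm n k) ≤ 2 * n := fun k => by
    have := maxFreq_pauliSum_le (bond (n := n) k)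
    rwa [Fintype.card_fin] at this
  obtain ⟨-, -, hlo⟩ := trotter_rCorr_ge heisenbergTerm_isHermitian hL1 hρ p (by positivity) h1 h2 hO hω
  have hup := trotter_rCorr_le heisenbergTerm_isHermitian hL1 p (by positivity) h1 h2 hn0
    (le_norm_heisenberg hn2) hn0 (le_maxFreq_heisenbergTerm hn2)
  rw [← hC] at hlo hup
  have e : ∀ x : ℝ, 0 ≤ x → x * (1 / (L * (n : ℝ) ^ 3)) = Real.sqrt (x ^ 2 / ((n : ℝ) ^ 3) ^ 2) / L := by
    intro x hx
    rw [← div_pow, Real.sqrt_sq (by positivity)]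
    field_simp
  refine SharpPatch.of_guarantee (by positivity) (le_trans ?_ hlo) (hup.trans ?_)
    (guarantee_rCorr hU hρ _ p) ?_
  · rw [e a ha0.le]
    refine div_le_div_of_nonneg_right (Real.sqrt_le_sqrt ?_) hL.le
    rw [ha, Real.sq_sqrt (by positivity), div_div, div_le_div_iff₀ (by positivity) (by positivity)]
    have h6 : (n : ℝ) ^ 6 ≤ (n : ℝ) ^ 8 := pow_le_pow_right₀ hn1 (by norm_num)
    push_cast
    calc (9 * 64 : ℝ) * (8 * (16 * (768 * n) * (3 * n) * (2 * n) ^ 4 * 3 + 32 * (3 * n) ^ 2 * (2 * n) ^ 6))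
        = (9 * 64 : ℝ) * (8 * (16 * 768 * 3 * 2 ^ 4 * 3 * n ^ 6 + 32 * 9 * 2 ^ 6 * n ^ 8)) := by ring
      _ ≤ (9 * 64 : ℝ) * (8 * (16 * 768 * 3 * 2 ^ 4 * 3 * n ^ 8 + 32 * 9 * 2 ^ 6 * n ^ 8)) := by
        gcongr
      _ = 9 * (8 * n) ^ 2 * (D * (n ^ 3) ^ 2) := by rw [hD]; ring
  · rw [e 144 (by norm_num)]
    refine div_le_div_of_nonneg_right (Real.sqrt_le_sqrt ?_) hL.le
    push_cast
    rw [div_le_div_iff₀ (by positivity) (by positivity)]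
    have : (0 : ℝ) ≤ n ^ 6 := by positivity
    -- The term with the other parameters is dropped; the ‖O‖²ω⁶ term is already of order n⁸, and
    -- 144² = 9 · 768²/256.
    calc 9 * (768 * (n : ℝ)) ^ 2 * (n ^ 3) ^ 2 = 144 ^ 2 * (8 * (0 + 32 * n ^ 2 * n ^ 6)) := by ring
      _ ≤ _ := by
        gcongr
        norm_num
        positivity
  · rw [Finset.sum_singleton, hcurv]
    calc 64 * a ^ 4 / 72 * (1 / (n : ℝ) ^ 10)
        = 1 / 72 * ((L : ℝ) ^ 2 * (8 * n)) ^ 2 * (a * (1 / (L * (n : ℝ) ^ 3))) ^ 4 := by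
          field_simp
          norm_num
      _ ≤ _ := by gcongr

end Heisenberg

/-! ## Excitation generators -/

section Excitation

variable {n : ℕ}

/-- The computational basis vector of a bit string. -/
noncomputable def basisKet (b : Fin n → Fin 2) : (Fin n → Fin 2) → ℂ :=
  productKet (fun j => ket (b j))

lemma basisKet_eq_single (b : Fin n → Fin 2) : basisKet b = Pi.single b 1 := by
  classical
  funext b'
  rw [basisKet, productKet]
  by_cases h : b' = b
  · subst h
    rw [Pi.single_eq_same]
    exact Finset.prod_eq_one fun j _ => by simp [ket]
  · rw [Pi.single_eq_of_ne h]
    obtain ⟨j, hj⟩ := Function.ne_iff.1 h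
    exact Finset.prod_eq_zero (Finset.mem_univ j) (by simp [ket, hj])

lemma basisKet_inner (b : Fin n → Fin 2) : star (basisKet b) ⬝ᵥ basisKet b = 1 := by
  rw [basisKet_eq_single]; simp

lemma isDensity_basisKet (b : Fin n → Fin 2) : IsDensity (pureState (basisKet b)) :=
  isDensity_pureState (basisKet_inner b)

lemma expect_basisKet (b : Fin n → Fin 2) (X : Op n) :
    expect (pureState (basisKet b)) X = (X b b).re := by
  rw [expect_pureState, basisKet_eq_single]
  simp

lemma onQubit_mulVec_productKet (p : Fin n) (M : Matrix (Fin 2) (Fin 2) ℂ) (v : Fin n → Fin 2 → ℂ) :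
    onQubit p M *ᵥ productKet v = productKet (Function.update v p (M *ᵥ v p)) := by
  rw [onQubit, tensor_mulVec]
  congr 1
  funext j
  by_cases h : j = p
  · subst h; simp
  · simp [h]

lemma lowering_eq (p : Fin n) : lowering p = onQubit p !![0, 1; 0, 0] := by
  ext b b'
  simp only [lowering, onQubit, Matrix.smul_apply, Matrix.add_apply, tensor_update_apply, smul_eq_mul]
  have : ∀ x y : Fin 2, (1 / 2 : ℂ) * (pauli 1 x y + Complex.I * pauli 2 x y)
      = !![0, 1; 0, 0] x y := by
    intro x y
    fin_cases x <;> fin_cases y <;> simp [pauli]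
    norm_num
  rw [← this]; ring

lemma lowering_conjTranspose_eq (p : Fin n) : (lowering p)ᴴ = onQubit p !![0, 0; 1, 0] := by
  rw [lowering_eq, conjTranspose_onQubit]
  congr 1
  ext x y
  fin_cases x <;> fin_cases y <;> simp

lemma productKet_update_zero (v : Fin n → Fin 2 → ℂ) (p : Fin n) :
    productKet (Function.update v p 0) = 0 := by
  funext b
  exact Finset.prod_eq_zero (Finset.mem_univ p) (by simp)

lemma productKet_update_ket (b : Fin n → Fin 2) (p : Fin n) (y : Fin 2) :
    productKet (Function.update (fun j => ket (b j)) p (ket y)) = basisKet (Function.update b p y) := by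
  rw [basisKet]
  congr 1
  funext j
  by_cases h : j = p
  · subst h; simp
  · simp [h]

lemma lowering_mulVec_one {b : Fin n → Fin 2} {p : Fin n} (h : b p = 1) :
    lowering p *ᵥ basisKet b = basisKet (Function.update b p 0) := by
  rw [lowering_eq, basisKet, onQubit_mulVec_productKet, ← productKet_update_ket, h]
  congr 2
  ext x
  fin_cases x <;> simp [ket, Matrix.mulVec, dotProduct, Fin.sum_univ_two]

lemma lowering_mulVec_zero {b : Fin n → Fin 2} {p : Fin n} (h : b p = 0) :
    lowering p *ᵥ basisKet b = 0 := by
  rw [lowering_eq, basisKet, onQubit_mulVec_productKet, h]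
  convert productKet_update_zero _ p using 3
  ext x
  fin_cases x <;> simp [ket, Matrix.mulVec, dotProduct, Fin.sum_univ_two]

lemma raising_mulVec_zero {b : Fin n → Fin 2} {p : Fin n} (h : b p = 0) :
    (lowering p)ᴴ *ᵥ basisKet b = basisKet (Function.update b p 1) := by
  rw [lowering_conjTranspose_eq, basisKet, onQubit_mulVec_productKet, ← productKet_update_ket, h]
  congr 2
  ext x
  fin_cases x <;> simp [ket, Matrix.mulVec, dotProduct, Fin.sum_univ_two]

lemma uccGen_isHermitian (x : Single n ⊕ Double n) : (uccGen x).IsHermitian := by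
  rw [Matrix.IsHermitian, uccGen, Matrix.conjTranspose_smul, Matrix.conjTranspose_sub,
    Matrix.conjTranspose_conjTranspose, Complex.star_def, Complex.conj_I, neg_smul, ← smul_neg,
    neg_sub]

/-- With the source occupied and the target empty, the reverse excitation annihilates the basis
state. -/
lemma uccGen_single_mulVec (x : Single n) {b : Fin n → Fin 2} (hq : b x.1.2 = 1)
    (hp : b x.1.1 = 0) : uccGen (.inl x) *ᵥ basisKet b
      = Complex.I • basisKet (Function.update (Function.update b x.1.2 0) x.1.1 1) := by
  have hne : x.1.1 ≠ x.1.2 := x.2.ne'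
  rw [uccGen, Matrix.smul_mulVec, Matrix.sub_mulVec, excitation, Matrix.conjTranspose_mul,
    Matrix.conjTranspose_conjTranspose, ← Matrix.mulVec_mulVec, ← Matrix.mulVec_mulVec,
    lowering_mulVec_one hq, lowering_mulVec_zero hp, Matrix.mulVec_zero, sub_zero,
    raising_mulVec_zero (by simp [hne, hp])]

lemma uccGen_double_mulVec (x : Double n) {b : Fin n → Fin 2} (hs : b x.1.2.2.2 = 1)
    (hr : b x.1.2.2.1 = 1) (hq : b x.1.2.1 = 0) (hp : b x.1.1 = 0) :
    uccGen (.inr x) *ᵥ basisKet b = Complex.I • basisKet (Function.update (Function.update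
      (Function.update (Function.update b x.1.2.2.2 0) x.1.2.2.1 0) x.1.2.1 1) x.1.1 1) := by
  obtain ⟨h1, h2, h3⟩ := x.2
  have e1 : x.1.2.2.1 ≠ x.1.2.2.2 := h1.ne'
  have e2 : x.1.2.1 ≠ x.1.2.2.1 := h2.ne'
  have e3 : x.1.2.1 ≠ x.1.2.2.2 := (h1.trans h2).ne'
  have e4 : x.1.1 ≠ x.1.2.1 := h3.ne'
  have e5 : x.1.1 ≠ x.1.2.2.1 := (h2.trans h3).ne'
  have e6 : x.1.1 ≠ x.1.2.2.2 := (h1.trans (h2.trans h3)).ne'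
  rw [uccGen, Matrix.smul_mulVec, Matrix.sub_mulVec, excitation]
  simp only [Matrix.conjTranspose_mul, Matrix.conjTranspose_conjTranspose, ← Matrix.mulVec_mulVec]
  rw [lowering_mulVec_one hs, lowering_mulVec_zero hp, Matrix.mulVec_zero, Matrix.mulVec_zero,
    Matrix.mulVec_zero, sub_zero, lowering_mulVec_one (by simp [e1, hr]),
    raising_mulVec_zero (by simp [e2, e3, hq]), raising_mulVec_zero (by simp [e4, e5, e6, hp])]

/-- The qubits on which an excitation acts. -/
def sites : Single n ⊕ Double n → Finset (Fin n)
  | .inl x => {x.1.1, x.1.2}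
  | .inr x => {x.1.1, x.1.2.1, x.1.2.2.1, x.1.2.2.2}

lemma card_sites_le (x : Single n ⊕ Double n) : (sites x).card ≤ 4 := by
  rcases x with x | x
  · exact Finset.card_le_two.trans (by norm_num)
  · exact Finset.card_le_four

lemma onQubit_commute {p : Fin n} {s : Fin n → Fin 4} (h : s p = 0) (M : Matrix (Fin 2) (Fin 2) ℂ) :
    Commute (onQubit p M) (pauliString s) := by
  rw [commute_iff_eq, pauliString, onQubit_mul_tensor, tensor_mul_onQubit, h]
  simp [pauli]

lemma uccGen_commute {x : Single n ⊕ Double n} {s : Fin n → Fin 4} (h : ∀ q ∈ sites x, s q = 0) :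
    Commute (uccGen x) (pauliString s) := by
  have h1 : ∀ q ∈ sites x, Commute (lowering q) (pauliString s) := fun q hq => by
    rw [lowering_eq]; exact onQubit_commute (h q hq) _
  have h2 : ∀ q ∈ sites x, Commute (lowering q)ᴴ (pauliString s) := fun q hq => by
    rw [lowering_conjTranspose_eq]; exact onQubit_commute (h q hq) _
  rw [uccGen]
  refine Commute.smul_left (Commute.sub_left ?_ ?_) _
  · rcases x with x | x
    · exact (h2 _ (by simp [sites])).mul_left (h1 _ (by simp [sites]))
    · exact (((h2 _ (by simp [sites])).mul_left (h2 _ (by simp [sites]))).mul_left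
        (h1 _ (by simp [sites]))).mul_left (h1 _ (by simp [sites]))
  · rcases x with x | x
    · rw [excitation, Matrix.conjTranspose_mul, Matrix.conjTranspose_conjTranspose]
      exact (h2 _ (by simp [sites])).mul_left (h1 _ (by simp [sites]))
    · simp only [excitation, Matrix.conjTranspose_mul, Matrix.conjTranspose_conjTranspose]
      exact (h2 _ (by simp [sites])).mul_left ((h2 _ (by simp [sites])).mul_left
        ((h1 _ (by simp [sites])).mul_left (h1 _ (by simp [sites]))))

lemma norm_lowering_le (p : Fin n) : ‖lowering p‖ ≤ 1 := by
  rw [lowering, norm_smul]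
  have h1 : ‖onQubit p (pauli 1)‖ = 1 := by rw [onQubit_pauli, norm_pauliString]
  have h2 : ‖onQubit p (pauli 2)‖ = 1 := by rw [onQubit_pauli, norm_pauliString]
  have := norm_add_le (onQubit p (pauli 1)) (Complex.I • onQubit p (pauli 2))
  rw [norm_smul, Complex.norm_I, h1, h2] at this
  have e : ‖(1 / 2 : ℂ)‖ = 1 / 2 := by simp
  rw [e]
  linarith

lemma norm_uccGen_le (x : Single n ⊕ Double n) : ‖uccGen x‖ ≤ 2 := by
  have h1 := norm_lowering_le (n := n)
  have h2 : ∀ p : Fin n, ‖(lowering p)ᴴ‖ ≤ 1 := fun p => by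
    rw [← Matrix.star_eq_conjTranspose, norm_star]; exact h1 p
  have hm : ∀ {A B : Op n}, ‖A‖ ≤ 1 → ‖B‖ ≤ 1 → ‖A * B‖ ≤ 1 := fun hA hB =>
    (norm_mul_le _ _).trans (mul_le_one₀ hA (norm_nonneg _) hB)
  have hτ : ‖excitation x‖ ≤ 1 := by
    rcases x with x | x
    · exact hm (h2 _) (h1 _)
    · exact hm (hm (hm (h2 _) (h2 _)) (h1 _)) (h1 _)
  have hτ' : ‖(excitation x)ᴴ‖ ≤ 1 := by
    rw [← Matrix.star_eq_conjTranspose, norm_star]; exact hτ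
  rw [uccGen, norm_smul, Complex.norm_I, one_mul]
  exact (norm_sub_le _ _).trans (by linarith)

lemma maxFreq_uccGen_le (x : Single n ⊕ Double n) : maxFreq (uccGen x) ≤ 4 :=
  (maxFreq_le _).trans (by have := norm_uccGen_le x; linarith)

lemma one_le_norm_of_mulVec {H : Op n} {b b' : Fin n → Fin 2} {z : ℂ} (hz : ‖z‖ = 1)
    (h : H *ᵥ basisKet b = z • basisKet b') : 1 ≤ ‖H‖ := by
  have := Matrix.l2_opNorm_mulVec H (WithLp.toLp 2 (basisKet b))
  have e : ∀ b : Fin n → Fin 2, ‖(WithLp.toLp 2 (basisKet b) : EuclideanSpace ℂ (Fin n → Fin 2))‖ = 1 := by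
    intro b
    rw [basisKet_eq_single]
    exact (PiLp.norm_single 2 (fun _ => ℂ) b (1 : ℂ)).trans norm_one
  rw [h] at this
  change ‖z • (WithLp.toLp 2 (basisKet b') : EuclideanSpace ℂ (Fin n → Fin 2))‖ ≤ _ at this
  rw [norm_smul, hz, e, e] at this
  linarith

lemma one_le_norm_uccGen (x : Single n ⊕ Double n) : 1 ≤ ‖uccGen x‖ := by
  rcases x with x | x
  · have hne : x.1.1 ≠ x.1.2 := x.2.ne'
    exact one_le_norm_of_mulVec Complex.norm_I (uccGen_single_mulVec x
      (b := fun j => if j = x.1.2 then 1 else 0) (by simp) (by simp [hne]))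
  · obtain ⟨h1, h2, h3⟩ := x.2
    exact one_le_norm_of_mulVec Complex.norm_I (uccGen_double_mulVec x
      (b := fun j => if j = x.1.2.2.2 ∨ j = x.1.2.2.1 then 1 else 0) (by simp) (by simp)
      (by simp [h2.ne', (h1.trans h2).ne']) (by simp [(h2.trans h3).ne', (h1.trans (h2.trans h3)).ne']))

/-- Each generator is flipped by the phase of its highest qubit. -/
lemma uccGen_anticommute (x : Single n ⊕ Double n) :
    ∃ p : Fin n, uccGen x * onQubit p (pauli 3) = -(onQubit p (pauli 3) * uccGen x) := by
  have h1 : ∀ p : Fin n, onQubit p (pauli 3) * lowering p = -(lowering p * onQubit p (pauli 3)) := by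
    intro p
    simp only [lowering, onQubit_pauli]
    have a := pauliString_mul_comm (Pi.single p 3 : Fin n → Fin 4) (Pi.single p 1)
    have b := pauliString_mul_comm (Pi.single p 3 : Fin n → Fin 4) (Pi.single p 2)
    have e : ∀ y : Fin 4, y = 1 ∨ y = 2 →
        ∏ j, pauliSign ((Pi.single p 3 : Fin n → Fin 4) j) ((Pi.single p y : Fin n → Fin 4) j) = -1 := by
      intro y hy
      rw [Finset.prod_eq_single p]
      · rcases hy with rfl | rfl <;> simp [pauliSign]
      · intro j _ hj
        simp [pauliSign, hj]
      · simp
    rw [e 1 (by simp), neg_one_smul] at a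
    rw [e 2 (by simp), neg_one_smul] at b
    rw [mul_smul_comm, mul_add, mul_smul_comm, a, b, smul_mul_assoc, add_mul, smul_mul_assoc,
      smul_neg, ← neg_add, smul_neg]
  have hZ : ∀ p : Fin n, (onQubit p (pauli 3))ᴴ = onQubit p (pauli 3) := fun p =>
    onQubit_pauli_isHermitian p 3
  have h2 : ∀ p : Fin n, onQubit p (pauli 3) * (lowering p)ᴴ = -((lowering p)ᴴ * onQubit p (pauli 3)) := by
    intro p
    have := congrArg Matrix.conjTranspose (h1 p)
    rw [Matrix.conjTranspose_mul, Matrix.conjTranspose_neg, Matrix.conjTranspose_mul, hZ] at this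
    rw [this, neg_neg]
  have hcl : ∀ {p q : Fin n}, q ≠ p → Commute (onQubit p (pauli 3)) (lowering q) := by
    intro p q h
    rw [lowering_eq, onQubit_pauli]
    exact (onQubit_commute (by simp [h]) _).symm
  have hcr : ∀ {p q : Fin n}, q ≠ p → Commute (onQubit p (pauli 3)) (lowering q)ᴴ := by
    intro p q h
    rw [lowering_conjTranspose_eq, onQubit_pauli]
    exact (onQubit_commute (by simp [h]) _).symm
  have key : ∃ p : Fin n, onQubit p (pauli 3) * excitation x = -(excitation x * onQubit p (pauli 3)) := by
    rcases x with x | x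
    · refine ⟨x.1.1, ?_⟩
      rw [excitation, ← mul_assoc, h2, neg_mul, mul_assoc, (hcl x.2.ne).eq, mul_assoc]
    · obtain ⟨e1, e2, e3⟩ := x.2
      refine ⟨x.1.1, ?_⟩
      have c := ((hcr e3.ne).mul_right (hcl (e2.trans e3).ne)).mul_right (hcl (e1.trans (e2.trans e3)).ne)
      have : excitation (.inr x) = (lowering x.1.1)ᴴ * ((lowering x.1.2.1)ᴴ * lowering x.1.2.2.1
          * lowering x.1.2.2.2) := by simp only [excitation, mul_assoc]
      rw [this, ← mul_assoc, h2, neg_mul, mul_assoc, c.eq]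
      simp only [mul_assoc]
  obtain ⟨p, hp⟩ := key
  refine ⟨p, ?_⟩
  have hp' := congrArg Matrix.conjTranspose hp
  rw [Matrix.conjTranspose_mul, Matrix.conjTranspose_neg, Matrix.conjTranspose_mul, hZ] at hp'
  rw [uccGen, smul_mul_assoc, mul_smul_comm, sub_mul, mul_sub, hp, hp', ← smul_neg]
  congr 1
  abel

/-- The generator anticommutes with some σ_z, so its commutator with this σ_z has norm 2‖H‖ ≥ 2,
whereas `norm_ad_le` bounds it by ω(H). -/
lemma two_le_maxFreq_uccGen (x : Single n ⊕ Double n) : 2 ≤ maxFreq (uccGen x) := by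
  obtain ⟨p, hp⟩ := uccGen_anticommute x
  have hn : ‖onQubit p (pauli 3)‖ = 1 := by rw [onQubit_pauli, norm_pauliString]
  have h := norm_ad_le (uccGen_isHermitian x) (onQubit p (pauli 3))
  have e : onQubit p (pauli 3) * uccGen x = -(uccGen x * onQubit p (pauli 3)) := by rw [hp, neg_neg]
  rw [ad_apply, e, sub_neg_eq_add, ← two_smul ℂ, norm_smul, norm_smul, Complex.norm_I, hn] at h
  have h1 : ‖uccGen x‖ ≤ ‖uccGen x * onQubit p (pauli 3)‖ := by
    have := norm_mul_le (uccGen x * onQubit p (pauli 3)) (onQubit p (pauli 3))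
    rwa [mul_assoc, onQubit_pauli_sq, mul_one, hn, mul_one] at this
  have h2 := one_le_norm_uccGen x
  have e2 : ‖(2 : ℂ)‖ = 2 := by simp
  rw [e2] at h
  linarith

end Excitation

/-! ## Bounds on the patch radius -/

namespace Circuit

variable {n : ℕ} {G : Type} [LinearOrder G] [Fintype G] {C : Circuit n G G}

lemma le_rUncorr {ρ O : Op n} {Λ : Finset G} (hΛ : Λ.Nonempty) {x : ℝ}
    (h : ∀ l ∈ Λ, x ^ 2 ≤ 9 * C.curv ρ O 0 l ^ 2 /
      (8 * C.curv ρ O 0 l * C.ampA O 0 l + 24 * C.beta O 0 l)) : x ≤ C.rUncorr ρ O Λ := by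
  have : Nonempty Λ := hΛ.to_subtype
  exact Real.le_sqrt_of_sq_le (le_ciInf fun l : Λ => h l l.2)

lemma rUncorr_le {ρ O : Op n} {Λ : Finset G} {l : G} (hl : l ∈ Λ) :
    C.rUncorr ρ O Λ ≤ Real.sqrt (9 * C.curv ρ O 0 l ^ 2 /
      (8 * C.curv ρ O 0 l * C.ampA O 0 l + 24 * C.beta O 0 l)) :=
  Real.sqrt_le_sqrt (ciInf_le (Set.finite_range _).bddBelow (⟨l, hl⟩ : Λ))

lemma beta_pos (hC : C.IsUnitary) (hpar : C.par = id) {ρ : Op n} (hρ : IsDensity ρ) (O : Op n) {l : G}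
    (hc : 0 < C.curv ρ O 0 l) : 0 < C.beta O 0 l := by
  have h := curv_le hC hpar hρ O l
  have he := curv_le_effFreq_sq hC hpar hρ O l
  have hω : 0 < maxFreq (C.gen l) := by
    refine (maxFreq_nonneg _).lt_of_ne fun h0 => ?_
    rw [← h0] at h
    simp at h
    linarith
  have hO : 0 < ‖O‖ := by
    refine (norm_nonneg _).lt_of_ne fun h0 => ?_
    rw [← h0] at h
    simp at h
    linarith
  by_cases hl : ∀ μ, l ≤ μ
  · rw [beta_of_first O hl]
    have : 0 < (C.effFreq O 0 l ^ 2) ^ 2 := pow_pos (hc.trans_le he) 2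
    rw [show C.effFreq O 0 l ^ 4 = (C.effFreq O 0 l ^ 2) ^ 2 by ring]
    positivity
  · rw [beta_of_not_first O hl]
    positivity

/-- 43700 exceeds 32 · 4⁶/3, the value away from the first gate; the first gate needs only 2 · 4² ·
16²/3. -/
lemma beta_le (hC : C.IsUnitary) (hpar : C.par = id) (O : Op n) {l : G}
    (hω : maxFreq (C.gen l) ≤ 4) : C.beta O 0 l ≤ 43700 * ‖O‖ ^ 2 := by
  have hω0 := maxFreq_nonneg (C.gen l)
  by_cases hl : ∀ μ, l ≤ μ
  · rw [beta_of_first O hl, show C.effFreq O 0 l ^ 4 = (C.effFreq O 0 l ^ 2) ^ 2 by ring]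
    have h1 : C.effFreq O 0 l ^ 2 ≤ 4 ^ 2 * ‖O‖ :=
      (effFreq_sq_le hC hpar O l).trans (by gcongr)
    calc 2 * maxFreq (C.gen l) ^ 2 * (C.effFreq O 0 l ^ 2) ^ 2 / 3
        ≤ 2 * 4 ^ 2 * (4 ^ 2 * ‖O‖) ^ 2 / 3 := by gcongr
      _ ≤ _ := by nlinarith [sq_nonneg ‖O‖]
  · rw [beta_of_not_first O hl]
    calc 32 * maxFreq (C.gen l) ^ 6 * ‖O‖ ^ 2 / 3 ≤ 32 * 4 ^ 6 * ‖O‖ ^ 2 / 3 := by gcongr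
      _ ≤ _ := by nlinarith [sq_nonneg ‖O‖]

end Circuit

section Relaxed

variable {n K L : ℕ} {H : Fin K → Op n}

lemma relaxed_effFreq_sq (hH : ∀ k, (H k).IsHermitian) (O : Op n) (μ : Fin L ×ₗ Fin K) :
    (relaxed L H).effFreq O 0 μ ^ 2 = ‖(ad (H (ofLex μ).2) ^ 2) O‖ := by
  rw [effFreq_sq (relaxed_isUnitary hH) rfl, heisD_single_origin fun _ => rfl]
  rfl

/-- 80 = 4 · 4² + 4²: every gate is charged for both sums of `ampA`, with all frequencies at most 4.
-/
lemma relaxed_ampA_le (hH : ∀ k, (H k).IsHermitian) (hω : ∀ k, maxFreq (H k) ≤ 4) (O : Op n) {e : ℝ}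
    (he : ∀ k, ‖(ad (H k) ^ 2) O‖ ≤ e) (l : Fin L ×ₗ Fin K) :
    (relaxed L H).ampA O 0 l ≤ 80 * e * (K * L) := by
  have he0 : 0 ≤ e := (norm_nonneg _).trans (he (ofLex l).2)
  have hcard : ∑ _μ : Fin L ×ₗ Fin K, e = e * (K * L) := by
    rw [Finset.sum_const, nsmul_eq_mul, Finset.card_univ, Fintype.card_lex, Fintype.card_prod,
      Fintype.card_fin, Fintype.card_fin]
    push_cast; ring
  have h1 : ∑ μ ∈ Finset.univ.filter (fun μ => μ < l), (relaxed L H).effFreq O 0 μ ^ 2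
      ≤ e * (K * L) := by
    rw [← hcard]
    refine (Finset.sum_le_sum fun μ _ => ?_).trans
      (Finset.sum_le_sum_of_subset_of_nonneg (Finset.filter_subset _ _) fun _ _ _ => he0)
    rw [relaxed_effFreq_sq hH]
    exact he _
  have h2 : ∑ μ ∈ Finset.univ.filter (fun μ => l < μ), (relaxed L H).effFreq2 O 0 l μ ^ 2
      ≤ 16 * (e * (K * L)) := by
    rw [← hcard, Finset.mul_sum]
    refine (Finset.sum_le_sum fun μ hμ => ?_).trans
      (Finset.sum_le_sum_of_subset_of_nonneg (Finset.filter_subset _ _) fun _ _ _ => by positivity)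
    rw [relaxed_effFreq2_sq hH _ (Finset.mem_filter.1 hμ).2]
    refine (norm_ad_pow_le (hH _) _ 2).trans ?_
    calc _ ≤ 4 ^ 2 * e := by
          have := maxFreq_nonneg (H (ofLex μ).2)
          gcongr
          · exact hω _
          · exact he _
      _ = _ := by norm_num
  have h3 : 4 * maxFreq ((relaxed L H).gen l) ^ 2 ≤ 64 := by
    have := maxFreq_nonneg ((relaxed L H).gen l)
    have h4 : maxFreq ((relaxed L H).gen l) ≤ 4 := hω _
    calc 4 * maxFreq ((relaxed L H).gen l) ^ 2 ≤ 4 * 4 ^ 2 := by gcongr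
      _ = 64 := by norm_num
  have h0 : 0 ≤ ∑ μ ∈ Finset.univ.filter (fun μ => μ < l), (relaxed L H).effFreq O 0 μ ^ 2 :=
    Finset.sum_nonneg fun _ _ => sq_nonneg _
  unfold ampA
  calc _ ≤ 64 * (e * (K * L)) + 16 * (e * (K * L)) := by gcongr
    _ = _ := by ring

lemma card_layers {Λ : Finset (Fin K)} {Λ' : Finset (Fin L ×ₗ Fin K)}
    (h : ∀ g, g ∈ Λ' ↔ (ofLex g).2 ∈ Λ) : Λ'.card = L * Λ.card := by
  have : Λ' = ((Finset.univ : Finset (Fin L)) ×ˢ Λ).map toLex.toEmbedding := by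
    ext g
    rw [h, Finset.mem_map_equiv, Finset.mem_product]
    simp
  rw [this, Finset.card_map, Finset.card_product, Finset.card_univ, Fintype.card_fin]

end Relaxed

/-! ## Unitary coupled cluster with an arbitrary observable -/

section UCC

variable {n K L : ℕ}

lemma norm_ad_uccGen_sq_le (x : Single n ⊕ Double n) (O : Op n) :
    ‖(ad (uccGen x) ^ 2) O‖ ≤ 16 * ‖O‖ := by
  refine (norm_ad_pow_le (uccGen_isHermitian x) O 2).trans ?_
  have h0 := maxFreq_nonneg (uccGen x)
  have := maxFreq_uccGen_le x
  calc maxFreq (uccGen x) ^ 2 * ‖O‖ ≤ 4 ^ 2 * ‖O‖ := by gcongr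
    _ = _ := by norm_num

/-- The 𝒜 term is only linear in o = ‖O‖. Since c₁ ≤ 16 o, it is bounded by a quadratic term, o ≤
(16/c₁) o², which puts it on the scale of β. -/
lemma uccRadius_ge {c c₁ c₂ A β o m D : ℝ} (hc₁ : 0 < c₁) (h1 : c₁ ≤ c) (h2 : c ≤ c₂) (hm : 1 ≤ m)
    (ho : c ≤ 16 * o) (hA0 : 0 ≤ A) (hA : A ≤ 80 * (16 * o) * m) (hβ0 : 0 < β)
    (hβ : β ≤ 43700 * o ^ 2) (hD : D = 8 * c₂ * (80 * 16) * (16 / c₁) + 24 * 43700) :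
    (Real.sqrt (9 * c₁ ^ 2 / D) * (1 / (Real.sqrt m * o))) ^ 2 ≤ 9 * c ^ 2 / (8 * c * A + 24 * β) := by
  have hc : 0 < c := hc₁.trans_le h1
  have hc₂ : 0 < c₂ := hc.trans_le h2
  have ho0 : 0 < o := by linarith
  have hm0 : 0 < m := by linarith
  have hD0 : 0 < D := by rw [hD]; positivity
  rw [mul_pow, Real.sq_sqrt (by positivity), div_pow, one_pow, mul_pow, Real.sq_sqrt hm0.le,
    div_mul_div_comm, mul_one, div_le_div_iff₀ (by positivity) (by positivity)]
  have k1 : o ≤ 16 / c₁ * o ^ 2 := by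
    rw [div_mul_eq_mul_div, le_div_iff₀ hc₁]
    nlinarith
  calc 9 * c₁ ^ 2 * (8 * c * A + 24 * β)
      ≤ 9 * c₁ ^ 2 * (8 * c₂ * (80 * (16 * o) * m) + 24 * (43700 * o ^ 2)) := by gcongr
    _ = 9 * c₁ ^ 2 * (8 * c₂ * (80 * 16) * m * o + 24 * 43700 * 1 * o ^ 2) := by ring
    _ ≤ 9 * c₁ ^ 2 * (8 * c₂ * (80 * 16) * m * (16 / c₁ * o ^ 2) + 24 * 43700 * m * o ^ 2) := by
      gcongr
    _ = 9 * c₁ ^ 2 * (D * (m * o ^ 2)) := by rw [hD]; ring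
    _ ≤ 9 * c ^ 2 * (D * (m * o ^ 2)) := by gcongr

theorem relaxed_ucc_lowerPatch (c₁ c₂ : ℝ) (hc₁ : 0 < c₁) (hc₂ : c₁ ≤ c₂) : ∃ a v : ℝ, 0 < a ∧ 0 < v ∧
    ∀ (n L K : ℕ) (e : Fin K ≃ Single n ⊕ Double n) (ρ O : Op n)
      (C : Circuit n (Fin L ×ₗ Fin K) (Fin L ×ₗ Fin K))
      (Λ : Finset (Fin K)) (Λ' : Finset (Fin L ×ₗ Fin K)),
      1 ≤ L → IsDensity ρ → Λ.Nonempty →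
      C = relaxed L (fun k => uccGen (e k)) → (∀ g, g ∈ Λ' ↔ (ofLex g).2 ∈ Λ) →
      (∀ g ∈ Λ', c₁ ≤ C.curv ρ O 0 g ∧ C.curv ρ O 0 g ≤ c₂) →
      C.LowerPatch ρ O Λ' (C.rUncorr ρ O Λ')
        a (1 / (Real.sqrt (K * L) * ‖O‖))
        v (L * (Λ.card : ℝ) / (((K : ℝ) * L) ^ 2 * ‖O‖ ^ 4)) := by
  have hc₂' : 0 < c₂ := hc₁.trans_le hc₂
  obtain ⟨D, hD⟩ : ∃ D, D = 8 * c₂ * (80 * 16) * (16 / c₁) + 24 * 43700 := ⟨_, rfl⟩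
  have hD0 : 0 < D := by rw [hD]; positivity
  obtain ⟨a, ha⟩ : ∃ a, a = Real.sqrt (9 * c₁ ^ 2 / D) := ⟨_, rfl⟩
  have ha0 : 0 < a := by rw [ha]; positivity
  refine ⟨a, c₁ ^ 2 * a ^ 4 / 72, ha0, by positivity, ?_⟩
  rintro n L K e ρ O C Λ Λ' hL hρ ⟨k₀, hk₀⟩ hC hΛ hc
  have hH : ∀ k, (uccGen (e k)).IsHermitian := fun k => uccGen_isHermitian _
  have hU : C.IsUnitary := hC ▸ relaxed_isUnitary hH
  have hpar : C.par = id := by rw [hC]; rfl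
  have hω : ∀ l, maxFreq (C.gen l) ≤ 4 := fun l => by rw [hC]; exact maxFreq_uccGen_le _
  have hle : ∀ l, C.curv ρ O 0 l ≤ 16 * ‖O‖ := fun l => (curv_le hU hpar hρ O l).trans (by
    have := maxFreq_nonneg (C.gen l)
    calc _ ≤ 4 ^ 2 * ‖O‖ := by gcongr; exact hω l
      _ = _ := by norm_num)
  have hA : ∀ l, C.ampA O 0 l ≤ 80 * (16 * ‖O‖) * (K * L) := fun l => by
    rw [hC]
    exact relaxed_ampA_le hH (fun k => maxFreq_uccGen_le _) O (fun k => norm_ad_uccGen_sq_le _ O) l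
  have hg₀ : toLex (⟨0, hL⟩, k₀) ∈ Λ' := (hΛ _).2 hk₀
  have hO : 0 < ‖O‖ := by
    have := hle (toLex (⟨0, hL⟩, k₀))
    have := (hc _ hg₀).1
    linarith
  have hm : (1 : ℝ) ≤ K * L :=
    one_le_mul_of_one_le_of_one_le (Nat.one_le_cast.2 k₀.pos) (Nat.one_le_cast.2 hL)
  have hm0 : (0 : ℝ) < K * L := by linarith
  have hw : 0 < 1 / (Real.sqrt (K * L) * ‖O‖) := by positivity
  refine LowerPatch.of_guarantee (mul_pos ha0 hw) (le_rUncorr ⟨_, hg₀⟩ fun l hl => ?_)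
    (guarantee_rUncorr hU hpar hρ O Λ') ?_
  · obtain ⟨h1, h2⟩ := hc l hl
    rw [ha]
    exact uccRadius_ge hc₁ h1 h2 hm (hle l) (ampA_nonneg O l) (hA l)
      (beta_pos hU hpar hρ O (hc₁.trans_le h1)) (beta_le hU hpar O (hω l)) hD
  · have hsum : L * (Λ.card : ℝ) * c₁ ^ 2 ≤ ∑ l ∈ Λ', C.curv ρ O 0 l ^ 2 := by
      calc L * (Λ.card : ℝ) * c₁ ^ 2 = ∑ l ∈ Λ', c₁ ^ 2 := by
            rw [Finset.sum_const, card_layers hΛ, nsmul_eq_mul]; push_cast; ring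
        _ ≤ _ := Finset.sum_le_sum fun l hl => pow_le_pow_left₀ hc₁.le (hc l hl).1 2
    have e4 : Real.sqrt (K * L) ^ 4 = ((K : ℝ) * L) ^ 2 := by
      rw [show Real.sqrt (K * L) ^ 4 = (Real.sqrt (K * L) ^ 2) ^ 2 by ring, Real.sq_sqrt hm0.le]
    calc c₁ ^ 2 * a ^ 4 / 72 * (L * (Λ.card : ℝ) / (((K : ℝ) * L) ^ 2 * ‖O‖ ^ 4))
        = 1 / 72 * (L * (Λ.card : ℝ) * c₁ ^ 2) * (a * (1 / (Real.sqrt (K * L) * ‖O‖))) ^ 4 := by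
          rw [mul_pow a, div_pow, mul_pow (Real.sqrt _), e4]
          ring
      _ ≤ _ := by gcongr

/-- 32768 = 8 · 16 · 4⁴ and 1048576 = 8 · 32 · 4⁶, from the frequency bound 4. -/
lemma uccCorrRadius_ge {c₁ c₂ o k : ℝ} (hc₁ : 0 < c₁) (hc₂ : 0 < c₂) (ho : 0 < o) (hk : 0 < k) :
    Real.sqrt (9 * c₁ ^ 2 / (32768 * c₂ + 1048576)) * (1 / Real.sqrt (o * (k + o)))
      ≤ Real.sqrt (9 * c₁ ^ 2 / (8 * (16 * c₂ * o * 4 ^ 4 * k + 32 * o ^ 2 * 4 ^ 6))) := by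
  rw [mul_one_div, ← Real.sqrt_div' _ (by positivity), div_div]
  refine Real.sqrt_le_sqrt (div_le_div_of_nonneg_left (by positivity) (by positivity) ?_)
  have h1 : 0 ≤ c₂ * o ^ 2 := by positivity
  have h2 : 0 ≤ o * k := by positivity
  nlinarith

/-- Splitting k + o as (k − 1) + 1 + o, the middle unit is not covered by the sum over the other
parameters; c₁ ≤ 16 o lets the quadratic term in o pay for it. -/
lemma uccCorrRadius_le {c₁ c₂ o k : ℝ} (hc₁ : 0 < c₁) (ho : 0 < o) (hco : c₁ ≤ 16 * o)
    (hk : 1 ≤ k) :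
    Real.sqrt (9 * c₂ ^ 2 / (8 * (16 * c₁ * o * 2 ^ 4 * (k - 1) + 32 * o ^ 2 * 2 ^ 6)))
      ≤ Real.sqrt (9 * c₂ ^ 2 / (512 * min c₁ 1)) * (1 / Real.sqrt (o * (k + o))) := by
  have hk0 : 0 < k := by linarith
  obtain ⟨m, hm⟩ : ∃ m, m = min c₁ 1 := ⟨_, rfl⟩
  have hm0 : 0 < m := hm ▸ lt_min hc₁ one_pos
  have hm1 : m ≤ c₁ := hm ▸ min_le_left _ _
  have hm2 : m ≤ 1 := hm ▸ min_le_right _ _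
  rw [← hm, mul_one_div, ← Real.sqrt_div' _ (by positivity), div_div]
  refine Real.sqrt_le_sqrt (div_le_div_of_nonneg_left (by positivity) (by positivity) ?_)
  have h1 : m * (o * (k - 1)) ≤ c₁ * (o * (k - 1)) :=
    mul_le_mul_of_nonneg_right hm1 (mul_nonneg ho.le (by linarith))
  have h2 : m * o ≤ 16 * o * o := mul_le_mul_of_nonneg_right (by linarith) ho.le
  have h3 : m * o ^ 2 ≤ 1 * o ^ 2 := mul_le_mul_of_nonneg_right hm2 (by positivity)
  have h4 : 0 ≤ c₁ * (o * (k - 1)) := mul_nonneg hc₁.le (mul_nonneg ho.le (by linarith))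
  nlinarith [sq_nonneg o]

theorem trotter_ucc_sharpPatch (c₁ c₂ : ℝ) (hc₁ : 0 < c₁) (hc₂ : c₁ ≤ c₂) :
    ∃ a b v : ℝ, 0 < a ∧ 0 < b ∧ 0 < v ∧
    ∀ (n L K : ℕ) (e : Fin K ≃ Single n ⊕ Double n) (ρ O : Op n)
      (C : Circuit n (Fin L ×ₗ Fin K) (Fin K)) (p : Fin K),
      1 ≤ L → IsDensity ρ →
      C = trotter L (fun k => uccGen (e k)) →
      c₁ * (L : ℝ) ^ 2 ≤ C.curv ρ O 0 p → C.curv ρ O 0 p ≤ c₂ * (L : ℝ) ^ 2 →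
      C.SharpPatch ρ O {p} (C.rCorr ρ O p)
        a b (1 / (L * Real.sqrt (‖O‖ * (K + ‖O‖))))
        v (1 / (‖O‖ ^ 2 * (K + ‖O‖) ^ 2)) := by
  have hc₂' : 0 < c₂ := hc₁.trans_le hc₂
  obtain ⟨a, ha⟩ : ∃ a, a = Real.sqrt (9 * c₁ ^ 2 / (32768 * c₂ + 1048576)) := ⟨_, rfl⟩
  have ha0 : 0 < a := by rw [ha]; positivity
  refine ⟨a, Real.sqrt (9 * c₂ ^ 2 / (512 * min c₁ 1)), c₁ ^ 2 * a ^ 4 / 72, ha0,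
    Real.sqrt_pos.2 (div_pos (by positivity) (mul_pos (by norm_num) (lt_min hc₁ one_pos))),
    by positivity, ?_⟩
  rintro n L K e ρ O C p hL1 hρ hC h1 h2
  have hH : ∀ k, (uccGen (e k)).IsHermitian := fun k => uccGen_isHermitian _
  have hU : C.IsUnitary := hC ▸ trotter_isUnitary hH
  have hL : (0 : ℝ) < L := Nat.cast_pos.2 hL1
  have hcurv : C.curv ρ O 0 p = L ^ 2 * |expect ρ ((ad (uccGen (e p)) ^ 2) O)| :=
    hC ▸ trotter_curv hH ρ O p
  rw [hcurv] at h1 h2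
  have h1' : c₁ ≤ |expect ρ ((ad (uccGen (e p)) ^ 2) O)| :=
    le_of_mul_le_mul_left (by linarith : (L : ℝ) ^ 2 * c₁ ≤ _) (by positivity : (0 : ℝ) < (L : ℝ) ^ 2)
  have h2' : |expect ρ ((ad (uccGen (e p)) ^ 2) O)| ≤ c₂ :=
    le_of_mul_le_mul_left (by linarith : _ ≤ (L : ℝ) ^ 2 * c₂) (by positivity : (0 : ℝ) < (L : ℝ) ^ 2)
  have hco : c₁ ≤ 16 * ‖O‖ := h1'.trans ((abs_expect_le hρ _).trans (norm_ad_uccGen_sq_le _ O))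
  have ho : 0 < ‖O‖ := by linarith
  have hK1 : (1 : ℝ) ≤ K := Nat.one_le_cast.2 p.pos
  have hK0 : (0 : ℝ) < K := by linarith
  obtain ⟨-, -, hlo⟩ := trotter_rCorr_ge hH hL1 hρ p hc₁ h1' h2' le_rfl fun k => maxFreq_uccGen_le (e k)
  have hup := trotter_rCorr_le hH hL1 p hc₁ h1' h2' ho le_rfl two_pos
    fun k => two_le_maxFreq_uccGen (e k)
  rw [← hC] at hlo hup
  have ew : ∀ x : ℝ, x * (1 / (L * Real.sqrt (‖O‖ * (K + ‖O‖))))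
      = x * (1 / Real.sqrt (‖O‖ * (K + ‖O‖))) / L := by
    intro x; field_simp
  have hw : 0 < 1 / (L * Real.sqrt (‖O‖ * (K + ‖O‖))) := by positivity
  refine SharpPatch.of_guarantee (mul_pos ha0 hw) (le_trans ?_ hlo) (hup.trans ?_)
    (guarantee_rCorr hU hρ O p) ?_
  · rw [ew, ha]
    exact div_le_div_of_nonneg_right (uccCorrRadius_ge hc₁ hc₂' ho hK0) hL.le
  · rw [ew]
    exact div_le_div_of_nonneg_right (uccCorrRadius_le hc₁ ho hco hK1) hL.le
  · rw [Finset.sum_singleton, hcurv]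
    have e4 : Real.sqrt (‖O‖ * (K + ‖O‖)) ^ 4 = (‖O‖ * (K + ‖O‖)) ^ 2 := by
      rw [show Real.sqrt (‖O‖ * (K + ‖O‖)) ^ 4 = (Real.sqrt (‖O‖ * (K + ‖O‖)) ^ 2) ^ 2 by ring,
        Real.sq_sqrt (by positivity)]
    calc c₁ ^ 2 * a ^ 4 / 72 * (1 / (‖O‖ ^ 2 * (K + ‖O‖) ^ 2))
        = 1 / 72 * ((L : ℝ) ^ 2 * c₁) ^ 2 * (a * (1 / (L * Real.sqrt (‖O‖ * (K + ‖O‖))))) ^ 4 := by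
          rw [mul_pow a, div_pow, mul_pow (L : ℝ) _ 4, e4]
          field_simp
      _ ≤ _ := by gcongr

end UCC

/-! ## The ring of `σ_z σ_z` couplings -/

section Couplings

variable {n : ℕ}

/-- The bonds of the ring joining unequal bits. -/
def walls (b : Fin n → Fin 2) : Finset (Fin n) :=
  Finset.univ.filter fun i => b i ≠ b (finRotate n i)

/-- Each bond contributes +1 between equal bits and −1 across a domain wall. -/
lemma zzRing_mulVec (hn : 2 ≤ n) (b : Fin n → Fin 2) :
    zzRing n *ᵥ basisKet b = ((n - 2 * (walls b).card : ℝ) : ℂ) • basisKet b := by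
  have h : ∀ i, pauliString (bond 2 i) *ᵥ basisKet b
      = (1 - 2 * (if b i ≠ b (finRotate n i) then (1 : ℂ) else 0)) • basisKet b := by
    intro i
    rw [basisKet, bond_z_mulVec_productKet hn]
    congr 1
    generalize b i = x
    generalize b (finRotate n i) = y
    fin_cases x <;> fin_cases y <;> simp <;> norm_num
  rw [zzRing, pauliSum, Matrix.sum_mulVec, Finset.sum_congr rfl fun i _ => h i, ← Finset.sum_smul]
  congr 1
  rw [Finset.sum_sub_distrib, ← Finset.mul_sum, Finset.sum_boole]
  simp [walls]

lemma norm_zzRing (hn : 2 ≤ n) : ‖zzRing n‖ = n := by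
  refine le_antisymm ((norm_pauliSum_le _).trans (by rw [Fintype.card_fin])) ?_
  have h := abs_expect_le (isDensity_basisKet (fun _ : Fin n => 0)) (zzRing n)
  refine le_trans (le_of_eq ?_) ((le_abs_self _).trans h)
  rw [expect_pureState, zzRing_mulVec hn, dotProduct_smul, basisKet_inner]
  simp [walls]

/-- The double commutator enters as 2HOH − H²O − OH². The first term evaluates `O` at the excited
basis state, the other two at the original one. -/
lemma expect_ad_sq_of_mulVec {H O : Op n} (hH : H.IsHermitian) (hOh : O.IsHermitian) {b b' : Fin n → Fin 2} {z : ℂ}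
    (hz : ‖z‖ = 1) (h : H *ᵥ basisKet b = z • basisKet b') {E E' : ℝ}
    (hO : O *ᵥ basisKet b = (E : ℂ) • basisKet b) (hO' : O *ᵥ basisKet b' = (E' : ℂ) • basisKet b') :
    expect (pureState (basisKet b)) ((ad H ^ 2) O) = 2 * (E' - E) := by
  have hl : ∀ v, star (basisKet b) ⬝ᵥ (H *ᵥ v) = star (z • basisKet b') ⬝ᵥ v := by
    intro v
    rw [Matrix.dotProduct_mulVec, ← h, Matrix.star_mulVec, hH.eq]
  have hzz : star z * z = 1 := by
    rw [Complex.star_def, Complex.conj_mul', hz]; simp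
  have e1 : star (basisKet b) ⬝ᵥ ((H * (H * O)) *ᵥ basisKet b) = E := by
    rw [← Matrix.mulVec_mulVec, ← Matrix.mulVec_mulVec, hO, hl, Matrix.mulVec_smul, h]
    simp only [star_smul, smul_dotProduct, dotProduct_smul, basisKet_inner, smul_eq_mul, mul_one]
    linear_combination (E : ℂ) * hzz
  have e2 : star (basisKet b) ⬝ᵥ ((H * O * H) *ᵥ basisKet b) = E' := by
    rw [← Matrix.mulVec_mulVec, ← Matrix.mulVec_mulVec, h, hl, Matrix.mulVec_smul, hO']
    simp only [star_smul, smul_dotProduct, dotProduct_smul, basisKet_inner, smul_eq_mul, mul_one]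
    linear_combination (E' : ℂ) * hzz
  have e3 : star (basisKet b) ⬝ᵥ ((O * (H * H)) *ᵥ basisKet b) = E := by
    have hlO : ∀ v, star (basisKet b) ⬝ᵥ (O *ᵥ v) = star ((E : ℂ) • basisKet b) ⬝ᵥ v := by
      intro v
      rw [Matrix.dotProduct_mulVec, ← hO, Matrix.star_mulVec, hOh.eq]
    rw [← Matrix.mulVec_mulVec, hlO, star_smul, smul_dotProduct, ← Matrix.mulVec_mulVec, hl, h]
    simp only [star_smul, smul_dotProduct, dotProduct_smul, basisKet_inner, smul_eq_mul, mul_one]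
    rw [show star (E : ℂ) = E from Complex.conj_ofReal E]
    linear_combination (E : ℂ) * hzz
  have e : (ad H ^ 2) O = H * O * H + H * O * H - H * (H * O) - O * (H * H) := by
    rw [ad_sq_apply]; noncomm_ring
  rw [e, expect_pureState, Matrix.sub_mulVec, Matrix.sub_mulVec, Matrix.add_mulVec, dotProduct_sub,
    dotProduct_sub, dotProduct_add, e1, e2, e3]
  simp
  ring

/-- An excitation acts on at most 4 sites and so meets at most 8 bonds; each costs at most 4² = 16.
The point is that the bound does not depend on n, unlike 16‖O‖. -/
lemma norm_ad_uccGen_sq_zzRing_le (x : Single n ⊕ Double n) :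
    ‖(ad (uccGen x) ^ 2) (zzRing n)‖ ≤ 128 := by
  classical
  set S : Finset (Fin n) := (sites x).biUnion fun q => Finset.univ.filter fun i => bond 2 i q ≠ 0 with hS
  have hcard : S.card ≤ 8 := by
    refine (Finset.card_biUnion_le_card_mul _ _ 2 fun q _ => card_bond_touching 2 q).trans ?_
    have := card_sites_le x
    omega
  have h0 : ∀ i ∉ S, (ad (uccGen x) ^ 2) (pauliString (bond 2 i)) = 0 := by
    intro i hi
    refine ad_pow_eq_zero (uccGen_commute fun q hq => ?_) two_ne_zero
    by_contra hne
    exact hi (Finset.mem_biUnion.2 ⟨q, hq, Finset.mem_filter.2 ⟨Finset.mem_univ _, hne⟩⟩)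
  have h1 : (ad (uccGen x) ^ 2) (zzRing n)
      = ∑ i ∈ S, (ad (uccGen x) ^ 2) (pauliString (bond 2 i)) := by
    rw [zzRing, pauliSum, map_sum]
    exact (Finset.sum_subset (Finset.subset_univ S) fun i _ hi => h0 i hi).symm
  rw [h1]
  refine (norm_sum_le_of_le _ (n := fun _ => (16 : ℝ)) fun i _ => ?_).trans ?_
  · have := norm_ad_uccGen_sq_le x (pauliString (bond 2 i))
    rwa [norm_pauliString, mul_one] at this
  · rw [Finset.sum_const, nsmul_eq_mul]
    have : (S.card : ℝ) ≤ 8 := by exact_mod_cast hcard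
    linarith

/-! ### Integrality of the curvature -/

/-- Operators with integer matrix elements. -/
noncomputable def intOps (n : ℕ) : Subring (Op n) := ((Int.castRingHom ℂ).mapMatrix).range

lemma tensor_mem_intOps {A : Fin n → Matrix (Fin 2) (Fin 2) ℂ} {M : Fin n → Matrix (Fin 2) (Fin 2) ℤ}
    (h : ∀ j, A j = (M j).map (Int.castRingHom ℂ)) : tensor A ∈ intOps n := by
  refine ⟨fun b b' => ∏ j, M j (b j) (b' j), ?_⟩
  ext b b'
  change ((∏ j, M j (b j) (b' j) : ℤ) : ℂ) = ∏ j, A j (b j) (b' j)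
  push_cast
  exact Finset.prod_congr rfl fun j _ => by rw [h]; rfl

lemma onQubit_mem_intOps (p : Fin n) (M : Matrix (Fin 2) (Fin 2) ℤ) :
    onQubit p (M.map (Int.castRingHom ℂ)) ∈ intOps n := by
  refine tensor_mem_intOps (M := Function.update 1 p M) fun j => ?_
  by_cases h : j = p
  · subst h; simp
  · simp [h]

lemma lowering_mem_intOps (p : Fin n) : lowering p ∈ intOps n := by
  rw [lowering_eq]
  convert onQubit_mem_intOps p !![0, 1; 0, 0] using 2
  ext x y; fin_cases x <;> fin_cases y <;> simp

lemma raising_mem_intOps (p : Fin n) : (lowering p)ᴴ ∈ intOps n := by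
  rw [lowering_conjTranspose_eq]
  convert onQubit_mem_intOps p !![0, 0; 1, 0] using 2
  ext x y; fin_cases x <;> fin_cases y <;> simp

lemma zzRing_mem_intOps : zzRing n ∈ intOps n := by
  rw [zzRing, pauliSum]
  refine Subring.sum_mem (intOps n) fun i _ => ?_
  refine tensor_mem_intOps (M := fun j => if j = i ∨ j = finRotate n i then !![1, 0; 0, -1] else 1)
    fun j => ?_
  unfold bond
  split_ifs
  · ext x y; fin_cases x <;> fin_cases y <;> simp [pauli]
  · simp [pauli]

lemma exists_int_expect (b : Fin n → Fin 2) {X : Op n} (hX : X ∈ intOps n) :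
    ∃ k : ℤ, expect (pureState (basisKet b)) X = k := by
  obtain ⟨M, rfl⟩ := hX
  exact ⟨M b b, by rw [expect_basisKet]; simp⟩

/-- The two factors i, in the generator and in `ad`, combine to −1, leaving an integer commutator
with τ − τ†. -/
lemma ad_uccGen_sq_mem_intOps (x : Single n ⊕ Double n) {X : Op n} (hX : X ∈ intOps n) :
    (ad (uccGen x) ^ 2) X ∈ intOps n := by
  have hτ : excitation x ∈ intOps n := by
    rcases x with x | x
    · exact Subring.mul_mem _ (raising_mem_intOps _) (lowering_mem_intOps _)
    · exact Subring.mul_mem _ (Subring.mul_mem _ (Subring.mul_mem _ (raising_mem_intOps _)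
        (raising_mem_intOps _)) (lowering_mem_intOps _)) (lowering_mem_intOps _)
  have hτ' : (excitation x)ᴴ ∈ intOps n := by
    obtain ⟨M, hM⟩ := hτ
    refine ⟨Mᵀ, ?_⟩
    rw [← hM]
    ext b b'
    simp
  have key : ∀ Y ∈ intOps n, ad (uccGen x) Y ∈ intOps n := by
    intro Y hY
    have e : ad (uccGen x) Y = -((excitation x - (excitation x)ᴴ) * Y
        - Y * (excitation x - (excitation x)ᴴ)) := by
      rw [ad_apply, uccGen, smul_mul_assoc, mul_smul_comm, ← smul_sub, smul_smul, Complex.I_mul_I,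
        neg_one_smul]
    rw [e]
    have hN := Subring.sub_mem _ hτ hτ'
    exact Subring.neg_mem _ (Subring.sub_mem _ (Subring.mul_mem _ hN hY) (Subring.mul_mem _ hY hN))
  rw [pow_two, Module.End.mul_apply]
  exact key _ (key _ hX)

/-- A diagonal entry of an integer matrix is an integer, so no list of the possible curvatures is
needed. -/
lemma one_le_abs_expect (b : Fin n → Fin 2) (x : Single n ⊕ Double n)
    (h : expect (pureState (basisKet b)) ((ad (uccGen x) ^ 2) (zzRing n)) ≠ 0) :
    1 ≤ |expect (pureState (basisKet b)) ((ad (uccGen x) ^ 2) (zzRing n))| := by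
  obtain ⟨k, hk⟩ := exists_int_expect b (ad_uccGen_sq_mem_intOps x zzRing_mem_intOps)
  rw [hk] at h ⊢
  have : (1 : ℤ) ≤ |k| := Int.one_le_abs (by exact_mod_cast h)
  exact_mod_cast this

end Couplings

/-! ## The half-filled state -/

section HalfFilled

variable {n : ℕ}

/-- The bit string of the half-filled state. -/
def halfBits (n : ℕ) : Fin n → Fin 2 := fun j => if j.val < n / 2 then 1 else 0

lemma halfFilled_eq (n : ℕ) : halfFilled n = pureState (basisKet (halfBits n)) := by
  rw [halfFilled, basisKet]
  congr 2
  funext j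
  unfold halfBits
  split_ifs <;> rfl

/-- The only walls are in the middle and at the closing bond of the ring. -/
lemma card_walls_halfBits_le (hn : 4 ≤ n) (he : Even n) : (walls (halfBits n)).card ≤ 2 := by
  refine (Finset.card_le_card (t := {⟨n / 2 - 1, by omega⟩, ⟨n - 1, by omega⟩}) fun i hi => ?_).trans
    Finset.card_le_two
  have hv := val_finRotate i
  have hi := (Finset.mem_filter.1 hi).2
  rw [Finset.mem_insert, Finset.mem_singleton, Fin.ext_iff, Fin.ext_iff]
  unfold halfBits at hi
  by_contra hne
  push Not at hne
  obtain ⟨m, hm⟩ := he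
  have := i.isLt
  simp only at hne
  split_ifs at hi hv <;> first | exact hi rfl | omega

lemma four_le_card_walls {b : Fin n → Fin 2} {i₁ i₂ i₃ i₄ : Fin n} (h₁ : i₁ ∈ walls b)
    (h₂ : i₂ ∈ walls b) (h₃ : i₃ ∈ walls b) (h₄ : i₄ ∈ walls b) (h : i₁ ≠ i₂ ∧ i₁ ≠ i₃ ∧ i₁ ≠ i₄ ∧
      i₂ ≠ i₃ ∧ i₂ ≠ i₄ ∧ i₃ ≠ i₄) : 4 ≤ (walls b).card := by
  have : ({i₁, i₂, i₃, i₄} : Finset (Fin n)).card = 4 := by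
    obtain ⟨a, b, c, d, e, f⟩ := h
    rw [Finset.card_insert_of_notMem, Finset.card_insert_of_notMem, Finset.card_insert_of_notMem,
      Finset.card_singleton] <;> simp [*]
  rw [← this]
  refine Finset.card_le_card fun i hi => ?_
  simp only [Finset.mem_insert, Finset.mem_singleton] at hi
  rcases hi with rfl | rfl | rfl | rfl <;> assumption

/-- Going from at most 2 to at least 4 walls lowers the energy by at least 4, and the curvature is
twice the energy difference. -/
lemma abs_expect_halfFilled_ge (hn : 4 ≤ n) (he : Even n) {x : Single n ⊕ Double n}
    {b' : Fin n → Fin 2} (h : uccGen x *ᵥ basisKet (halfBits n) = Complex.I • basisKet b')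
    (hb' : 4 ≤ (walls b').card) :
    8 ≤ |expect (halfFilled n) ((ad (uccGen x) ^ 2) (zzRing n))| := by
  have hn2 : 2 ≤ n := by omega
  rw [halfFilled_eq, expect_ad_sq_of_mulVec (uccGen_isHermitian x)
    (show (zzRing n).IsHermitian from pauliSum_isHermitian _) Complex.norm_I h (zzRing_mulVec hn2 _) (zzRing_mulVec hn2 _)]
  have h1 : ((walls (halfBits n)).card : ℝ) ≤ 2 := by exact_mod_cast card_walls_halfBits_le hn he
  have h2 : (4 : ℝ) ≤ (walls b').card := by exact_mod_cast hb'
  rw [abs_of_nonpos (by linarith)]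
  linarith

/-- The excitation from the last occupied to the first empty qubit. -/
lemma abs_expect_single_mid (hn : 4 ≤ n) (he : Even n) (x : Single n)
    (hx : x.1.1.val = n / 2 ∧ x.1.2.val = n / 2 - 1) :
    8 ≤ |expect (halfFilled n) ((ad (uccGen (.inl x)) ^ 2) (zzRing n))| := by
  obtain ⟨m, hm⟩ := he
  refine abs_expect_halfFilled_ge hn ⟨m, hm⟩ (uccGen_single_mulVec x ?_ ?_)
    (four_le_card_walls (i₁ := ⟨n / 2 - 2, by omega⟩) (i₂ := ⟨n / 2 - 1, by omega⟩)
      (i₃ := ⟨n / 2, by omega⟩) (i₄ := ⟨n - 1, by omega⟩) ?_ ?_ ?_ ?_ ?_)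
  · exact if_pos (by omega)
  · exact if_neg (by omega)
  all_goals try
    refine Finset.mem_filter.2 ⟨Finset.mem_univ _, ?_⟩
    simp only [Function.update_apply, Fin.ext_iff, val_finRotate, halfBits, hx.1, hx.2]
    split_ifs <;> first | decide | (exfalso; omega)
  simp only [Ne, Fin.ext_iff]
  omega

/-- The excitation from the first to the last qubit. -/
lemma abs_expect_single_ends (hn : 4 ≤ n) (he : Even n) (x : Single n)
    (hx : x.1.1.val = n - 1 ∧ x.1.2.val = 0) :
    8 ≤ |expect (halfFilled n) ((ad (uccGen (.inl x)) ^ 2) (zzRing n))| := by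
  obtain ⟨m, hm⟩ := he
  refine abs_expect_halfFilled_ge hn ⟨m, hm⟩ (uccGen_single_mulVec x ?_ ?_)
    (four_le_card_walls (i₁ := ⟨0, by omega⟩) (i₂ := ⟨n / 2 - 1, by omega⟩)
      (i₃ := ⟨n - 2, by omega⟩) (i₄ := ⟨n - 1, by omega⟩) ?_ ?_ ?_ ?_ ?_)
  · exact if_pos (by omega)
  · exact if_neg (by omega)
  all_goals try
    refine Finset.mem_filter.2 ⟨Finset.mem_univ _, ?_⟩
    simp only [Function.update_apply, Fin.ext_iff, val_finRotate, halfBits, hx.1, hx.2]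
    split_ifs <;> first | decide | (exfalso; omega)
  simp only [Ne, Fin.ext_iff]
  omega

/-- Double excitations that create two separated holes in the occupied half. -/
lemma abs_expect_double (hn : 4 ≤ n) (he : Even n) (x : Double n)
    (hs : 1 ≤ x.1.2.2.2.val) (hr : x.1.2.2.2.val + 2 ≤ x.1.2.2.1.val)
    (hr' : x.1.2.2.1.val + 2 ≤ n / 2) (hq : n / 2 ≤ x.1.2.1.val) :
    8 ≤ |expect (halfFilled n) ((ad (uccGen (.inr x)) ^ 2) (zzRing n))| := by
  have hsr := x.2.1
  have hrq := x.2.2.1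
  have hqp := x.2.2.2
  have hp := x.1.1.isLt
  have h1 := uccGen_double_mulVec (b := halfBits n) x (if_pos (by omega)) (if_pos (by omega))
    (if_neg (by omega)) (if_neg (by omega))
  refine abs_expect_halfFilled_ge hn he h1 ?_
  generalize hb' : Function.update (Function.update (Function.update (Function.update (halfBits n)
    x.1.2.2.2 0) x.1.2.2.1 0) x.1.2.1 1) x.1.1 1 = b'
  have hocc : ∀ j : Fin n, j.val < n / 2 → j ≠ x.1.2.2.1 → j ≠ x.1.2.2.2 → b' j = 1 := by
    intro j hj h3 h4
    rw [← hb']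
    simp only [Function.update_apply, h3, h4, if_false]
    split_ifs
    · rfl
    · rfl
    · exact if_pos hj
  have hempty : ∀ j : Fin n, j = x.1.2.2.1 ∨ j = x.1.2.2.2 → b' j = 0 := by
    intro j hj
    rw [← hb']
    have e1 : j ≠ x.1.1 := by rintro rfl; rcases hj with hj | hj <;> rw [Fin.ext_iff] at hj <;> omega
    have e2 : j ≠ x.1.2.1 := by rintro rfl; rcases hj with hj | hj <;> rw [Fin.ext_iff] at hj <;> omega
    simp only [Function.update_apply, e1, e2, if_false]
    rcases hj with rfl | rfl <;> simp
  have hwall : ∀ i j : Fin n, j.val = i.val + 1 → b' i ≠ b' j → i ∈ walls b' := by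
    intro i j hij hne
    have : finRotate n i = j := Fin.ext (by rw [val_finRotate, if_neg (by omega), hij])
    exact Finset.mem_filter.2 ⟨Finset.mem_univ _, by rwa [this]⟩
  have key : ∀ i j : Fin n, j.val = i.val + 1 → (b' i = 1 ∧ b' j = 0) ∨ (b' i = 0 ∧ b' j = 1) →
      i ∈ walls b' := by
    rintro i j hij (⟨h, h'⟩ | ⟨h, h'⟩) <;> exact hwall i j hij (by rw [h, h']; decide)
  -- The walls are the two sides of each hole. The spacing hypotheses keep all four neighbours
  -- inside the occupied half and different from the holes.
  refine four_le_card_walls (i₁ := ⟨x.1.2.2.2.val - 1, by omega⟩) (i₂ := x.1.2.2.2)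
    (i₃ := ⟨x.1.2.2.1.val - 1, by omega⟩) (i₄ := x.1.2.2.1)
    (key _ x.1.2.2.2 (by simp only; omega) (.inl ⟨hocc _ ?_ ?_ ?_, hempty _ (.inr rfl)⟩))
    (key _ ⟨x.1.2.2.2.val + 1, by omega⟩ rfl (.inr ⟨hempty _ (.inr rfl), hocc _ ?_ ?_ ?_⟩))
    (key _ x.1.2.2.1 (by simp only; omega) (.inl ⟨hocc _ ?_ ?_ ?_, hempty _ (.inl rfl)⟩))
    (key _ ⟨x.1.2.2.1.val + 1, by omega⟩ rfl (.inr ⟨hempty _ (.inl rfl), hocc _ ?_ ?_ ?_⟩)) ?_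
  all_goals simp only [Ne, Fin.ext_iff]
  all_goals omega

end HalfFilled

/-! ## Unitary coupled cluster for the half-filled state -/

section Counting

variable {n : ℕ}

/-- The excitations in whose direction the loss is curved. -/
noncomputable def curvedExcitations (n : ℕ) : Finset (Single n ⊕ Double n) :=
  open Classical in
  Finset.univ.filter fun x => expect (halfFilled n) ((ad (uccGen x) ^ 2) (zzRing n)) ≠ 0

lemma mem_curvedExcitations {x : Single n ⊕ Double n} :
    x ∈ curvedExcitations n ↔ expect (halfFilled n) ((ad (uccGen x) ^ 2) (zzRing n)) ≠ 0 := by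
  simp [curvedExcitations]

lemma mem_curvedExcitations_of_le {x : Single n ⊕ Double n}
    (h : 8 ≤ |expect (halfFilled n) ((ad (uccGen x) ^ 2) (zzRing n))|) : x ∈ curvedExcitations n :=
  mem_curvedExcitations.2 fun h0 => by rw [h0] at h; norm_num at h

/-- Covers small n, where the family of double excitations may be empty; two elements are also what
`ampA_max_ge` requires. -/
lemma two_le_card_curvedExcitations (hn : 4 ≤ n) (he : Even n) : 2 ≤ (curvedExcitations n).card := by
  have h1 : (⟨n / 2 - 1, by omega⟩ : Fin n) < ⟨n / 2, by omega⟩ := by rw [Fin.mk_lt_mk]; omega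
  have h2 : (⟨0, by omega⟩ : Fin n) < ⟨n - 1, by omega⟩ := by rw [Fin.mk_lt_mk]; omega
  refine Finset.one_lt_card.2 ⟨.inl ⟨(_, _), h1⟩, mem_curvedExcitations_of_le
    (abs_expect_single_mid hn he _ ⟨rfl, rfl⟩), .inl ⟨(_, _), h2⟩, mem_curvedExcitations_of_le
    (abs_expect_single_ends hn he _ ⟨rfl, rfl⟩), fun h => ?_⟩
  have := congrArg (fun x : Single n => x.1.1.val) (Sum.inl.inj h)
  simp only at this
  omega

/-- With m = (n/2 − 3)/2 the holes are chosen in 1, …, m and m + 2, …, 2m + 1, and the targets in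
two consecutive blocks of length m of the empty half. The gaps guarantee separated holes for every
choice. -/
lemma pow_le_card_curvedExcitations (hn : 4 ≤ n) (he : Even n) :
    ((n / 2 - 3) / 2) ^ 4 ≤ (curvedExcitations n).card := by
  obtain ⟨m, hm⟩ : ∃ m, m = (n / 2 - 3) / 2 := ⟨_, rfl⟩
  have hcard : Fintype.card (Fin m × Fin m × Fin m × Fin m) = m ^ 4 := by
    simp only [Fintype.card_prod, Fintype.card_fin]; ring
  obtain ⟨k, hk⟩ := id he
  rw [← hm, ← hcard]
  refine Finset.card_le_card_of_injOn (s := Finset.univ)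
    (fun x => .inr ⟨(⟨n / 2 + m + x.1.val, by omega⟩, ⟨n / 2 + x.2.1.val, by omega⟩,
      ⟨m + 2 + x.2.2.1.val, by omega⟩, ⟨1 + x.2.2.2.val, by omega⟩), by
        simp only [Fin.mk_lt_mk]; omega⟩) (fun x _ => ?_) fun x _ y _ hxy => ?_
  · refine mem_curvedExcitations_of_le (abs_expect_double hn he _ ?_ ?_ ?_ ?_) <;> simp only <;> omega
  · simp only [Sum.inr.injEq, Subtype.mk.injEq, Prod.mk.injEq, Fin.mk.injEq] at hxy
    obtain ⟨h1, h2, h3, h4⟩ := hxy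
    simp only [Prod.ext_iff, Fin.ext_iff]
    omega

/-- 41472 = 2 · 12⁴: there are at most n² + n⁴ ≤ 2n⁴ excitations, and n ≤ 12m with m = (n/2 − 3)/2
once n ≥ 10. For n ≤ 8 two curved excitations are enough. -/
lemma card_excitations_le (hn : 4 ≤ n) (he : Even n) :
    Fintype.card (Single n ⊕ Double n) ≤ 41472 * (curvedExcitations n).card := by
  have h1 : Fintype.card (Single n) ≤ n ^ 2 := (Fintype.card_subtype_le _).trans (by
    simp only [Fintype.card_prod, Fintype.card_fin]; exact le_of_eq (by ring))
  have h2 : Fintype.card (Double n) ≤ n ^ 4 := (Fintype.card_subtype_le _).trans (by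
    simp only [Fintype.card_prod, Fintype.card_fin]; exact le_of_eq (by ring))
  have h3 := two_le_card_curvedExcitations hn he
  have h4 := pow_le_card_curvedExcitations hn he
  rw [Fintype.card_sum]
  by_cases h8 : n ≤ 8
  · have h5 : n ^ 2 ≤ 8 ^ 2 := Nat.pow_le_pow_left h8 2
    have h6 : n ^ 4 ≤ 8 ^ 4 := Nat.pow_le_pow_left h8 4
    omega
  · obtain ⟨k, hk⟩ := he
    have h5 : n ^ 4 ≤ (12 * ((n / 2 - 3) / 2)) ^ 4 := Nat.pow_le_pow_left (by omega) 4
    have h6 : n ^ 2 ≤ n ^ 4 := Nat.pow_le_pow_right (by omega) (by omega)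
    rw [mul_pow] at h5
    omega

/-- The single excitations from the lower to the upper half already number (n/2)². -/
lemma sq_le_card_excitations (he : Even n) : n ^ 2 ≤ 4 * Fintype.card (Single n ⊕ Double n) := by
  obtain ⟨h, hh⟩ := he
  have key : Fintype.card (Fin h × Fin h) ≤ Fintype.card (Single n ⊕ Double n) := by
    refine Fintype.card_le_of_injective (fun x => .inl ⟨(⟨h + x.1.val, by omega⟩, ⟨x.2.val, by omega⟩), by
      simp only [Fin.mk_lt_mk]; omega⟩) fun x y hxy => ?_
    simp only [Sum.inl.injEq, Subtype.mk.injEq, Prod.mk.injEq, Fin.mk.injEq] at hxy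
    obtain ⟨h1, h2⟩ := hxy
    simp only [Prod.ext_iff, Fin.ext_iff]
    omega
  simp only [Fintype.card_prod, Fintype.card_fin] at key
  calc n ^ 2 = 4 * (h * h) := by rw [hh]; ring
    _ ≤ _ := by omega

end Counting

section Half

variable {n K L : ℕ}

lemma isDensity_halfFilled (n : ℕ) : IsDensity (halfFilled n) := by
  rw [halfFilled_eq]; exact isDensity_basisKet _

lemma one_le_abs_expect_halfFilled {x : Single n ⊕ Double n} (hx : x ∈ curvedExcitations n) :
    1 ≤ |expect (halfFilled n) ((ad (uccGen x) ^ 2) (zzRing n))| := by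
  have h := mem_curvedExcitations.1 hx
  rw [halfFilled_eq] at h ⊢
  exact one_le_abs_expect _ x h

lemma abs_expect_halfFilled_le (x : Single n ⊕ Double n) :
    |expect (halfFilled n) ((ad (uccGen x) ^ 2) (zzRing n))| ≤ 128 :=
  (abs_expect_le (isDensity_halfFilled n) _).trans (norm_ad_uccGen_sq_zzRing_le x)

/-- `𝒜_l` at the last of a set of curved parameters grows with their number. -/
lemma ampA_max_ge {G : Type} [LinearOrder G] [Fintype G] {C : Circuit n G G} (hC : C.IsUnitary)
    (hpar : C.par = id) {ρ : Op n} (hρ : IsDensity ρ) (O : Op n) {Λ : Finset G} (hΛ : 2 ≤ Λ.card)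
    (hc : ∀ l ∈ Λ, 1 ≤ C.curv ρ O 0 l) (hω : ∀ l, 2 ≤ maxFreq (C.gen l)) (hne : Λ.Nonempty) :
    8 * (Λ.card : ℝ) ≤ C.ampA O 0 (Λ.max' hne) := by
  set l := Λ.max' hne with hl
  have h1 : ((Λ.erase l).card : ℝ)
      ≤ ∑ μ ∈ Finset.univ.filter (fun μ => μ < l), C.effFreq O 0 μ ^ 2 := by
    have hsub : Λ.erase l ⊆ Finset.univ.filter (fun μ => μ < l) := fun μ hμ =>
      Finset.mem_filter.2 ⟨Finset.mem_univ _, lt_of_le_of_ne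
        (Λ.le_max' μ (Finset.mem_of_mem_erase hμ)) (Finset.ne_of_mem_erase hμ)⟩
    calc ((Λ.erase l).card : ℝ) = ∑ μ ∈ Λ.erase l, 1 := by simp
      _ ≤ ∑ μ ∈ Λ.erase l, C.effFreq O 0 μ ^ 2 := Finset.sum_le_sum fun μ hμ =>
        (hc μ (Finset.mem_of_mem_erase hμ)).trans (curv_le_effFreq_sq hC hpar hρ O μ)
      _ ≤ _ := Finset.sum_le_sum_of_subset_of_nonneg hsub fun _ _ _ => sq_nonneg _
  rw [Finset.card_erase_of_mem (Λ.max'_mem hne), Nat.cast_sub (by omega)] at h1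
  have h2 : (0 : ℝ) ≤ ∑ μ ∈ Finset.univ.filter (fun μ => l < μ), C.effFreq2 O 0 l μ ^ 2 :=
    Finset.sum_nonneg fun _ _ => sq_nonneg _
  have h3 : (2 : ℝ) ≤ Λ.card := by exact_mod_cast hΛ
  -- Each earlier curved parameter contributes at least 4 · 2² · 1, so 𝒜 is at least 16(|Λ| − 1),
  -- which is at least 8|Λ| because |Λ| ≥ 2.
  have h4 : (2 : ℝ) ^ 2 ≤ maxFreq (C.gen l) ^ 2 := pow_le_pow_left₀ zero_le_two (hω l) 2
  unfold ampA
  push_cast at h1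
  nlinarith

/-- Curvatures lie between 1 and 128 and a fixed fraction of the KL parameters is curved. From
below, 𝒜 is of order at most KL and β of order at most n². From above, the last curved parameter has
𝒜 of order KL, and n² ≤ 4KL makes this comparable with KL + n². -/
theorem relaxed_halfFilled_sharpPatch (e : Fin K ≃ Single n ⊕ Double n)
    {C : Circuit n (Fin L ×ₗ Fin K) (Fin L ×ₗ Fin K)} (he : Even n) (hn : 4 ≤ n) (hL : 1 ≤ L)
    (hCe : C = relaxed L (fun k => uccGen (e k))) :
    C.SharpPatch (halfFilled n) (zzRing n) (curvedSet C (halfFilled n) (zzRing n))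
      (C.rUncorr (halfFilled n) (zzRing n) (curvedSet C (halfFilled n) (zzRing n)))
      (Real.sqrt (9 / 1130720)) (Real.sqrt 3732480) (1 / Real.sqrt (K * L + (n : ℝ) ^ 2))
      (Real.sqrt (9 / 1130720) ^ 4 / (72 * 41472)) (K * L / (K * L + (n : ℝ) ^ 2) ^ 2) := by
  classical
  set O := zzRing n
  set ρ := halfFilled n
  set Λ := curvedSet C ρ O with hΛdef
  have hH : ∀ k, (uccGen (e k)).IsHermitian := fun k => uccGen_isHermitian _
  have hU : C.IsUnitary := hCe ▸ relaxed_isUnitary hH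
  have hpar : C.par = id := by rw [hCe]; rfl
  have hρ : IsDensity ρ := isDensity_halfFilled n
  have hcurv : ∀ g, C.curv ρ O 0 g = |expect ρ ((ad (uccGen (e (ofLex g).2)) ^ 2) O)| := fun g => by
    rw [hCe, relaxed_curv hH]
  have hmem : ∀ g, g ∈ Λ ↔ (ofLex g).2 ∈ (curvedExcitations n).map e.symm.toEmbedding := fun g => by
    rw [Finset.mem_map_equiv, Equiv.symm_symm, mem_curvedExcitations, hΛdef]
    simp [curvedSet, hcurv, ρ, O]
  have hcard : Λ.card = L * (curvedExcitations n).card := by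
    rw [card_layers hmem, Finset.card_map]
  have hK : K = Fintype.card (Single n ⊕ Double n) := by
    rw [← Fintype.card_congr e, Fintype.card_fin]
  have hc1 : ∀ l ∈ Λ, 1 ≤ C.curv ρ O 0 l := fun l hl => by
    rw [hcurv]
    refine one_le_abs_expect_halfFilled ?_
    have := (hmem l).1 hl
    rwa [Finset.mem_map_equiv, Equiv.symm_symm] at this
  have hc2 : ∀ l, C.curv ρ O 0 l ≤ 128 := fun l => by
    rw [hcurv]; exact abs_expect_halfFilled_le _
  have hΛ2 : 2 ≤ Λ.card := by
    rw [hcard]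
    exact (two_le_card_curvedExcitations hn he).trans (Nat.le_mul_of_pos_left _ hL)
  have hne : Λ.Nonempty := Finset.card_pos.1 (by omega)
  have hω : ∀ l, maxFreq (C.gen l) ≤ 4 := fun l => by rw [hCe]; exact maxFreq_uccGen_le _
  have hω2 : ∀ l, 2 ≤ maxFreq (C.gen l) := fun l => by rw [hCe]; exact two_le_maxFreq_uccGen _
  have hO : ‖O‖ = n := norm_zzRing (by omega)
  have hKΛ : (K : ℝ) * L ≤ 41472 * Λ.card := by
    have : K * L ≤ 41472 * Λ.card := by
      rw [hcard]
      calc K * L ≤ 41472 * (curvedExcitations n).card * L :=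
            Nat.mul_le_mul_right _ (hK ▸ card_excitations_le hn he)
        _ = _ := by ring
    exact_mod_cast this
  have hnK : (n : ℝ) ^ 2 ≤ 4 * (K * L) := by
    have : n ^ 2 ≤ 4 * (K * L) := by
      have h1 := sq_le_card_excitations he
      rw [← hK] at h1
      exact h1.trans (Nat.mul_le_mul_left _ (Nat.le_mul_of_pos_right _ hL))
    exact_mod_cast this
  have hn0 : (0 : ℝ) < n := by exact_mod_cast (by omega : 0 < n)
  obtain ⟨m, hm⟩ : ∃ m : ℝ, m = K * L := ⟨_, rfl⟩
  rw [← hm] at hKΛ hnK ⊢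
  have hn2 : (0 : ℝ) < (n : ℝ) ^ 2 := by positivity
  have hm0 : 0 < m := by linarith
  have hQ : 0 < m + (n : ℝ) ^ 2 := by positivity
  have hΛ0 : (0 : ℝ) < Λ.card := by exact_mod_cast (by omega : 0 < Λ.card)
  refine SharpPatch.of_guarantee (by positivity) (le_rUncorr hne fun l hl => ?_)
    ((rUncorr_le (Λ.max'_mem hne)).trans ?_) (guarantee_rUncorr hU hpar hρ O Λ) ?_
  · have h1 := hc1 l hl
    have h2 := hc2 l
    have hA : C.ampA O 0 l ≤ 80 * 128 * m := by
      rw [hCe, hm]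
      exact relaxed_ampA_le hH (fun k => maxFreq_uccGen_le _) O
        (fun k => norm_ad_uccGen_sq_zzRing_le _) l
    have hA0 : 0 ≤ C.ampA O 0 l := ampA_nonneg O l
    have hβ0 : 0 < C.beta O 0 l := beta_pos hU hpar hρ O (zero_lt_one.trans_le h1)
    have hβ : C.beta O 0 l ≤ 43700 * (n : ℝ) ^ 2 := hO ▸ beta_le hU hpar O (hω l)
    have hc0 : 0 < C.curv ρ O 0 l := by linarith
    rw [mul_pow, div_pow, Real.sq_sqrt (by norm_num), Real.sq_sqrt hQ.le, one_pow,
      div_mul_div_comm, mul_one, div_le_div_iff₀ (by positivity) (by positivity)]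
    -- 1130720 = 8 · 80 · 128 + 24 · 43700; c ≥ 1 allows both terms to be measured against c².
    have k1 : C.beta O 0 l ≤ 43700 * (n : ℝ) ^ 2 * C.curv ρ O 0 l := by
      nlinarith
    have k2 : 8 * C.curv ρ O 0 l * C.ampA O 0 l ≤ 8 * C.curv ρ O 0 l * (80 * 128 * m) := by gcongr
    have k3 : C.curv ρ O 0 l * (m + (n : ℝ) ^ 2) ≤ C.curv ρ O 0 l ^ 2 * (m + (n : ℝ) ^ 2) := by
      rw [pow_two]
      gcongr
      nlinarith
    have k4 : 0 ≤ C.curv ρ O 0 l * m := by positivity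
    have k5 : 0 ≤ C.curv ρ O 0 l * (n : ℝ) ^ 2 := by positivity
    nlinarith
  · have h1 := hc1 _ (Λ.max'_mem hne)
    have hA := ampA_max_ge hU hpar hρ O hΛ2 hc1 hω2 hne
    have hβ0 := beta_pos hU hpar hρ O (zero_lt_one.trans_le h1)
    have h2 := hc2 (Λ.max' hne)
    obtain ⟨c, hc⟩ : ∃ c, c = C.curv ρ O 0 (Λ.max' hne) := ⟨_, rfl⟩
    rw [← hc] at h1 h2 ⊢
    have hc0 : 0 < c := by linarith
    rw [mul_one_div, ← Real.sqrt_div' _ hQ.le]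
    refine Real.sqrt_le_sqrt ?_
    have hA0 : 0 < C.ampA O 0 (Λ.max' hne) := by linarith
    rw [div_le_div_iff₀ (by positivity) hQ]
    -- m + n² ≤ 5m ≤ 5 · 41472 |Λ| and 8|Λ| ≤ 𝒜. With c ≤ 128 the constant becomes 9 · 128 · 5 ·
    -- 41472/64 = 3732480.
    have k1 : m + (n : ℝ) ^ 2 ≤ 5 * 41472 * (C.ampA O 0 (Λ.max' hne) / 8) := by linarith
    calc 9 * c ^ 2 * (m + (n : ℝ) ^ 2)
        ≤ 9 * c ^ 2 * (5 * 41472 * (C.ampA O 0 (Λ.max' hne) / 8)) := by gcongr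
      _ = 9 * c * (5 * 41472 / 8) * (c * C.ampA O 0 (Λ.max' hne)) := by ring
      _ ≤ 9 * 128 * (5 * 41472 / 8) * (c * C.ampA O 0 (Λ.max' hne)) := by gcongr
      _ ≤ _ := by
        have : 0 ≤ c * C.ampA O 0 (Λ.max' hne) := by positivity
        nlinarith
  · have hsum : m / 41472 ≤ ∑ l ∈ Λ, C.curv ρ O 0 l ^ 2 := by
      calc m / 41472 ≤ ∑ l ∈ Λ, (1 : ℝ) ^ 2 := by
            rw [Finset.sum_const, nsmul_eq_mul]; linarith
        _ ≤ _ := Finset.sum_le_sum fun l hl => pow_le_pow_left₀ zero_le_one (hc1 l hl) 2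
    have e4 : Real.sqrt (m + (n : ℝ) ^ 2) ^ 4 = (m + (n : ℝ) ^ 2) ^ 2 := by
      rw [show Real.sqrt (m + (n : ℝ) ^ 2) ^ 4 = (Real.sqrt (m + (n : ℝ) ^ 2) ^ 2) ^ 2 by ring,
        Real.sq_sqrt hQ.le]
    calc _ = 1 / 72 * (m / 41472)
          * (Real.sqrt (9 / 1130720) * (1 / Real.sqrt (m + (n : ℝ) ^ 2))) ^ 4 := by
          rw [mul_pow (Real.sqrt (9 / 1130720)), div_pow 1, e4]
          ring
      _ ≤ _ := by gcongr

end Half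

theorem relaxed_halfFilled_scaling : ∃ a b v : ℝ, 0 < a ∧ 0 < b ∧ 0 < v ∧
    ∀ (n L K : ℕ) (e : Fin K ≃ Single n ⊕ Double n)
      (C : Circuit n (Fin L ×ₗ Fin K) (Fin L ×ₗ Fin K)) (R : ℝ),
      Even n → 4 ≤ n → 1 ≤ L →
      C = relaxed L (fun k => uccGen (e k)) →
      R = C.rUncorr (halfFilled n) (zzRing n) (curvedSet C (halfFilled n) (zzRing n)) →
      C.SharpPatch (halfFilled n) (zzRing n) (curvedSet C (halfFilled n) (zzRing n)) R
        a b (1 / Real.sqrt (K * L + (n : ℝ) ^ 2))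
        v (K * L / (K * L + (n : ℝ) ^ 2) ^ 2) ∧
      v * (L * (n : ℝ) ^ 2 / (K * L + (n : ℝ) ^ 2) ^ 2)
        ≤ C.patchVar (halfFilled n) (zzRing n) R := by
  obtain ⟨w, hw⟩ : ∃ w : ℝ, w = Real.sqrt (9 / 1130720) ^ 4 / (72 * 41472) := ⟨_, rfl⟩
  have hw0 : 0 < w := by rw [hw]; positivity
  refine ⟨Real.sqrt (9 / 1130720), Real.sqrt 3732480, w / 4, by positivity, by positivity,
    by positivity, ?_⟩
  rintro n L K e C R he hn hL hC rfl
  have h := relaxed_halfFilled_sharpPatch e he hn hL hC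
  rw [← hw] at h
  refine ⟨h.mono le_rfl le_rfl ?_, le_trans ?_ h.2.2.2⟩
  · gcongr
    linarith
  -- The second variance bound follows from the first through n² ≤ 4K, which is why the constant was
  -- divided by 4.
  · have hK : (n : ℝ) ^ 2 ≤ 4 * K := by
      have := sq_le_card_excitations he
      rw [← Fintype.card_congr e, Fintype.card_fin] at this
      exact_mod_cast this
    calc w / 4 * (L * (n : ℝ) ^ 2 / (K * L + (n : ℝ) ^ 2) ^ 2)
        ≤ w / 4 * (L * (4 * K) / (K * L + (n : ℝ) ^ 2) ^ 2) := by gcongr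
      _ = _ := by ring

theorem trotter_halfFilled_sharpPatch : ∃ a b v : ℝ, 0 < a ∧ 0 < b ∧ 0 < v ∧
    ∀ (n L K : ℕ) (e : Fin K ≃ Single n ⊕ Double n)
      (C : Circuit n (Fin L ×ₗ Fin K) (Fin K)) (p : Fin K),
      Even n → 4 ≤ n → 1 ≤ L →
      C = trotter L (fun k => uccGen (e k)) →
      (∀ q, C.curv (halfFilled n) (zzRing n) 0 q ≤ C.curv (halfFilled n) (zzRing n) 0 p) →
      C.SharpPatch (halfFilled n) (zzRing n) {p}
        (C.rCorr (halfFilled n) (zzRing n) p)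
        a b (1 / (L * Real.sqrt (n * (K + n)))) v (1 / ((n : ℝ) ^ 2 * (K + n) ^ 2)) := by
  -- Integrality gives 1 as lower curvature constant, the count of touched bonds gives 128. A
  -- parameter of maximal curvature inherits the lower bound from any curved excitation.
  obtain ⟨a, b, v, ha, hb, hv, key⟩ := trotter_ucc_sharpPatch 1 128 one_pos (by norm_num)
  refine ⟨a, b, v, ha, hb, hv, ?_⟩
  intro n L K e C p he hn hL hC hp
  have hcurv : ∀ q, C.curv (halfFilled n) (zzRing n) 0 q
      = L ^ 2 * |expect (halfFilled n) ((ad (uccGen (e q)) ^ 2) (zzRing n))| := fun q => by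
    rw [hC, trotter_curv fun k => uccGen_isHermitian _]
  have hO : ‖zzRing n‖ = n := norm_zzRing (by omega)
  have h := key n L K e (halfFilled n) (zzRing n) C p hL (isDensity_halfFilled n) hC ?_ ?_
  · rwa [hO] at h
  · obtain ⟨x, hx⟩ : (curvedExcitations n).Nonempty :=
      Finset.card_pos.1 (by have := two_le_card_curvedExcitations hn he; omega)
    refine le_trans ?_ (hp (e.symm x))
    rw [hcurv, e.apply_symm_apply, one_mul]
    exact le_mul_of_one_le_right (by positivity) (one_le_abs_expect_halfFilled hx)
  · rw [hcurv, mul_comm]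
    gcongr
    exact abs_expect_halfFilled_le _

end PQC

/-! ### The scaling statements for all four families -/

theorem mainTheorem6 :
    -- Tensor-product ansatz, uncorrelated parameters.
    (∃ a b v : ℝ, 0 < a ∧ 0 < b ∧ 0 < v ∧ ∀ n : ℕ, 1 ≤ n →
      (tpUncorr n).SharpPatch (tpState n) (globalZ n) (tpSet n)
        ((tpUncorr n).rUncorr (tpState n) (globalZ n) (tpSet n))
        a b (1 / Real.sqrt n) v (1 / n)) ∧
    -- Tensor-product ansatz, one common parameter.
    (∃ a b v : ℝ, 0 < a ∧ 0 < b ∧ 0 < v ∧ ∀ n : ℕ, 1 ≤ n →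
      (tpCorr n).SharpPatch (tpState n) (globalZ n) {0}
        ((tpCorr n).rCorr (tpState n) (globalZ n) 0)
        a b (1 / n) v 1) ∧
    -- Hardware-efficient ansatz, global observable.
    (∃ a b v : ℝ, 0 < a ∧ 0 < b ∧ 0 < v ∧ ∀ n L : ℕ, 2 ≤ n → 1 ≤ L →
      (hea n L).SharpPatch (zeroState n) (globalZ n) (heaSetGlobal n L)
        ((hea n L).rUncorr (zeroState n) (globalZ n) (heaSetGlobal n L))
        a b (1 / Real.sqrt (n * L)) v (1 / (n * L))) ∧
    -- Hardware-efficient ansatz, local observable, arbitrary depth.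
    (∃ a b v : ℝ, 0 < a ∧ 0 < b ∧ 0 < v ∧ ∀ n L : ℕ, 2 ≤ n → 1 ≤ L →
      (hea n L).SharpPatch (zeroState n) (localZ n) (heaSetLocal n L)
        ((hea n L).rUncorr (zeroState n) (localZ n) (heaSetLocal n L))
        a b (1 / Real.sqrt L) v (1 / L)) ∧
    -- Hardware-efficient ansatz, local observable, depth of the order of the number of qubits.
    (∀ B : ℝ, ∃ a b v : ℝ, 0 < a ∧ 0 < b ∧ 0 < v ∧ ∀ n L : ℕ, 2 ≤ n → 1 ≤ L →
      (n : ℝ) ≤ B * L → (L : ℝ) ≤ B * n →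
      (hea n L).SharpPatch (zeroState n) (localZ n) (heaSetLocal n L)
        ((hea n L).rUncorr (zeroState n) (localZ n) (heaSetLocal n L))
        a b (1 / ((n : ℝ) * L) ^ (1 / 4 : ℝ)) v (1 / Real.sqrt (n * L))) ∧
    -- Relaxed Hamiltonian variational ansatz for a geometrically local Hamiltonian.
    (∀ (K D κ κO : ℕ) [NeZero K] (c₁ c₂ : ℝ), 0 < c₁ → c₁ ≤ c₂ →
      ∃ a b v : ℝ, 0 < a ∧ 0 < b ∧ 0 < v ∧
        ∀ (n L NO : ℕ) [NeZero L] (N : Fin K → ℕ)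
          (h : (k : Fin K) → Fin (N k) → Fin n → Fin 4) (P : Fin NO → Fin n → Fin 4) (ρ : Op n)
          (C : Circuit n (Fin L ×ₗ Fin K) (Fin L ×ₗ Fin K)) (O : Op n) (l₁ : Fin L ×ₗ Fin K),
          IsLocalModel D κ κO h P → IsDensity ρ → 1 ≤ NO →
          C = relaxed L (fun k => pauliSum (h k)) → O = pauliSum P → l₁ = toLex (0, 0) →
          c₁ * NO ≤ C.curv ρ O 0 l₁ → C.curv ρ O 0 l₁ ≤ c₂ * NO →
          C.SharpPatch ρ O {l₁} (C.rUncorrWith ρ O l₁ (localBeta (h 0) P))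
            a b (1 / Real.sqrt (K * L)) v ((NO : ℝ) ^ 2 / ((K : ℝ) * L) ^ 2)) ∧
    -- Trotterized Hamiltonian variational ansatz for a geometrically local Hamiltonian.
    (∀ (K D κ κO : ℕ) [NeZero K] (c₁ c₂ : ℝ), 0 < c₁ → c₁ ≤ c₂ →
      ∃ a v : ℝ, 0 < a ∧ 0 < v ∧
        ∀ (n L NO : ℕ) [NeZero L] (N : Fin K → ℕ)
          (h : (k : Fin K) → Fin (N k) → Fin n → Fin 4) (P : Fin NO → Fin n → Fin 4) (ρ : Op n)
          (C : Circuit n (Fin L ×ₗ Fin K) (Fin K)) (O : Op n),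
          IsLocalModel D κ κO h P → IsDensity ρ → 1 ≤ NO →
          C = trotter L (fun k => pauliSum (h k)) → O = pauliSum P →
          c₁ * (NO * (L : ℝ) ^ 2) ≤ C.curv ρ O 0 0 → C.curv ρ O 0 0 ≤ c₂ * (NO * (L : ℝ) ^ 2) →
          C.LowerPatch ρ O {0} (C.rCorr ρ O 0)
            a (1 / (L * ((Finset.univ.sup N : ℕ) : ℝ) ^ 3))
            v ((NO : ℝ) ^ 2 / ((Finset.univ.sup N : ℕ) : ℝ) ^ 12)) ∧
    -- Relaxed Hamiltonian variational ansatz for the Heisenberg ring.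
    (∃ a b v : ℝ, 0 < a ∧ 0 < b ∧ 0 < v ∧ ∀ (n L : ℕ) [NeZero L], Even n → 4 < n →
      ∀ l₁ : Fin L ×ₗ Fin 3, l₁ = toLex (0, 0) →
      (relaxed L (heisenbergTerm n)).SharpPatch (neelState n) (heisenberg n) {l₁}
        ((relaxed L (heisenbergTerm n)).rUncorrWith (neelState n) (heisenberg n) l₁
          (localBeta (bond (n := n) 0) (heisenbergStrings n)))
        a b (1 / Real.sqrt L) v ((n : ℝ) ^ 2 / (L : ℝ) ^ 2)) ∧
    -- Trotterized Hamiltonian variational ansatz for the Heisenberg ring.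
    (∃ a b v : ℝ, 0 < a ∧ 0 < b ∧ 0 < v ∧ ∀ (n L : ℕ), Even n → 4 < n → 1 ≤ L →
      ∀ (C : Circuit n (Fin L ×ₗ Fin 3) (Fin 3)) (p : Fin 3),
        C = trotter L (heisenbergTerm n) →
        (∀ q, C.curv (neelState n) (heisenberg n) 0 q
          ≤ C.curv (neelState n) (heisenberg n) 0 p) →
        C.SharpPatch (neelState n) (heisenberg n) {p}
          (C.rCorr (neelState n) (heisenberg n) p)
          a b (1 / (L * (n : ℝ) ^ 3)) v (1 / (n : ℝ) ^ 10)) ∧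
    -- Relaxed UCCSD with an arbitrary observable.
    (∀ c₁ c₂ : ℝ, 0 < c₁ → c₁ ≤ c₂ → ∃ a v : ℝ, 0 < a ∧ 0 < v ∧
      ∀ (n L K : ℕ) (e : Fin K ≃ Single n ⊕ Double n) (ρ O : Op n)
        (C : Circuit n (Fin L ×ₗ Fin K) (Fin L ×ₗ Fin K))
        (Λ : Finset (Fin K)) (Λ' : Finset (Fin L ×ₗ Fin K)),
        1 ≤ L → SinglesFirst e → IsDensity ρ → O.IsHermitian → Λ.Nonempty →
        C = relaxed L (fun k => uccGen (e k)) → (∀ g, g ∈ Λ' ↔ (ofLex g).2 ∈ Λ) →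
        (∀ g ∈ Λ', c₁ ≤ C.curv ρ O 0 g ∧ C.curv ρ O 0 g ≤ c₂) →
        C.LowerPatch ρ O Λ' (C.rUncorr ρ O Λ')
          a (1 / (Real.sqrt (K * L) * ‖O‖))
          v (L * (Λ.card : ℝ) / (((K : ℝ) * L) ^ 2 * ‖O‖ ^ 4))) ∧
    -- Trotterized UCCSD with an arbitrary observable.
    (∀ c₁ c₂ : ℝ, 0 < c₁ → c₁ ≤ c₂ → ∃ a b v : ℝ, 0 < a ∧ 0 < b ∧ 0 < v ∧
      ∀ (n L K : ℕ) (e : Fin K ≃ Single n ⊕ Double n) (ρ O : Op n)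
        (C : Circuit n (Fin L ×ₗ Fin K) (Fin K)) (p : Fin K),
        1 ≤ L → SinglesFirst e → IsDensity ρ → O.IsHermitian →
        C = trotter L (fun k => uccGen (e k)) →
        c₁ * (L : ℝ) ^ 2 ≤ C.curv ρ O 0 p → C.curv ρ O 0 p ≤ c₂ * (L : ℝ) ^ 2 →
        C.SharpPatch ρ O {p} (C.rCorr ρ O p)
          a b (1 / (L * Real.sqrt (‖O‖ * (K + ‖O‖))))
          v (1 / (‖O‖ ^ 2 * (K + ‖O‖) ^ 2))) ∧
    -- Relaxed UCCSD for the ring of `σ_z σ_z` couplings and the half-filled state.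
    (∃ a b v : ℝ, 0 < a ∧ 0 < b ∧ 0 < v ∧
      ∀ (n L K : ℕ) (e : Fin K ≃ Single n ⊕ Double n)
        (C : Circuit n (Fin L ×ₗ Fin K) (Fin L ×ₗ Fin K)) (R : ℝ),
        Even n → 4 ≤ n → 1 ≤ L → SinglesFirst e →
        C = relaxed L (fun k => uccGen (e k)) →
        R = C.rUncorr (halfFilled n) (zzRing n) (curvedSet C (halfFilled n) (zzRing n)) →
        C.SharpPatch (halfFilled n) (zzRing n) (curvedSet C (halfFilled n) (zzRing n)) R
          a b (1 / Real.sqrt (K * L + (n : ℝ) ^ 2))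
          v (K * L / (K * L + (n : ℝ) ^ 2) ^ 2) ∧
        v * (L * (n : ℝ) ^ 2 / (K * L + (n : ℝ) ^ 2) ^ 2)
          ≤ C.patchVar (halfFilled n) (zzRing n) R) ∧
    -- Trotterized UCCSD for the ring of `σ_z σ_z` couplings and the half-filled state.
    (∃ a b v : ℝ, 0 < a ∧ 0 < b ∧ 0 < v ∧
      ∀ (n L K : ℕ) (e : Fin K ≃ Single n ⊕ Double n)
        (C : Circuit n (Fin L ×ₗ Fin K) (Fin K)) (p : Fin K),
        Even n → 4 ≤ n → 1 ≤ L → SinglesFirst e →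
        C = trotter L (fun k => uccGen (e k)) →
        (∀ q, C.curv (halfFilled n) (zzRing n) 0 q ≤ C.curv (halfFilled n) (zzRing n) 0 p) →
        C.SharpPatch (halfFilled n) (zzRing n) {p}
          (C.rCorr (halfFilled n) (zzRing n) p)
          a b (1 / (L * Real.sqrt (n * (K + n)))) v (1 / ((n : ℝ) ^ 2 * (K + n) ^ 2))) := by
  refine ⟨⟨1 / 24, 1, 1 / 186624, by norm_num, by norm_num, by norm_num, fun n hn => tpUncorr_sharpPatch hn⟩,
    ⟨1 / 72, 1, 256 / 72 ^ 5, by norm_num, by norm_num, by norm_num, fun n hn => tpCorr_sharpPatch hn⟩,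
    ⟨1 / 12, 1, 1 / 93312, by norm_num, by norm_num, by norm_num,
      fun n L hn hL => hea_global_sharpPatch hn hL⟩,
    ⟨1 / 24, 1, 1 / 186624, by norm_num, by norm_num, by norm_num,
      fun n L hn hL => hea_local_sharpPatch hn hL⟩,
    hea_local_sharpPatch_proportional, fun K D κ κO _ c₁ c₂ hc hc₂ =>
      relaxed_hva_sharpPatch K D κ κO c₁ c₂ hc hc₂, ?_, relaxed_heisenberg_sharpPatch,
    trotter_heisenberg_sharpPatch, ?_, ?_, ?_, ?_⟩
  · intro K D κ κO _ c₁ c₂ hc hc₂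
    obtain ⟨a, v, ha, hv, key⟩ := trotter_hva_lowerPatch K hc hc₂
    refine ⟨a, v, ha, hv, ?_⟩
    rintro n L NO _ N h P ρ _ _ - hρ hNO rfl rfl h1 h2
    exact key n L NO N h P ρ hρ hNO h1 h2
  · intro c₁ c₂ hc₁ hc₂
    obtain ⟨a, v, ha, hv, key⟩ := relaxed_ucc_lowerPatch c₁ c₂ hc₁ hc₂
    exact ⟨a, v, ha, hv, fun n L K e ρ O C Λ Λ' hL _ hρ _ => key n L K e ρ O C Λ Λ' hL hρ⟩
  · intro c₁ c₂ hc₁ hc₂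
    obtain ⟨a, b, v, ha, hb, hv, key⟩ := trotter_ucc_sharpPatch c₁ c₂ hc₁ hc₂
    exact ⟨a, b, v, ha, hb, hv, fun n L K e ρ O C p hL _ hρ _ => key n L K e ρ O C p hL hρ⟩
  · obtain ⟨a, b, v, ha, hb, hv, key⟩ := relaxed_halfFilled_scaling
    exact ⟨a, b, v, ha, hb, hv, fun n L K e C R he hn hL _ => key n L K e C R he hn hL⟩
  · obtain ⟨a, b, v, ha, hb, hv, key⟩ := trotter_halfFilled_sharpPatch
    exact ⟨a, b, v, ha, hb, hv, fun n L K e C p he hn hL _ => key n L K e C p he hn hL⟩
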